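/- **Theorem (Reverse ODE in $\tau$).** Let $\alpha,\sigma:[0,1]\to[0,\infty)$ be differentiable with $\alpha_0=1$, $\alpha_1=0$, $\sigma_0=0$, $\sigma_1=1$, $\alpha_t>0$ for $t<1$, $\sigma_t>0$ for $t>0$. Put $f_t=\dot\alpha_t/\alpha_t$ and $g_t^2=\frac{d}{dt}\sigma_t^2-2f_t\sigma_t^2$, and assume $g_t^2\ge 0$ for $0\le t<1$. Let $p_0$ be a probability density on $\mathbb{R}^d$, let $p_t(x)=\int_{\mathbb{R}^d}\mathcal N(x;\alpha_tx_0,\sigma_t^2I)\,p_0(x_0)\,dx_0$ for $0<t\le1$ (so $p_1$ is the standard Gaussian density), and let $q_\tau=p_{1-\tau}$ for $0\le\tau\le1$. Then $q_\tau>0$ for $0\le\tau<1$, and the following hold. 1. The probability-flow ODE $$\frac{dY_\tau}{d\tau}=-f_{1-\tau}Y_\tau+\tfrac12 g_{1-\tau}^2\nabla\log q_\tau(Y_\tau),\quad 0<\tau<1,\qquad Y_0\sim q_0=p_1,$$ has a solution: a random process on some probability space whose paths are almost surely continuous on $[0,1]$ and satisfy the equation at every $\tau\in(0,1)$. For every such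 solution and every $\tau\in[0,1]$, $Y_\tau$ has density $q_\tau$. 2. This is the density path of the reverse SDE $$dZ_\tau=b^{\mathrm{rev}}_\tau(Z_\tau)\,d\tau+g_{1-\tau}\,dW_\tau,\qquad b^{\mathrm{rev}}_\tau(x)=-f_{1-\tau}x+g_{1-\tau}^2\nabla\log q_\tau(x),$$ with initial law $p_1$: for every weak solution $Z$ with paths continuous on $(0,1]$, and every $\tau\in(0,1]$, $Z_\tau$ has density $q_\tau$. Here a weak solution is a solution on $(0,1)$ of the martingale problem for $\varphi\mapsto b^{\mathrm{rev}}_\tau\cdot\nabla\varphi+\frac12g_{1-\tau}^2\Delta\varphi$, $\varphi\in C_c^\infty(\mathbb{R}^d)$, with coefficients $f_{1-\tau}$, $g_{1-\tau}^2$ that are locally integrable on $(0,1)$ and with the usual integrability of the generator term; since the coefficients are singular at $\tau=0$, the initial condition means that the law of $Z_\tau$ converges weakly to $p_1\,dx$ as $\tau\to0^+$. 3. On $(0,1)\times\mathbb{R}^d$ the path $q_\tau$ is a classical solution both of the continuity equation of the ODE and of the Fokker–Planck equation of the SDE: $$\partial_\tau q_\tau=-\nabla\cdot\Bigl(q_\tau\bigl[-f_{1-\tau}x+\tfrac12g_{1-\tau}^2\nabla\log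 q_\tau\bigr]\Bigr)=-\nabla\cdot\bigl(q_\tau b^{\mathrm{rev}}_\tau\bigr)+\tfrac12g_{1-\tau}^2\Delta q_\tau .$$ -/

import Mathlib

open MeasureTheory ProbabilityTheory Set Filter Topology

noncomputable section

namespace ReverseDiffusion

/-- The state space `ℝ^d` with its Euclidean norm. -/
abbrev State (d : ℕ) : Type := EuclideanSpace ℝ (Fin d)

/-- `f_t = α'_t / α_t` (one-sided derivatives at the ends of `[0,1]`). -/
def linearDrift (α : ℝ → ℝ) (t : ℝ) : ℝ :=
  derivWithin α (Icc 0 1) t / α t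

/-- `g_t^2 = (d/dt) σ_t^2 - 2 (α'_t / α_t) σ_t^2`; only the square of `g` enters the equations. -/
def diffusionSq (α σ : ℝ → ℝ) (t : ℝ) : ℝ :=
  derivWithin (fun s => σ s ^ 2) (Icc 0 1) t - 2 * linearDrift α t * σ t ^ 2

/-- Noising schedules. Strict positivity is what is needed for `f_t`, `g_t^2` to be defined for
`t < 1` and for the Gaussian kernel to have a density for `t > 0`. -/
structure IsNoiseSchedule (α σ : ℝ → ℝ) : Prop where
  differentiableOn_signal : DifferentiableOn ℝ α (Icc 0 1)
  differentiableOn_noise : DifferentiableOn ℝ σ (Icc 0 1)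
  signal_zero : α 0 = 1
  signal_one : α 1 = 0
  noise_zero : σ 0 = 0
  noise_one : σ 1 = 1
  signal_pos : ∀ t ∈ Ico (0 : ℝ) 1, 0 < α t
  noise_pos : ∀ t ∈ Ioc (0 : ℝ) 1, 0 < σ t
  diffusionSq_nonneg : ∀ t ∈ Ico (0 : ℝ) 1, 0 ≤ diffusionSq α σ t

/-- `p` is a probability density on `ℝ^d`. -/
structure IsProbDensity {d : ℕ} (p : State d → ℝ) : Prop where
  nonneg : ∀ x, 0 ≤ p x
  integrable : Integrable p
  integral_eq_one : ∫ x, p x = 1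

/-- The measure on `ℝ^d` with density `p` with respect to Lebesgue measure. -/
def densityMeasure {d : ℕ} (p : State d → ℝ) : Measure (State d) :=
  volume.withDensity (fun x => ENNReal.ofReal (p x))

/-- The Gaussian kernel `p_t(x | x₀)`, the density of `N(α_t x₀, σ_t^2 I)` at `x`. -/
def condDensity {d : ℕ} (α σ : ℝ → ℝ) (t : ℝ) (x₀ x : State d) : ℝ :=
  (2 * Real.pi * σ t ^ 2) ^ (-(d : ℝ) / 2) *
    Real.exp (-(‖x - α t • x₀‖ ^ 2) / (2 * σ t ^ 2))

/-- The marginal density `p_t(x) = ∫ p_t(x | x₀) p₀(x₀) dx₀`. At `t = 0`, where `σ_0 = 0` and the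
kernel is the point mass at `x₀`, it is the data density itself. -/
def forwardDensity {d : ℕ} (α σ : ℝ → ℝ) (p₀ : State d → ℝ) (t : ℝ) (x : State d) : ℝ :=
  if t = 0 then p₀ x else ∫ x₀, condDensity α σ t x₀ x * p₀ x₀

/-- The reverse density path `q_τ = p_{1-τ}`. -/
def reverseDensity {d : ℕ} (α σ : ℝ → ℝ) (p₀ : State d → ℝ) (τ : ℝ) (x : State d) : ℝ :=
  forwardDensity α σ p₀ (1 - τ) x

/-- The score `∇ log q_τ`. -/
def reverseScore {d : ℕ} (α σ : ℝ → ℝ) (p₀ : State d → ℝ) (τ : ℝ) (x : State d) : State d :=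
  gradient (fun y => Real.log (reverseDensity α σ p₀ τ y)) x

/-- The velocity field `-f_{1-τ} x + (1/2) g_{1-τ}^2 ∇ log q_τ(x)` of the probability-flow ODE. -/
def odeVelocity {d : ℕ} (α σ : ℝ → ℝ) (p₀ : State d → ℝ) (τ : ℝ) (x : State d) : State d :=
  -(linearDrift α (1 - τ) • x) + ((1 / 2 : ℝ) * diffusionSq α σ (1 - τ)) • reverseScore α σ p₀ τ x

/-- The drift `-f_{1-τ} x + g_{1-τ}^2 ∇ log q_τ(x)` of the reverse SDE. -/
def sdeDrift {d : ℕ} (α σ : ℝ → ℝ) (p₀ : State d → ℝ) (τ : ℝ) (x : State d) : State d :=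
  -(linearDrift α (1 - τ) • x) + diffusionSq α σ (1 - τ) • reverseScore α σ p₀ τ x

/-- The generator `b_τ^rev · ∇ φ + (1/2) g_{1-τ}^2 Δ φ` of the reverse SDE. -/
def sdeGenerator {d : ℕ} (α σ : ℝ → ℝ) (p₀ : State d → ℝ) (τ : ℝ) (φ : State d → ℝ)
    (x : State d) : ℝ :=
  inner ℝ (sdeDrift α σ p₀ τ x) (gradient φ x) +
    (1 / 2 : ℝ) * diffusionSq α σ (1 - τ) * Laplacian.laplacian φ x

/-- The random process `Y` on `[0,1]` solves `dY_τ/dτ = v_τ(Y_τ)` started from `Y_0 ∼ q_0 = p_1`,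
with `v` the velocity field of the probability-flow ODE: almost every path is continuous on `[0,1]`
and satisfies the equation at every `τ ∈ (0,1)`. (The coefficients `f_{1-τ}`, `g_{1-τ}^2` are
singular at `τ = 0`, and the score need not exist at `τ = 1`.) -/
structure IsReverseODESolution {d : ℕ} (α σ : ℝ → ℝ) (p₀ : State d → ℝ)
    {Ω : Type*} [MeasurableSpace Ω] (P : Measure Ω) (Y : ℝ → Ω → State d) : Prop where
  aemeasurable : ∀ τ ∈ Icc (0 : ℝ) 1, AEMeasurable (Y τ) P
  continuousOn : ∀ᵐ ω ∂P, ContinuousOn (fun τ => Y τ ω) (Icc 0 1)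
  hasDerivAt : ∀ᵐ ω ∂P, ∀ τ ∈ Ioo (0 : ℝ) 1,
    HasDerivAt (fun s => Y s ω) (odeVelocity α σ p₀ τ (Y τ ω)) τ
  initial : HasLaw (Y 0) (densityMeasure (reverseDensity α σ p₀ 0)) P

/-- `Z` is a weak solution, in the sense of the (Stroock-Varadhan) martingale problem, of
`dZ_τ = b_τ^rev(Z_τ) dτ + g_{1-τ} dW_τ` on `(0,1)` with initial law `q_0 = p_1`, for the
filtration `𝓕`.

Since `f_{1-τ}` and `g_{1-τ}^2` are not integrable at `τ = 0`, the equation is imposed on `(0,1)`,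
and the initial condition says that the law of `Z_τ` tends weakly to `p_1` as `τ → 0+`. -/
structure IsReverseSDESolution {d : ℕ} (α σ : ℝ → ℝ) (p₀ : State d → ℝ)
    {Ω : Type*} [mΩ : MeasurableSpace Ω] (P : Measure Ω) (𝓕 : Filtration ℝ mΩ)
    (Z : ℝ → Ω → State d) : Prop where
  adapted : ∀ τ ∈ Ioc (0 : ℝ) 1, StronglyMeasurable[𝓕 τ] (Z τ)
  continuousOn : ∀ᵐ ω ∂P, ContinuousOn (fun τ => Z τ ω) (Ioc 0 1)
  /-- The coefficients are locally integrable in time on `(0,1)`, so that the drift integral and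
  the Itô integral make sense. -/
  locallyIntegrable : ∀ s t : ℝ, 0 < s → s ≤ t → t < 1 →
    IntervalIntegrable (fun τ => linearDrift α (1 - τ)) volume s t ∧
      IntervalIntegrable (fun τ => diffusionSq α σ (1 - τ)) volume s t
  integrable : ∀ φ : State d → ℝ, ContDiff ℝ (⊤ : ℕ∞) φ → HasCompactSupport φ →
    ∀ s t : ℝ, 0 < s → s ≤ t → t < 1 →
      Integrable (fun z : ℝ × Ω => sdeGenerator α σ p₀ z.1 φ (Z z.1 z.2))
        ((volume.restrict (Ioc s t)).prod P)
  /-- `φ(Z_t) - φ(Z_s) - ∫_s^t (L_r φ)(Z_r) dr` is a martingale in `t`. -/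
  martingale : ∀ φ : State d → ℝ, ContDiff ℝ (⊤ : ℕ∞) φ → HasCompactSupport φ →
    ∀ s t : ℝ, 0 < s → s ≤ t → t < 1 →
      P[fun ω => φ (Z t ω) - φ (Z s ω) - ∫ r in s..t, sdeGenerator α σ p₀ r φ (Z r ω) | 𝓕 s]
        =ᵐ[P] 0
  initial : ∀ φ : BoundedContinuousFunction (State d) ℝ,
    Tendsto (fun τ => ∫ ω, φ (Z τ ω) ∂P) (𝓝[>] 0)
      (𝓝 (∫ x, φ x ∂(densityMeasure (reverseDensity α σ p₀ 0))))

/-- The process `Y` has density path `q` over the times in `I`. -/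
def HasDensityPath {d : ℕ} {Ω : Type*} [MeasurableSpace Ω] (P : Measure Ω)
    (Y : ℝ → Ω → State d) (I : Set ℝ) (q : ℝ → State d → ℝ) : Prop :=
  ∀ τ ∈ I, HasLaw (Y τ) (densityMeasure (q τ)) P

/-- The divergence of a vector field on `ℝ^d`. -/
def divergence {d : ℕ} (F : State d → State d) (x : State d) : ℝ :=
  ∑ i : Fin d, (fderiv ℝ F x (EuclideanSpace.single i 1)) i

/-- Classical solutions on `(0,1) × ℝ^d` of the continuity equation `∂_τ q = -∇·(q v)`. -/
def SolvesContinuityEquation {d : ℕ} (q : ℝ → State d → ℝ) (v : ℝ → State d → State d) : Prop :=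
  ∀ τ ∈ Ioo (0 : ℝ) 1, Differentiable ℝ (fun y => q τ y • v τ y) ∧
    ∀ x, HasDerivAt (fun s => q s x) (-divergence (fun y => q τ y • v τ y) x) τ

/-- Classical solutions on `(0,1) × ℝ^d` of the Fokker-Planck equation
`∂_τ q = -∇·(q b) + (1/2) a_τ Δ q`. -/
def SolvesFokkerPlanck {d : ℕ} (q : ℝ → State d → ℝ) (b : ℝ → State d → State d)
    (a : ℝ → ℝ) : Prop :=
  ∀ τ ∈ Ioo (0 : ℝ) 1, ContDiff ℝ 2 (q τ) ∧ Differentiable ℝ (fun y => q τ y • b τ y) ∧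
    ∀ x, HasDerivAt (fun s => q s x)
      (-divergence (fun y => q τ y • b τ y) x + (1 / 2 : ℝ) * a τ * Laplacian.laplacian (q τ) x) τ

end ReverseDiffusion

end

open ReverseDiffusion

/-!
In the coordinates `ρ = σ² / α²` (`noiseRatio`) and `u = x / α`, the forward density is the heat
flow of the data, `r_ρ = p₀ * N(0, ρ I)` (`heat`, `reverseDensity_eq_heat`). It is positive, and
smooth for `ρ > 0`, because Gaussian averages are partition functions of an exponential family, and
`∂_ρ r = ½ Δ r` (`hasDerivAt_heat`). Undoing the change of variables gives the continuity equation
and the Fokker-Planck equation (`solvesContinuityEquation`, `solvesFokkerPlanck`). No moments of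
`p₀` are assumed, and at `ρ = 0` and `ρ = ∞` the coefficients are singular; these two ends carry
the work.

*The ODE.* In the time `s = log ρ` the probability flow is the flow of `-½ e^s ∇ log r`
(`heatField`), a smooth field of linear growth, so it has global solutions, and by Liouville's
theorem (`IsTameField.map_flow_densityMeasure`) they transport the densities `r`. As the noise
vanishes, almost every flow line converges: its expected speed is at most a multiple of `e^s
ρ^{-1/2} = e^{s/2}`, which is integrable at `-∞` (`ae_tendsto_heatFlow_atBot`). At infinite noise,
the flow line in units of the noise's standard deviation moves with a multiple of the posterior
mean of the rescaled data (Tweedie's formula). That mean is bounded, and Lipschitz in the position,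
locally uniformly, by a multiple of the truncated first moment `truncMoment`, whose integral over
time is finite whatever `p₀` is. Hence every line converges (`tendsto_scaledFlow`), and distinct
lines have distinct limits (`injective_flowEnd`). Lines drawn with law `r_1` therefore form a
solution (`IsNoiseSchedule.exists_reverseODESolution`). Conversely, every path of a solution is
such a line, and as the limit is a measurable injective function of the line, the initial law `p_1`
determines the law of the line and with it the whole density path
(`IsNoiseSchedule.hasDensityPath_of_isReverseODESolution`).

*The SDE.* In heat coordinates the backward operator of the reverse SDE is `-∂_ρ + ∇ log r · ∇ + ½
Δ` (`heatResidual`). It annihilates quotients `N_{ρ - ρ₃}(· - y) / r_ρ` of two solutions of the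
heat equation (`heatResidual_mul_heatQuotient`), and for a point mass, delayed by `ρ₃ > 0`, the
quotient is bounded (`exists_heatQuotient_dirac_le`). By Dynkin's formula for time-dependent test
functions (`integral_heatPoint_sub`), in which coefficients need only be locally integrable in time
(`diagonal_sub_eq_integral`), the expectation of the quotient along any weak solution is conserved
(`integral_heatQuotient_eq`). At reverse time `0` all Gaussian mixtures agree, so the initial
condition shows that this expectation equals `1` (`integral_heatQuotient_eq_one`). As `y` varies
this is the Laplace transform of the law, reweighted by a Gaussian over its candidate density, and
it identifies the law (`eq_densityMeasure_of_integral_heat_div`,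
`IsNoiseSchedule.hasDensityPath_of_isReverseSDESolution`). The final time, at which the drift is
singular again, is reached by continuity of paths (`hasLaw_reverseDensity_of_tendsto`).
-/

noncomputable section

namespace ReverseDiffusion

variable {d : ℕ}

/-! ### Exponential families of a finite measure -/

/-- The linear functional `(b, c) ↦ ⟪b, x⟫ - c ‖x‖²`, the exponent of the Gaussian exponential
family in its natural parameters. -/
def gaussExponent (x : State d) : State d × ℝ →L[ℝ] ℝ :=
  (innerSL ℝ x).comp (ContinuousLinearMap.fst ℝ _ _) -
    (‖x‖ ^ 2) • ContinuousLinearMap.snd ℝ (State d) ℝ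

lemma gaussExponent_apply (x : State d) (θ : State d × ℝ) :
    gaussExponent x θ = inner ℝ x θ.1 - ‖x‖ ^ 2 * θ.2 := by
  simp [gaussExponent]

lemma continuous_gaussExponent : Continuous (gaussExponent (d := d)) := by
  unfold gaussExponent
  have h1 : Continuous fun x : State d => innerSL ℝ x := (innerSL ℝ).continuous
  have h2 := h1.clm_comp (continuous_const (y := ContinuousLinearMap.fst ℝ (State d) ℝ))
  exact h2.sub ((continuous_norm.pow 2).smul continuous_const)

lemma norm_gaussExponent_le (x : State d) : ‖gaussExponent x‖ ≤ (1 + ‖x‖) ^ 2 := by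
  refine ContinuousLinearMap.opNorm_le_bound _ (by positivity) fun θ => ?_
  rw [gaussExponent_apply, Real.norm_eq_abs]
  have h1 : |inner ℝ x θ.1| ≤ ‖x‖ * ‖θ‖ :=
    (abs_real_inner_le_norm _ _).trans (by gcongr; exact norm_fst_le θ)
  have h2 : |‖x‖ ^ 2 * θ.2| ≤ ‖x‖ ^ 2 * ‖θ‖ := by
    rw [abs_mul, abs_of_nonneg (by positivity : (0 : ℝ) ≤ ‖x‖ ^ 2)]
    gcongr; exact norm_snd_le θ
  calc _ ≤ |inner ℝ x θ.1| + |‖x‖ ^ 2 * θ.2| := abs_sub _ _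
    _ ≤ ‖x‖ * ‖θ‖ + ‖x‖ ^ 2 * ‖θ‖ := add_le_add h1 h2
    _ ≤ _ := by nlinarith [norm_nonneg x, norm_nonneg θ, mul_nonneg (norm_nonneg x) (norm_nonneg θ)]

lemma exists_polynomial_mul_gauss_le (n : ℕ) (B : ℝ) {c : ℝ} (hc : 0 < c) :
    ∃ C, 0 ≤ C ∧ ∀ y : ℝ, 0 ≤ y → (1 + y) ^ n * Real.exp (B * y - c * y ^ 2) ≤ C := by
  refine ⟨n.factorial * Real.exp (1 + (B + 1) ^ 2 / (4 * c)), by positivity, fun y hy => ?_⟩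
  have h1 : (1 + y) ^ n ≤ n.factorial * Real.exp (1 + y) := by
    have := Real.pow_div_factorial_le_exp (1 + y) (by linarith) n
    rwa [div_le_iff₀' (by positivity)] at this
  calc _ ≤ n.factorial * Real.exp (1 + y) * Real.exp (B * y - c * y ^ 2) := by gcongr
    _ = n.factorial * Real.exp (1 + ((B + 1) * y - c * y ^ 2)) := by
      rw [mul_assoc, ← Real.exp_add]; ring_nf
    _ ≤ _ := by
      gcongr
      rw [le_div_iff₀ (by positivity)]
      nlinarith [sq_nonneg (2 * c * y - (B + 1))]

/-- Polynomial growth. -/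
def PolyGrowth {F : Type*} [NormedAddCommGroup F] (k : State d → F) : Prop :=
  ∃ (C : ℝ) (n : ℕ), 0 ≤ C ∧ ∀ x, ‖k x‖ ≤ C * (1 + ‖x‖) ^ n

/-- On a neighbourhood of a parameter with `c > 0`, the exponential beats every polynomial
uniformly. -/
lemma exists_gauss_bound {F : Type*} [NormedAddCommGroup F] {k : State d → F}
    (hk : PolyGrowth k) (θ₀ : State d × ℝ) (hθ : 0 < θ₀.2) :
    ∃ C, 0 ≤ C ∧ ∀ θ ∈ Metric.ball θ₀ (min 1 (θ₀.2 / 2)), ∀ x : State d,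
      Real.exp (gaussExponent x θ) * ‖k x‖ ≤ C := by
  obtain ⟨C, n, hC, hk⟩ := hk
  obtain ⟨C', hC', h⟩ := exists_polynomial_mul_gauss_le n (‖θ₀‖ + 1) (half_pos hθ)
  refine ⟨C * C', by positivity, fun θ hθb x => ?_⟩
  rw [mem_ball_iff_norm, lt_min_iff] at hθb
  have hb : ‖θ.1‖ ≤ ‖θ₀‖ + 1 := by
    have := norm_le_norm_add_norm_sub' θ θ₀
    linarith [norm_fst_le θ, hθb.1]
  have hc : θ₀.2 / 2 ≤ θ.2 := by
    have h3 : ‖(θ - θ₀).2‖ ≤ ‖θ - θ₀‖ := norm_snd_le _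
    rw [Prod.snd_sub, Real.norm_eq_abs] at h3
    have := neg_abs_le (θ.2 - θ₀.2)
    linarith [hθb.2]
  have hexp : gaussExponent x θ ≤ (‖θ₀‖ + 1) * ‖x‖ - θ₀.2 / 2 * ‖x‖ ^ 2 := by
    rw [gaussExponent_apply]
    have h1 : inner ℝ x θ.1 ≤ ‖x‖ * ‖θ.1‖ := real_inner_le_norm _ _
    nlinarith [mul_le_mul_of_nonneg_left hb (norm_nonneg x),
      mul_le_mul_of_nonneg_left hc (sq_nonneg ‖x‖)]
  calc _ ≤ Real.exp ((‖θ₀‖ + 1) * ‖x‖ - θ₀.2 / 2 * ‖x‖ ^ 2) * (C * (1 + ‖x‖) ^ n) := by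
        gcongr; exact hk x
    _ = C * ((1 + ‖x‖) ^ n * Real.exp ((‖θ₀‖ + 1) * ‖x‖ - θ₀.2 / 2 * ‖x‖ ^ 2)) := by ring
    _ ≤ _ := by gcongr; exact h _ (norm_nonneg x)

variable {F : Type*} [NormedAddCommGroup F] [NormedSpace ℝ F]

/-- The weighted partition function `(b, c) ↦ ∫ exp (⟪b, x⟫ - c ‖x‖²) k(x) dμ(x)`. -/
def expFamily (μ : Measure (State d)) (k : State d → F) (θ : State d × ℝ) : F :=
  ∫ x, Real.exp (gaussExponent x θ) • k x ∂μ

lemma continuous_exp_smul {k : State d → F}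
    (hk : Continuous k) (θ : State d × ℝ) :
    Continuous (fun x => Real.exp (gaussExponent x θ) • k x) :=
  (Real.continuous_exp.comp (continuous_gaussExponent.clm_apply continuous_const)).smul hk

lemma integrable_exp_smul {μ : Measure (State d)} [IsFiniteMeasure μ] {k : State d → F}
    (hk : Continuous k) (hg : PolyGrowth k) {θ : State d × ℝ} (hθ : 0 < θ.2) :
    Integrable (fun x => Real.exp (gaussExponent x θ) • k x) μ := by
  obtain ⟨C, -, h⟩ := exists_gauss_bound hg θ hθ
  refine Integrable.of_bound
    (continuous_exp_smul hk θ).aestronglyMeasurable C (ae_of_all _ fun x => ?_)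
  rw [norm_smul, Real.norm_eq_abs, Real.abs_exp]
  exact h θ (Metric.mem_ball_self (by positivity)) x

lemma PolyGrowth.smulRight_gaussExponent {k : State d → F} (hg : PolyGrowth k) :
    PolyGrowth (fun x => (gaussExponent x).smulRight (k x)) := by
  obtain ⟨C, n, hC, h⟩ := hg
  refine ⟨C, n + 2, hC, fun x => ?_⟩
  rw [ContinuousLinearMap.norm_smulRight_apply, pow_add]
  calc _ ≤ (1 + ‖x‖) ^ 2 * (C * (1 + ‖x‖) ^ n) := by
        gcongr
        · exact norm_gaussExponent_le x
        · exact h x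
    _ = _ := by ring

lemma continuous_smulRight_gaussExponent {k : State d → F} (hk : Continuous k) :
    Continuous (fun x => (gaussExponent x).smulRight (k x)) :=
  ((ContinuousLinearMap.smulRightL ℝ (State d × ℝ) F).continuous₂.comp
    (continuous_gaussExponent.prodMk hk))

/-- Differentiating a partition function multiplies the weight by the exponent. -/
lemma hasFDerivAt_expFamily {μ : Measure (State d)} [IsFiniteMeasure μ] {k : State d → F}
    (hk : Continuous k) (hg : PolyGrowth k) {θ : State d × ℝ} (hθ : 0 < θ.2) :
    HasFDerivAt (expFamily μ k)
      (expFamily μ (fun x => (gaussExponent x).smulRight (k x)) θ) θ := by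
  obtain ⟨C, hC, h⟩ := exists_gauss_bound hg.smulRight_gaussExponent θ hθ
  refine hasFDerivAt_integral_of_dominated_of_fderiv_le
    (F := fun θ x => Real.exp (gaussExponent x θ) • k x)
    (F' := fun θ x => Real.exp (gaussExponent x θ) • (gaussExponent x).smulRight (k x))
    (bound := fun _ => C) (Metric.ball_mem_nhds θ (ε := min 1 (θ.2 / 2)) (by positivity))
    (Eventually.of_forall fun θ' =>
      (continuous_exp_smul hk θ').aestronglyMeasurable)
    (integrable_exp_smul hk hg hθ)
    (continuous_exp_smul
      (continuous_smulRight_gaussExponent hk) θ).aestronglyMeasurable ?_ (integrable_const C) ?_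
  · refine ae_of_all _ fun x θ' hθ' => ?_
    rw [norm_smul, Real.norm_eq_abs, Real.abs_exp]
    exact h θ' hθ' x
  · refine ae_of_all _ fun x θ' _ => ?_
    have h1 : HasFDerivAt (fun θ => Real.exp (gaussExponent x θ))
        (Real.exp (gaussExponent x θ') • gaussExponent x) θ' :=
      (gaussExponent x).hasFDerivAt.exp
    convert h1.smul_const (k x) using 1
    ext θ'' <;> simp [mul_smul]

lemma isOpen_snd_pos : IsOpen {θ : State d × ℝ | 0 < θ.2} :=
  isOpen_lt continuous_const continuous_snd

lemma contDiffOn_expFamily_nat {μ : Measure (State d)} [IsFiniteMeasure μ] (n : ℕ) :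
    ∀ {F : Type} [NormedAddCommGroup F] [NormedSpace ℝ F] {k : State d → F},
      Continuous k → PolyGrowth k → ContDiffOn ℝ n (expFamily μ k) {θ | 0 < θ.2} := by
  induction n with
  | zero =>
    intro F _ _ k hk hg
    rw [Nat.cast_zero, contDiffOn_zero]
    exact fun θ hθ => (hasFDerivAt_expFamily hk hg hθ).continuousAt.continuousWithinAt
  | succ n ih =>
    intro F _ _ k hk hg
    rw [Nat.cast_succ, contDiffOn_succ_iff_fderiv_of_isOpen isOpen_snd_pos]
    refine ⟨fun θ hθ => (hasFDerivAt_expFamily hk hg hθ).differentiableAt.differentiableWithinAt,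
      by simp, ?_⟩
    exact (ih (continuous_smulRight_gaussExponent hk) hg.smulRight_gaussExponent).congr
      fun θ hθ => (hasFDerivAt_expFamily hk hg hθ).fderiv

/-- Partition functions are smooth in the natural parameters. -/
lemma contDiffOn_expFamily {μ : Measure (State d)} [IsFiniteMeasure μ]
    {F : Type} [NormedAddCommGroup F] [NormedSpace ℝ F] {k : State d → F}
    (hk : Continuous k) (hg : PolyGrowth k) :
    ContDiffOn ℝ (⊤ : ℕ∞) (expFamily μ k) {θ | 0 < θ.2} :=
  contDiffOn_infty.2 fun n => contDiffOn_expFamily_nat n hk hg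

/-! ### The heat semigroup acting on a finite measure -/

section Weighted
variable {F : Type} [NormedAddCommGroup F] [NormedSpace ℝ F]

/-- The unnormalised Gaussian average `∫ exp (-‖u - x‖² / (2ρ)) k(x) dμ(x)` at `p = (ρ, u)`. -/
def gaussAverage (μ : Measure (State d)) (k : State d → F) (p : ℝ × State d) : F :=
  ∫ x, Real.exp (-‖p.2 - x‖ ^ 2 / (2 * p.1)) • k x ∂μ

/-- Natural parameters `(u / ρ, 1 / (2ρ))` of the Gaussian kernel in the variable of
integration. -/
def naturalParam (p : ℝ × State d) : State d × ℝ := (p.1⁻¹ • p.2, (2 * p.1)⁻¹)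

lemma gauss_eq_exp_mul {p : ℝ × State d} (hp : 0 < p.1) (x : State d) :
    Real.exp (-‖p.2 - x‖ ^ 2 / (2 * p.1)) =
      Real.exp (-‖p.2‖ ^ 2 / (2 * p.1)) * Real.exp (gaussExponent x (naturalParam p)) := by
  rw [← Real.exp_add, gaussExponent_apply, naturalParam, norm_sub_sq_real, inner_smul_right,
    real_inner_comm]
  congr 1
  field_simp
  ring

lemma gaussAverage_eq {μ : Measure (State d)} (k : State d → F) {p : ℝ × State d}
    (hp : 0 < p.1) :
    gaussAverage μ k p =
      Real.exp (-‖p.2‖ ^ 2 / (2 * p.1)) • expFamily μ k (naturalParam p) := by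
  simp only [gaussAverage, expFamily, gauss_eq_exp_mul hp, mul_smul, integral_smul]

lemma naturalParam_pos {p : ℝ × State d} (hp : 0 < p.1) : 0 < (naturalParam p).2 := by
  simp only [naturalParam]; positivity

lemma integrable_gaussAverage {μ : Measure (State d)} [IsFiniteMeasure μ] {k : State d → F}
    (hk : Continuous k) (hg : PolyGrowth k) {p : ℝ × State d} (hp : 0 < p.1) :
    Integrable (fun x => Real.exp (-‖p.2 - x‖ ^ 2 / (2 * p.1)) • k x) μ := by
  simp only [gauss_eq_exp_mul hp, mul_smul]
  exact (integrable_exp_smul hk hg (naturalParam_pos hp)).smul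
    (Real.exp (-‖p.2‖ ^ 2 / (2 * p.1)))

lemma contDiffOn_naturalParam :
    ContDiffOn ℝ (⊤ : ℕ∞) (naturalParam (d := d)) {p | 0 < p.1} := by
  unfold naturalParam
  refine ContDiffOn.prodMk (ContDiffOn.smul (contDiffOn_fst.inv ?_) contDiffOn_snd)
    ((contDiffOn_const.mul contDiffOn_fst).inv ?_)
  · exact fun p hp => ne_of_gt hp
  · exact fun p hp => by have : 0 < p.1 := hp; positivity

lemma contDiffOn_gaussAverage {μ : Measure (State d)} [IsFiniteMeasure μ] {k : State d → F}
    (hk : Continuous k) (hg : PolyGrowth k) :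
    ContDiffOn ℝ (⊤ : ℕ∞) (gaussAverage μ k) {p | 0 < p.1} := by
  have h1 : ContDiffOn ℝ (⊤ : ℕ∞)
      (fun p : ℝ × State d => Real.exp (-‖p.2‖ ^ 2 / (2 * p.1))) {p | 0 < p.1} := by
    refine ContDiffOn.exp (ContDiffOn.div ?_ (contDiffOn_const.mul contDiffOn_fst) ?_)
    · exact (contDiffOn_snd.norm_sq ℝ).neg
    · exact fun p hp => by have : 0 < p.1 := hp; positivity
  have h2 : ContDiffOn ℝ (⊤ : ℕ∞) (fun p => expFamily μ k (naturalParam p)) {p | 0 < p.1} :=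
    (contDiffOn_expFamily hk hg).comp contDiffOn_naturalParam fun p hp => naturalParam_pos hp
  exact (h1.smul h2).congr fun p hp => gaussAverage_eq k hp

lemma hasFDerivAt_naturalParam {p : ℝ × State d} (hp : 0 < p.1) :
    ∃ L : ℝ × State d →L[ℝ] State d × ℝ, HasFDerivAt naturalParam L p ∧
      ∀ v, L v = (p.1⁻¹ • v.2 - (v.1 / p.1 ^ 2) • p.2, -v.1 / (2 * p.1 ^ 2)) := by
  have hf : HasFDerivAt (fun q : ℝ × State d => q.1) (ContinuousLinearMap.fst ℝ ℝ (State d)) p :=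
    hasFDerivAt_fst
  have hi := (hasDerivAt_inv hp.ne').comp_hasFDerivAt p hf
  have hi2 := (hasDerivAt_inv (by positivity : (2 * p.1) ≠ 0)).comp_hasFDerivAt p
      (hf.const_mul 2)
  refine ⟨_, (hi.smul hasFDerivAt_snd).prodMk hi2, fun v => ?_⟩
  ext1
  · simp only [ContinuousLinearMap.prod_apply, add_apply,
      smul_apply, ContinuousLinearMap.smulRight_apply,
      ContinuousLinearMap.coe_fst', ContinuousLinearMap.coe_snd', smul_eq_mul]
    rw [sub_eq_add_neg, ← neg_smul]
    congr 2
    field_simp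
  · simp only [ContinuousLinearMap.prod_apply,
      FunLike.coe_smul, Pi.smul_apply, ContinuousLinearMap.coe_fst', smul_eq_mul]
    field_simp

lemma hasFDerivAt_exp_norm_sq {p : ℝ × State d} (hp : 0 < p.1) :
    ∃ L : ℝ × State d →L[ℝ] ℝ,
      HasFDerivAt (fun q : ℝ × State d => Real.exp (-‖q.2‖ ^ 2 / (2 * q.1))) L p ∧
      ∀ v, L v = Real.exp (-‖p.2‖ ^ 2 / (2 * p.1)) *
        (‖p.2‖ ^ 2 / (2 * p.1 ^ 2) * v.1 - p.1⁻¹ * inner ℝ p.2 v.2) := by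
  have hf : HasFDerivAt (fun q : ℝ × State d => q.1)
    (ContinuousLinearMap.fst ℝ ℝ (State d)) p := hasFDerivAt_fst
  have hs : HasFDerivAt (fun q : ℝ × State d => q.2)
    (ContinuousLinearMap.snd ℝ ℝ (State d)) p := hasFDerivAt_snd
  have hi2 := (hasDerivAt_inv (by positivity : (2 * p.1) ≠ 0)).comp_hasFDerivAt p
      (hf.const_mul 2)
  have h2 := (hs.norm_sq.fun_neg.fun_mul hi2).exp
  refine ⟨_, h2.congr_of_eventuallyEq (Eventually.of_forall fun q => ?_), fun v => ?_⟩
  · simp [div_eq_mul_inv]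
  · simp only [FunLike.coe_smul, FunLike.coe_add, FunLike.coe_neg, Pi.smul_apply, Pi.add_apply,
      Pi.neg_apply, ContinuousLinearMap.comp_apply, ContinuousLinearMap.coe_fst',
      ContinuousLinearMap.coe_snd', innerSL_apply_apply, smul_eq_mul, Function.comp_apply,
      div_eq_mul_inv]
    simp only [nsmul_eq_mul, Nat.cast_ofNat]
    congr 1
    field_simp
    ring

/-- Differentiation under the integral sign for the Gaussian kernel, in `(ρ, u)` jointly. -/
lemma hasFDerivAt_gaussAverage {μ : Measure (State d)} [IsFiniteMeasure μ] {k : State d → F}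
    [CompleteSpace F]
    (hk : Continuous k) (hg : PolyGrowth k) {p : ℝ × State d} (hp : 0 < p.1) :
    ∃ L : ℝ × State d →L[ℝ] F, HasFDerivAt (gaussAverage μ k) L p ∧
      ∀ v, L v = ∫ x, Real.exp (-‖p.2 - x‖ ^ 2 / (2 * p.1)) •
        ((‖p.2 - x‖ ^ 2 / (2 * p.1 ^ 2) * v.1 - p.1⁻¹ * inner ℝ (p.2 - x) v.2) • k x) ∂μ := by
  obtain ⟨L₁, hL₁, hL₁v⟩ := hasFDerivAt_naturalParam hp
  have h1 := (hasFDerivAt_expFamily (μ := μ) hk hg (naturalParam_pos hp)).comp p hL₁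
  obtain ⟨L₂, hL₂, hL₂v⟩ := hasFDerivAt_exp_norm_sq hp
  have h3 := hL₂.fun_smul h1
  refine ⟨_, h3.congr_of_eventuallyEq ?_, fun v => ?_⟩
  · filter_upwards [(isOpen_lt continuous_const continuous_fst).mem_nhds hp] with q hq
    exact gaussAverage_eq k hq
  · have hint := integrable_exp_smul (μ := μ) (continuous_smulRight_gaussExponent hk)
      hg.smulRight_gaussExponent (naturalParam_pos hp)
    have hint0 := integrable_exp_smul (μ := μ) hk hg (naturalParam_pos hp)
    simp only [FunLike.coe_add, FunLike.coe_smul, Pi.add_apply, Pi.smul_apply,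
      ContinuousLinearMap.smulRight_apply, ContinuousLinearMap.comp_apply, Function.comp_apply]
    rw [expFamily, ContinuousLinearMap.integral_apply hint, expFamily, ← integral_smul,
      ← integral_smul, ← integral_add]
    · refine integral_congr_ae (ae_of_all _ fun x => ?_)
      simp only [FunLike.coe_smul, Pi.smul_apply, ContinuousLinearMap.smulRight_apply, hL₁v, hL₂v,
        gaussExponent_apply, gauss_eq_exp_mul hp, smul_smul, ← add_smul]
      congr 1
      simp only [norm_sub_sq_real, inner_sub_left, inner_sub_right, inner_smul_right]
      rw [real_inner_comm p.2 x]
      field_simp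
      ring
    · exact (hint.apply_continuousLinearMap _).smul _
    · exact hint0.smul _

end Weighted

lemma polyGrowth_one : PolyGrowth (fun _ : State d => (1 : ℝ)) :=
  ⟨1, 0, zero_le_one, fun x => by simp⟩

lemma polyGrowth_id : PolyGrowth (fun x : State d => x) :=
  ⟨1, 1, zero_le_one, fun x => by simp⟩

/-- The density at `u` of the convolution of `μ` with the centred Gaussian of variance `ρ`, as a
function of `p = (ρ, u)`. -/
def heat (μ : Measure (State d)) (p : ℝ × State d) : ℝ :=
  (2 * Real.pi * p.1) ^ (-(d : ℝ) / 2) * gaussAverage μ (fun _ => (1 : ℝ)) p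

/-- The spatial gradient of `heat`. -/
def heatGrad (μ : Measure (State d)) (p : ℝ × State d) : State d :=
  (2 * Real.pi * p.1) ^ (-(d : ℝ) / 2) • (p.1⁻¹ •
    (gaussAverage μ (fun x => x) p - gaussAverage μ (fun _ => (1 : ℝ)) p • p.2))

/-- The spatial Laplacian of `heat`. -/
def heatLap (μ : Measure (State d)) (p : ℝ × State d) : ℝ :=
  divergence (fun u => heatGrad μ (p.1, u)) p.2

lemma contDiffOn_normalisation :
    ContDiffOn ℝ (⊤ : ℕ∞) (fun p : ℝ × State d => (2 * Real.pi * p.1) ^ (-(d : ℝ) / 2))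
      {p | 0 < p.1} := by
  refine ContDiffOn.rpow_const_of_ne (contDiffOn_const.mul contDiffOn_fst) fun p hp => ?_
  have : 0 < p.1 := hp
  positivity

section Finite
variable {μ : Measure (State d)} [IsFiniteMeasure μ]

lemma contDiffOn_heat : ContDiffOn ℝ (⊤ : ℕ∞) (heat μ) {p | 0 < p.1} :=
  contDiffOn_normalisation.mul (contDiffOn_gaussAverage continuous_const polyGrowth_one)

lemma contDiffOn_heatGrad : ContDiffOn ℝ (⊤ : ℕ∞) (heatGrad μ) {p | 0 < p.1} := by
  refine contDiffOn_normalisation.smul (ContDiffOn.smul (contDiffOn_fst.inv ?_)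
    ((contDiffOn_gaussAverage continuous_id' polyGrowth_id).sub
      ((contDiffOn_gaussAverage continuous_const polyGrowth_one).smul contDiffOn_snd)))
  exact fun p hp => ne_of_gt hp

lemma hasFDerivAt_snd_slice {F : Type*} [NormedAddCommGroup F] [NormedSpace ℝ F]
    {f : ℝ × State d → F} {L : ℝ × State d →L[ℝ] F} {ρ : ℝ} {u : State d}
    (h : HasFDerivAt f L (ρ, u)) :
    HasFDerivAt (fun u => f (ρ, u)) (L.comp (ContinuousLinearMap.inr ℝ ℝ (State d))) u :=
  h.comp u (hasFDerivAt_prodMk_right ρ u)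

lemma hasDerivAt_fst_slice {F : Type*} [NormedAddCommGroup F] [NormedSpace ℝ F]
    {f : ℝ × State d → F} {L : ℝ × State d →L[ℝ] F} {ρ : ℝ} {u : State d}
    (h : HasFDerivAt f L (ρ, u)) :
    HasDerivAt (fun r => f (r, u)) (L (1, 0)) ρ := by
  have := (h.comp ρ (hasFDerivAt_prodMk_left ρ u)).hasDerivAt
  simpa [Function.comp_def] using this

lemma hasGradientAt_heat {ρ : ℝ} (hρ : 0 < ρ) (u : State d) :
    HasGradientAt (fun u => heat μ (ρ, u)) (heatGrad μ (ρ, u)) u := by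
  obtain ⟨L, hL, hLv⟩ := hasFDerivAt_gaussAverage (μ := μ) (p := (ρ, u))
    (continuous_const (y := (1 : ℝ))) polyGrowth_one hρ
  have h := (hasFDerivAt_snd_slice hL).const_mul ((2 * Real.pi * ρ) ^ (-(d : ℝ) / 2))
  rw [hasGradientAt_iff_hasFDerivAt]
  refine h.congr_fderiv ?_
  symm
  apply ContinuousLinearMap.ext
  intro v
  simp only [InnerProductSpace.toDual_apply_apply, heatGrad, FunLike.coe_smul,
    Pi.smul_apply,
    ContinuousLinearMap.comp_apply, ContinuousLinearMap.inr_apply, hLv, inner_smul_left,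
    inner_sub_left, smul_eq_mul, gaussAverage]
  have e1 : inner ℝ (∫ x, Real.exp (-‖u - x‖ ^ 2 / (2 * ρ)) • x ∂μ) v =
      ∫ x, Real.exp (-‖u - x‖ ^ 2 / (2 * ρ)) * inner ℝ x v ∂μ := by
    have := integrable_gaussAverage (μ := μ) (p := (ρ, u)) continuous_id' polyGrowth_id hρ
    rw [real_inner_comm, ← integral_inner this]
    simp only [inner_smul_right, real_inner_comm v]
  have i1 : Integrable (fun x => Real.exp (-‖u - x‖ ^ 2 / (2 * ρ)) * inner ℝ x v) μ := by
    have := (integrable_gaussAverage (μ := μ) (p := (ρ, u))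
      continuous_id' polyGrowth_id hρ).inner_const (𝕜 := ℝ) v
    simpa [inner_smul_left] using this
  have i2 : Integrable (fun x => Real.exp (-‖u - x‖ ^ 2 / (2 * ρ)) * 1) μ :=
    integrable_gaussAverage (μ := μ) (p := (ρ, u)) continuous_const polyGrowth_one hρ
  have e2 : ∫ x, Real.exp (-‖u - x‖ ^ 2 / (2 * ρ)) *
      ((‖u - x‖ ^ 2 / (2 * ρ ^ 2) * 0 - ρ⁻¹ * (inner ℝ u v - inner ℝ x v)) * 1) ∂μ =
      ρ⁻¹ * (∫ x, Real.exp (-‖u - x‖ ^ 2 / (2 * ρ)) * inner ℝ x v ∂μ -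
        (∫ x, Real.exp (-‖u - x‖ ^ 2 / (2 * ρ)) * 1 ∂μ) * inner ℝ u v) := by
    rw [← integral_mul_const, ← integral_sub i1 (i2.mul_const _), ← integral_const_mul]
    refine integral_congr_ae (ae_of_all _ fun x => ?_)
    simp only
    ring
  rw [e1, e2]
  simp

lemma heat_pos (hμ : μ ≠ 0) {ρ : ℝ} (hρ : 0 < ρ) (u : State d) : 0 < heat μ (ρ, u) := by
  have h1 := integrable_gaussAverage (μ := μ) (p := (ρ, u))
    (continuous_const (y := (1 : ℝ))) polyGrowth_one hρ
  refine mul_pos (by positivity) ((integral_pos_iff_support_of_nonneg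
    (fun x => by simp; positivity) h1).2 ?_)
  have : Function.support (fun x : State d =>
      Real.exp (-‖((ρ, u) : ℝ × State d).2 - x‖ ^ 2 / (2 * ((ρ, u) : ℝ × State d).1)) • (1 : ℝ))
      = univ := by
    ext x; simp
  rw [this]
  simpa [pos_iff_ne_zero] using hμ

lemma sum_inner_single_mul (a b : State d) :
    ∑ i, inner ℝ a (EuclideanSpace.single i (1 : ℝ)) * b i = inner ℝ a b := by
  simp [PiLp.inner_apply, mul_comm]

/-- Divergence of the product of a scalar and a vector field. -/
lemma divergence_smul {f : State d → ℝ} {g : State d} {G : State d → State d} {x : State d}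
    (hf : HasGradientAt f g x) (hG : DifferentiableAt ℝ G x) :
    divergence (fun y => f y • G y) x = inner ℝ g (G x) + f x * divergence G x := by
  have h := hf.hasFDerivAt.fun_smul hG.hasFDerivAt
  unfold divergence
  rw [h.fderiv]
  simp only [FunLike.coe_add, FunLike.coe_smul, Pi.add_apply, Pi.smul_apply,
    ContinuousLinearMap.smulRight_apply, InnerProductSpace.toDual_apply_apply, PiLp.add_apply,
    PiLp.smul_apply, smul_eq_mul, Finset.sum_add_distrib, Finset.mul_sum]
  rw [sum_inner_single_mul, add_comm]

lemma divergence_const_smul {G : State d → State d} {x : State d} (c : ℝ)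
    (hG : DifferentiableAt ℝ G x) :
    divergence (fun y => c • G y) x = c * divergence G x := by
  unfold divergence
  rw [(hG.hasFDerivAt.fun_const_smul c).fderiv]
  simp [Finset.mul_sum]

lemma divergence_add {G H : State d → State d} {x : State d}
    (hG : DifferentiableAt ℝ G x) (hH : DifferentiableAt ℝ H x) :
    divergence (fun y => G y + H y) x = divergence G x + divergence H x := by
  unfold divergence
  rw [(hG.hasFDerivAt.fun_add hH.hasFDerivAt).fderiv]
  simp [Finset.sum_add_distrib]

lemma divergence_sub {G H : State d → State d} {x : State d}
    (hG : DifferentiableAt ℝ G x) (hH : DifferentiableAt ℝ H x) :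
    divergence (fun y => G y - H y) x = divergence G x - divergence H x := by
  unfold divergence
  rw [(hG.hasFDerivAt.fun_sub hH.hasFDerivAt).fderiv]
  simp [Finset.sum_sub_distrib]

lemma divergence_id (x : State d) : divergence (fun y : State d => y) x = d := by
  unfold divergence
  rw [show fderiv ℝ (fun y : State d => y) x = _ from fderiv_fun_id]
  simp

/-- The Laplacian of a `C²` function is the divergence of its gradient. -/
lemma laplacian_eq_divergence_gradient {f : State d → ℝ} {x : State d}
    (hf : ContDiffAt ℝ 2 f x) :
    Laplacian.laplacian f x = divergence (gradient f) x := by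
  rw [InnerProductSpace.laplacian_eq_iteratedFDeriv_orthonormalBasis f
    (EuclideanSpace.basisFun (Fin d) ℝ)]
  unfold divergence
  have h1 : DifferentiableAt ℝ (fderiv ℝ f) x :=
    (hf.fderiv_right (m := 1) (by norm_num)).differentiableAt (by norm_num)
  have hcomp : ∀ (i : Fin d) (y : State d),
      gradient f y i = fderiv ℝ f y (EuclideanSpace.single i 1) := fun i y => by
    rw [← InnerProductSpace.toDual_symm_apply (𝕜 := ℝ), real_inner_comm]
    simp [gradient, EuclideanSpace.inner_single_left]
  have hd : DifferentiableAt ℝ (gradient f) x := by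
    rw [differentiableAt_euclidean]
    intro i
    simp only [hcomp]
    exact h1.clm_apply (differentiableAt_const _)
  refine Finset.sum_congr rfl fun i _ => ?_
  have h2 : (fderiv ℝ (gradient f) x (EuclideanSpace.single i 1)) i =
      fderiv ℝ (fun y => gradient f y i) x (EuclideanSpace.single i 1) := by
    have := ((EuclideanSpace.proj (𝕜 := ℝ) (ι := Fin d) i).hasFDerivAt.comp x
      hd.hasFDerivAt).fderiv
    have h3 : fderiv ℝ (fun y => gradient f y i) x =
      (EuclideanSpace.proj i).comp (fderiv ℝ (gradient f) x) := this
    rw [h3]; rfl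
  rw [h2, iteratedFDeriv_two_apply]
  simp only [hcomp]
  rw [fderiv_clm_apply h1 (differentiableAt_const _)]
  simp

end Finite

/-! #### Heat equation and growth of the score -/

section PolyGrowth
variable {F : Type*} [NormedAddCommGroup F]

lemma polyGrowth_const (c : F) : PolyGrowth (fun _ : State d => c) :=
  ⟨‖c‖, 0, norm_nonneg c, fun x => by simp⟩

lemma PolyGrowth.add {k l : State d → F} (hk : PolyGrowth k) (hl : PolyGrowth l) :
    PolyGrowth (fun x => k x + l x) := by
  obtain ⟨C, n, hC, h⟩ := hk
  obtain ⟨D, m, hD, h'⟩ := hl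
  refine ⟨C + D, n + m, by positivity, fun x => ?_⟩
  have h1 : (1 : ℝ) ≤ 1 + ‖x‖ := by linarith [norm_nonneg x]
  calc _ ≤ ‖k x‖ + ‖l x‖ := norm_add_le _ _
    _ ≤ C * (1 + ‖x‖) ^ n + D * (1 + ‖x‖) ^ m := add_le_add (h x) (h' x)
    _ ≤ C * (1 + ‖x‖) ^ (n + m) + D * (1 + ‖x‖) ^ (n + m) := by
      gcongr <;> first | exact h1 | omega
    _ = _ := by ring

lemma PolyGrowth.smul [NormedSpace ℝ F] {f : State d → ℝ} {k : State d → F} (hf : PolyGrowth f)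
    (hk : PolyGrowth k) : PolyGrowth (fun x => f x • k x) := by
  obtain ⟨C, n, hC, h⟩ := hf
  obtain ⟨D, m, hD, h'⟩ := hk
  refine ⟨C * D, n + m, by positivity, fun x => ?_⟩
  rw [norm_smul]
  calc _ ≤ (C * (1 + ‖x‖) ^ n) * (D * (1 + ‖x‖) ^ m) := by
        gcongr
        · exact h x
        · exact h' x
    _ = _ := by ring

lemma PolyGrowth.inner {k l : State d → State d} (hk : PolyGrowth k) (hl : PolyGrowth l) :
    PolyGrowth (fun x => inner ℝ (k x) (l x)) := by
  obtain ⟨C, n, hC, h⟩ := hk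
  obtain ⟨D, m, hD, h'⟩ := hl
  refine ⟨C * D, n + m, by positivity, fun x => ?_⟩
  calc _ ≤ ‖k x‖ * ‖l x‖ := norm_inner_le_norm _ _
    _ ≤ (C * (1 + ‖x‖) ^ n) * (D * (1 + ‖x‖) ^ m) := by
        gcongr
        · exact h x
        · exact h' x
    _ = _ := by ring

lemma polyGrowth_apply (i : Fin d) : PolyGrowth (fun x : State d => x i) :=
  ⟨1, 1, zero_le_one, fun x => by
    have := PiLp.norm_apply_le x i
    simp only [one_mul, pow_one]; linarith⟩

lemma polyGrowth_sub_left (u : State d) : PolyGrowth (fun x : State d => u - x) := by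
  simpa [sub_eq_add_neg] using (polyGrowth_const u).add
    ((polyGrowth_const (-1 : ℝ)).smul polyGrowth_id)

lemma polyGrowth_norm_sub_sq (u : State d) : PolyGrowth (fun x : State d => ‖u - x‖ ^ 2) := by
  simpa only [real_inner_self_eq_norm_sq] using
    (polyGrowth_sub_left u).inner (polyGrowth_sub_left u)

end PolyGrowth

section Finite
variable {μ : Measure (State d)} [IsFiniteMeasure μ]

lemma heatLap_eq {ρ : ℝ} (hρ : 0 < ρ) (u : State d) :
    heatLap μ (ρ, u) = (2 * Real.pi * ρ) ^ (-(d : ℝ) / 2) *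
      ∫ x, Real.exp (-‖u - x‖ ^ 2 / (2 * ρ)) * (‖u - x‖ ^ 2 / ρ ^ 2 - d / ρ) ∂μ := by
  obtain ⟨L, hL, hLv⟩ := hasFDerivAt_gaussAverage (μ := μ) (p := (ρ, u))
    (continuous_const (y := (1 : ℝ))) polyGrowth_one hρ
  obtain ⟨M, hM, hMv⟩ := hasFDerivAt_gaussAverage (μ := μ) (p := (ρ, u))
    (continuous_id' (X := State d)) polyGrowth_id hρ
  have hB := (hasFDerivAt_snd_slice hL).hasGradientAt
  have hA := hasFDerivAt_snd_slice hM
  have hint : ∀ {k : State d → ℝ}, Continuous k → PolyGrowth k →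
      Integrable (fun x => Real.exp (-‖u - x‖ ^ 2 / (2 * ρ)) * k x) μ := fun hk hg => by
    simpa only [smul_eq_mul] using integrable_gaussAverage (μ := μ) (p := (ρ, u)) hk hg hρ
  have hG : DifferentiableAt ℝ (fun y => gaussAverage μ (fun _ => (1 : ℝ)) (ρ, y) • y) u :=
    hB.differentiableAt.smul differentiableAt_fun_id
  have hdivA : divergence (fun y => gaussAverage μ (fun x => x) (ρ, y)) u =
      ∫ x, Real.exp (-‖u - x‖ ^ 2 / (2 * ρ)) * (-(ρ⁻¹ * inner ℝ (u - x) x)) ∂μ := by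
    unfold divergence
    rw [show fderiv ℝ (fun y => gaussAverage μ (fun x => x) (ρ, y)) u = _ from hA.fderiv]
    have e : ∀ i : Fin d, ((M.comp (ContinuousLinearMap.inr ℝ ℝ (State d)))
        (EuclideanSpace.single i 1)) i = ∫ x, Real.exp (-‖u - x‖ ^ 2 / (2 * ρ)) *
          (-(ρ⁻¹ * inner ℝ (u - x) (EuclideanSpace.single i 1)) * x i) ∂μ := fun i => by
      rw [ContinuousLinearMap.comp_apply, ContinuousLinearMap.inr_apply, hMv]
      have hi := integrable_gaussAverage (μ := μ) (p := (ρ, u))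
        (k := fun x => (‖u - x‖ ^ 2 / (2 * ρ ^ 2) * 0 -
          ρ⁻¹ * inner ℝ (u - x) (EuclideanSpace.single i 1)) • x) (by fun_prop) (by
          have := (((polyGrowth_const (-ρ⁻¹)).smul ((polyGrowth_sub_left u).inner
            (polyGrowth_const (EuclideanSpace.single i (1 : ℝ))))).smul polyGrowth_id)
          simpa using this) hρ
      have := ((EuclideanSpace.proj (𝕜 := ℝ) (ι := Fin d) i).integral_comp_comm hi).symm
      refine this.trans (integral_congr_ae (ae_of_all _ fun x => ?_))
      simp
    rw [Finset.sum_congr rfl fun i _ => e i, ← integral_finsetSum]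
    · refine integral_congr_ae (ae_of_all _ fun x => ?_)
      simp only
      rw [← sum_inner_single_mul, ← neg_mul, Finset.mul_sum, Finset.mul_sum]
      exact Finset.sum_congr rfl fun i _ => by ring
    · intro i _
      refine hint (by fun_prop) ?_
      have := (((polyGrowth_const (-ρ⁻¹)).smul ((polyGrowth_sub_left u).inner
            (polyGrowth_const (EuclideanSpace.single i (1 : ℝ))))).smul (polyGrowth_apply i))
      simpa using this
  have hdivB : divergence (fun y => gaussAverage μ (fun _ => (1 : ℝ)) (ρ, y) • y) u =
      ∫ x, Real.exp (-‖u - x‖ ^ 2 / (2 * ρ)) * (-(ρ⁻¹ * inner ℝ (u - x) u) + d) ∂μ := by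
    rw [divergence_smul hB differentiableAt_fun_id, divergence_id,
      InnerProductSpace.toDual_symm_apply, ContinuousLinearMap.comp_apply,
      ContinuousLinearMap.inr_apply, hLv, gaussAverage, ← integral_mul_const, ← integral_add]
    · refine integral_congr_ae (ae_of_all _ fun x => ?_)
      simp
      ring
    · have := hint (k := fun x => -(ρ⁻¹ * inner ℝ (u - x) u)) (by fun_prop) (by
        have := (polyGrowth_const (-ρ⁻¹)).smul
          ((polyGrowth_sub_left u).inner (polyGrowth_const u))
        simpa using this)
      simpa using this
    · exact (hint continuous_const polyGrowth_one).mul_const _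
  unfold heatLap heatGrad
  simp only
  rw [divergence_const_smul _ ((hA.differentiableAt.fun_sub hG).fun_const_smul _),
    divergence_const_smul _ (hA.differentiableAt.fun_sub hG),
    divergence_sub hA.differentiableAt hG, hdivA, hdivB, ← integral_sub, ← integral_const_mul]
  · congr 1
    refine integral_congr_ae (ae_of_all _ fun x => ?_)
    simp only
    rw [← real_inner_self_eq_norm_sq]
    have : inner ℝ (u - x) (u - x) = inner ℝ (u - x) u - inner ℝ (u - x) x := inner_sub_right _ _ _
    rw [this]
    field_simp
    ring
  · refine hint (by fun_prop) ?_
    have := (polyGrowth_const (-ρ⁻¹)).smul ((polyGrowth_sub_left u).inner polyGrowth_id)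
    simpa using this
  · refine hint (by fun_prop) ?_
    have := ((polyGrowth_const (-ρ⁻¹)).smul
      ((polyGrowth_sub_left u).inner (polyGrowth_const u))).add (polyGrowth_const (d : ℝ))
    simpa using this

/-- The heat equation `∂_ρ heat = ½ Δ heat`. -/
lemma hasDerivAt_heat {ρ : ℝ} (hρ : 0 < ρ) (u : State d) :
    HasDerivAt (fun r => heat μ (r, u)) (1 / 2 * heatLap μ (ρ, u)) ρ := by
  obtain ⟨L, hL, hLv⟩ := hasFDerivAt_gaussAverage (μ := μ) (p := (ρ, u))
    (continuous_const (y := (1 : ℝ))) polyGrowth_one hρ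
  have h1 := hasDerivAt_fst_slice hL
  have h0 : HasDerivAt (fun r : ℝ => 2 * Real.pi * r) (2 * Real.pi) ρ := by
    simpa using (hasDerivAt_id ρ).const_mul (2 * Real.pi)
  have h2 := h0.rpow_const (p := -(d : ℝ) / 2) (Or.inl (by positivity))
  refine (h2.fun_mul h1).congr_deriv ?_
  rw [heatLap_eq hρ, hLv, gaussAverage, Real.rpow_sub_one (by positivity)]
  have hi1 : Integrable (fun x => Real.exp (-‖u - x‖ ^ 2 / (2 * ρ)) * 1) μ :=
    integrable_gaussAverage (μ := μ) (p := (ρ, u)) continuous_const polyGrowth_one hρ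
  have hi2 : Integrable (fun x => Real.exp (-‖u - x‖ ^ 2 / (2 * ρ)) * ‖u - x‖ ^ 2) μ :=
    integrable_gaussAverage (μ := μ) (p := (ρ, u)) (by fun_prop) (polyGrowth_norm_sub_sq u) hρ
  have e1 : ∫ x, Real.exp (-‖u - x‖ ^ 2 / (2 * ρ)) * (‖u - x‖ ^ 2 / ρ ^ 2 - d / ρ) ∂μ =
      (∫ x, Real.exp (-‖u - x‖ ^ 2 / (2 * ρ)) * ‖u - x‖ ^ 2 ∂μ) / ρ ^ 2 -
      (∫ x, Real.exp (-‖u - x‖ ^ 2 / (2 * ρ)) * 1 ∂μ) * (d / ρ) := by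
    rw [← integral_div, ← integral_mul_const, ← integral_sub (hi2.div_const _) (hi1.mul_const _)]
    refine integral_congr_ae (ae_of_all _ fun x => ?_)
    simp only
    ring
  have e2 : ∫ x, Real.exp (-‖((ρ, u) : ℝ × State d).2 - x‖ ^ 2 / (2 * ((ρ, u) : ℝ × State d).1)) •
      ((‖((ρ, u) : ℝ × State d).2 - x‖ ^ 2 / (2 * ((ρ, u) : ℝ × State d).1 ^ 2) *
        ((1, 0) : ℝ × State d).1 - ((ρ, u) : ℝ × State d).1⁻¹ *
          inner ℝ (((ρ, u) : ℝ × State d).2 - x) ((1, 0) : ℝ × State d).2) • (1 : ℝ)) ∂μ =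
      (∫ x, Real.exp (-‖u - x‖ ^ 2 / (2 * ρ)) * ‖u - x‖ ^ 2 ∂μ) / (2 * ρ ^ 2) := by
    rw [← integral_div]
    refine integral_congr_ae (ae_of_all _ fun x => ?_)
    simp
    ring
  rw [e1, e2]
  simp only [smul_eq_mul]
  field_simp
  ring

lemma exists_ball_measure_pos (hμ : μ ≠ 0) :
    ∃ K, 0 ≤ K ∧ 0 < μ.real (Metric.closedBall 0 K) := by
  by_contra! h
  refine hμ (Measure.measure_univ_eq_zero.1 ?_)
  rw [← Metric.iUnion_closedBall_nat (0 : State d), measure_iUnion_null_iff]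
  intro n
  have := h n (Nat.cast_nonneg n)
  rw [← measureReal_eq_zero_iff]
  exact le_antisymm this measureReal_nonneg

lemma mul_exp_le_gaussAverage {K ρ : ℝ} (hρ : 0 < ρ) (u : State d) :
    μ.real (Metric.closedBall 0 K) * Real.exp (-(‖u‖ + K) ^ 2 / (2 * ρ)) ≤
      gaussAverage μ (fun _ => (1 : ℝ)) (ρ, u) := by
  have hi : Integrable (fun x => Real.exp (-‖u - x‖ ^ 2 / (2 * ρ)) * 1) μ :=
    integrable_gaussAverage (μ := μ) (p := (ρ, u)) continuous_const polyGrowth_one hρ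
  calc _ = ∫ x in Metric.closedBall 0 K, Real.exp (-(‖u‖ + K) ^ 2 / (2 * ρ)) ∂μ := by simp
    _ ≤ ∫ x in Metric.closedBall 0 K, Real.exp (-‖u - x‖ ^ 2 / (2 * ρ)) * 1 ∂μ := by
      refine setIntegral_mono_on (integrable_const _) hi.integrableOn
        Metric.isClosed_closedBall.measurableSet fun x hx => ?_
      rw [mul_one]
      have : ‖u - x‖ ≤ ‖u‖ + K :=
        (norm_sub_le u x).trans (by linarith [mem_closedBall_zero_iff.1 hx])
      gcongr
    _ ≤ _ := setIntegral_le_integral hi (ae_of_all _ fun x => by simp; positivity)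

/-- Linear growth of the score `∇ log heat`, uniformly for `ρ` in a compact subset of `(0, ∞)`:
points at distance more than `2 (‖u‖ + K)` from `u` are outweighed by the mass of the ball of
radius `K`. -/
lemma exists_norm_heatGrad_le (hμ : μ ≠ 0) {a b : ℝ} (ha : 0 < a) :
    ∃ C, 0 ≤ C ∧ ∀ ρ ∈ Icc a b, ∀ u : State d,
      ‖heatGrad μ (ρ, u)‖ ≤ C * (1 + ‖u‖) * heat μ (ρ, u) := by
  obtain ⟨K, hK, hκ⟩ := exists_ball_measure_pos hμ
  set κ := μ.real (Metric.closedBall 0 K)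
  set D := (1 + 4 * b) * μ.real univ / κ
  rcases lt_or_ge b a with hab | hab
  · exact ⟨0, le_rfl, fun ρ hρ => absurd (hρ.1.trans hρ.2) (not_le.2 hab)⟩
  have hb : 0 < b := ha.trans_le hab
  have hD : 0 ≤ D := by positivity
  refine ⟨a⁻¹ * (2 + 2 * K + D), by positivity, fun ρ hρ u => ?_⟩
  have hρ0 : 0 < ρ := ha.trans_le hρ.1
  have hi1 : Integrable (fun x => Real.exp (-‖u - x‖ ^ 2 / (2 * ρ)) * 1) μ :=
    integrable_gaussAverage (μ := μ) (p := (ρ, u)) continuous_const polyGrowth_one hρ0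
  have hix : Integrable (fun x => Real.exp (-‖u - x‖ ^ 2 / (2 * ρ)) • x) μ :=
    integrable_gaussAverage (μ := μ) (p := (ρ, u)) continuous_id' polyGrowth_id hρ0
  have hZ := mul_exp_le_gaussAverage (μ := μ) (K := K) hρ0 u
  set Z := gaussAverage μ (fun _ => (1 : ℝ)) (ρ, u) with hZdef
  set A := 2 * (‖u‖ + K) with hA
  have hpt : ∀ x, ‖Real.exp (-‖u - x‖ ^ 2 / (2 * ρ)) • (x - u)‖ ≤
      A * (Real.exp (-‖u - x‖ ^ 2 / (2 * ρ)) * 1) + (1 + 4 * ρ) * Real.exp (-A ^ 2 / (4 * ρ)) := by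
    intro x
    rw [norm_smul, Real.norm_eq_abs, Real.abs_exp, norm_sub_rev x u, mul_one]
    set y := ‖u - x‖
    have hy : 0 ≤ y := norm_nonneg _
    rcases le_or_gt y A with h | h
    · have : 0 ≤ (1 + 4 * ρ) * Real.exp (-A ^ 2 / (4 * ρ)) := by positivity
      nlinarith [Real.exp_pos (-y ^ 2 / (2 * ρ))]
    · have h1 : Real.exp (-y ^ 2 / (2 * ρ)) =
          Real.exp (-y ^ 2 / (4 * ρ)) * Real.exp (-y ^ 2 / (4 * ρ)) := by
        rw [← Real.exp_add]; congr 1; field_simp; ring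
      have h2 : y * Real.exp (-y ^ 2 / (4 * ρ)) ≤ 1 + 4 * ρ := by
        have h3 : Real.exp (-y ^ 2 / (4 * ρ)) * (1 + y ^ 2 / (4 * ρ)) ≤ 1 := by
          have h5 := Real.add_one_le_exp (y ^ 2 / (4 * ρ))
          calc _ ≤ Real.exp (-y ^ 2 / (4 * ρ)) * Real.exp (y ^ 2 / (4 * ρ)) := by
                gcongr; linarith
            _ = 1 := by rw [← Real.exp_add, neg_div, neg_add_cancel, Real.exp_zero]
        have h4 : y ≤ (1 + 4 * ρ) * (1 + y ^ 2 / (4 * ρ)) := by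
          have : (1 + 4 * ρ) * (1 + y ^ 2 / (4 * ρ)) =
            1 + 4 * ρ + y ^ 2 / (4 * ρ) + y ^ 2 := by field_simp; ring
          rw [this]
          have : 0 ≤ y ^ 2 / (4 * ρ) := by positivity
          nlinarith [sq_nonneg (y - 1)]
        calc _ ≤ (1 + 4 * ρ) * (1 + y ^ 2 / (4 * ρ)) * Real.exp (-y ^ 2 / (4 * ρ)) := by gcongr
          _ = (1 + 4 * ρ) * (Real.exp (-y ^ 2 / (4 * ρ)) * (1 + y ^ 2 / (4 * ρ))) := by ring
          _ ≤ (1 + 4 * ρ) * 1 := by gcongr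
          _ = _ := mul_one _
      have hA0 : 0 ≤ A := by positivity
      have h5 : Real.exp (-y ^ 2 / (4 * ρ)) ≤ Real.exp (-A ^ 2 / (4 * ρ)) := by gcongr
      have h6 : 0 ≤ A * Real.exp (-y ^ 2 / (2 * ρ)) := by positivity
      calc _ = (y * Real.exp (-y ^ 2 / (4 * ρ))) * Real.exp (-y ^ 2 / (4 * ρ)) := by
            rw [h1]; ring
        _ ≤ (1 + 4 * ρ) * Real.exp (-A ^ 2 / (4 * ρ)) := by gcongr
        _ ≤ _ := by linarith
  have hint : ‖∫ x, Real.exp (-‖u - x‖ ^ 2 / (2 * ρ)) • (x - u) ∂μ‖ ≤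
      A * Z + (1 + 4 * ρ) * Real.exp (-A ^ 2 / (4 * ρ)) * μ.real univ := by
    refine (norm_integral_le_of_norm_le ((hi1.const_mul A).add (integrable_const
      ((1 + 4 * ρ) * Real.exp (-A ^ 2 / (4 * ρ))))) (ae_of_all _ hpt)).trans_eq ?_
    simp only [Pi.add_apply]
    rw [integral_add (hi1.const_mul A) (integrable_const _), integral_const_mul, integral_const,
      smul_eq_mul, mul_comm (μ.real univ)]
    rfl
  have hgrad : heatGrad μ (ρ, u) = (2 * Real.pi * ρ) ^ (-(d : ℝ) / 2) • (ρ⁻¹ •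
      ∫ x, Real.exp (-‖u - x‖ ^ 2 / (2 * ρ)) • (x - u) ∂μ) := by
    simp only [heatGrad, gaussAverage, smul_sub]
    rw [integral_sub hix, ← integral_smul_const]
    · simp [smul_sub]
    · simpa using hi1.smul_const u
  have hZ2 : Real.exp (-A ^ 2 / (4 * ρ)) ≤ Z / κ := by
    rw [le_div_iff₀' hκ]
    refine le_trans ?_ hZ
    refine mul_le_mul_of_nonneg_left (Real.exp_le_exp.2 ?_) hκ.le
    rw [hA, div_le_div_iff₀ (by positivity) (by positivity)]
    nlinarith [mul_nonneg (sq_nonneg (‖u‖ + K)) hρ0.le]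
  have hZ0 : 0 ≤ Z := le_trans (by positivity) hZ
  rw [hgrad, norm_smul, norm_smul, heat, ← hZdef, norm_inv, Real.norm_of_nonneg hρ0.le,
    Real.norm_of_nonneg (by positivity)]
  have hfin : ‖∫ x, Real.exp (-‖u - x‖ ^ 2 / (2 * ρ)) • (x - u) ∂μ‖ ≤
      (2 + 2 * K + D) * (1 + ‖u‖) * Z := by
    calc _ ≤ _ := hint
      _ ≤ A * Z + (1 + 4 * b) * (Z / κ) * μ.real univ := by gcongr; exact hρ.2
      _ = (A + D) * Z := by simp only [D]; field_simp
      _ ≤ _ := by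
        gcongr
        rw [hA]
        nlinarith [mul_nonneg hK (norm_nonneg u), mul_nonneg hD (norm_nonneg u), norm_nonneg u]
  calc _ ≤ (2 * Real.pi * ρ) ^ (-(d : ℝ) / 2) * (a⁻¹ * ((2 + 2 * K + D) * (1 + ‖u‖) * Z)) := by
        gcongr; exact hρ.1
    _ = _ := by ring

end Finite

/-! ### Noise schedules -/

/-- The noise-to-signal ratio `σ_t² / α_t²`, the natural clock of the diffusion: in the variable
`x / α_t` the forward density is the heat flow of the data at this time. -/
def noiseRatio (α σ : ℝ → ℝ) (t : ℝ) : ℝ := σ t ^ 2 / α t ^ 2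

namespace IsNoiseSchedule
variable {α σ : ℝ → ℝ} (h : IsNoiseSchedule α σ)
include h

lemma hasDerivAt_signal {t : ℝ} (ht : t ∈ Ioo (0 : ℝ) 1) :
    HasDerivAt α (derivWithin α (Icc 0 1) t) t :=
  (h.differentiableOn_signal t (Ioo_subset_Icc_self ht)).hasDerivWithinAt.hasDerivAt
    (Icc_mem_nhds ht.1 ht.2)

lemma hasDerivAt_noise_sq {t : ℝ} (ht : t ∈ Ioo (0 : ℝ) 1) :
    HasDerivAt (fun s => σ s ^ 2) (derivWithin (fun s => σ s ^ 2) (Icc 0 1) t) t :=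
  ((h.differentiableOn_noise.pow 2) t (Ioo_subset_Icc_self ht)).hasDerivWithinAt.hasDerivAt
    (Icc_mem_nhds ht.1 ht.2)

lemma continuousOn_signal : ContinuousOn α (Icc 0 1) := h.differentiableOn_signal.continuousOn

lemma continuousOn_noise : ContinuousOn σ (Icc 0 1) := h.differentiableOn_noise.continuousOn

lemma continuousOn_noiseRatio : ContinuousOn (noiseRatio α σ) (Ico 0 1) := by
  refine ((h.continuousOn_noise.mono Ico_subset_Icc_self).pow 2).div
    ((h.continuousOn_signal.mono Ico_subset_Icc_self).pow 2) fun t ht => ?_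
  have := h.signal_pos t ht
  positivity

lemma noiseRatio_pos {t : ℝ} (ht : t ∈ Ioo (0 : ℝ) 1) : 0 < noiseRatio α σ t := by
  have h1 := h.signal_pos t ⟨ht.1.le, ht.2⟩
  have h2 := h.noise_pos t ⟨ht.1, ht.2.le⟩
  unfold noiseRatio
  positivity

lemma noiseRatio_zero : noiseRatio α σ 0 = 0 := by simp [noiseRatio, h.noise_zero]

lemma hasDerivAt_noiseRatio {t : ℝ} (ht : t ∈ Ioo (0 : ℝ) 1) :
    HasDerivAt (noiseRatio α σ) (diffusionSq α σ t / α t ^ 2) t := by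
  have hα : α t ≠ 0 := (h.signal_pos t ⟨ht.1.le, ht.2⟩).ne'
  have := (h.hasDerivAt_noise_sq ht).div ((h.hasDerivAt_signal ht).fun_pow 2) (by positivity)
  refine this.congr_deriv ?_
  unfold diffusionSq linearDrift
  field_simp
  norm_num
  ring

lemma monotoneOn_noiseRatio : MonotoneOn (noiseRatio α σ) (Ico 0 1) := by
  refine monotoneOn_of_deriv_nonneg (convex_Ico 0 1) h.continuousOn_noiseRatio ?_ ?_
  · rw [interior_Ico]
    exact fun t ht => (h.hasDerivAt_noiseRatio ht).differentiableAt.differentiableWithinAt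
  · rw [interior_Ico]
    intro t ht
    rw [(h.hasDerivAt_noiseRatio ht).deriv]
    have := h.diffusionSq_nonneg t ⟨ht.1.le, ht.2⟩
    positivity

lemma tendsto_noiseRatio_one : Tendsto (noiseRatio α σ) (𝓝[<] 1) atTop := by
  have hα : Tendsto α (𝓝[<] 1) (𝓝[>] 0) := by
    refine tendsto_nhdsWithin_iff.2 ⟨?_, ?_⟩
    · have := (h.continuousOn_signal 1 (by simp)).mono_left
        (nhdsWithin_mono 1 (Ioo_subset_Icc_self (a := (0 : ℝ))))
      rw [h.signal_one, nhdsWithin_Ioo_eq_nhdsLT zero_lt_one] at this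
      exact this
    · filter_upwards [Ioo_mem_nhdsLT (zero_lt_one (α := ℝ))] with t ht
      exact h.signal_pos t ⟨ht.1.le, ht.2⟩
  have hσ : Tendsto σ (𝓝[<] 1) (𝓝 1) := by
    have := (h.continuousOn_noise 1 (by simp)).mono_left
        (nhdsWithin_mono 1 (Ioo_subset_Icc_self (a := (0 : ℝ))))
    rwa [h.noise_one, nhdsWithin_Ioo_eq_nhdsLT zero_lt_one] at this
  have h1 : Tendsto (fun t => (σ t / α t) ^ 2) (𝓝[<] 1) atTop := by
    refine (tendsto_pow_atTop (by norm_num)).comp ?_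
    exact Tendsto.pos_mul_atTop zero_lt_one hσ (tendsto_inv_nhdsGT_zero.comp hα)
  refine h1.congr fun t => ?_
  rw [noiseRatio, div_pow]

/-- Every positive noise level is attained in the open time interval. -/
lemma exists_noiseRatio_eq {r : ℝ} (hr : 0 < r) :
    ∃ t ∈ Ioo (0 : ℝ) 1, noiseRatio α σ t = r := by
  obtain ⟨b, hb, hb1⟩ := ((h.tendsto_noiseRatio_one.eventually (eventually_gt_atTop r)).and
    (Ioo_mem_nhdsLT (zero_lt_one (α := ℝ)))).exists
  obtain ⟨t, ht, hrt⟩ := intermediate_value_Icc hb1.1.le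
    (h.continuousOn_noiseRatio.mono fun s hs => ⟨hs.1, hs.2.trans_lt hb1.2⟩)
    (show r ∈ Icc (noiseRatio α σ 0) (noiseRatio α σ b) from
      ⟨by rw [h.noiseRatio_zero]; exact hr.le, hb.le⟩)
  refine ⟨t, ⟨lt_of_le_of_ne ht.1 ?_, ht.2.trans_lt hb1.2⟩, hrt⟩
  rintro rfl
  rw [h.noiseRatio_zero] at hrt
  exact hr.ne hrt

end IsNoiseSchedule

/-! ### The forward density as a rescaled heat flow -/

/-- The density at `x` of `a • X + √v • N`, with `X` distributed as `μ` and `N` a standard Gaussian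
vector independent of `X`. -/
def gaussMix (μ : Measure (State d)) (a v : ℝ) (x : State d) : ℝ :=
  (2 * Real.pi * v) ^ (-(d : ℝ) / 2) * ∫ y, Real.exp (-‖x - a • y‖ ^ 2 / (2 * v)) ∂μ

lemma gaussMix_eq_heat (μ : Measure (State d)) {a v : ℝ} (ha : 0 < a) (hv : 0 < v)
    (x : State d) :
    gaussMix μ a v x = a ^ (-(d : ℝ)) * heat μ (v / a ^ 2, a⁻¹ • x) := by
  unfold gaussMix heat gaussAverage
  have h1 : (2 * Real.pi * v) ^ (-(d : ℝ) / 2) =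
      a ^ (-(d : ℝ)) * (2 * Real.pi * (v / a ^ 2)) ^ (-(d : ℝ) / 2) := by
    rw [show a ^ (-(d : ℝ)) = (a ^ 2) ^ (-(d : ℝ) / 2) by
      rw [← Real.rpow_natCast, ← Real.rpow_mul ha.le]; congr 1; push_cast; ring]
    rw [← Real.mul_rpow (by positivity) (by positivity)]
    congr 1
    field_simp
  rw [h1, mul_assoc]
  congr 2
  refine integral_congr_ae (ae_of_all _ fun y => ?_)
  simp only [smul_eq_mul, mul_one]
  congr 1
  have h2 : x - a • y = a • (a⁻¹ • x - y) := by
    rw [smul_sub, smul_smul, mul_inv_cancel₀ ha.ne', one_smul]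
  rw [h2, norm_smul, mul_pow, Real.norm_of_nonneg ha.le]
  field_simp

lemma IsProbDensity.isProbabilityMeasure {p : State d → ℝ} (hp : IsProbDensity p) :
    IsProbabilityMeasure (densityMeasure p) := by
  constructor
  rw [densityMeasure, withDensity_apply _ MeasurableSet.univ, Measure.restrict_univ,
    ← ofReal_integral_eq_lintegral_ofReal hp.integrable (ae_of_all _ hp.nonneg),
    hp.integral_eq_one, ENNReal.ofReal_one]

lemma integral_densityMeasure {F : Type*} [NormedAddCommGroup F] [NormedSpace ℝ F]
    {p : State d → ℝ} (h0 : ∀ x, 0 ≤ p x)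
    (hp : AEMeasurable p) (f : State d → F) :
    ∫ x, f x ∂(densityMeasure p) = ∫ x, p x • f x := by
  rw [densityMeasure, integral_withDensity_eq_integral_toReal_smul₀ hp.ennreal_ofReal
    (ae_of_all _ fun x => ENNReal.ofReal_lt_top)]
  simp [ENNReal.toReal_ofReal, h0]

lemma forwardDensity_eq_gaussMix {α σ : ℝ → ℝ} {p₀ : State d → ℝ} (hp₀ : IsProbDensity p₀)
    {t : ℝ} (ht : t ≠ 0) (x : State d) :
    forwardDensity α σ p₀ t x = gaussMix (densityMeasure p₀) (α t) (σ t ^ 2) x := by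
  rw [forwardDensity, if_neg ht, gaussMix,
    integral_densityMeasure hp₀.nonneg hp₀.integrable.1.aemeasurable, ← integral_const_mul]
  refine integral_congr_ae (ae_of_all _ fun y => ?_)
  simp only [condDensity, smul_eq_mul]
  ring

lemma reverseDensity_eq_heat {α σ : ℝ → ℝ} (h : IsNoiseSchedule α σ) {p₀ : State d → ℝ}
    (hp₀ : IsProbDensity p₀) {τ : ℝ} (hτ : τ ∈ Ioo (0 : ℝ) 1) (x : State d) :
    reverseDensity α σ p₀ τ x = α (1 - τ) ^ (-(d : ℝ)) *
      heat (densityMeasure p₀) (noiseRatio α σ (1 - τ), (α (1 - τ))⁻¹ • x) := by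
  have ht : 1 - τ ∈ Ioo (0 : ℝ) 1 := ⟨by linarith [hτ.2], by linarith [hτ.1]⟩
  have h1 := h.signal_pos _ ⟨ht.1.le, ht.2⟩
  have h2 := h.noise_pos _ ⟨ht.1, ht.2.le⟩
  rw [reverseDensity, forwardDensity_eq_gaussMix hp₀ ht.1.ne',
    gaussMix_eq_heat _ h1 (by positivity)]
  rfl

lemma gaussMix_pos {μ : Measure (State d)} [IsFiniteMeasure μ] (hμ : μ ≠ 0) {v : ℝ} (hv : 0 < v)
    (a : ℝ) (x : State d) : 0 < gaussMix μ a v x := by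
  have hi : Integrable (fun y => Real.exp (-‖x - a • y‖ ^ 2 / (2 * v))) μ := by
    refine Integrable.of_bound (by fun_prop) 1 (ae_of_all _ fun y => ?_)
    rw [Real.norm_eq_abs, Real.abs_exp]
    refine Real.exp_le_one_iff.2 ?_
    rw [neg_div, neg_nonpos]; positivity
  refine mul_pos (by positivity) ((integral_pos_iff_support_of_nonneg
    (fun x => by positivity) hi).2 ?_)
  have : Function.support (fun y : State d => Real.exp (-‖x - a • y‖ ^ 2 / (2 * v))) = univ := by
    ext x; simp
  rw [this]
  simpa [pos_iff_ne_zero] using hμ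

lemma reverseDensity_pos {α σ : ℝ → ℝ} (h : IsNoiseSchedule α σ) {p₀ : State d → ℝ}
    (hp₀ : IsProbDensity p₀) {τ : ℝ} (hτ : τ ∈ Ico (0 : ℝ) 1) (x : State d) :
    0 < reverseDensity α σ p₀ τ x := by
  have := hp₀.isProbabilityMeasure
  have h2 := h.noise_pos (1 - τ) ⟨by linarith [hτ.2], by linarith [hτ.1]⟩
  rw [reverseDensity, forwardDensity_eq_gaussMix hp₀ (by linarith [hτ.2])]
  exact gaussMix_pos (IsProbabilityMeasure.ne_zero _) (by positivity) _ _

/-! ### The continuity and Fokker-Planck equations -/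

section PDE
variable {α σ : ℝ → ℝ} (h : IsNoiseSchedule α σ) {p₀ : State d → ℝ} (hp₀ : IsProbDensity p₀)

lemma hasGradientAt_comp_smul {f : State d → ℝ} {g : State d} (c : ℝ) {x : State d}
    (hf : HasGradientAt f g (c • x)) : HasGradientAt (fun y => f (c • y)) (c • g) x := by
  rw [hasGradientAt_iff_hasFDerivAt]
  refine (hf.hasFDerivAt.comp x ((hasFDerivAt_id x).const_smul c)).congr_fderiv ?_
  apply ContinuousLinearMap.ext
  intro v
  simp

lemma HasGradientAt.const_mul' {f : State d → ℝ} {g : State d} (c : ℝ) {x : State d}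
    (hf : HasGradientAt f g x) : HasGradientAt (fun y => c * f y) (c • g) x := by
  rw [hasGradientAt_iff_hasFDerivAt]
  refine (hf.hasFDerivAt.const_mul c).congr_fderiv ?_
  apply ContinuousLinearMap.ext
  intro v
  simp

lemma divergence_comp_smul {G : State d → State d} (c : ℝ) {x : State d}
    (hG : DifferentiableAt ℝ G (c • x)) :
    divergence (fun y => G (c • y)) x = c * divergence G (c • x) := by
  unfold divergence
  have := hG.hasFDerivAt.comp x ((hasFDerivAt_id x).const_smul c)
  rw [show fderiv ℝ (fun y => G (c • y)) x = _ from this.fderiv]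
  simp [Finset.mul_sum]

lemma differentiable_heatGrad_slice {μ : Measure (State d)} [IsFiniteMeasure μ] {ρ : ℝ}
    (hρ : 0 < ρ) : Differentiable ℝ (fun u => heatGrad μ (ρ, u)) :=
  (contDiffOn_heatGrad.comp_contDiff (contDiff_const.prodMk contDiff_id)
    fun _ => hρ).differentiable (by simp)

/-- The gradient of `q_τ`. -/
def reverseGrad (α σ : ℝ → ℝ) (p₀ : State d → ℝ) (τ : ℝ) (x : State d) : State d :=
  α (1 - τ) ^ (-(d : ℝ)) • ((α (1 - τ))⁻¹ •
    heatGrad (densityMeasure p₀) (noiseRatio α σ (1 - τ), (α (1 - τ))⁻¹ • x))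

/-- The Laplacian of `q_τ`. -/
def reverseLap (α σ : ℝ → ℝ) (p₀ : State d → ℝ) (τ : ℝ) (x : State d) : ℝ :=
  α (1 - τ) ^ (-(d : ℝ)) * ((α (1 - τ))⁻¹ * ((α (1 - τ))⁻¹ *
    heatLap (densityMeasure p₀) (noiseRatio α σ (1 - τ), (α (1 - τ))⁻¹ • x)))

include h hp₀

lemma hasGradientAt_reverseDensity {τ : ℝ} (hτ : τ ∈ Ioo (0 : ℝ) 1) (x : State d) :
    HasGradientAt (reverseDensity α σ p₀ τ) (reverseGrad α σ p₀ τ x) x := by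
  have := hp₀.isProbabilityMeasure
  rw [show reverseDensity α σ p₀ τ = _ from funext (reverseDensity_eq_heat h hp₀ hτ)]
  exact HasGradientAt.const_mul' _ (hasGradientAt_comp_smul _ (hasGradientAt_heat
    (h.noiseRatio_pos ⟨by linarith [hτ.2], by linarith [hτ.1]⟩) _))

lemma gradient_reverseDensity {τ : ℝ} (hτ : τ ∈ Ioo (0 : ℝ) 1) :
    gradient (reverseDensity α σ p₀ τ) = reverseGrad α σ p₀ τ :=
  funext fun x => (hasGradientAt_reverseDensity h hp₀ hτ x).gradient

lemma contDiff_reverseDensity {τ : ℝ} (hτ : τ ∈ Ioo (0 : ℝ) 1) :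
    ContDiff ℝ (⊤ : ℕ∞) (reverseDensity α σ p₀ τ) := by
  have := hp₀.isProbabilityMeasure
  rw [show reverseDensity α σ p₀ τ = _ from funext (reverseDensity_eq_heat h hp₀ hτ)]
  refine contDiff_const.mul ?_
  exact contDiffOn_heat.comp_contDiff (contDiff_const.prodMk (contDiff_const_smul _))
    fun x => h.noiseRatio_pos ⟨by linarith [hτ.2], by linarith [hτ.1]⟩

lemma differentiable_reverseGrad {τ : ℝ} (hτ : τ ∈ Ioo (0 : ℝ) 1) :
    Differentiable ℝ (reverseGrad α σ p₀ τ) := by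
  have hρ := h.noiseRatio_pos (t := 1 - τ) ⟨by linarith [hτ.2], by linarith [hτ.1]⟩
  have := hp₀.isProbabilityMeasure
  have hc : Differentiable ℝ (fun y : State d => (α (1 - τ))⁻¹ • y) :=
    differentiable_id.fun_const_smul _
  exact (((differentiable_heatGrad_slice (μ := densityMeasure p₀) hρ).comp hc).fun_const_smul
    _).fun_const_smul _

lemma divergence_reverseGrad {τ : ℝ} (hτ : τ ∈ Ioo (0 : ℝ) 1) (x : State d) :
    divergence (reverseGrad α σ p₀ τ) x = reverseLap α σ p₀ τ x := by
  have hρ := h.noiseRatio_pos (t := 1 - τ) ⟨by linarith [hτ.2], by linarith [hτ.1]⟩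
  have := hp₀.isProbabilityMeasure
  have hd := differentiable_heatGrad_slice (μ := densityMeasure p₀) hρ
  have hc : DifferentiableAt ℝ (fun y => heatGrad (densityMeasure p₀)
      (noiseRatio α σ (1 - τ), (α (1 - τ))⁻¹ • y)) x :=
    (hd.comp (differentiable_id.const_smul (α (1 - τ))⁻¹)) x
  have h1 := divergence_const_smul (α (1 - τ) ^ (-(d : ℝ)))
    (hc.fun_const_smul (α (1 - τ))⁻¹)
  rw [divergence_const_smul _ hc, divergence_comp_smul (G := fun y => heatGrad
    (densityMeasure p₀) (noiseRatio α σ (1 - τ), y)) _ (hd _)] at h1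
  exact h1

lemma reverseScore_eq {τ : ℝ} (hτ : τ ∈ Ioo (0 : ℝ) 1) (x : State d) :
    reverseScore α σ p₀ τ x = (reverseDensity α σ p₀ τ x)⁻¹ • reverseGrad α σ p₀ τ x := by
  have hq := reverseDensity_pos h hp₀ ⟨hτ.1.le, hτ.2⟩ x
  have h1 := (hasGradientAt_reverseDensity h hp₀ hτ x).hasFDerivAt.log hq.ne'
  unfold reverseScore
  refine HasGradientAt.gradient ?_
  rw [hasGradientAt_iff_hasFDerivAt]
  refine h1.congr_fderiv ?_
  apply ContinuousLinearMap.ext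
  intro v
  simp

lemma smul_reverseScore {τ : ℝ} (hτ : τ ∈ Ioo (0 : ℝ) 1) (x : State d) :
    reverseDensity α σ p₀ τ x • reverseScore α σ p₀ τ x = reverseGrad α σ p₀ τ x := by
  rw [reverseScore_eq h hp₀ hτ, smul_smul,
    mul_inv_cancel₀ (reverseDensity_pos h hp₀ ⟨hτ.1.le, hτ.2⟩ x).ne', one_smul]

/-- The score in the variable `x / α`. -/
lemma reverseScore_eq_heat {τ : ℝ} (hτ : τ ∈ Ioo (0 : ℝ) 1) (x : State d) :
    reverseScore α σ p₀ τ x = (α (1 - τ))⁻¹ •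
      (heat (densityMeasure p₀) (noiseRatio α σ (1 - τ), (α (1 - τ))⁻¹ • x))⁻¹ •
      heatGrad (densityMeasure p₀) (noiseRatio α σ (1 - τ), (α (1 - τ))⁻¹ • x) := by
  have ha := h.signal_pos (1 - τ) ⟨by linarith [hτ.2], by linarith [hτ.1]⟩
  have hA : 0 < α (1 - τ) ^ (-(d : ℝ)) := by positivity
  rw [reverseScore_eq h hp₀ hτ, reverseDensity_eq_heat h hp₀ hτ, reverseGrad, smul_smul, smul_smul,
    smul_smul]
  congr 1
  rw [mul_inv]
  field_simp

/-- Forward equation for `q_τ`, from the heat equation by scaling. -/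
lemma hasDerivAt_reverseDensity {τ : ℝ} (hτ : τ ∈ Ioo (0 : ℝ) 1) (x : State d) :
    HasDerivAt (fun s => reverseDensity α σ p₀ s x)
      (linearDrift α (1 - τ) * (inner ℝ (reverseGrad α σ p₀ τ x) x +
        reverseDensity α σ p₀ τ x * d) -
        1 / 2 * diffusionSq α σ (1 - τ) * reverseLap α σ p₀ τ x) τ := by
  have := hp₀.isProbabilityMeasure
  have ht : 1 - τ ∈ Ioo (0 : ℝ) 1 := ⟨by linarith [hτ.2], by linarith [hτ.1]⟩
  have ha := h.signal_pos (1 - τ) ⟨ht.1.le, ht.2⟩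
  have hρ := h.noiseRatio_pos ht
  set μ := densityMeasure p₀
  have hα := h.hasDerivAt_signal ht
  have hα2 := hα.rpow_const (p := -(d : ℝ)) (Or.inl ha.ne')
  have hu : HasDerivAt (fun t => (α t)⁻¹ • x)
      ((-derivWithin α (Icc 0 1) (1 - τ) / α (1 - τ) ^ 2) • x) (1 - τ) :=
    (hα.fun_inv ha.ne').smul_const x
  have hF : HasFDerivAt (heat μ) (fderiv ℝ (heat μ) (noiseRatio α σ (1 - τ), (α (1 - τ))⁻¹ • x))
      (noiseRatio α σ (1 - τ), (α (1 - τ))⁻¹ • x) :=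
    ((contDiffOn_heat.contDiffAt ((isOpen_lt continuous_const continuous_fst).mem_nhds
      hρ)).differentiableAt (by simp)).hasFDerivAt
  set L := fderiv ℝ (heat μ) (noiseRatio α σ (1 - τ), (α (1 - τ))⁻¹ • x)
  set u := (α (1 - τ))⁻¹ • x
  have hL1 : L (1, 0) = 1 / 2 * heatLap μ (noiseRatio α σ (1 - τ), u) :=
    (hasDerivAt_fst_slice hF).unique (hasDerivAt_heat hρ u)
  have hL2 : ∀ v, L (0, v) = inner ℝ (heatGrad μ (noiseRatio α σ (1 - τ), u)) v := fun v => by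
    have := (hasFDerivAt_snd_slice hF).unique (hasGradientAt_heat hρ u).hasFDerivAt
    simpa using DFunLike.congr_fun this v
  have hcomp := hF.comp_hasDerivAt (1 - τ) ((h.hasDerivAt_noiseRatio ht).prodMk hu)
  have hq := (hα2.fun_mul hcomp).scomp τ ((hasDerivAt_id τ).const_sub 1)
  refine (hq.congr_of_eventuallyEq ?_).congr_deriv ?_
  · filter_upwards [Ioo_mem_nhds hτ.1 hτ.2] with s hs
    exact reverseDensity_eq_heat h hp₀ hs x
  · have hsplit : ∀ (r : ℝ) (v : State d), L (r, v) = r * L (1, 0) + L (0, v) := fun r v => by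
      rw [← smul_eq_mul, ← map_smul, ← map_add]; simp
    rw [hsplit, hL1, hL2, reverseDensity_eq_heat h hp₀ hτ, reverseGrad, reverseLap, linearDrift,
      Real.rpow_sub_one ha.ne']
    simp only [inner_smul_left, inner_smul_right, smul_eq_mul, Function.comp_apply,
      RCLike.conj_to_real]
    simp only [u, μ]
    field_simp
    ring

lemma divergence_flux {τ : ℝ} (hτ : τ ∈ Ioo (0 : ℝ) 1) (a b : ℝ) :
    (Differentiable ℝ fun y => reverseDensity α σ p₀ τ y •
      (-(a • y) + b • reverseScore α σ p₀ τ y)) ∧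
    ∀ x, divergence (fun y => reverseDensity α σ p₀ τ y •
      (-(a • y) + b • reverseScore α σ p₀ τ y)) x =
      -a * (inner ℝ (reverseGrad α σ p₀ τ x) x + reverseDensity α σ p₀ τ x * d) +
        b * reverseLap α σ p₀ τ x := by
  have e : (fun y => reverseDensity α σ p₀ τ y • (-(a • y) + b • reverseScore α σ p₀ τ y)) =
      fun y => (-a) • (reverseDensity α σ p₀ τ y • y) + b • reverseGrad α σ p₀ τ y := by
    funext y
    rw [← smul_reverseScore h hp₀ hτ]
    module
  have h1 : Differentiable ℝ (fun y => reverseDensity α σ p₀ τ y • y) := fun y =>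
    (hasGradientAt_reverseDensity h hp₀ hτ y).differentiableAt.smul differentiableAt_fun_id
  have h2 := differentiable_reverseGrad h hp₀ hτ
  rw [e]
  refine ⟨(h1.fun_const_smul _).fun_add (h2.fun_const_smul _), fun x => ?_⟩
  rw [divergence_add ((h1 x).fun_const_smul _) ((h2 x).fun_const_smul _),
    divergence_const_smul _ (h1 x),
    divergence_const_smul (G := fun y => reverseGrad α σ p₀ τ y) _ (h2 x),
    divergence_smul (hasGradientAt_reverseDensity h hp₀ hτ x) differentiableAt_fun_id,
    divergence_id, ← divergence_reverseGrad h hp₀ hτ]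

theorem solvesContinuityEquation :
    SolvesContinuityEquation (reverseDensity α σ p₀) (odeVelocity α σ p₀) := by
  intro τ hτ
  obtain ⟨h1, h2⟩ := divergence_flux h hp₀ hτ (linearDrift α (1 - τ))
    ((1 / 2 : ℝ) * diffusionSq α σ (1 - τ))
  refine ⟨h1, fun x => (hasDerivAt_reverseDensity h hp₀ hτ x).congr_deriv ?_⟩
  rw [show divergence (fun y => reverseDensity α σ p₀ τ y • odeVelocity α σ p₀ τ y) x = _ from h2 x]
  ring

theorem solvesFokkerPlanck :
    SolvesFokkerPlanck (reverseDensity α σ p₀) (sdeDrift α σ p₀)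
      (fun τ => diffusionSq α σ (1 - τ)) := by
  intro τ hτ
  obtain ⟨h1, h2⟩ := divergence_flux h hp₀ hτ (linearDrift α (1 - τ)) (diffusionSq α σ (1 - τ))
  have hC : ContDiff ℝ 2 (reverseDensity α σ p₀ τ) :=
    contDiff_infty.1 (contDiff_reverseDensity h hp₀ hτ) 2
  refine ⟨hC, h1, fun x => (hasDerivAt_reverseDensity h hp₀ hτ x).congr_deriv ?_⟩
  rw [show divergence (fun y => reverseDensity α σ p₀ τ y • sdeDrift α σ p₀ τ y) x = _ from h2 x,
    laplacian_eq_divergence_gradient hC.contDiffAt, gradient_reverseDensity h hp₀ hτ,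
    divergence_reverseGrad h hp₀ hτ]
  ring

end PDE

/-! ### Gaussian mixtures as laws -/

/-- The density at `x` of the centred Gaussian vector with covariance `v • I`. -/
def gaussDensity (v : ℝ) (x : State d) : ℝ :=
  (2 * Real.pi * v) ^ (-(d : ℝ) / 2) * Real.exp (-‖x‖ ^ 2 / (2 * v))

/-- The standard Gaussian measure on `ℝ^d`. -/
def stdNormal (d : ℕ) : Measure (State d) := densityMeasure (gaussDensity 1)

lemma gaussDensity_nonneg {v : ℝ} (hv : 0 < v) (x : State d) : 0 ≤ gaussDensity v x := by
  unfold gaussDensity; positivity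

lemma continuous_gaussDensity (v : ℝ) : Continuous (gaussDensity (d := d) v) := by
  unfold gaussDensity; fun_prop

lemma integral_exp_neg_norm_sq {v : ℝ} (hv : 0 < v) :
    ∫ x : State d, Real.exp (-‖x‖ ^ 2 / (2 * v)) = (2 * Real.pi * v) ^ ((d : ℝ) / 2) := by
  have h := GaussianFourier.integral_rexp_neg_mul_sq_norm (V := State d)
    (b := (2 * v)⁻¹) (by positivity)
  rw [finrank_euclideanSpace_fin, div_inv_eq_mul, ← mul_assoc, mul_comm Real.pi 2] at h
  rw [← h]
  refine integral_congr_ae (ae_of_all _ fun x => ?_)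
  simp only
  congr 1
  ring

lemma integral_gaussDensity {v : ℝ} (hv : 0 < v) : ∫ x : State d, gaussDensity v x = 1 := by
  simp only [gaussDensity]
  rw [integral_const_mul, integral_exp_neg_norm_sq hv, ← Real.rpow_add (by positivity), neg_div,
    neg_add_cancel, Real.rpow_zero]

lemma integrable_gaussDensity {v : ℝ} (hv : 0 < v) :
    Integrable (gaussDensity (d := d) v) := by
  by_contra h
  have := integral_gaussDensity (d := d) hv
  rw [integral_undef h] at this
  exact zero_ne_one this

instance : IsProbabilityMeasure (stdNormal d) :=
  IsProbDensity.isProbabilityMeasure ⟨gaussDensity_nonneg one_pos, integrable_gaussDensity one_pos,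
    integral_gaussDensity one_pos⟩

/-- Substituting `x = m + √v • y` in an integral against a Gaussian density. -/
lemma lintegral_gaussDensity_sub {v : ℝ} (hv : 0 < v) (m : State d) {f : State d → ENNReal}
    (hf : Measurable f) :
    ∫⁻ x, ENNReal.ofReal (gaussDensity v (x - m)) * f x =
      ∫⁻ y, f (m + Real.sqrt v • y) ∂(stdNormal d) := by
  have hs : 0 < Real.sqrt v := Real.sqrt_pos.2 hv
  rw [stdNormal, densityMeasure, lintegral_withDensity_eq_lintegral_mul _
    ((continuous_gaussDensity 1).measurable.ennreal_ofReal) (by fun_prop)]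
  rw [← lintegral_add_left_eq_self (μ := volume)
    (fun x => ENNReal.ofReal (gaussDensity v (x - m)) * f x) m]
  simp only [add_sub_cancel_left, Pi.mul_apply]
  have hg : Measurable fun x : State d => ENNReal.ofReal (gaussDensity v x) * f (m + x) :=
    ((continuous_gaussDensity v).measurable.ennreal_ofReal).mul (by fun_prop)
  have key : ∫⁻ y : State d, ENNReal.ofReal (gaussDensity v (Real.sqrt v • y)) *
      f (m + Real.sqrt v • y) = ENNReal.ofReal |(Real.sqrt v ^ d)⁻¹| *
      ∫⁻ x, ENNReal.ofReal (gaussDensity v x) * f (m + x) := by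
    rw [← lintegral_map (f := fun x => ENNReal.ofReal (gaussDensity v x) * f (m + x)) hg
      (measurable_const_smul (Real.sqrt v)), Measure.map_addHaar_smul _ hs.ne',
      lintegral_smul_measure, finrank_euclideanSpace_fin, smul_eq_mul]
  -- The Jacobian of the dilation by `√v` is the ratio of the normalising constants.
  have hdens : ∀ y : State d, ENNReal.ofReal (gaussDensity v (Real.sqrt v • y)) =
      ENNReal.ofReal |(Real.sqrt v ^ d)⁻¹| * ENNReal.ofReal (gaussDensity 1 y) := by
    intro y
    rw [← ENNReal.ofReal_mul (abs_nonneg _), abs_of_pos (by positivity)]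
    congr 1
    unfold gaussDensity
    rw [norm_smul, mul_pow, Real.norm_of_nonneg hs.le, Real.sq_sqrt hv.le,
      Real.mul_rpow (by positivity) hv.le, mul_one, mul_one]
    have : v ^ (-(d : ℝ) / 2) = (Real.sqrt v ^ d)⁻¹ := by
      rw [Real.sqrt_eq_rpow, ← Real.rpow_natCast, ← Real.rpow_mul hv.le, ← Real.rpow_neg hv.le]
      congr 1; ring
    rw [this]
    have : -(v * ‖y‖ ^ 2) / (2 * v) = -‖y‖ ^ 2 / 2 := by field_simp
    rw [this]
    ring
  simp only [hdens, mul_assoc] at key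
  have hm1 : Measurable fun y : State d =>
      ENNReal.ofReal (gaussDensity 1 y) * f (m + Real.sqrt v • y) :=
    ((continuous_gaussDensity 1).measurable.ennreal_ofReal).mul (by fun_prop)
  rw [lintegral_const_mul _ hm1] at key
  refine ((ENNReal.mul_right_inj ?_ ENNReal.ofReal_ne_top).1 key).symm
  rw [Ne, ENNReal.ofReal_eq_zero, not_le]
  positivity

lemma gaussMix_eq_integral (μ : Measure (State d)) (a v : ℝ) (x : State d) :
    gaussMix μ a v x = ∫ y, gaussDensity v (x - a • y) ∂μ := by
  rw [gaussMix, ← integral_const_mul]; rfl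

lemma gaussDensity_le {v : ℝ} (hv : 0 < v) (x : State d) :
    gaussDensity v x ≤ (2 * Real.pi * v) ^ (-(d : ℝ) / 2) := by
  unfold gaussDensity
  refine mul_le_of_le_one_right (by positivity) (Real.exp_le_one_iff.2 ?_)
  rw [neg_div, neg_nonpos]; positivity

lemma integrable_gaussDensity_sub {μ : Measure (State d)} [IsFiniteMeasure μ] {v : ℝ}
    (hv : 0 < v) (a : ℝ) (x : State d) :
    Integrable (fun y => gaussDensity v (x - a • y)) μ := by
  refine Integrable.of_bound ((continuous_gaussDensity v).comp
    (by fun_prop)).aestronglyMeasurable ((2 * Real.pi * v) ^ (-(d : ℝ) / 2))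
    (ae_of_all _ fun y => ?_)
  rw [Real.norm_of_nonneg (gaussDensity_nonneg hv _)]
  exact gaussDensity_le hv _

lemma gaussMix_nonneg (μ : Measure (State d)) (a : ℝ) {v : ℝ} (hv : 0 < v) (x : State d) :
    0 ≤ gaussMix μ a v x := by
  rw [gaussMix_eq_integral]
  exact integral_nonneg fun y => gaussDensity_nonneg hv _

lemma ofReal_gaussMix {μ : Measure (State d)} [IsFiniteMeasure μ] (a : ℝ) {v : ℝ} (hv : 0 < v)
    (x : State d) :
    ENNReal.ofReal (gaussMix μ a v x) = ∫⁻ y, ENNReal.ofReal (gaussDensity v (x - a • y)) ∂μ := by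
  rw [gaussMix_eq_integral, ofReal_integral_eq_lintegral_ofReal
    (integrable_gaussDensity_sub hv a x) (ae_of_all _ fun y => gaussDensity_nonneg hv _)]

/-- `gaussMix μ a v` is the density of `a • X + √v • N`. -/
lemma densityMeasure_gaussMix {μ : Measure (State d)} [IsFiniteMeasure μ] (a : ℝ) {v : ℝ}
    (hv : 0 < v) :
    densityMeasure (gaussMix μ a v) =
      (μ.prod (stdNormal d)).map (fun z => a • z.1 + Real.sqrt v • z.2) := by
  have hm : Measurable fun z : State d × State d => ENNReal.ofReal (gaussDensity v (z.1 - a • z.2)) :=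
    (((continuous_gaussDensity v).comp (by fun_prop)).measurable).ennreal_ofReal
  ext s hs
  rw [densityMeasure, withDensity_apply _ hs, Measure.map_apply (by fun_prop) hs,
    Measure.prod_apply (by measurability), ← lintegral_indicator hs]
  have h1 : ∀ x, s.indicator (fun x => ENNReal.ofReal (gaussMix μ a v x)) x =
      ∫⁻ y, ENNReal.ofReal (gaussDensity v (x - a • y)) * s.indicator 1 x ∂μ := fun x => by
    by_cases hx : x ∈ s
    · simp only [indicator_of_mem hx, Pi.one_apply, mul_one]
      exact ofReal_gaussMix a hv x
    · simp only [indicator_of_notMem hx, mul_zero, lintegral_zero]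
  simp only [h1]
  rw [lintegral_lintegral_swap]
  · refine lintegral_congr fun y => ?_
    rw [lintegral_gaussDensity_sub hv (a • y) (measurable_one.indicator hs)]
    have : (fun z => s.indicator (1 : State d → ENNReal) (a • y + Real.sqrt v • z)) =
        ((fun z : State d => a • y + Real.sqrt v • z) ⁻¹' s).indicator 1 := by
      ext z; rfl
    rw [this, lintegral_indicator_one (by measurability)]
    rfl
  · exact (hm.mul ((measurable_one.indicator hs).comp measurable_fst)).aemeasurable

lemma heat_eq_gaussMix (μ : Measure (State d)) (ρ : ℝ) (u : State d) :
    heat μ (ρ, u) = gaussMix μ 1 ρ u := by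
  simp [heat, gaussMix, gaussAverage]

lemma densityMeasure_heat {μ : Measure (State d)} [IsFiniteMeasure μ] {ρ : ℝ} (hρ : 0 < ρ) :
    densityMeasure (fun u => heat μ (ρ, u)) =
      (μ.prod (stdNormal d)).map (fun z => z.1 + Real.sqrt ρ • z.2) := by
  simp only [heat_eq_gaussMix]
  rw [show (fun u => gaussMix μ 1 ρ u) = gaussMix μ 1 ρ from rfl, densityMeasure_gaussMix 1 hρ]
  simp

lemma heat_nonneg (μ : Measure (State d)) {ρ : ℝ} (hρ : 0 < ρ) (u : State d) :
    0 ≤ heat μ (ρ, u) := by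
  rw [heat_eq_gaussMix]; exact gaussMix_nonneg _ _ hρ _

lemma continuous_heat_slice {μ : Measure (State d)} [IsFiniteMeasure μ] {ρ : ℝ} (hρ : 0 < ρ) :
    Continuous (fun u => heat μ (ρ, u)) :=
  (contDiffOn_heat.comp_contDiff (contDiff_const.prodMk contDiff_id) fun _ => hρ).continuous

instance isProbabilityMeasure_map_add {μ : Measure (State d)} [IsProbabilityMeasure μ] (a b : ℝ) :
    IsProbabilityMeasure ((μ.prod (stdNormal d)).map (fun z => a • z.1 + b • z.2)) :=
  Measure.isProbabilityMeasure_map (by fun_prop)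

lemma isProbabilityMeasure_heat {μ : Measure (State d)} [IsProbabilityMeasure μ] {ρ : ℝ}
    (hρ : 0 < ρ) : IsProbabilityMeasure (densityMeasure (fun u => heat μ (ρ, u))) := by
  rw [densityMeasure_heat hρ]
  exact Measure.isProbabilityMeasure_map (by fun_prop)

/-! #### The law of the forward process -/

section Law
variable {α σ : ℝ → ℝ} (h : IsNoiseSchedule α σ) {p₀ : State d → ℝ} (hp₀ : IsProbDensity p₀)
include h hp₀

/-- `q_τ` is the density of `α_{1-τ} X₀ + σ_{1-τ} N`. -/
lemma densityMeasure_reverseDensity {τ : ℝ} (hτ : τ ∈ Icc (0 : ℝ) 1) :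
    densityMeasure (reverseDensity α σ p₀ τ) =
      ((densityMeasure p₀).prod (stdNormal d)).map
        (fun z => α (1 - τ) • z.1 + σ (1 - τ) • z.2) := by
  have := hp₀.isProbabilityMeasure
  rcases eq_or_lt_of_le hτ.2 with rfl | hlt
  · have e : reverseDensity α σ p₀ 1 = p₀ := by
      funext x; simp [reverseDensity, forwardDensity]
    rw [e]
    simp only [sub_self, h.signal_zero, h.noise_zero, one_smul, zero_smul, add_zero]
    exact measurePreserving_fst.map_eq.symm
  · have h2 := h.noise_pos (1 - τ) ⟨by linarith, by linarith [hτ.1]⟩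
    have e : reverseDensity α σ p₀ τ =
        gaussMix (densityMeasure p₀) (α (1 - τ)) (σ (1 - τ) ^ 2) := by
      funext x
      rw [reverseDensity, forwardDensity_eq_gaussMix hp₀ (by linarith)]
    rw [e, densityMeasure_gaussMix _ (by positivity), Real.sqrt_sq h2.le]

lemma isProbabilityMeasure_reverseDensity {τ : ℝ} (hτ : τ ∈ Icc (0 : ℝ) 1) :
    IsProbabilityMeasure (densityMeasure (reverseDensity α σ p₀ τ)) := by
  have := hp₀.isProbabilityMeasure
  rw [densityMeasure_reverseDensity h hp₀ hτ]
  infer_instance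

/-- The laws `q_τ dx` depend on `τ ∈ [0, 1]` continuously for the weak topology. -/
lemma continuousOn_integral_reverseDensity (φ : BoundedContinuousFunction (State d) ℝ) :
    ContinuousOn (fun τ => ∫ x, φ x ∂(densityMeasure (reverseDensity α σ p₀ τ))) (Icc 0 1) := by
  have := hp₀.isProbabilityMeasure
  have hm : MapsTo (fun τ : ℝ => 1 - τ) (Icc 0 1) (Icc 0 1) :=
    fun τ hτ => ⟨by linarith [hτ.2], by linarith [hτ.1]⟩
  have hα : ContinuousOn (fun τ => α (1 - τ)) (Icc 0 1) :=
    h.continuousOn_signal.comp (by fun_prop) hm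
  have hσ : ContinuousOn (fun τ => σ (1 - τ)) (Icc 0 1) :=
    h.continuousOn_noise.comp (by fun_prop) hm
  have key : ContinuousOn (fun τ => ∫ z, φ (α (1 - τ) • z.1 + σ (1 - τ) • z.2)
      ∂((densityMeasure p₀).prod (stdNormal d))) (Icc 0 1) := by
    refine continuousOn_of_dominated (bound := fun _ => ‖φ‖) ?_ ?_ (integrable_const _) ?_
    · exact fun τ _ => (φ.continuous.comp (by fun_prop)).aestronglyMeasurable
    · exact fun τ _ => ae_of_all _ fun z => φ.norm_coe_le_norm _
    · exact ae_of_all _ fun z => φ.continuous.comp_continuousOn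
        ((hα.smul continuousOn_const).add (hσ.smul continuousOn_const))
  refine key.congr fun τ hτ => ?_
  simp only
  rw [densityMeasure_reverseDensity h hp₀ hτ, integral_map (by fun_prop)
    φ.continuous.aestronglyMeasurable]

/-- An almost sure limit of random variables with laws `q_τ` has the limit law. -/
lemma hasLaw_reverseDensity_of_tendsto {Ω : Type*} [MeasurableSpace Ω] {P : Measure Ω}
    [IsProbabilityMeasure P] {Y : ℝ → Ω → State d} {τ₀ : ℝ} (hτ₀ : τ₀ ∈ Icc (0 : ℝ) 1)
    (hlaw : ∀ τ ∈ Ioo (0 : ℝ) 1, HasLaw (Y τ) (densityMeasure (reverseDensity α σ p₀ τ)) P)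
    {X : Ω → State d}
    (hlim : ∀ᵐ ω ∂P, Tendsto (fun τ => Y τ ω) (𝓝[Ioo 0 1] τ₀) (𝓝 (X ω))) :
    HasLaw X (densityMeasure (reverseDensity α σ p₀ τ₀)) P := by
  have hne : (𝓝[Ioo (0 : ℝ) 1] τ₀).NeBot := by
    rw [← mem_closure_iff_nhdsWithin_neBot, closure_Ioo zero_ne_one]
    exact hτ₀
  obtain ⟨t, ht, htlim⟩ : ∃ t : ℕ → ℝ, (∀ n, t n ∈ Ioo (0 : ℝ) 1) ∧
      Tendsto t atTop (𝓝[Ioo 0 1] τ₀) := by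
    obtain ⟨t, ht⟩ := exists_seq_tendsto (𝓝[Ioo (0 : ℝ) 1] τ₀)
    obtain ⟨N, hN⟩ := eventually_atTop.1 (ht.eventually self_mem_nhdsWithin)
    exact ⟨fun n => t (n + N), fun n => hN _ (by omega), ht.comp (tendsto_add_atTop_nat N)⟩
  have hX : AEMeasurable X P := aemeasurable_of_tendsto_metrizable_ae atTop
    (fun n => (hlaw _ (ht n)).aemeasurable) (hlim.mono fun ω hω => hω.comp htlim)
  refine ⟨hX, ?_⟩
  have := isProbabilityMeasure_reverseDensity h hp₀ hτ₀
  have := Measure.isProbabilityMeasure_map hX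
  refine ext_of_forall_integral_eq_of_IsFiniteMeasure fun φ => ?_
  rw [integral_map hX φ.continuous.aestronglyMeasurable]
  have h1 : Tendsto (fun n => ∫ ω, φ (Y (t n) ω) ∂P) atTop (𝓝 (∫ ω, φ (X ω) ∂P)) := by
    refine tendsto_integral_of_dominated_convergence (fun _ => ‖φ‖) ?_ (integrable_const _) ?_ ?_
    · exact fun n => φ.continuous.comp_aestronglyMeasurable
        (hlaw _ (ht n)).aemeasurable.aestronglyMeasurable
    · exact fun n => ae_of_all _ fun ω => φ.norm_coe_le_norm _
    · exact hlim.mono fun ω hω => (φ.continuous.tendsto _).comp (hω.comp htlim)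
  have h2 : Tendsto (fun n => ∫ ω, φ (Y (t n) ω) ∂P) atTop
      (𝓝 (∫ x, φ x ∂(densityMeasure (reverseDensity α σ p₀ τ₀)))) := by
    have h3 := ((continuousOn_integral_reverseDensity h hp₀ φ) τ₀ hτ₀).mono_left
      (nhdsWithin_mono τ₀ Ioo_subset_Icc_self)
    refine (h3.comp htlim).congr fun n => ?_
    simp only [Function.comp_apply]
    rw [← (hlaw _ (ht n)).map_eq, integral_map (hlaw _ (ht n)).aemeasurable
      φ.continuous.aestronglyMeasurable]
  exact tendsto_nhds_unique h1 h2

end Law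

/-! ### Flows of time-dependent vector fields -/

/-- Grönwall's inequality, with the rate given through a primitive `A` so that no integrability of
the rate is needed. -/
lemma gronwall_of_deriv_le {D A D' A' : ℝ → ℝ} {a b : ℝ} (hab : a ≤ b)
    (hD : ContinuousOn D (Icc a b)) (hA : ContinuousOn A (Icc a b))
    (hD' : ∀ t ∈ Ioo a b, HasDerivAt D (D' t) t) (hA' : ∀ t ∈ Ioo a b, HasDerivAt A (A' t) t)
    (hle : ∀ t ∈ Ioo a b, D' t ≤ A' t * D t) :
    D b ≤ Real.exp (A b - A a) * D a := by
  have hd : ∀ t ∈ Ioo a b, HasDerivAt (fun t => D t * Real.exp (-A t))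
      (D' t * Real.exp (-A t) + D t * (Real.exp (-A t) * -A' t)) t :=
    fun t ht => (hD' t ht).fun_mul (hA' t ht).fun_neg.exp
  have hanti : AntitoneOn (fun t => D t * Real.exp (-A t)) (Icc a b) := by
    refine antitoneOn_of_deriv_nonpos (convex_Icc a b) (hD.mul (hA.neg.rexp)) ?_ ?_
    · rw [interior_Icc]
      exact fun t ht => (hd t ht).differentiableAt.differentiableWithinAt
    · rw [interior_Icc]
      intro t ht
      rw [(hd t ht).deriv]
      have := hle t ht
      have he := Real.exp_pos (-A t)
      nlinarith
  have h := hanti (left_mem_Icc.2 hab) (right_mem_Icc.2 hab) hab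
  simp only at h
  rw [Real.exp_sub, ← mul_div_right_comm, le_div_iff₀ (Real.exp_pos _)]
  rw [Real.exp_neg, Real.exp_neg] at h
  field_simp at h
  linarith

/-- Two-sided version of Grönwall's inequality. -/
lemma gronwall_two_sided {D A D' A' : ℝ → ℝ} {a b : ℝ} (hab : a ≤ b)
    (hD : ContinuousOn D (Icc a b)) (hA : ContinuousOn A (Icc a b))
    (hD' : ∀ t ∈ Ioo a b, HasDerivAt D (D' t) t) (hA' : ∀ t ∈ Ioo a b, HasDerivAt A (A' t) t)
    (hle : ∀ t ∈ Ioo a b, |D' t| ≤ A' t * D t) :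
    D b ≤ Real.exp (A b - A a) * D a ∧ D a ≤ Real.exp (A b - A a) * D b := by
  have ha : a ∈ Icc a b := left_mem_Icc.2 hab
  have hb : b ∈ Icc a b := right_mem_Icc.2 hab
  constructor
  · exact gronwall_of_deriv_le hab hD hA hD' hA' fun t ht => (le_abs_self _).trans (hle t ht)
  · have hd : ∀ t ∈ Ioo a b, HasDerivAt (fun t => D t * Real.exp (A t))
        (D' t * Real.exp (A t) + D t * (Real.exp (A t) * A' t)) t :=
      fun t ht => (hD' t ht).fun_mul (hA' t ht).exp
    have hmono : MonotoneOn (fun t => D t * Real.exp (A t)) (Icc a b) := by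
      refine monotoneOn_of_deriv_nonneg (convex_Icc a b) (hD.mul (hA.rexp)) ?_ ?_
      · rw [interior_Icc]
        exact fun t ht => (hd t ht).differentiableAt.differentiableWithinAt
      · rw [interior_Icc]
        intro t ht
        rw [(hd t ht).deriv]
        have := (abs_le.1 (hle t ht)).1
        have he := Real.exp_pos (A t)
        nlinarith
    have h := hmono ha hb hab
    simp only at h
    rw [Real.exp_sub, ← mul_div_right_comm, le_div_iff₀ (Real.exp_pos _)]
    linarith

/-- Comparison of two solutions of `γ' = c(τ) v(S(τ), γ)` where `S' = c` has constant sign `ε`. -/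
lemma dist_sq_solutions_le {v : ℝ × State d → State d} {S c : ℝ → ℝ} {a b L ε : ℝ}
    {γ₁ γ₂ : ℝ → State d} (hab : a ≤ b)
    (hS : ContinuousOn S (Icc a b)) (hS' : ∀ τ ∈ Ioo a b, HasDerivAt S (c τ) τ)
    (hc : ∀ τ ∈ Ioo a b, |c τ| ≤ ε * c τ)
    (hγ₁ : ContinuousOn γ₁ (Icc a b)) (hγ₂ : ContinuousOn γ₂ (Icc a b))
    (hγ₁' : ∀ τ ∈ Ioo a b, HasDerivAt γ₁ (c τ • v (S τ, γ₁ τ)) τ)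
    (hγ₂' : ∀ τ ∈ Ioo a b, HasDerivAt γ₂ (c τ • v (S τ, γ₂ τ)) τ)
    (hv : ∀ τ ∈ Ioo a b, ‖v (S τ, γ₁ τ) - v (S τ, γ₂ τ)‖ ≤ L * ‖γ₁ τ - γ₂ τ‖) :
    ‖γ₁ b - γ₂ b‖ ^ 2 ≤
      Real.exp (2 * L * ε * S b - 2 * L * ε * S a) * ‖γ₁ a - γ₂ a‖ ^ 2 ∧
    ‖γ₁ a - γ₂ a‖ ^ 2 ≤
      Real.exp (2 * L * ε * S b - 2 * L * ε * S a) * ‖γ₁ b - γ₂ b‖ ^ 2 := by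
  refine gronwall_two_sided (D := fun τ => ‖γ₁ τ - γ₂ τ‖ ^ 2) (A := fun τ => 2 * L * ε * S τ) hab
    ((hγ₁.sub hγ₂).norm.pow 2) (continuousOn_const.mul hS)
    (fun τ hτ => ((hγ₁' τ hτ).fun_sub (hγ₂' τ hτ)).norm_sq)
    (fun τ hτ => (hS' τ hτ).const_mul _) fun τ hτ => ?_
  rw [← smul_sub, inner_smul_right, abs_mul, abs_mul, abs_two]
  have h1 : |inner ℝ (γ₁ τ - γ₂ τ) (v (S τ, γ₁ τ) - v (S τ, γ₂ τ))| ≤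
      ‖γ₁ τ - γ₂ τ‖ * (L * ‖γ₁ τ - γ₂ τ‖) :=
    (abs_real_inner_le_norm _ _).trans (by gcongr; exact hv τ hτ)
  calc 2 * (|c τ| * |inner ℝ (γ₁ τ - γ₂ τ) (v (S τ, γ₁ τ) - v (S τ, γ₂ τ))|)
      ≤ 2 * ((ε * c τ) * (‖γ₁ τ - γ₂ τ‖ * (L * ‖γ₁ τ - γ₂ τ‖))) := by
        have h0 := (abs_nonneg _).trans (hc τ hτ)
        gcongr
        exact hc τ hτ
    _ = _ := by ring

/-- Time-dependent vector fields of class `C¹` with linear growth, locally uniformly in time. -/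
structure IsTameField (v : ℝ × State d → State d) : Prop where
  contDiff : ContDiff ℝ 1 v
  growth : ∀ T, ∃ C, 0 ≤ C ∧ ∀ s ∈ Icc (-T) T, ∀ x, ‖v (s, x)‖ ≤ C * (1 + ‖x‖)

namespace IsTameField
variable {v : ℝ × State d → State d} (hv : IsTameField v)

lemma exists_lipschitz (hv : ContDiff ℝ 1 v) (T R : ℝ) :
    ∃ K : NNReal, ∀ s ∈ Icc (-T) T,
      LipschitzOnWith K (fun x => v (s, x)) (Metric.closedBall 0 R) := by
  obtain ⟨K, hK⟩ := hv.locallyLipschitz.locallyLipschitzOn.exists_lipschitzOnWith_of_compact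
    ((isCompact_Icc (a := -T) (b := T)).prod (isCompact_closedBall (0 : State d) R))
  refine ⟨K, fun s hs => LipschitzOnWith.of_dist_le_mul fun x hx y hy => ?_⟩
  refine (hK.dist_le_mul (s, x) ⟨hs, hx⟩ (s, y) ⟨hs, hy⟩).trans_eq ?_
  simp [Prod.dist_eq]

/-- A priori bound for solutions of an equation with linear growth. -/
lemma norm_sq_le_of_growth {w : ℝ × State d → State d} {C a b : ℝ} (hC : 0 ≤ C) (hab : a ≤ b)
    {γ : ℝ → State d} (hγ : ContinuousOn γ (Icc a b))
    (hγ' : ∀ s ∈ Ioo a b, HasDerivAt γ (w (s, γ s)) s)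
    (hw : ∀ s ∈ Ioo a b, ∀ x, ‖w (s, x)‖ ≤ C * (1 + ‖x‖)) :
    1 + ‖γ b‖ ^ 2 ≤ Real.exp (4 * C * b - 4 * C * a) * (1 + ‖γ a‖ ^ 2) ∧
    1 + ‖γ a‖ ^ 2 ≤ Real.exp (4 * C * b - 4 * C * a) * (1 + ‖γ b‖ ^ 2) := by
  refine gronwall_two_sided (D := fun s => 1 + ‖γ s‖ ^ 2) (A := fun s => 4 * C * s)
    (A' := fun _ => 4 * C) hab
    (continuousOn_const.add (hγ.norm.pow 2)) (by fun_prop)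
    (fun s hs => ((hγ' s hs).norm_sq).const_add 1)
    (fun s _ => by simpa using (hasDerivAt_id s).const_mul (4 * C)) fun s hs => ?_
  rw [abs_mul, abs_two]
  have h1 : |inner ℝ (γ s) (w (s, γ s))| ≤ ‖γ s‖ * (C * (1 + ‖γ s‖)) :=
    (abs_real_inner_le_norm _ _).trans (by gcongr; exact hw s hs _)
  nlinarith [mul_nonneg hC (sq_nonneg (‖γ s‖ - 1)), mul_nonneg hC (sq_nonneg ‖γ s‖)]

include hv

lemma norm_le_of_solution (T : ℝ) : ∃ M : ℝ → ℝ, ∀ R, ∀ a ∈ Icc (-T) T, ∀ b ∈ Icc (-T) T,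
    ∀ γ : ℝ → State d, ContinuousOn γ (uIcc a b) →
      (∀ s ∈ Ioo (min a b) (max a b), HasDerivAt γ (v (s, γ s)) s) →
      ‖γ a‖ ≤ R → ‖γ b‖ ≤ M R := by
  obtain ⟨C, hC, hg⟩ := hv.growth T
  refine ⟨fun R => 1 + Real.exp (8 * C * T) * (1 + R ^ 2), fun R a ha b hb γ hγ hγ' hR => ?_⟩
  have hT : 0 ≤ T := by linarith [ha.1, ha.2]
  have key : 1 + ‖γ b‖ ^ 2 ≤ Real.exp (8 * C * T) * (1 + ‖γ a‖ ^ 2) := by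
    rcases le_total a b with hab | hab
    · rw [uIcc_of_le hab] at hγ
      rw [min_eq_left hab, max_eq_right hab] at hγ'
      have := (norm_sq_le_of_growth hC hab hγ hγ' fun s hs =>
        hg s ⟨ha.1.trans hs.1.le, hs.2.le.trans hb.2⟩).1
      refine this.trans ?_
      gcongr
      nlinarith [ha.1, hb.2]
    · rw [uIcc_of_ge hab] at hγ
      rw [min_eq_right hab, max_eq_left hab] at hγ'
      have := (norm_sq_le_of_growth hC hab hγ hγ' fun s hs =>
        hg s ⟨hb.1.trans hs.1.le, hs.2.le.trans ha.2⟩).2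
      refine this.trans ?_
      gcongr
      nlinarith [hb.1, ha.2]
  have h2 : ‖γ a‖ ^ 2 ≤ R ^ 2 := by gcongr
  have h3 : Real.exp (8 * C * T) * (1 + ‖γ a‖ ^ 2) ≤ Real.exp (8 * C * T) * (1 + R ^ 2) := by gcongr
  nlinarith [sq_nonneg (‖γ b‖ - 1)]

/-- Solutions that agree at one time agree. -/
lemma eq_of_solution {a b : ℝ} {γ₁ γ₂ : ℝ → State d}
    (h₁ : ContinuousOn γ₁ (uIcc a b)) (h₂ : ContinuousOn γ₂ (uIcc a b))
    (h₁' : ∀ s ∈ Ioo (min a b) (max a b), HasDerivAt γ₁ (v (s, γ₁ s)) s)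
    (h₂' : ∀ s ∈ Ioo (min a b) (max a b), HasDerivAt γ₂ (v (s, γ₂ s)) s)
    (heq : γ₁ a = γ₂ a) : γ₁ b = γ₂ b := by
  obtain ⟨R₁, hR₁⟩ := isCompact_uIcc.exists_bound_of_continuousOn h₁
  obtain ⟨R₂, hR₂⟩ := isCompact_uIcc.exists_bound_of_continuousOn h₂
  obtain ⟨K, hK⟩ := exists_lipschitz hv.contDiff (max |a| |b|) (max R₁ R₂)
  have hsub : uIcc a b ⊆ Icc (-(max |a| |b|)) (max |a| |b|) := by
    intro s hs
    have h := abs_le_max_abs_abs hs.1 hs.2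
    refine abs_le.1 (h.trans ?_)
    rcases le_total a b with hab | hab <;> simp [hab, max_comm]
  have hIoo : Ioo (min a b) (max a b) ⊆ uIcc a b := Ioo_subset_Icc_self
  have hlip : ∀ s ∈ Ioo (min a b) (max a b),
      ‖v (s, γ₁ s) - v (s, γ₂ s)‖ ≤ K * ‖γ₁ s - γ₂ s‖ := fun s hs => by
    rw [← dist_eq_norm, ← dist_eq_norm]
    refine (hK s (hsub (hIoo hs))).dist_le_mul _ ?_ _ ?_
    · exact mem_closedBall_zero_iff.2 ((hR₁ s (hIoo hs)).trans (le_max_left _ _))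
    · exact mem_closedBall_zero_iff.2 ((hR₂ s (hIoo hs)).trans (le_max_right _ _))
  have := dist_sq_solutions_le (v := v) (S := fun s => s) (c := fun _ => 1) (ε := 1)
    (γ₁ := γ₁) (γ₂ := γ₂)
    (min_le_max (a := a) (b := b)) (by fun_prop) (fun s _ => hasDerivAt_id s)
    (by simp) h₁ h₂ (by simpa using h₁') (by simpa using h₂') hlip
  rcases le_total a b with hab | hab
  · rw [min_eq_left hab, max_eq_right hab] at this
    have h := this.1
    rw [heq, sub_self, norm_zero] at h
    have : ‖γ₁ b - γ₂ b‖ ^ 2 ≤ 0 := by simpa using h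
    exact sub_eq_zero.1 (norm_eq_zero.1 (pow_eq_zero_iff (two_ne_zero)|>.1
      (le_antisymm this (sq_nonneg _))))
  · rw [min_eq_right hab, max_eq_left hab] at this
    have h := this.2
    rw [heq, sub_self, norm_zero] at h
    have : ‖γ₁ b - γ₂ b‖ ^ 2 ≤ 0 := by simpa using h
    exact sub_eq_zero.1 (norm_eq_zero.1 (pow_eq_zero_iff (two_ne_zero)|>.1
      (le_antisymm this (sq_nonneg _))))

/-- Existence on a bounded time interval: the field is cut off outside a ball that the a priori
bound shows solutions cannot leave, and the Picard-Lindelöf theorem applies to the bounded field so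
obtained. -/
lemma exists_solution_Ioo {T s₀ : ℝ} (hs₀ : s₀ ∈ Ioo (-T) T) (x₀ : State d) :
    ∃ γ : ℝ → State d, γ s₀ = x₀ ∧ ∀ s ∈ Ioo (-T) T, HasDerivAt γ (v (s, γ s)) s := by
  obtain ⟨C, hC, hg⟩ := hv.growth T
  have hT : 0 < T := by linarith [hs₀.1, hs₀.2]
  set R : ℝ := 1 + Real.exp (8 * C * T) * (1 + ‖x₀‖ ^ 2) with hR
  have hR0 : 0 < R := by positivity
  let χ : ContDiffBump (0 : State d) := ⟨R, R + 1, hR0, by linarith⟩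
  set w : ℝ × State d → State d := fun p => χ p.2 • v p with hw
  have hwC : ContDiff ℝ 1 w := (χ.contDiff.comp contDiff_snd).smul hv.contDiff
  have hwg : ∀ s ∈ Icc (-T) T, ∀ x, ‖w (s, x)‖ ≤ C * (1 + ‖x‖) := fun s hs x => by
    rw [hw, norm_smul, Real.norm_of_nonneg χ.nonneg]
    exact (mul_le_of_le_one_left (norm_nonneg _) χ.le_one).trans (hg s hs x)
  have hwb : ∀ s ∈ Icc (-T) T, ∀ x, ‖w (s, x)‖ ≤ C * (R + 2) := fun s hs x => by
    rcases lt_or_ge ‖x‖ (R + 1) with hx | hx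
    · exact (hwg s hs x).trans (mul_le_mul_of_nonneg_left (by linarith) hC)
    · have : χ x = 0 := χ.zero_of_le_dist (by simpa using hx)
      simp only [hw, this, zero_smul, norm_zero]
      positivity
  set L : NNReal := ⟨C * (R + 2), by positivity⟩ with hLdef
  set a : NNReal := L * ⟨2 * T, by positivity⟩ with hadef
  obtain ⟨K, hK⟩ := exists_lipschitz hwC T (‖x₀‖ + a)
  have hPL : IsPicardLindelof (fun s x => w (s, x)) (tmin := -T) (tmax := T)
      ⟨s₀, Ioo_subset_Icc_self hs₀⟩ x₀ a 0 L K := by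
    refine ⟨fun s hs => (hK s hs).mono ?_, fun x _ => ?_, fun s hs x _ => hwb s hs x, ?_⟩
    · exact Metric.closedBall_subset_closedBall' (by simp [add_comm])
    · exact (hwC.continuous.comp (Continuous.prodMk continuous_id continuous_const)).continuousOn
    · have haL : (a : ℝ) = L * (2 * T) := rfl
      rw [haL, NNReal.coe_zero, sub_zero]
      refine mul_le_mul_of_nonneg_left (max_le ?_ ?_) L.coe_nonneg
      · change T - s₀ ≤ 2 * T; linarith [hs₀.1]
      · change s₀ - -T ≤ 2 * T; linarith [hs₀.2]
  obtain ⟨γ, hγ0, hγ⟩ := hPL.exists_eq_forall_mem_Icc_hasDerivWithinAt₀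
  have hγ0' : γ s₀ = x₀ := hγ0
  have hγd : ∀ s ∈ Ioo (-T) T, HasDerivAt γ (w (s, γ s)) s := fun s hs =>
    (hγ s (Ioo_subset_Icc_self hs)).hasDerivAt (Icc_mem_nhds hs.1 hs.2)
  refine ⟨γ, hγ0', fun s hs => ?_⟩
  have hcont : ContinuousOn γ (Ioo (-T) T) := fun s hs => (hγd s hs).continuousAt.continuousWithinAt
  have hbound : 1 + ‖γ s‖ ^ 2 ≤ Real.exp (8 * C * T) * (1 + ‖x₀‖ ^ 2) := by
    rcases le_total s₀ s with hle | hle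
    · have hsub : Icc s₀ s ⊆ Ioo (-T) T := fun r hr => ⟨hs₀.1.trans_le hr.1, hr.2.trans_lt hs.2⟩
      have := (norm_sq_le_of_growth hC hle (hcont.mono hsub)
        (fun r hr => hγd r (hsub (Ioo_subset_Icc_self hr)))
        fun r hr => hwg r (Ioo_subset_Icc_self (hsub (Ioo_subset_Icc_self hr)))).1
      rw [hγ0'] at this
      refine this.trans ?_
      gcongr
      nlinarith [hs₀.1, hs.2]
    · have hsub : Icc s s₀ ⊆ Ioo (-T) T := fun r hr => ⟨hs.1.trans_le hr.1, hr.2.trans_lt hs₀.2⟩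
      have := (norm_sq_le_of_growth hC hle (hcont.mono hsub)
        (fun r hr => hγd r (hsub (Ioo_subset_Icc_self hr)))
        fun r hr => hwg r (Ioo_subset_Icc_self (hsub (Ioo_subset_Icc_self hr)))).2
      rw [hγ0'] at this
      refine this.trans ?_
      gcongr
      nlinarith [hs.1, hs₀.2]
  have hle : ‖γ s‖ ≤ R := by
    rw [hR]
    nlinarith [sq_nonneg (‖γ s‖ - 1)]
  have h1 := hγd s hs
  have hχ : χ (γ s) = 1 := χ.one_of_mem_closedBall (by simpa using hle)
  simpa only [hw, hχ, one_smul] using h1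

/-- Global existence. -/
lemma exists_solution (s₀ : ℝ) (x₀ : State d) :
    ∃ γ : ℝ → State d, γ s₀ = x₀ ∧ ∀ s, HasDerivAt γ (v (s, γ s)) s := by
  have hmem : ∀ n : ℕ, s₀ ∈ Ioo (-(|s₀| + n + 1)) (|s₀| + n + 1) := fun n => by
    have : (0 : ℝ) ≤ n := Nat.cast_nonneg n
    exact abs_lt.1 (by linarith)
  choose γ hγ0 hγ using fun n : ℕ => hv.exists_solution_Ioo (hmem n) x₀
  have hagree : ∀ n m : ℕ, n ≤ m → ∀ s ∈ Ioo (-(|s₀| + n + 1)) (|s₀| + n + 1),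
      γ n s = γ m s := fun n m hnm s hs => by
    have hc : (n : ℝ) ≤ m := by exact_mod_cast hnm
    have hsub : uIcc s₀ s ⊆ Ioo (-(|s₀| + n + 1)) (|s₀| + n + 1) :=
      ordConnected_Ioo.uIcc_subset (hmem n) hs
    have hsub' : Ioo (-(|s₀| + n + 1)) (|s₀| + n + 1) ⊆ Ioo (-(|s₀| + m + 1)) (|s₀| + m + 1) :=
      Ioo_subset_Ioo (by linarith) (by linarith)
    refine hv.eq_of_solution (a := s₀)
      (fun r hr => (hγ n r (hsub hr)).continuousAt.continuousWithinAt)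
      (fun r hr => (hγ m r (hsub' (hsub hr))).continuousAt.continuousWithinAt)
      (fun r hr => hγ n r (hsub (Ioo_subset_Icc_self hr)))
      (fun r hr => hγ m r (hsub' (hsub (Ioo_subset_Icc_self hr)))) ?_
    rw [hγ0, hγ0]
  have hin : ∀ (n : ℕ) (s : ℝ), |s| ≤ n → s ∈ Ioo (-(|s₀| + n + 1)) (|s₀| + n + 1) :=
    fun n s hs => abs_lt.1 (by linarith [abs_nonneg s₀])
  refine ⟨fun s => γ ⌈|s|⌉₊ s, hγ0 _, fun s => ?_⟩
  obtain ⟨N, hN⟩ := exists_nat_gt |s|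
  have hval : ∀ r : ℝ, |r| < N → γ ⌈|r|⌉₊ r = γ N r := fun r hr =>
    hagree _ _ (Nat.ceil_le.2 hr.le) r (hin _ r (Nat.le_ceil _))
  have h1 := hγ N s (hin N s hN.le)
  rw [← hval s hN] at h1
  refine h1.congr_of_eventuallyEq ?_
  filter_upwards [(isOpen_lt continuous_abs continuous_const).mem_nhds hN] with r hr
  exact hval r hr

omit hv in
/-- The flow of a tame vector field: `flow hv s₀ x s` is the value at time `s` of the solution
that starts from `x` at time `s₀`. -/
def flow (hv : IsTameField v) (s₀ : ℝ) (x : State d) (s : ℝ) : State d :=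
  (hv.exists_solution s₀ x).choose s

lemma flow_self (s₀ : ℝ) (x : State d) : hv.flow s₀ x s₀ = x :=
  (hv.exists_solution s₀ x).choose_spec.1

lemma hasDerivAt_flow (s₀ : ℝ) (x : State d) (s : ℝ) :
    HasDerivAt (hv.flow s₀ x) (v (s, hv.flow s₀ x s)) s :=
  (hv.exists_solution s₀ x).choose_spec.2 s

lemma continuous_flow (s₀ : ℝ) (x : State d) : Continuous (hv.flow s₀ x) :=
  continuous_iff_continuousAt.2 fun s => (hv.hasDerivAt_flow s₀ x s).continuousAt

lemma eq_flow {γ : ℝ → State d} (hγ : ∀ s, HasDerivAt γ (v (s, γ s)) s) (s₀ s : ℝ) :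
    hv.flow s₀ (γ s₀) s = γ s :=
  hv.eq_of_solution (a := s₀) (hv.continuous_flow _ _).continuousOn
    (fun r _ => (hγ r).continuousAt.continuousWithinAt)
    (fun r _ => hv.hasDerivAt_flow _ _ r) (fun r _ => hγ r) (hv.flow_self _ _)

lemma flow_flow (s₀ s₁ s : ℝ) (x : State d) :
    hv.flow s₁ (hv.flow s₀ x s₁) s = hv.flow s₀ x s :=
  hv.eq_flow (hv.hasDerivAt_flow s₀ x) s₁ s

lemma exists_norm_flow_le (T R : ℝ) : ∃ M, ∀ s₀ ∈ Icc (-T) T, ∀ s ∈ Icc (-T) T, ∀ x : State d,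
    ‖x‖ ≤ R → ‖hv.flow s₀ x s‖ ≤ M := by
  obtain ⟨M, hM⟩ := hv.norm_le_of_solution T
  exact ⟨M R, fun s₀ hs₀ s hs x hx => hM R s₀ hs₀ s hs _ (hv.continuous_flow _ _).continuousOn
    (fun r _ => hv.hasDerivAt_flow _ _ r) (by rwa [hv.flow_self])⟩

lemma exists_lipschitz_flow (T R : ℝ) : ∃ K, 0 ≤ K ∧ ∀ s₀ ∈ Icc (-T) T, ∀ s ∈ Icc (-T) T,
    ∀ x y : State d, ‖x‖ ≤ R → ‖y‖ ≤ R →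
      ‖hv.flow s₀ x s - hv.flow s₀ y s‖ ≤ K * ‖x - y‖ := by
  obtain ⟨M, hM⟩ := hv.exists_norm_flow_le T R
  obtain ⟨L, hL⟩ := exists_lipschitz hv.contDiff T M
  refine ⟨Real.exp (2 * L * T), by positivity, fun s₀ hs₀ s hs x y hx hy => ?_⟩
  have hsub : Ioo (min s₀ s) (max s₀ s) ⊆ Icc (-T) T := fun r hr =>
    ⟨(le_min hs₀.1 hs.1).trans hr.1.le, hr.2.le.trans (max_le hs₀.2 hs.2)⟩
  have hlip : ∀ r ∈ Ioo (min s₀ s) (max s₀ s),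
      ‖v (r, hv.flow s₀ x r) - v (r, hv.flow s₀ y r)‖ ≤
        L * ‖hv.flow s₀ x r - hv.flow s₀ y r‖ := fun r hr => by
    rw [← dist_eq_norm, ← dist_eq_norm]
    exact (hL r (hsub hr)).dist_le_mul _ (mem_closedBall_zero_iff.2 (hM s₀ hs₀ r (hsub hr) x hx)) _
      (mem_closedBall_zero_iff.2 (hM s₀ hs₀ r (hsub hr) y hy))
  have := dist_sq_solutions_le (v := v) (S := fun s => s) (c := fun _ => 1) (ε := 1)
    (min_le_max (a := s₀) (b := s)) (by fun_prop) (fun s _ => hasDerivAt_id s)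
    (by simp) (hv.continuous_flow s₀ x).continuousOn (hv.continuous_flow s₀ y).continuousOn
    (by simpa using fun r _ _ => hv.hasDerivAt_flow s₀ x r)
    (by simpa using fun r _ _ => hv.hasDerivAt_flow s₀ y r) hlip
  have hT : 0 ≤ T := by linarith [hs.1, hs.2]
  have key : ‖hv.flow s₀ x s - hv.flow s₀ y s‖ ^ 2 ≤ Real.exp (4 * L * T) * ‖x - y‖ ^ 2 := by
    rcases le_total s₀ s with hab | hab
    · rw [min_eq_left hab, max_eq_right hab, hv.flow_self, hv.flow_self] at this
      refine this.1.trans ?_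
      gcongr
      nlinarith [hs₀.1, hs.2, L.coe_nonneg]
    · rw [min_eq_right hab, max_eq_left hab, hv.flow_self, hv.flow_self] at this
      refine this.2.trans ?_
      gcongr
      nlinarith [hs.1, hs₀.2, L.coe_nonneg]
  refine (sq_le_sq₀ (norm_nonneg _) (by positivity)).1 ?_
  calc _ ≤ _ := key
    _ = _ := by rw [mul_pow, ← Real.exp_nat_mul]; congr 2; push_cast; ring

lemma exists_norm_field_le (T R : ℝ) : ∃ M, 0 ≤ M ∧ ∀ s ∈ Icc (-T) T, ∀ x : State d, ‖x‖ ≤ R →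
    ‖v (s, x)‖ ≤ M := by
  obtain ⟨C, hC, hg⟩ := hv.growth T
  refine ⟨C * (1 + |R|), by positivity, fun s hs x hx => (hg s hs x).trans ?_⟩
  gcongr
  exact hx.trans (le_abs_self R)

/-- Displacement along the flow is at most proportional to the elapsed time. -/
lemma exists_norm_flow_sub_le (T R : ℝ) : ∃ M, 0 ≤ M ∧ ∀ s₀ ∈ Icc (-T) T, ∀ s ∈ Icc (-T) T,
    ∀ x : State d, ‖x‖ ≤ R → ‖hv.flow s₀ x s - x‖ ≤ M * |s - s₀| := by
  obtain ⟨M, hM⟩ := hv.exists_norm_flow_le T R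
  obtain ⟨B, hB0, hB⟩ := hv.exists_norm_field_le T M
  refine ⟨B, hB0, fun s₀ hs₀ s hs x hx => ?_⟩
  have := (convex_Icc (-T) T).norm_image_sub_le_of_norm_hasDerivWithin_le
    (fun r _ => (hv.hasDerivAt_flow s₀ x r).hasDerivWithinAt)
    (fun r hr => hB r hr _ (hM s₀ hs₀ r hr x hx)) hs₀ hs
  rwa [hv.flow_self] at this

lemma exists_lipschitz_flow_left (T R : ℝ) : ∃ K, 0 ≤ K ∧ ∀ s₀ ∈ Icc (-T) T, ∀ s₁ ∈ Icc (-T) T,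
    ∀ s ∈ Icc (-T) T, ∀ x : State d, ‖x‖ ≤ R →
      ‖hv.flow s₀ x s - hv.flow s₁ x s‖ ≤ K * |s₀ - s₁| := by
  obtain ⟨M, hM⟩ := hv.exists_norm_flow_le T R
  obtain ⟨B, hB0, hB⟩ := hv.exists_norm_flow_sub_le T R
  obtain ⟨K, hK0, hK⟩ := hv.exists_lipschitz_flow T (max M R)
  refine ⟨K * B, by positivity, fun s₀ hs₀ s₁ hs₁ s hs x hx => ?_⟩
  rw [← hv.flow_flow s₀ s₁ s x]
  calc _ ≤ K * ‖hv.flow s₀ x s₁ - x‖ := hK s₁ hs₁ s hs _ _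
        ((hM s₀ hs₀ s₁ hs₁ x hx).trans (le_max_left _ _)) (hx.trans (le_max_right _ _))
    _ ≤ K * (B * |s₁ - s₀|) := by gcongr; exact hB s₀ hs₀ s₁ hs₁ x hx
    _ = _ := by rw [abs_sub_comm, mul_assoc]

lemma continuous_flow_prod (s₀ : ℝ) : Continuous (fun p : ℝ × State d => hv.flow s₀ p.2 p.1) := by
  rw [continuous_iff_continuousAt]
  rintro ⟨s, x⟩
  set T := max |s₀| (|s| + 1)
  set R := ‖x‖ + 1
  have hs₀ : s₀ ∈ Icc (-T) T := abs_le.1 (le_max_left _ _)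
  obtain ⟨K, hK0, hK⟩ := hv.exists_lipschitz_flow T R
  have h1 : Tendsto (fun p : ℝ × State d => K * ‖p.2 - x‖ + ‖hv.flow s₀ x p.1 - hv.flow s₀ x s‖)
      (𝓝 (s, x)) (𝓝 0) := by
    have hc := hv.continuous_flow s₀ x
    have : Continuous fun p : ℝ × State d =>
      K * ‖p.2 - x‖ + ‖hv.flow s₀ x p.1 - hv.flow s₀ x s‖ := by fun_prop
    simpa using this.tendsto (s, x)
  rw [ContinuousAt, tendsto_iff_norm_sub_tendsto_zero]
  refine squeeze_zero' (Eventually.of_forall fun _ => norm_nonneg _) ?_ h1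
  have h2 : ∀ᶠ p : ℝ × State d in 𝓝 (s, x), |p.1| < |s| + 1 ∧ ‖p.2‖ < ‖x‖ + 1 :=
    (((isOpen_lt (continuous_abs.comp continuous_fst) continuous_const).inter
      (isOpen_lt (continuous_norm.comp continuous_snd) continuous_const)).mem_nhds
      (by constructor <;> simp))
  filter_upwards [h2] with p hp
  calc _ = ‖(hv.flow s₀ p.2 p.1 - hv.flow s₀ x p.1) + (hv.flow s₀ x p.1 - hv.flow s₀ x s)‖ := by
        rw [sub_add_sub_cancel]
    _ ≤ _ := norm_add_le _ _
    _ ≤ _ := by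
      gcongr
      exact hK s₀ hs₀ p.1 (abs_le.1 (hp.1.le.trans (le_max_right _ _))) _ _ hp.2.le
        (by simp [R])

/-- The flow as a function of its starting time, at the final time: `∂_r X_{r → s}(x) = -v(s, x)`
at `r = s`. -/
lemma hasDerivAt_flow_left (s : ℝ) (x : State d) :
    HasDerivAt (fun r => hv.flow r x s) (-v (s, x)) s := by
  rw [hasDerivAt_iff_isLittleO, Asymptotics.isLittleO_iff]
  intro ε hε
  have hcont := (hv.contDiff.continuous).continuousAt (x := (s, x))
  obtain ⟨δ, hδ, hδε⟩ := Metric.continuousAt_iff.1 hcont ε hε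
  obtain ⟨M, hM0, hM⟩ := hv.exists_norm_flow_sub_le (|s| + 1) ‖x‖
  set η := min 1 (δ / (M + 2)) with hη
  have hη0 : 0 < η := by positivity
  filter_upwards [Metric.ball_mem_nhds s hη0] with r hr
  rw [Metric.mem_ball, Real.dist_eq] at hr
  rw [hv.flow_self]
  have hs : s ∈ Icc (-(|s| + 1)) (|s| + 1) := abs_le.1 (by linarith)
  have hIcc : ∀ q ∈ uIcc r s, q ∈ Icc (-(|s| + 1)) (|s| + 1) ∧ |q - s| < η ∧ |q - r| < η := by
    intro q hq
    have h1 : |q - s| ≤ |r - s| := abs_sub_left_of_mem_uIcc (by rwa [uIcc_comm]) |>.trans_eq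
      (abs_sub_comm _ _ |>.trans (abs_sub_comm _ _))
    have h2 : |q - r| ≤ |s - r| := abs_sub_left_of_mem_uIcc hq
    have h3 : |q| ≤ |q - s| + |s| := by
      calc |q| = |(q - s) + s| := by ring_nf
        _ ≤ _ := abs_add_le _ _
    refine ⟨abs_le.1 ?_, h1.trans_lt hr, h2.trans_lt (by rwa [abs_sub_comm])⟩
    linarith [min_le_left 1 (δ / (M + 2))]
  have hr' := (hIcc r left_mem_uIcc).1
  set g : ℝ → State d := fun q => hv.flow r x q - q • v (s, x)
  have hg : ∀ q ∈ uIcc r s,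
      HasDerivWithinAt g (v (q, hv.flow r x q) - v (s, x)) (uIcc r s) q := fun q _ => by
    have := (hv.hasDerivAt_flow r x q).fun_sub ((hasDerivAt_id q).smul_const (v (s, x)))
    simpa using this.hasDerivWithinAt
  have hgb : ∀ q ∈ uIcc r s, ‖v (q, hv.flow r x q) - v (s, x)‖ ≤ ε := fun q hq => by
    obtain ⟨hq1, hq2, hq3⟩ := hIcc q hq
    rw [← dist_eq_norm]
    refine (hδε ?_).le
    rw [Prod.dist_eq, max_lt_iff, Real.dist_eq, dist_eq_norm]
    have hηδ : η * (M + 2) ≤ δ := by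
      have := min_le_right 1 (δ / (M + 2))
      rwa [← hη, le_div_iff₀ (by positivity)] at this
    refine ⟨by nlinarith, (hM r hr' q hq1 x le_rfl).trans_lt ?_⟩
    nlinarith [abs_nonneg (q - r)]
  have := (convex_uIcc r s).norm_image_sub_le_of_norm_hasDerivWithin_le hg hgb
    left_mem_uIcc right_mem_uIcc
  simp only [g, hv.flow_self] at this
  rw [abs_sub_comm] at hr
  calc ‖hv.flow r x s - x - (r - s) • -v (s, x)‖
      = ‖hv.flow r x s - s • v (s, x) - (x - r • v (s, x))‖ := by congr 1; module
    _ ≤ ε * ‖s - r‖ := this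
    _ = _ := by rw [norm_sub_rev]

end IsTameField

/-! ### Transport of densities along a flow -/

/-- Finite measures on `ℝ^d` are determined by their integrals of compactly supported Lipschitz
functions. -/
lemma measure_ext_of_lipschitz {μ ν : Measure (State d)} [IsFiniteMeasure μ] [IsFiniteMeasure ν]
    (h : ∀ (ψ : State d → ℝ) (K : NNReal), LipschitzWith K ψ → HasCompactSupport ψ →
      ∫ x, ψ x ∂μ = ∫ x, ψ x ∂ν) : μ = ν := by
  have hK : ∀ K : Set (State d), IsCompact K → μ K = ν K := fun K hK => by
    have hpos : ∀ n : ℕ, (0 : ℝ) < 1 / ((n : ℝ) + 1) := fun n => by positivity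
    have hlim := tendsto_one_div_add_atTop_nhds_zero_nat (𝕜 := ℝ)
    have h1 := tendsto_integral_thickenedIndicator_of_isClosed μ hK.isClosed hpos hlim
    have h2 := tendsto_integral_thickenedIndicator_of_isClosed ν hK.isClosed hpos hlim
    have heq : ∀ n : ℕ, ∫ x, (thickenedIndicator (hpos n) K x : ℝ) ∂μ =
        ∫ x, (thickenedIndicator (hpos n) K x : ℝ) ∂ν := fun n => by
      obtain ⟨L, hL⟩ : ∃ L, LipschitzWith L (thickenedIndicator (hpos n) K) :=
        ⟨_, lipschitzWith_thickenedIndicator (hpos n) K⟩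
      refine h _ (1 * L) (LipschitzWith.comp (g := thickenedIndicator (hpos n) K)
        (f := fun z : NNReal => (z : ℝ))
        (LipschitzWith.of_dist_le_mul fun x y => by simp [NNReal.dist_eq, Real.dist_eq]) hL) ?_
      refine HasCompactSupport.intro (K := Metric.cthickening (1 / ((n : ℝ) + 1)) K)
        (hK.cthickening) fun x hx => ?_
      rw [thickenedIndicator_zero (hpos n) K fun hx' => hx (Metric.thickening_subset_cthickening _ _ hx')]
      simp
    have := tendsto_nhds_unique h1 ((tendsto_congr heq).2 h2)
    rwa [measureReal_def, measureReal_def, ENNReal.toReal_eq_toReal_iff' (measure_ne_top _ _)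
      (measure_ne_top _ _)] at this
  ext A hA
  rw [hA.measure_eq_iSup_isCompact, hA.measure_eq_iSup_isCompact]
  exact iSup_congr fun K => iSup_congr fun _ => iSup_congr fun hc => hK K hc

lemma fderiv_apply_eq_sum (L : State d →L[ℝ] ℝ) (y : State d) :
    L y = ∑ i, L (EuclideanSpace.single i 1) * y i := by
  conv_lhs => rw [← (EuclideanSpace.basisFun (Fin d) ℝ).sum_repr y]
  simp [mul_comm]

lemma aestronglyMeasurable_fderiv_apply {η : State d → ℝ} {G : State d → State d}
    (hG : Continuous G) : AEStronglyMeasurable (fun x => fderiv ℝ η x (G x)) := by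
  have e : (fun x => fderiv ℝ η x (G x)) = fun x =>
      ∑ i, fderiv ℝ η x (EuclideanSpace.single i 1) * (G x) i :=
    funext fun x => fderiv_apply_eq_sum _ _
  rw [e]
  refine (Finset.measurable_sum _ fun i _ => ?_).aestronglyMeasurable
  refine (measurable_fderiv_apply_const ℝ _ _).mul ?_
  exact Continuous.measurable (by fun_prop)

/-- Integration by parts of a Lipschitz function against a compactly supported `C¹` field. -/
lemma integral_fderiv_apply_eq_of_hasCompactSupport {η : State d → ℝ} {K : NNReal}
    (hη : LipschitzWith K η) {G : State d → State d} (hG : ContDiff ℝ 1 G)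
    (hGc : HasCompactSupport G) :
    ∫ x, fderiv ℝ η x (G x) = -∫ x, η x * divergence G x := by
  have hGi : ∀ i : Fin d, ContDiff ℝ 1 (fun x => G x i) := fun i => by fun_prop
  have hGic : ∀ i : Fin d, HasCompactSupport (fun x => G x i) := fun i =>
    hGc.comp_left (g := fun y : State d => y i) (by simp)
  have hlip : ∀ i : Fin d, ∃ D, LipschitzWith D (fun x => G x i) := fun i =>
    ⟨_, (hGi i).lipschitzWith_of_hasCompactSupport (hGic i) one_ne_zero |>.choose_spec⟩
  have hderiv : ∀ (i : Fin d) (x : State d), lineDeriv ℝ (fun x => G x i) x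
      (-EuclideanSpace.single i 1) = -(fderiv ℝ G x (EuclideanSpace.single i 1)) i := fun i x => by
    have hd : DifferentiableAt ℝ G x := hG.differentiable one_ne_zero x
    have h2 : HasFDerivAt (fun x => G x i)
        ((EuclideanSpace.proj i : State d →L[ℝ] ℝ).comp (fderiv ℝ G x)) x :=
      (EuclideanSpace.proj i : State d →L[ℝ] ℝ).hasFDerivAt.comp x hd.hasFDerivAt
    rw [(h2.hasLineDerivAt _).lineDeriv]
    simp
  have hcont : ∀ i : Fin d, Continuous fun x => (fderiv ℝ G x (EuclideanSpace.single i 1)) i :=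
    fun i => by
      have := hG.continuous_fderiv one_ne_zero
      fun_prop
  have hint1 : ∀ i : Fin d, Integrable (fun x =>
      lineDeriv ℝ η x (EuclideanSpace.single i 1) * G x i) := fun i => by
    have hGint : Integrable (fun x => G x i) :=
      (hGi i).continuous.integrable_of_hasCompactSupport (hGic i)
    exact Integrable.bdd_mul (c := K * ‖(EuclideanSpace.single i 1 : State d)‖) hGint (hη.memLp_lineDeriv _ |>.aestronglyMeasurable)
      (ae_of_all _ fun x => norm_lineDeriv_le_of_lipschitz ℝ hη)
  have hint2 : ∀ i : Fin d, Integrable (fun x =>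
      η x * (fderiv ℝ G x (EuclideanSpace.single i 1)) i) := fun i => by
    refine (hη.continuous.mul (hcont i)).integrable_of_hasCompactSupport ?_
    refine HasCompactSupport.mul_left ?_
    exact (hGc.fderiv (𝕜 := ℝ)).comp_left
      (g := fun L : State d →L[ℝ] State d => (L (EuclideanSpace.single i 1)) i) (by simp)
  calc ∫ x, fderiv ℝ η x (G x)
      = ∫ x, ∑ i, lineDeriv ℝ η x (EuclideanSpace.single i 1) * G x i := by
        refine integral_congr_ae ?_
        filter_upwards [hη.ae_differentiableAt (μ := volume)] with x hx
        simp only [fderiv_apply_eq_sum (fderiv ℝ η x) (G x), hx.lineDeriv_eq_fderiv]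
    _ = ∑ i, ∫ x, lineDeriv ℝ η x (EuclideanSpace.single i 1) * G x i :=
        integral_finsetSum _ fun i _ => hint1 i
    _ = ∑ i, -∫ x, η x * (fderiv ℝ G x (EuclideanSpace.single i 1)) i := by
        refine Finset.sum_congr rfl fun i _ => ?_
        obtain ⟨D, hD⟩ := hlip i
        rw [hη.integral_lineDeriv_mul_eq hD (hGic i), ← integral_neg]
        simp only [hderiv]
        exact integral_congr_ae (ae_of_all _ fun x => by ring)
    _ = -∫ x, η x * divergence G x := by
        rw [Finset.sum_neg_distrib, ← integral_finsetSum _ fun i _ => hint2 i]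
        simp only [divergence, Finset.mul_sum]

/-- Integration by parts of a compactly supported Lipschitz function against a `C¹` field. -/
lemma integral_fderiv_apply_eq {η : State d → ℝ} {K : NNReal}
    (hη : LipschitzWith K η) (hηc : HasCompactSupport η) {G : State d → State d}
    (hG : ContDiff ℝ 1 G) :
    ∫ x, fderiv ℝ η x (G x) = -∫ x, η x * divergence G x := by
  obtain ⟨R, hR⟩ := hηc.isBounded.subset_closedBall 0
  let χ : ContDiffBump (0 : State d) := ⟨max R 0 + 1, max R 0 + 2, by positivity, by linarith⟩
  have h1 : ∀ x ∈ tsupport η, (χ : State d → ℝ) =ᶠ[𝓝 x] 1 := fun x hx => by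
    refine χ.eventuallyEq_one_of_mem_ball ?_
    have := hR hx
    rw [mem_closedBall_zero_iff] at this
    rw [mem_ball_zero_iff]
    change ‖x‖ < max R 0 + 1
    linarith [le_max_left R 0]
  have hG' : ContDiff ℝ 1 (fun x => χ x • G x) := χ.contDiff.smul hG
  have key := integral_fderiv_apply_eq_of_hasCompactSupport hη hG'
    (χ.hasCompactSupport.smul_right)
  -- The cutoff is `1` near the support of `η`, so it affects neither side.
  have e1 : ∀ x, fderiv ℝ η x (χ x • G x) = fderiv ℝ η x (G x) := fun x => by
    by_cases hx : x ∈ tsupport η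
    · rw [(h1 x hx).eq_of_nhds]; simp
    · have : fderiv ℝ η x = 0 := by
        by_contra hne
        exact hx (support_fderiv_subset ℝ (by simpa using hne))
      simp [this]
  have e2 : ∀ x, η x * divergence (fun x => χ x • G x) x = η x * divergence G x := fun x => by
    by_cases hx : x ∈ tsupport η
    · have : (fun x => χ x • G x) =ᶠ[𝓝 x] G := (h1 x hx).mono fun y hy => by simp [hy]
      simp only [divergence, this.fderiv_eq]
    · rw [image_eq_zero_of_notMem_tsupport hx]; simp
  simpa only [e1, e2] using key

namespace IsTameField
variable {v : ℝ × State d → State d} (hv : IsTameField v)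
include hv

lemma support_flow_subset {ψ : State d → ℝ} (hψc : HasCompactSupport ψ) (T : ℝ) :
    ∃ M : ℝ, 0 ≤ M ∧ ∀ s ∈ Icc (-T) T, ∀ s₀ ∈ Icc (-T) T, ∀ x : State d, M < ‖x‖ →
      ψ (hv.flow s x s₀) = 0 := by
  obtain ⟨R, hR⟩ := hψc.isBounded.subset_closedBall 0
  obtain ⟨M, hM⟩ := hv.exists_norm_flow_le T R
  refine ⟨max M 0, le_max_right _ _, fun s hs s₀ hs₀ x hx => ?_⟩
  by_contra hne
  have h1 := mem_closedBall_zero_iff.1 (hR (subset_tsupport ψ hne))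
  have h2 := hM s₀ hs₀ s hs _ h1
  rw [hv.flow_flow, hv.flow_self] at h2
  linarith [le_max_left M 0]

/-- A compactly supported Lipschitz function composed with the flow is again Lipschitz. -/
lemma exists_lipschitzWith_comp_flow {ψ : State d → ℝ} {K : NNReal} (hψ : LipschitzWith K ψ)
    (hψc : HasCompactSupport ψ) (s s₀ : ℝ) :
    ∃ L, LipschitzWith L (fun x => ψ (hv.flow s x s₀)) := by
  set T := max |s| |s₀|
  have hs : s ∈ Icc (-T) T := abs_le.1 (le_max_left _ _)
  have hs₀ : s₀ ∈ Icc (-T) T := abs_le.1 (le_max_right _ _)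
  obtain ⟨M, hM0, hM⟩ := hv.support_flow_subset hψc T
  obtain ⟨L, hL0, hL⟩ := hv.exists_lipschitz_flow T (M + 1)
  obtain ⟨B, hB⟩ := hψ.continuous.bounded_above_of_compact_support hψc
  have hB0 : 0 ≤ B := (norm_nonneg _).trans (hB 0)
  have key : ∀ x y : State d, ‖x‖ ≤ M → |ψ (hv.flow s x s₀) - ψ (hv.flow s y s₀)| ≤
      (K * L + B) * ‖x - y‖ := fun x y hx => by
    have hn := norm_nonneg (x - y)
    rcases le_or_gt ‖y‖ (M + 1) with hy | hy
    · have h1 := hψ.dist_le_mul (hv.flow s x s₀) (hv.flow s y s₀)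
      rw [Real.dist_eq, dist_eq_norm] at h1
      have h2 := hL s hs s₀ hs₀ x y (by linarith) hy
      calc _ ≤ _ := h1
        _ ≤ K * (L * ‖x - y‖) := by gcongr
        _ ≤ _ := by nlinarith [mul_nonneg hB0 hn]
    · -- Here `ψ` vanishes at the second point, which is at distance at least `1` from the first, so
      -- the sup bound of `ψ` serves as a Lipschitz bound.
      rw [hM s hs s₀ hs₀ y (by linarith), sub_zero]
      have h1 : 1 ≤ ‖x - y‖ := by
        have := norm_sub_norm_le y x
        rw [norm_sub_rev] at this
        linarith
      have h2 := hB (hv.flow s x s₀)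
      rw [Real.norm_eq_abs] at h2
      have h3 : 0 ≤ K * L * ‖x - y‖ := by positivity
      nlinarith
  refine ⟨⟨K * L + B, by positivity⟩, LipschitzWith.of_dist_le_mul fun x y => ?_⟩
  rw [Real.dist_eq, dist_eq_norm]
  change _ ≤ (K * L + B) * ‖x - y‖
  rcases le_or_gt ‖x‖ M with hx | hx
  · exact key x y hx
  rcases le_or_gt ‖y‖ M with hy | hy
  · rw [abs_sub_comm, norm_sub_rev]
    exact key y x hy
  · rw [hM s hs s₀ hs₀ x hx, hM s hs s₀ hs₀ y hy]
    simp only [sub_self, abs_zero]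
    positivity

/-- Local Lipschitz bound in time for the integrand of the transport identity. -/
lemma exists_lipschitz_mul_comp_flow {r : ℝ × State d → ℝ} (hr : ContDiff ℝ 1 r)
    {ψ : State d → ℝ} {K : NNReal} (hψ : LipschitzWith K ψ) (hψc : HasCompactSupport ψ)
    (T s₀ : ℝ) (hs₀ : s₀ ∈ Icc (-T) T) :
    ∃ M C : ℝ, 0 ≤ C ∧ ∀ t ∈ Icc (-T) T, ∀ t' ∈ Icc (-T) T, ∀ x : State d,
      |ψ (hv.flow t x s₀) * r (t, x) - ψ (hv.flow t' x s₀) * r (t', x)| ≤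
        (Metric.closedBall (0 : State d) M).indicator (fun _ => C) x * |t - t'| := by
  obtain ⟨M, hM0, hM⟩ := hv.support_flow_subset hψc T
  obtain ⟨J, hJ0, hJ⟩ := hv.exists_lipschitz_flow_left T M
  obtain ⟨B, hB⟩ := hψ.continuous.bounded_above_of_compact_support hψc
  have hB0 : 0 ≤ B := (norm_nonneg _).trans (hB 0)
  have hcpt : IsCompact (Icc (-T) T ×ˢ Metric.closedBall (0 : State d) M) :=
    isCompact_Icc.prod (isCompact_closedBall _ _)
  obtain ⟨N, hN⟩ := hcpt.exists_bound_of_continuousOn hr.continuous.continuousOn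
  obtain ⟨D, hD⟩ := hr.locallyLipschitz.locallyLipschitzOn.exists_lipschitzOnWith_of_compact hcpt
  have hN0 : 0 ≤ N := (norm_nonneg _).trans (hN (s₀, 0) ⟨hs₀, by simpa using hM0⟩)
  refine ⟨M, K * J * N + B * D, by positivity, fun t ht t' ht' x => ?_⟩
  rcases le_or_gt ‖x‖ M with hx | hx
  · have hxm : x ∈ Metric.closedBall (0 : State d) M := by simpa using hx
    rw [indicator_of_mem hxm]
    have h1 : |ψ (hv.flow t x s₀) - ψ (hv.flow t' x s₀)| ≤ K * (J * |t - t'|) := by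
      have h := hψ.dist_le_mul (hv.flow t x s₀) (hv.flow t' x s₀)
      rw [Real.dist_eq, dist_eq_norm] at h
      exact h.trans (by gcongr; exact hJ t ht t' ht' s₀ hs₀ x hx)
    have h2 : |r (t, x) - r (t', x)| ≤ D * |t - t'| := by
      have h := hD.dist_le_mul (t, x) ⟨ht, hxm⟩ (t', x) ⟨ht', hxm⟩
      simpa [Prod.dist_eq, Real.dist_eq] using h
    have h3 : |r (t, x)| ≤ N := hN (t, x) ⟨ht, hxm⟩
    have h4 : |ψ (hv.flow t' x s₀)| ≤ B := hB _
    calc |ψ (hv.flow t x s₀) * r (t, x) - ψ (hv.flow t' x s₀) * r (t', x)|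
        = |(ψ (hv.flow t x s₀) - ψ (hv.flow t' x s₀)) * r (t, x) +
            ψ (hv.flow t' x s₀) * (r (t, x) - r (t', x))| := by ring_nf
      _ ≤ |ψ (hv.flow t x s₀) - ψ (hv.flow t' x s₀)| * |r (t, x)| +
            |ψ (hv.flow t' x s₀)| * |r (t, x) - r (t', x)| := by
          rw [← abs_mul, ← abs_mul]; exact abs_add_le _ _
      _ ≤ K * (J * |t - t'|) * N + B * (D * |t - t'|) := by gcongr
      _ = _ := by ring
  · have hxm : x ∉ Metric.closedBall (0 : State d) M := by simpa using hx
    rw [indicator_of_notMem hxm]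
    simp [hM t ht s₀ hs₀ x hx, hM t' ht' s₀ hs₀ x hx]

lemma hasCompactSupport_comp_flow {ψ : State d → ℝ} (hψc : HasCompactSupport ψ) (s s₀ : ℝ) :
    HasCompactSupport (fun x => ψ (hv.flow s x s₀)) := by
  obtain ⟨M, -, hM⟩ := hv.support_flow_subset hψc (max |s| |s₀|)
  refine HasCompactSupport.intro (isCompact_closedBall (0 : State d) M) fun x hx => ?_
  exact hM s (abs_le.1 (le_max_left _ _)) s₀ (abs_le.1 (le_max_right _ _)) x (by simpa using hx)

/-- Derivative in time of a test function composed with the backward flow. -/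
lemma hasDerivAt_comp_flow {ψ : State d → ℝ} {s s₀ : ℝ} {x : State d}
    (hx : DifferentiableAt ℝ (fun x => ψ (hv.flow s x s₀)) x) :
    HasDerivAt (fun t => ψ (hv.flow t x s₀))
      (-fderiv ℝ (fun x => ψ (hv.flow s x s₀)) x (v (s, x))) s := by
  have e : (fun t => ψ (hv.flow t x s₀)) =
      (fun x => ψ (hv.flow s x s₀)) ∘ fun t => hv.flow t x s := by
    funext t; simp only [Function.comp]; rw [hv.flow_flow]
  rw [e, ← map_neg]
  refine HasFDerivAt.comp_hasDerivAt s ?_ (hv.hasDerivAt_flow_left s x)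
  rw [hv.flow_self]
  exact hx.hasFDerivAt

/-- The integral of a test function along the backward flow has zero derivative, since
`∂_s (ψ ∘ X_{s → s₀}) = -v · ∇(ψ ∘ X_{s → s₀})` at almost every point, by Rademacher's theorem. -/
lemma hasDerivAt_integral_comp_flow {r : ℝ × State d → ℝ} (hr : ContDiff ℝ 1 r)
    (hcont : ∀ s x, HasDerivAt (fun t => r (t, x))
      (-divergence (fun y => r (s, y) • v (s, y)) x) s)
    {ψ : State d → ℝ} {K : NNReal} (hψ : LipschitzWith K ψ) (hψc : HasCompactSupport ψ)
    (s₀ s : ℝ) :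
    HasDerivAt (fun s => ∫ x, ψ (hv.flow s x s₀) * r (s, x)) 0 s := by
  obtain ⟨L, hL⟩ := hv.exists_lipschitzWith_comp_flow hψ hψc s s₀
  have hηc := hv.hasCompactSupport_comp_flow hψc s s₀
  obtain ⟨M, C, hC, hMC⟩ := hv.exists_lipschitz_mul_comp_flow hr hψ hψc (max |s₀| (|s| + 1)) s₀
    (abs_le.1 (le_max_left _ _))
  have hsI := abs_lt.1 ((lt_add_one |s|).trans_le (le_max_right |s₀| (|s| + 1)))
  have hFcont : ∀ t, Continuous (fun x => ψ (hv.flow t x s₀) * r (t, x)) := fun t =>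
    ((hv.exists_lipschitzWith_comp_flow hψ hψc t s₀).choose_spec.continuous).mul
      (hr.continuous.comp (by fun_prop : Continuous fun x : State d => (t, x)))
  have hG : ContDiff ℝ 1 (fun y => r (s, y) • v (s, y)) :=
    (hr.comp (by fun_prop : ContDiff ℝ 1 fun y : State d => (s, y))).smul
      (hv.contDiff.comp (by fun_prop : ContDiff ℝ 1 fun y : State d => (s, y)))
  have hdivc : Continuous (divergence fun y => r (s, y) • v (s, y)) := by
    have := hG.continuous_fderiv one_ne_zero
    unfold divergence
    fun_prop
  have hηcont := hL.continuous
  have hd : ∀ᵐ x, HasDerivAt (fun t => ψ (hv.flow t x s₀) * r (t, x))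
      (-(fderiv ℝ (fun x => ψ (hv.flow s x s₀)) x (r (s, x) • v (s, x)) +
        ψ (hv.flow s x s₀) * divergence (fun y => r (s, y) • v (s, y)) x)) s := by
    filter_upwards [hL.ae_differentiableAt (μ := volume)] with x hx
    refine ((hv.hasDerivAt_comp_flow hx).fun_mul (hcont s x)).congr_deriv ?_
    rw [map_smul, smul_eq_mul]
    ring
  generalize hη : (fun x => ψ (hv.flow s x s₀)) = η at hL hηc hηcont hd
  have hη' : ∀ x, ψ (hv.flow s x s₀) = η x := fun x => congrFun hη x
  simp only [hη'] at hd
  have hmeas1 := aestronglyMeasurable_fderiv_apply (η := η) hG.continuous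
  have hint1 : Integrable (fun x => η x * divergence (fun y => r (s, y) • v (s, y)) x) :=
    (hηcont.mul hdivc).integrable_of_hasCompactSupport
      (HasCompactSupport.mul_right (f := η) (f' := divergence fun y => r (s, y) • v (s, y)) hηc)
  have hbound : Integrable ((Metric.closedBall (0 : State d) M).indicator fun _ => C) :=
    (integrableOn_const (by exact measure_closedBall_lt_top.ne)).integrable_indicator
      Metric.isClosed_closedBall.measurableSet
  have hFint : Integrable (fun x => ψ (hv.flow s x s₀) * r (s, x)) := by
    refine (hFcont s).integrable_of_hasCompactSupport ?_
    simp only [hη']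
    exact HasCompactSupport.mul_right (f := η) (f' := fun x => r (s, x)) hηc
  have key := hasDerivAt_integral_of_dominated_loc_of_lip (μ := volume) (𝕜 := ℝ)
    (F := fun t x => ψ (hv.flow t x s₀) * r (t, x)) (x₀ := s)
    (F' := fun x => -(fderiv ℝ η x (r (s, x) • v (s, x)) +
      η x * divergence (fun y => r (s, y) • v (s, y)) x))
    (bound := (Metric.closedBall (0 : State d) M).indicator fun _ => C)
    (Ioo_mem_nhds hsI.1 hsI.2)
    (Eventually.of_forall fun t => (hFcont t).aestronglyMeasurable)
    hFint (hmeas1.add (hηcont.mul hdivc).aestronglyMeasurable).neg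
    (ae_of_all _ fun x => LipschitzOnWith.of_dist_le_mul fun t ht t' ht' => by
      rw [Real.dist_eq, Real.dist_eq, Real.coe_nnabs, abs_of_nonneg (a := indicator _ _ _)
        (indicator_nonneg (fun _ _ => hC) x)]
      exact hMC t (Ioo_subset_Icc_self ht) t' (Ioo_subset_Icc_self ht') x) hbound hd
  have hi : Integrable (fun x => fderiv ℝ η x (r (s, x) • v (s, x))) := by
    refine (key.1.add hint1).neg.congr (ae_of_all _ fun x => ?_)
    simp only [Pi.add_apply, Pi.neg_apply]
    ring
  refine key.2.congr_deriv ?_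
  -- Integration by parts cancels the transport term against the divergence term.
  rw [integral_neg, integral_add hi hint1, integral_fderiv_apply_eq hL hηc hG]
  ring

/-- **Liouville's theorem**, tested against a Lipschitz function: densities that solve the
continuity equation of a tame field classically are transported by its flow. -/
lemma integral_comp_flow_eq {r : ℝ × State d → ℝ} (hr : ContDiff ℝ 1 r)
    (hcont : ∀ s x, HasDerivAt (fun t => r (t, x))
      (-divergence (fun y => r (s, y) • v (s, y)) x) s)
    {ψ : State d → ℝ} {K : NNReal} (hψ : LipschitzWith K ψ) (hψc : HasCompactSupport ψ)
    (s₀ s : ℝ) :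
    ∫ x, ψ (hv.flow s x s₀) * r (s, x) = ∫ x, ψ x * r (s₀, x) := by
  have hder := hv.hasDerivAt_integral_comp_flow hr hcont hψ hψc s₀
  have hconst := is_const_of_deriv_eq_zero (fun s => (hder s).differentiableAt)
    (fun s => (hder s).deriv) s s₀
  simpa only [hv.flow_self] using hconst

lemma continuous_flow_right (s₀ s : ℝ) : Continuous (fun x => hv.flow s₀ x s) :=
  (hv.continuous_flow_prod s₀).comp (by fun_prop : Continuous fun x : State d => (s, x))

/-- Liouville's theorem for measures. Testing against `ψ` composed with the backward flow identifies
the push-forward from `s` to `s₀`; the push-forward from `s₀` to `s` is its inverse. -/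
lemma map_flow_densityMeasure {r : ℝ × State d → ℝ} (hr : ContDiff ℝ 1 r) (hr0 : ∀ p, 0 ≤ r p)
    (hri : ∀ s, IsFiniteMeasure (densityMeasure fun x => r (s, x)))
    (hcont : ∀ s x, HasDerivAt (fun t => r (t, x))
      (-divergence (fun y => r (s, y) • v (s, y)) x) s) (s₀ s : ℝ) :
    (densityMeasure fun x => r (s₀, x)).map (fun x => hv.flow s₀ x s) =
      densityMeasure fun x => r (s, x) := by
  have hm : Measurable (fun x => hv.flow s₀ x s) := (hv.continuous_flow_right s₀ s).measurable
  have hrm : ∀ t, AEMeasurable (fun x => r (t, x)) := fun t =>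
    (hr.continuous.comp (by fun_prop : Continuous fun x : State d => (t, x))).aemeasurable
  have := hri s
  have := hri s₀
  have hback : (densityMeasure fun x => r (s, x)).map (fun x => hv.flow s x s₀) =
      densityMeasure fun x => r (s₀, x) := by
    refine measure_ext_of_lipschitz fun ψ K hψ hψc => ?_
    rw [integral_map (hv.continuous_flow_right s s₀).aemeasurable
        hψ.continuous.aestronglyMeasurable,
      integral_densityMeasure (fun x => hr0 _) (hrm _),
      integral_densityMeasure (fun x => hr0 _) (hrm _)]
    simp only [smul_eq_mul]
    simpa only [mul_comm] using hv.integral_comp_flow_eq hr hcont hψ hψc s₀ s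
  rw [← hback, Measure.map_map hm (hv.continuous_flow_right s s₀).measurable]
  have : (fun x => hv.flow s₀ x s) ∘ (fun x => hv.flow s x s₀) = id := by
    funext x; simp only [Function.comp, hv.flow_flow, hv.flow_self, id]
  rw [this, Measure.map_id]

end IsTameField

/-! ### The heat flow in logarithmic time -/

variable {μ : Measure (State d)}

/-- The probability flow of the heat equation `∂_ρ r = ½ Δ r` in the logarithmic time `s = log ρ`,
that is `v(s, u) = -½ e^s ∇ log r_{e^s}(u)`. -/
def heatField (μ : Measure (State d)) (p : ℝ × State d) : State d :=
  (-(1 / 2 : ℝ) * Real.exp p.1 * (heat μ (Real.exp p.1, p.2))⁻¹) • heatGrad μ (Real.exp p.1, p.2)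

lemma contDiff_heat_exp [IsFiniteMeasure μ] :
    ContDiff ℝ (⊤ : ℕ∞) fun p : ℝ × State d => heat μ (Real.exp p.1, p.2) := by
  have h : ContDiff ℝ (⊤ : ℕ∞) fun p : ℝ × State d => (Real.exp p.1, p.2) := by fun_prop
  refine contDiff_iff_contDiffAt.2 fun p => ?_
  exact ((contDiffOn_heat (μ := μ)).contDiffAt ((isOpen_lt continuous_const
    continuous_fst).mem_nhds (Real.exp_pos p.1 : 0 < Real.exp p.1))).comp p h.contDiffAt

lemma contDiff_heatGrad_exp [IsFiniteMeasure μ] :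
    ContDiff ℝ (⊤ : ℕ∞) fun p : ℝ × State d => heatGrad μ (Real.exp p.1, p.2) := by
  have h : ContDiff ℝ (⊤ : ℕ∞) fun p : ℝ × State d => (Real.exp p.1, p.2) := by fun_prop
  refine contDiff_iff_contDiffAt.2 fun p => ?_
  exact ((contDiffOn_heatGrad (μ := μ)).contDiffAt ((isOpen_lt continuous_const
    continuous_fst).mem_nhds (Real.exp_pos p.1 : 0 < Real.exp p.1))).comp p h.contDiffAt

lemma isTameField_heatField [IsFiniteMeasure μ] (hμ : μ ≠ 0) : IsTameField (heatField μ) where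
  contDiff := by
    have h1 : ContDiff ℝ 1 fun p : ℝ × State d => (heat μ (Real.exp p.1, p.2))⁻¹ :=
      (contDiff_heat_exp.of_le (by norm_cast)).inv fun p =>
        (heat_pos hμ (Real.exp_pos _) _).ne'
    have h2 : ContDiff ℝ 1 fun p : ℝ × State d => heatGrad μ (Real.exp p.1, p.2) :=
      contDiff_heatGrad_exp.of_le (by norm_cast)
    unfold heatField
    fun_prop
  growth T := by
    obtain ⟨C, hC, h⟩ := exists_norm_heatGrad_le hμ (b := Real.exp T) (Real.exp_pos (-T))
    refine ⟨1 / 2 * Real.exp T * C, by positivity, fun s hs x => ?_⟩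
    have hr := heat_pos hμ (Real.exp_pos s) x
    have h1 := h (Real.exp s) ⟨Real.exp_le_exp.2 hs.1, Real.exp_le_exp.2 hs.2⟩ x
    rw [heatField, norm_smul, Real.norm_eq_abs, abs_mul, abs_mul, abs_neg,
      abs_of_pos (Real.exp_pos _), abs_of_pos (inv_pos.2 hr), abs_of_pos (by norm_num)]
    calc 1 / 2 * Real.exp s * (heat μ (Real.exp s, x))⁻¹ * ‖heatGrad μ (Real.exp s, x)‖
        ≤ 1 / 2 * Real.exp T * (heat μ (Real.exp s, x))⁻¹ *
          (C * (1 + ‖x‖) * heat μ (Real.exp s, x)) := by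
          gcongr
          exact hs.2
      _ = _ := by field_simp

lemma hasDerivAt_heat_exp [IsFiniteMeasure μ] (hμ : μ ≠ 0) (s : ℝ) (x : State d) :
    HasDerivAt (fun t => heat μ (Real.exp t, x))
      (-divergence (fun y => heat μ (Real.exp s, y) • heatField μ (s, y)) x) s := by
  have h1 := (hasDerivAt_heat (μ := μ) (Real.exp_pos s) x).comp s (Real.hasDerivAt_exp s)
  have e : (fun y => heat μ (Real.exp s, y) • heatField μ (s, y)) =
      fun y => (-(1 / 2 : ℝ) * Real.exp s) • heatGrad μ (Real.exp s, y) := by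
    funext y
    have := (heat_pos hμ (Real.exp_pos s) y).ne'
    simp only [heatField, smul_smul]
    congr 1
    field_simp
  rw [e, divergence_const_smul _ (differentiable_heatGrad_slice (Real.exp_pos s) x)]
  refine h1.congr_deriv ?_
  change _ = -(-(1 / 2) * Real.exp s * heatLap μ (Real.exp s, x))
  ring

/-- The probability flow transports the solution of the heat equation. -/
lemma map_heatFlow [IsProbabilityMeasure μ] (s₀ s : ℝ) :
    (densityMeasure fun x => heat μ (Real.exp s₀, x)).map
      (fun x => (isTameField_heatField (IsProbabilityMeasure.ne_zero μ)).flow s₀ x s) =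
      densityMeasure fun x => heat μ (Real.exp s, x) := by
  refine (isTameField_heatField (IsProbabilityMeasure.ne_zero μ)).map_flow_densityMeasure
    (r := fun p => heat μ (Real.exp p.1, p.2))
    (contDiff_heat_exp.of_le (by norm_cast)) (fun p => heat_nonneg μ (Real.exp_pos _) _)
    (fun s => ?_) (fun s x => hasDerivAt_heat_exp (IsProbabilityMeasure.ne_zero μ) s x) s₀ s
  have := isProbabilityMeasure_heat (μ := μ) (Real.exp_pos s)
  infer_instance

/-! ### Posterior means at high noise level -/

/-- Likelihood ratio `dN(l x, I) / dN(0, I)` at `w`: the weight of the sample `x` in the posterior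
given the observation `w`, when the signal-to-noise ratio is `l`. -/
def tiltWeight (l : ℝ) (w x : State d) : ℝ := Real.exp (l * inner ℝ w x - (l * ‖x‖) ^ 2 / 2)

/-- Evidence of the observation `w`. -/
def tiltMass (μ : Measure (State d)) (l : ℝ) (w : State d) : ℝ := ∫ x, tiltWeight l w x ∂μ

/-- Unnormalised posterior mean of `l • x`. -/
def tiltMoment (μ : Measure (State d)) (l : ℝ) (w : State d) : State d :=
  ∫ x, tiltWeight l w x • (l • x) ∂μ

/-- Posterior mean of `l • x` given the observation `w`. -/
def tiltMean (μ : Measure (State d)) (l : ℝ) (w : State d) : State d :=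
  (tiltMass μ l w)⁻¹ • tiltMoment μ l w

/-- Truncated first moment of `l • x`. As a function of `s = -2 log l` it is integrable, whether or
not `μ` has moments. -/
def truncMoment (μ : Measure (State d)) (l : ℝ) : ℝ := ∫ x, l * ‖x‖ / (1 + (l * ‖x‖) ^ 2) ∂μ

lemma abs_exp_sub_exp_le (a b : ℝ) :
    |Real.exp a - Real.exp b| ≤ |a - b| * (Real.exp a + Real.exp b) := by
  have key : ∀ a b : ℝ, Real.exp a - Real.exp b ≤ |a - b| * (Real.exp a + Real.exp b) := by
    intro a b
    have h1 := Real.add_one_le_exp (b - a)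
    have h2 : Real.exp b = Real.exp a * Real.exp (b - a) := by rw [← Real.exp_add]; ring_nf
    have ha := Real.exp_pos a
    have hb := Real.exp_pos b
    have h3 := le_abs_self (a - b)
    have h4 := abs_nonneg (a - b)
    have h5 : Real.exp a * (b - a + 1) ≤ Real.exp b := by rw [h2]; gcongr
    have h6 := mul_le_mul_of_nonneg_left h3 ha.le
    have h7 := mul_nonneg h4 hb.le
    linarith
  refine abs_le.2 ⟨?_, key a b⟩
  have := key b a
  rw [abs_sub_comm, add_comm] at this
  linarith

lemma tiltWeight_pos (l : ℝ) (w x : State d) : 0 < tiltWeight l w x := Real.exp_pos _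

lemma continuous_tiltWeight (l : ℝ) (w : State d) : Continuous (tiltWeight l w) := by
  unfold tiltWeight; fun_prop

/-- The Gaussian factor of the weight absorbs polynomials in `l ‖x‖`, uniformly in `l`. -/
lemma exists_tiltWeight_le (d : ℕ) (R : ℝ) : ∃ C, 0 ≤ C ∧ ∀ l, 0 ≤ l → ∀ w x : State d, ‖w‖ ≤ R →
    (1 + l * ‖x‖) ^ 4 * tiltWeight l w x ≤ C := by
  obtain ⟨C, hC, h⟩ := exists_polynomial_mul_gauss_le 4 R (c := 1 / 2) (by norm_num)
  refine ⟨C, hC, fun l hl w x hw => ?_⟩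
  refine le_trans ?_ (h (l * ‖x‖) (by positivity))
  unfold tiltWeight
  have h1 : l * inner ℝ w x ≤ R * (l * ‖x‖) := by
    have := real_inner_le_norm w x
    calc l * inner ℝ w x ≤ l * (‖w‖ * ‖x‖) := by gcongr
      _ ≤ l * (R * ‖x‖) := by gcongr
      _ = _ := by ring
  gcongr
  linarith

variable {μ : Measure (State d)}

lemma norm_tiltWeight_smul_le {R C l : ℝ} (hl : 0 ≤ l) {w x : State d} (hw : ‖w‖ ≤ R)
    (h : ∀ l, 0 ≤ l → ∀ w x : State d, ‖w‖ ≤ R → (1 + l * ‖x‖) ^ 4 * tiltWeight l w x ≤ C) :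
    ‖tiltWeight l w x • (l • x)‖ ≤ C * (l * ‖x‖ / (1 + (l * ‖x‖) ^ 2)) := by
  have hT := tiltWeight_pos l w x
  have hy : 0 ≤ l * ‖x‖ := by positivity
  have h1 := h l hl w x hw
  rw [norm_smul, norm_smul, Real.norm_of_nonneg hT.le, Real.norm_of_nonneg hl, ← mul_div_assoc,
    le_div_iff₀ (by positivity)]
  have h2 : 1 + (l * ‖x‖) ^ 2 ≤ (1 + l * ‖x‖) ^ 4 := by
    nlinarith [pow_nonneg hy 3, pow_nonneg hy 4, pow_nonneg hy 2]
  calc _ = (l * ‖x‖) * ((1 + (l * ‖x‖) ^ 2) * tiltWeight l w x) := by ring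
    _ ≤ (l * ‖x‖) * ((1 + l * ‖x‖) ^ 4 * tiltWeight l w x) := by gcongr
    _ ≤ (l * ‖x‖) * C := by gcongr
    _ = _ := by ring

lemma abs_tiltWeight_sub_le {R C l : ℝ} (hl : 0 ≤ l) {w w' x : State d} (hw : ‖w‖ ≤ R)
    (hw' : ‖w'‖ ≤ R)
    (h : ∀ l, 0 ≤ l → ∀ w x : State d, ‖w‖ ≤ R → (1 + l * ‖x‖) ^ 4 * tiltWeight l w x ≤ C) :
    (1 + l * ‖x‖) * |tiltWeight l w x - tiltWeight l w' x| ≤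
      2 * C * (l * ‖x‖ / (1 + (l * ‖x‖) ^ 2)) * ‖w - w'‖ := by
  have hy : 0 ≤ l * ‖x‖ := by positivity
  have h1 : |tiltWeight l w x - tiltWeight l w' x| ≤
      (l * ‖x‖ * ‖w - w'‖) * (tiltWeight l w x + tiltWeight l w' x) := by
    refine (abs_exp_sub_exp_le _ _).trans ?_
    have e : l * inner ℝ w x - (l * ‖x‖) ^ 2 / 2 - (l * inner ℝ w' x - (l * ‖x‖) ^ 2 / 2) =
        l * inner ℝ (w - w') x := by rw [inner_sub_left]; ring
    rw [e, abs_mul, abs_of_nonneg hl]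
    change _ * (tiltWeight l w x + tiltWeight l w' x) ≤ _
    have := abs_real_inner_le_norm (w - w') x
    have h2 := tiltWeight_pos l w x
    have h3 := tiltWeight_pos l w' x
    have h4 : l * |inner ℝ (w - w') x| ≤ l * ‖x‖ * ‖w - w'‖ := by
      calc l * |inner ℝ (w - w') x| ≤ l * (‖w - w'‖ * ‖x‖) := by gcongr
        _ = _ := by ring
    exact mul_le_mul_of_nonneg_right h4 (by positivity)
  have h2 : (1 + l * ‖x‖) * (1 + (l * ‖x‖) ^ 2) ≤ (1 + l * ‖x‖) ^ 4 := by
    nlinarith [pow_nonneg hy 3, pow_nonneg hy 4, pow_nonneg hy 2]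
  have h3 := h l hl w x hw
  have h4 := h l hl w' x hw'
  have h5 := tiltWeight_pos l w x
  have h6 := tiltWeight_pos l w' x
  rw [← mul_div_assoc, div_mul_eq_mul_div, le_div_iff₀ (by positivity)]
  calc (1 + l * ‖x‖) * |tiltWeight l w x - tiltWeight l w' x| * (1 + (l * ‖x‖) ^ 2)
      ≤ (1 + l * ‖x‖) * ((l * ‖x‖ * ‖w - w'‖) * (tiltWeight l w x + tiltWeight l w' x)) *
        (1 + (l * ‖x‖) ^ 2) := by gcongr
    _ = (l * ‖x‖ * ‖w - w'‖) * (((1 + l * ‖x‖) * (1 + (l * ‖x‖) ^ 2)) *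
        (tiltWeight l w x + tiltWeight l w' x)) := by ring
    _ ≤ (l * ‖x‖ * ‖w - w'‖) * ((1 + l * ‖x‖) ^ 4 *
        (tiltWeight l w x + tiltWeight l w' x)) := by gcongr
    _ ≤ (l * ‖x‖ * ‖w - w'‖) * (2 * C) :=
        mul_le_mul_of_nonneg_left (by linarith) (by positivity)
    _ = _ := by ring

lemma div_one_add_sq_le_one (y : ℝ) : |y / (1 + y ^ 2)| ≤ 1 := by
  rw [abs_div, abs_of_pos (a := 1 + y ^ 2) (by positivity), div_le_one (by positivity),
    ← sq_abs y]
  nlinarith [sq_nonneg (|y| - 1)]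

lemma truncMoment_nonneg {l : ℝ} (hl : 0 ≤ l) : 0 ≤ truncMoment μ l :=
  integral_nonneg fun x => by positivity

section Probability
variable [IsProbabilityMeasure μ]

lemma integrable_truncMoment (l : ℝ) :
    Integrable (fun x : State d => l * ‖x‖ / (1 + (l * ‖x‖) ^ 2)) μ := by
  refine Integrable.of_bound (C := 1) (Measurable.aestronglyMeasurable (by fun_prop))
    (ae_of_all _ fun x => ?_)
  exact div_one_add_sq_le_one _

lemma truncMoment_le_one (l : ℝ) : truncMoment μ l ≤ 1 := by
  have := integral_mono (integrable_truncMoment (μ := μ) l) (integrable_const 1) fun x =>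
    (le_abs_self _).trans (div_one_add_sq_le_one (l * ‖x‖))
  unfold truncMoment
  simpa using this

lemma integrable_tiltWeight {l : ℝ} (hl : 0 ≤ l) (w : State d) :
    Integrable (tiltWeight l w) μ := by
  obtain ⟨C, hC, h⟩ := exists_tiltWeight_le d ‖w‖
  refine Integrable.of_bound (C := C) (continuous_tiltWeight l w).aestronglyMeasurable
    (ae_of_all _ fun x => ?_)
  have h1 := h l hl w x le_rfl
  have hT := tiltWeight_pos l w x
  rw [Real.norm_of_nonneg hT.le]
  refine le_trans ?_ h1
  refine le_mul_of_one_le_left hT.le (one_le_pow₀ ?_)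
  have : 0 ≤ l * ‖x‖ := by positivity
  linarith

lemma integrable_tiltWeight_smul {l : ℝ} (hl : 0 ≤ l) (w : State d) :
    Integrable (fun x => tiltWeight l w x • (l • x)) μ := by
  obtain ⟨C, hC, h⟩ := exists_tiltWeight_le d ‖w‖
  have hc := continuous_tiltWeight l w
  exact Integrable.mono' ((integrable_truncMoment (μ := μ) l).const_mul C)
    (Continuous.aestronglyMeasurable (by fun_prop))
    (ae_of_all _ fun x => norm_tiltWeight_smul_le hl le_rfl h)

omit [IsProbabilityMeasure μ] in
/-- Gaussian averages at noise level `l⁻²`, in units of the standard deviation `l⁻¹`. -/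
lemma gaussAverage_eq_tilt {F : Type} [NormedAddCommGroup F] [NormedSpace ℝ F]
    (k : State d → F) {l : ℝ} (hl : 0 < l) (w : State d) :
    gaussAverage μ k ((l ^ 2)⁻¹, l⁻¹ • w) =
      Real.exp (-‖w‖ ^ 2 / 2) • ∫ x, tiltWeight l w x • k x ∂μ := by
  rw [gaussAverage, ← integral_smul]
  refine integral_congr_ae (ae_of_all _ fun x => ?_)
  simp only [smul_smul, tiltWeight]
  rw [← Real.exp_add]
  congr 2
  have : l⁻¹ • w - x = l⁻¹ • (w - l • x) := by
    rw [smul_sub, smul_smul, inv_mul_cancel₀ hl.ne', one_smul]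
  rw [this, norm_smul, mul_pow, norm_sub_sq_real, inner_smul_right, norm_smul, norm_inv,
    Real.norm_of_nonneg hl.le]
  field_simp
  ring

/-- The evidence is bounded below, locally uniformly in the observation and uniformly as the
signal-to-noise ratio tends to `0`. -/
lemma exists_le_tiltMass (μ : Measure (State d)) [IsProbabilityMeasure μ] (R : ℝ) :
    ∃ c, 0 < c ∧ ∀ l ∈ Ioc (0 : ℝ) 1, ∀ w : State d, ‖w‖ ≤ R → c ≤ tiltMass μ l w := by
  obtain ⟨K, hK, hpos⟩ := exists_ball_measure_pos (IsProbabilityMeasure.ne_zero μ)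
  refine ⟨μ.real (Metric.closedBall 0 K) * Real.exp (-(R + K) ^ 2 / 2), by positivity,
    fun l hl w hw => ?_⟩
  have h := mul_exp_le_gaussAverage (μ := μ) (K := K) (ρ := (l ^ 2)⁻¹)
    (by have := hl.1; positivity) (l⁻¹ • w)
  rw [gaussAverage_eq_tilt _ hl.1] at h
  simp only [smul_eq_mul, mul_one] at h
  have h1 : Real.exp (-‖w‖ ^ 2 / 2) * tiltMass μ l w ≤ tiltMass μ l w := by
    refine mul_le_of_le_one_left (integral_nonneg fun x => (tiltWeight_pos l w x).le) ?_
    rw [Real.exp_le_one_iff]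
    have := sq_nonneg ‖w‖
    linarith
  refine le_trans ?_ (h.trans h1)
  have hl0 := hl.1
  refine mul_le_mul_of_nonneg_left (Real.exp_le_exp.2 ?_) measureReal_nonneg
  rw [norm_smul, norm_inv, Real.norm_of_nonneg hl0.le, div_le_div_iff₀ (by positivity) (by positivity)]
  have e : (l⁻¹ * ‖w‖ + K) ^ 2 = (‖w‖ + l * K) ^ 2 * (l ^ 2)⁻¹ := by field_simp
  rw [e]
  have h2 : (‖w‖ + l * K) ^ 2 ≤ (R + K) ^ 2 := by
    have : l * K ≤ K := mul_le_of_le_one_left hK hl.2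
    have : 0 ≤ l * K := by positivity
    gcongr
  have h3 : (0 : ℝ) < (l ^ 2)⁻¹ := by positivity
  nlinarith [mul_le_mul_of_nonneg_right h2 h3.le]

lemma tiltMass_pos {l : ℝ} (hl : l ∈ Ioc (0 : ℝ) 1) (w : State d) : 0 < tiltMass μ l w := by
  obtain ⟨c, hc, h⟩ := exists_le_tiltMass μ ‖w‖
  exact hc.trans_le (h l hl w le_rfl)

/-- The posterior mean is bounded by the truncated first moment, and is Lipschitz with a constant of
the same size, locally uniformly. -/
lemma exists_tiltMean_bounds (μ : Measure (State d)) [IsProbabilityMeasure μ] (R : ℝ) :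
    ∃ C, 0 ≤ C ∧ ∀ l ∈ Ioc (0 : ℝ) 1, ∀ w w' : State d, ‖w‖ ≤ R → ‖w'‖ ≤ R →
      ‖tiltMean μ l w‖ ≤ C * truncMoment μ l ∧
      ‖tiltMean μ l w - tiltMean μ l w'‖ ≤ C * truncMoment μ l * ‖w - w'‖ := by
  obtain ⟨c, hc, hmass⟩ := exists_le_tiltMass μ R
  obtain ⟨C, hC, h⟩ := exists_tiltWeight_le d R
  refine ⟨c⁻¹ * C + (c⁻¹ * (2 * C) + c⁻¹ * c⁻¹ * (2 * C) * C), by positivity,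
    fun l hl w w' hw hw' => ?_⟩
  have hl0 := hl.1.le
  set b := truncMoment μ l with hb
  have hb0 : 0 ≤ b := truncMoment_nonneg hl0
  have hb1 : b ≤ 1 := truncMoment_le_one l
  have hint := integrable_truncMoment (μ := μ) l
  have hN : ∀ w : State d, ‖w‖ ≤ R → ‖tiltMoment μ l w‖ ≤ C * b := fun w hw => by
    rw [hb, truncMoment, ← integral_const_mul]
    exact norm_integral_le_of_norm_le (hint.const_mul C)
      (ae_of_all _ fun x => norm_tiltWeight_smul_le hl0 hw h)
  have hDd : |tiltMass μ l w - tiltMass μ l w'| ≤ 2 * C * b * ‖w - w'‖ := by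
    rw [← Real.norm_eq_abs, tiltMass, tiltMass, ← integral_sub (integrable_tiltWeight hl0 w)
      (integrable_tiltWeight hl0 w'), hb, truncMoment, ← integral_const_mul, ← integral_mul_const]
    refine norm_integral_le_of_norm_le ((hint.const_mul (2 * C)).mul_const _)
      (ae_of_all _ fun x => ?_)
    refine le_trans ?_ (abs_tiltWeight_sub_le hl0 hw hw' h)
    refine le_mul_of_one_le_left (abs_nonneg _) ?_
    have : 0 ≤ l * ‖x‖ := by positivity
    linarith
  have hNd : ‖tiltMoment μ l w - tiltMoment μ l w'‖ ≤ 2 * C * b * ‖w - w'‖ := by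
    rw [tiltMoment, tiltMoment, ← integral_sub (integrable_tiltWeight_smul hl0 w)
      (integrable_tiltWeight_smul hl0 w'), hb, truncMoment, ← integral_const_mul,
      ← integral_mul_const]
    refine norm_integral_le_of_norm_le ((hint.const_mul (2 * C)).mul_const _)
      (ae_of_all _ fun x => ?_)
    refine le_trans ?_ (abs_tiltWeight_sub_le hl0 hw hw' h)
    rw [← sub_smul, norm_smul, norm_smul, Real.norm_of_nonneg hl0, mul_comm, Real.norm_eq_abs]
    gcongr
    linarith
  have hD := hmass l hl w hw
  have hD' := hmass l hl w' hw'
  have hDp := hc.trans_le hD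
  have hDp' := hc.trans_le hD'
  have hi : (tiltMass μ l w)⁻¹ ≤ c⁻¹ := inv_anti₀ hc hD
  have hi' : (tiltMass μ l w')⁻¹ ≤ c⁻¹ := inv_anti₀ hc hD'
  constructor
  · rw [tiltMean, norm_smul, Real.norm_of_nonneg (by positivity)]
    calc _ ≤ c⁻¹ * (C * b) := by gcongr; exact hN w hw
      _ ≤ _ := by
        have h1 : 0 ≤ c⁻¹ * (2 * C) + c⁻¹ * c⁻¹ * (2 * C) * C := by positivity
        rw [← mul_assoc]
        exact mul_le_mul_of_nonneg_right (by linarith) hb0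
  · have e : tiltMean μ l w - tiltMean μ l w' =
        (tiltMass μ l w)⁻¹ • (tiltMoment μ l w - tiltMoment μ l w') +
        ((tiltMass μ l w)⁻¹ * (tiltMass μ l w')⁻¹ * (tiltMass μ l w' - tiltMass μ l w)) •
          tiltMoment μ l w' := by
      have : (tiltMass μ l w)⁻¹ * (tiltMass μ l w')⁻¹ * (tiltMass μ l w' - tiltMass μ l w) =
          (tiltMass μ l w)⁻¹ - (tiltMass μ l w')⁻¹ := by field_simp
      rw [this, tiltMean, tiltMean]
      module
    rw [e]
    have hDd' : |tiltMass μ l w' - tiltMass μ l w| ≤ 2 * C * b * ‖w - w'‖ := by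
      rwa [abs_sub_comm]
    have h1 : ‖(tiltMass μ l w)⁻¹ • (tiltMoment μ l w - tiltMoment μ l w')‖ ≤
        c⁻¹ * (2 * C * b * ‖w - w'‖) := by
      rw [norm_smul, Real.norm_of_nonneg (by positivity)]
      gcongr
    have h2 : ‖((tiltMass μ l w)⁻¹ * (tiltMass μ l w')⁻¹ * (tiltMass μ l w' - tiltMass μ l w)) •
          tiltMoment μ l w'‖ ≤ c⁻¹ * c⁻¹ * (2 * C * b * ‖w - w'‖) * (C * 1) := by
      rw [norm_smul, Real.norm_eq_abs, abs_mul, abs_of_nonneg (a := (tiltMass μ l w)⁻¹ * _)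
        (by positivity)]
      gcongr
      exact (hN w' hw').trans (by gcongr)
    calc _ ≤ _ := norm_add_le _ _
      _ ≤ _ := add_le_add h1 h2
      _ = (c⁻¹ * (2 * C) + c⁻¹ * c⁻¹ * (2 * C) * C) * b * ‖w - w'‖ := by ring
      _ ≤ _ := by
        have h3 : 0 ≤ c⁻¹ * C := by positivity
        have h4 := norm_nonneg (w - w')
        exact mul_le_mul_of_nonneg_right (mul_le_mul_of_nonneg_right (by linarith) hb0) h4

/-- Monotonicity of the posterior mean along rays from the origin, an instance of Chebyshev's
association inequality. -/
lemma inner_tiltMean_zero_le {l : ℝ} (hl : l ∈ Ioc (0 : ℝ) 1) (w : State d) :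
    inner ℝ (tiltMean μ l 0) w ≤ inner ℝ (tiltMean μ l w) w := by
  have hl0 := hl.1.le
  have hD := tiltMass_pos (μ := μ) hl w
  have hD0 := tiltMass_pos (μ := μ) hl 0
  set z : State d → ℝ := fun x => l * inner ℝ w x
  set m := inner ℝ (tiltMean μ l 0) w with hm
  have hint : ∀ w', Integrable (fun x => tiltWeight l w' x * z x) μ := fun w' => by
    have := (integrable_tiltWeight_smul (μ := μ) hl0 w').const_inner (𝕜 := ℝ) w
    refine this.congr (ae_of_all _ fun x => ?_)
    simp only [inner_smul_right, z]
  have hmom : ∀ w', inner ℝ (tiltMoment μ l w') w = ∫ x, tiltWeight l w' x * z x ∂μ := fun w' => by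
    rw [tiltMoment, real_inner_comm, ← integral_inner (integrable_tiltWeight_smul hl0 w')]
    refine integral_congr_ae (ae_of_all _ fun x => ?_)
    simp only [inner_smul_right, z]
  have hT : ∀ x, tiltWeight l w x = Real.exp (z x) * tiltWeight l 0 x := fun x => by
    simp only [tiltWeight, z, ← Real.exp_add, inner_zero_left]
    ring_nf
  -- The integrand is a weight times `(z - m) (e^z - e^m)`, a product of factors of the same sign.
  have h0 : 0 ≤ ∫ x, (tiltWeight l w x * z x - m * tiltWeight l w x -
      Real.exp m * (tiltWeight l 0 x * z x - m * tiltWeight l 0 x)) ∂μ := by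
    refine integral_nonneg fun x => ?_
    have e : tiltWeight l w x * z x - m * tiltWeight l w x -
      Real.exp m * (tiltWeight l 0 x * z x - m * tiltWeight l 0 x) =
      tiltWeight l 0 x * ((z x - m) * (Real.exp (z x) - Real.exp m)) := by rw [hT]; ring
    simp only [Pi.zero_apply]
    rw [e]
    refine mul_nonneg (tiltWeight_pos _ _ _).le ?_
    rcases le_total m (z x) with h | h
    · exact mul_nonneg (sub_nonneg.2 h) (sub_nonneg.2 (Real.exp_le_exp.2 h))
    · exact mul_nonneg_of_nonpos_of_nonpos (sub_nonpos.2 h) (sub_nonpos.2 (Real.exp_le_exp.2 h))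
  have i1 := hint w
  have i2 := (integrable_tiltWeight (μ := μ) hl0 w).const_mul m
  have i3 := hint 0
  have i4 := (integrable_tiltWeight (μ := μ) hl0 0).const_mul m
  have i12 : Integrable (fun x => tiltWeight l w x * z x - m * tiltWeight l w x) μ := i1.sub i2
  have i34 : Integrable (fun x => tiltWeight l 0 x * z x - m * tiltWeight l 0 x) μ := i3.sub i4
  rw [integral_sub i12 (i34.const_mul _), integral_sub i1 i2, integral_const_mul,
    integral_const_mul, integral_sub i3 i4, integral_const_mul, ← hmom, ← hmom] at h0
  change 0 ≤ inner ℝ (tiltMoment μ l w) w - m * tiltMass μ l w -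
    Real.exp m * (inner ℝ (tiltMoment μ l 0) w - m * tiltMass μ l 0) at h0
  have hm0 : inner ℝ (tiltMoment μ l 0) w - m * tiltMass μ l 0 = 0 := by
    rw [hm, tiltMean, real_inner_smul_left]
    field_simp
    ring
  rw [hm0, mul_zero, sub_zero] at h0
  rw [tiltMean, real_inner_smul_left, ← div_eq_inv_mul, le_div_iff₀ hD]
  linarith

/-- In units of the noise's standard deviation the heat field is the difference between the position
and the posterior mean (Tweedie's formula). -/
lemma heatField_eq_tilt (s : ℝ) (w : State d) :
    heatField μ (s, Real.exp (s / 2) • w) =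
      ((1 / 2 : ℝ) * Real.exp (s / 2)) • (w - tiltMean μ (Real.exp (-s / 2)) w) := by
  set l := Real.exp (-s / 2) with hl
  have hl0 : 0 < l := Real.exp_pos _
  have e1 : Real.exp s = (l ^ 2)⁻¹ := by
    rw [hl, ← Real.exp_nat_mul, ← Real.exp_neg]; congr 1; push_cast; ring
  have e2 : Real.exp (s / 2) = l⁻¹ := by rw [hl, ← Real.exp_neg]; congr 1; ring
  have hm : tiltMass μ l w ≠ 0 := by
    intro h0
    have h1 := gaussAverage_eq_tilt (μ := μ) (fun _ => (1 : ℝ)) hl0 w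
    have h2 := heat_pos (IsProbabilityMeasure.ne_zero μ) (by positivity : 0 < (l ^ 2)⁻¹) (l⁻¹ • w)
    simp only [smul_eq_mul, mul_one] at h1
    rw [tiltMass] at h0
    rw [heat, h1, h0] at h2
    simp at h2
  have hmom : ∫ x, tiltWeight l w x • x ∂μ = l⁻¹ • tiltMoment μ l w := by
    rw [tiltMoment, ← integral_smul]
    refine integral_congr_ae (ae_of_all _ fun x => ?_)
    simp only [smul_smul]
    congr 1
    field_simp
  have hmass : ∫ x, tiltWeight l w x • (1 : ℝ) ∂μ = tiltMass μ l w := by simp [tiltMass]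
  rw [heatField, heat, heatGrad]
  simp only [e1, e2]
  rw [gaussAverage_eq_tilt _ hl0, gaussAverage_eq_tilt _ hl0, hmom, hmass, tiltMean]
  have hn : (2 * Real.pi * (l ^ 2)⁻¹) ^ (-(d : ℝ) / 2) ≠ 0 := by positivity
  have he := (Real.exp_pos (-‖w‖ ^ 2 / 2)).ne'
  generalize (2 * Real.pi * (l ^ 2)⁻¹) ^ (-(d : ℝ) / 2) = n at hn
  generalize Real.exp (-‖w‖ ^ 2 / 2) = e at he
  generalize tiltMass μ l w = m at hm
  generalize tiltMoment μ l w = M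
  simp only [smul_smul, smul_sub, smul_eq_mul, mul_inv]
  rw [← neg_sub, ← sub_eq_zero, ← sub_eq_zero]
  match_scalars <;> field_simp <;> ring

end Probability

/-! ### The heat flow at infinite and at vanishing noise -/

section HeatFlow
variable {μ : Measure (State d)} [IsProbabilityMeasure μ]

/-- Position at time `s` of the particle that the probability flow of the heat equation carries
through `w` at time `0`, when the noise level `e^s` is `1`. -/
def heatFlow (μ : Measure (State d)) [IsProbabilityMeasure μ] (w : State d) (s : ℝ) : State d :=
  (isTameField_heatField (IsProbabilityMeasure.ne_zero μ)).flow 0 w s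

lemma heatFlow_zero (w : State d) : heatFlow μ w 0 = w := IsTameField.flow_self _ 0 w

lemma hasDerivAt_heatFlow (w : State d) (s : ℝ) :
    HasDerivAt (heatFlow μ w) (heatField μ (s, heatFlow μ w s)) s :=
  IsTameField.hasDerivAt_flow _ 0 w s

lemma continuous_heatFlow_prod :
    Continuous (fun p : ℝ × State d => heatFlow μ p.2 p.1) :=
  IsTameField.continuous_flow_prod _ 0

lemma continuous_heatFlow_right (s : ℝ) : Continuous (fun w => heatFlow μ w s) :=
  IsTameField.continuous_flow_right _ 0 s

lemma map_heatFlow_densityMeasure (s : ℝ) :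
    (densityMeasure fun x => heat μ (1, x)).map (fun w => heatFlow μ w s) =
      densityMeasure fun x => heat μ (Real.exp s, x) := by
  have h := map_heatFlow (μ := μ) 0 s
  simp only [Real.exp_zero] at h
  exact h

/-- The flow line in units of the noise's standard deviation. -/
def scaledFlow (μ : Measure (State d)) [IsProbabilityMeasure μ] (w : State d) (s : ℝ) : State d :=
  Real.exp (-s / 2) • heatFlow μ w s

/-- The rescaled flow line moves only by the posterior mean, which is small at high noise. -/
lemma hasDerivAt_scaledFlow (w : State d) (s : ℝ) :
    HasDerivAt (scaledFlow μ w)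
      (-(1 / 2 : ℝ) • tiltMean μ (Real.exp (-s / 2)) (scaledFlow μ w s)) s := by
  have h1 : HasDerivAt (fun s : ℝ => Real.exp (-s / 2)) (Real.exp (-s / 2) * (-1 / 2)) s :=
    (((hasDerivAt_id s).neg).div_const 2).exp
  have h2 := h1.fun_smul (hasDerivAt_heatFlow (μ := μ) w s)
  refine h2.congr_deriv ?_
  have hinv : Real.exp (s / 2) * Real.exp (-s / 2) = 1 := by
    rw [← Real.exp_add]; ring_nf; exact Real.exp_zero
  have e : heatFlow μ w s = Real.exp (s / 2) • scaledFlow μ w s := by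
    rw [scaledFlow, smul_smul, hinv, one_smul]
  have e2 := heatField_eq_tilt (μ := μ) s (scaledFlow μ w s)
  rw [← e] at e2
  rw [e2, e]
  simp only [smul_smul, smul_sub]
  have h3 : Real.exp (-s / 2) * (1 / 2 * Real.exp (s / 2)) = 1 / 2 := by
    linear_combination (1 / 2) * hinv
  have h4 : Real.exp (-s / 2) * (-1 / 2) * Real.exp (s / 2) = -1 / 2 := by
    linear_combination (-1 / 2) * hinv
  rw [h3, h4]
  module

lemma continuous_scaledFlow (w : State d) : Continuous (scaledFlow μ w) :=
  continuous_iff_continuousAt.2 fun s => (hasDerivAt_scaledFlow w s).continuousAt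

/-- A bounded primitive of `s ↦ truncMoment μ (e^{-s/2})`. -/
def truncPrimitive (μ : Measure (State d)) (s : ℝ) : ℝ :=
  ∫ x, -2 * Real.arctan (Real.exp (-s / 2) * ‖x‖) ∂μ

lemma hasDerivAt_truncPrimitive (s : ℝ) :
    HasDerivAt (truncPrimitive μ) (truncMoment μ (Real.exp (-s / 2))) s := by
  have hd : ∀ (x : State d) (s : ℝ),
      HasDerivAt (fun s => -2 * Real.arctan (Real.exp (-s / 2) * ‖x‖))
        (Real.exp (-s / 2) * ‖x‖ / (1 + (Real.exp (-s / 2) * ‖x‖) ^ 2)) s := fun x s => by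
    have h1 : HasDerivAt (fun s : ℝ => Real.exp (-s / 2)) (Real.exp (-s / 2) * (-1 / 2)) s :=
      (((hasDerivAt_id s).neg).div_const 2).exp
    refine (((h1.mul_const ‖x‖).arctan).const_mul (-2)).congr_deriv ?_
    field_simp
  have hmeas : ∀ s : ℝ, AEStronglyMeasurable
      (fun x : State d => -2 * Real.arctan (Real.exp (-s / 2) * ‖x‖)) μ := fun s =>
    (continuous_const.mul (Real.continuous_arctan.comp (by fun_prop))).aestronglyMeasurable
  refine (hasDerivAt_integral_of_dominated_loc_of_deriv_le (μ := μ) (s := univ)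
    (bound := fun _ => (1 : ℝ)) (F' := fun s x =>
      Real.exp (-s / 2) * ‖x‖ / (1 + (Real.exp (-s / 2) * ‖x‖) ^ 2))
    univ_mem (Eventually.of_forall hmeas) ?_ (integrable_truncMoment _).aestronglyMeasurable
    (ae_of_all _ fun x s _ => div_one_add_sq_le_one _) (integrable_const _)
    (ae_of_all _ fun x s _ => hd x s)).2
  refine Integrable.of_bound (hmeas s) (C := Real.pi) (ae_of_all _ fun x => ?_)
  have h1 := Real.arctan_lt_pi_div_two (Real.exp (-s / 2) * ‖x‖)
  have h2 := Real.neg_pi_div_two_lt_arctan (Real.exp (-s / 2) * ‖x‖)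
  rw [Real.norm_eq_abs, abs_le]
  constructor <;> linarith

lemma truncPrimitive_mem (s : ℝ) : truncPrimitive μ s ∈ Icc (-Real.pi) 0 := by
  have hi : Integrable (fun x : State d => -2 * Real.arctan (Real.exp (-s / 2) * ‖x‖)) μ := by
    refine Integrable.of_bound (C := Real.pi)
      (continuous_const.mul (Real.continuous_arctan.comp (by fun_prop))).aestronglyMeasurable
      (ae_of_all _ fun x => ?_)
    have h1 := Real.arctan_lt_pi_div_two (Real.exp (-s / 2) * ‖x‖)
    have h2 := Real.neg_pi_div_two_lt_arctan (Real.exp (-s / 2) * ‖x‖)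
    rw [Real.norm_eq_abs, abs_le]
    constructor <;> linarith
  constructor
  · have := integral_mono (integrable_const (-Real.pi)) hi fun x => by
      have h1 := Real.arctan_lt_pi_div_two (Real.exp (-s / 2) * ‖x‖)
      simp only
      linarith
    simpa [truncPrimitive] using this
  · refine integral_nonpos fun x => ?_
    have : 0 ≤ Real.arctan (Real.exp (-s / 2) * ‖x‖) := Real.arctan_nonneg.2 (by positivity)
    simp only [Pi.zero_apply]
    linarith

lemma exp_neg_half_mem {s : ℝ} (hs : 0 ≤ s) : Real.exp (-s / 2) ∈ Ioc (0 : ℝ) 1 :=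
  ⟨Real.exp_pos _, Real.exp_le_one_iff.2 (by linarith)⟩

lemma continuous_truncPrimitive : Continuous (truncPrimitive μ) :=
  continuous_iff_continuousAt.2 fun s => (hasDerivAt_truncPrimitive s).continuousAt

/-- The rate that controls the rescaled flow is integrable up to infinite noise, as the derivative of
a bounded monotone function. -/
lemma integrableOn_truncMoment :
    IntegrableOn (fun s => truncMoment μ (Real.exp (-s / 2))) (Ioi 0) := by
  have hmono : Monotone (truncPrimitive μ) := monotone_of_deriv_nonneg
    (fun s => (hasDerivAt_truncPrimitive s).differentiableAt) fun s => by
      rw [(hasDerivAt_truncPrimitive s).deriv]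
      exact truncMoment_nonneg (Real.exp_pos _).le
  refine integrableOn_Ioi_deriv_of_nonneg' (fun s _ => hasDerivAt_truncPrimitive s)
    (fun s _ => truncMoment_nonneg (Real.exp_pos _).le)
    (tendsto_atTop_ciSup hmono ⟨0, ?_⟩)
  rintro _ ⟨s, rfl⟩
  exact (truncPrimitive_mem s).2

/-- Rescaled flow lines stay bounded: by monotonicity the posterior mean pushes outwards no more
than it does at the origin. -/
lemma exists_norm_scaledFlow_le (w : State d) : ∃ R, ∀ s, 0 ≤ s → ‖scaledFlow μ w s‖ ≤ R := by
  obtain ⟨C, hC, h⟩ := exists_tiltMean_bounds μ 0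
  refine ⟨Real.exp (C * Real.pi) * (1 + ‖scaledFlow μ w 0‖ ^ 2), fun s hs => ?_⟩
  have key := gronwall_of_deriv_le (D := fun s => 1 + ‖scaledFlow μ w s‖ ^ 2)
    (A := fun s => C * truncPrimitive μ s) hs
    (continuous_const.add ((continuous_scaledFlow w).norm.pow 2)).continuousOn
    (continuous_const.mul continuous_truncPrimitive).continuousOn
    (fun t _ => ((hasDerivAt_scaledFlow w t).norm_sq).const_add 1)
    (fun t _ => (hasDerivAt_truncPrimitive t).const_mul C) fun t ht => by
      have hl := exp_neg_half_mem ht.1.le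
      have h1 := inner_tiltMean_zero_le (μ := μ) hl (scaledFlow μ w t)
      have h2 := (h _ hl 0 0 (by simp) (by simp)).1
      have h3 := abs_le.1 (abs_real_inner_le_norm (tiltMean μ (Real.exp (-t / 2)) 0)
        (scaledFlow μ w t))
      have hb := truncMoment_nonneg (μ := μ) hl.1.le
      have h4 : ‖tiltMean μ (Real.exp (-t / 2)) 0‖ * ‖scaledFlow μ w t‖ ≤
          C * truncMoment μ (Real.exp (-t / 2)) * (1 + ‖scaledFlow μ w t‖ ^ 2) := by
        gcongr
        nlinarith [sq_nonneg (‖scaledFlow μ w t‖ - 1)]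
      rw [inner_smul_right, real_inner_comm]
      linarith [h3.1]
  have h1 : ‖scaledFlow μ w s‖ ≤ 1 + ‖scaledFlow μ w s‖ ^ 2 := by
    nlinarith [sq_nonneg (‖scaledFlow μ w s‖ - 1)]
  refine h1.trans (key.trans ?_)
  have h2 := (truncPrimitive_mem (μ := μ) s).2
  have h3 := (truncPrimitive_mem (μ := μ) 0).1
  gcongr
  nlinarith

/-- End point of the rescaled flow line as the noise level tends to infinity. -/
def flowEnd (μ : Measure (State d)) [IsProbabilityMeasure μ] (w : State d) : State d :=
  limUnder atTop (scaledFlow μ w)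

lemma tendsto_scaledFlow (w : State d) :
    Tendsto (scaledFlow μ w) atTop (𝓝 (flowEnd μ w)) := by
  obtain ⟨R, hR⟩ := exists_norm_scaledFlow_le (μ := μ) w
  obtain ⟨C, hC, h⟩ := exists_tiltMean_bounds μ R
  refine tendsto_limUnder_of_hasDerivAt_of_integrableOn_Ioi (a := 0)
    (fun s _ => (hasDerivAt_scaledFlow w s).differentiableAt.hasDerivAt) ?_
  refine Integrable.mono' (integrableOn_truncMoment (μ := μ) |>.const_mul C)
    (measurable_deriv _).aestronglyMeasurable ?_
  filter_upwards [ae_restrict_mem measurableSet_Ioi] with s hs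
  rw [(hasDerivAt_scaledFlow w s).deriv, norm_smul]
  have h1 := (h _ (exp_neg_half_mem (le_of_lt hs)) _ _ (hR s (le_of_lt hs))
    (hR s (le_of_lt hs))).1
  have h2 : ‖(-(1 / 2) : ℝ)‖ ≤ 1 := by norm_num
  nlinarith [norm_nonneg (tiltMean μ (Real.exp (-s / 2)) (scaledFlow μ w s))]

lemma measurable_flowEnd : Measurable (flowEnd μ) := by
  refine measurable_of_tendsto_metrizable' atTop (f := fun (s : ℝ) w => scaledFlow μ w s)
    (fun s => ?_) (tendsto_pi_nhds.2 fun w => tendsto_scaledFlow (μ := μ) w)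
  exact ((continuous_heatFlow_right (μ := μ) s).const_smul (Real.exp (-s / 2))).measurable

/-- Distinct flow lines stay apart up to infinite noise: the posterior mean is Lipschitz with an
integrable constant, so the distance shrinks at most by a constant factor. -/
lemma injective_flowEnd : Function.Injective (flowEnd μ) := by
  intro w w' heq
  obtain ⟨R, hR⟩ := exists_norm_scaledFlow_le (μ := μ) w
  obtain ⟨R', hR'⟩ := exists_norm_scaledFlow_le (μ := μ) w'
  obtain ⟨C, hC, h⟩ := exists_tiltMean_bounds μ (max R R')
  have key : ∀ s, 0 ≤ s → ‖scaledFlow μ w 0 - scaledFlow μ w' 0‖ ^ 2 ≤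
      Real.exp (C * Real.pi) * ‖scaledFlow μ w s - scaledFlow μ w' s‖ ^ 2 := fun s hs => by
    refine (gronwall_two_sided (D := fun s => ‖scaledFlow μ w s - scaledFlow μ w' s‖ ^ 2)
      (A := fun s => C * truncPrimitive μ s) hs
      (((continuous_scaledFlow (μ := μ) w).sub (continuous_scaledFlow (μ := μ) w')).norm.pow 2).continuousOn
      (continuous_const.mul continuous_truncPrimitive).continuousOn
      (fun t _ => ((hasDerivAt_scaledFlow w t).fun_sub (hasDerivAt_scaledFlow w' t)).norm_sq)
      (fun t _ => (hasDerivAt_truncPrimitive t).const_mul C) fun t ht => ?_).2.trans ?_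
    · have h1 := (h _ (exp_neg_half_mem ht.1.le) _ _ ((hR t ht.1.le).trans (le_max_left _ _))
        ((hR' t ht.1.le).trans (le_max_right _ _))).2
      rw [← smul_sub, inner_smul_right]
      have h2 := abs_real_inner_le_norm (scaledFlow μ w t - scaledFlow μ w' t)
        (tiltMean μ (Real.exp (-t / 2)) (scaledFlow μ w t) -
          tiltMean μ (Real.exp (-t / 2)) (scaledFlow μ w' t))
      have h3 := mul_le_mul_of_nonneg_left h1 (norm_nonneg (scaledFlow μ w t - scaledFlow μ w' t))
      rw [abs_mul, abs_mul, abs_two, abs_neg, abs_of_pos (by norm_num : (0 : ℝ) < 1 / 2)]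
      linarith
    · have h2 := (truncPrimitive_mem (μ := μ) s).2
      have h3 := (truncPrimitive_mem (μ := μ) 0).1
      gcongr
      nlinarith
  have hlim : Tendsto (fun s => Real.exp (C * Real.pi) *
      ‖scaledFlow μ w s - scaledFlow μ w' s‖ ^ 2) atTop (𝓝 0) := by
    have := (((tendsto_scaledFlow (μ := μ) w).sub (tendsto_scaledFlow (μ := μ) w')).norm.pow 2).const_mul
      (Real.exp (C * Real.pi))
    simpa [heq] using this
  have h0 := ge_of_tendsto hlim ((eventually_ge_atTop 0).mono key)
  have h1 : ‖scaledFlow μ w 0 - scaledFlow μ w' 0‖ ^ 2 = 0 := le_antisymm h0 (sq_nonneg _)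
  have h2 : scaledFlow μ w 0 - scaledFlow μ w' 0 = 0 := by simpa using h1
  simpa [scaledFlow, heatFlow_zero, sub_eq_zero] using h2

/-- The standard Gaussian measure has a finite first absolute moment. -/
lemma lintegral_enorm_stdNormal_lt_top : ∫⁻ y, ‖y‖ₑ ∂(stdNormal d) < ⊤ := by
  obtain ⟨C, hC, h⟩ := exists_polynomial_mul_gauss_le 1 0 (c := 1 / 4) (by norm_num)
  rw [stdNormal, densityMeasure, lintegral_withDensity_eq_lintegral_mul _
    ((continuous_gaussDensity 1).measurable.ennreal_ofReal) (by fun_prop)]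
  -- Half of the Gaussian exponent absorbs the factor `‖y‖`; the other half is, up to a constant, the
  -- Gaussian density of variance `2`.
  have hfin : Integrable (fun y : State d => (C * ((2 * Real.pi * 1) ^ (-(d : ℝ) / 2) *
      ((2 * Real.pi * 2) ^ (-(d : ℝ) / 2))⁻¹)) * gaussDensity 2 y) :=
    (integrable_gaussDensity two_pos).const_mul _
  refine lt_of_le_of_lt (lintegral_mono fun y => ?_) hfin.hasFiniteIntegral
  simp only [Pi.mul_apply]
  rw [← ofReal_norm, ← ofReal_norm,
    ← ENNReal.ofReal_mul (gaussDensity_nonneg one_pos y)]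
  refine ENNReal.ofReal_le_ofReal ((le_abs_self _).trans' ?_)
  simp only [gaussDensity]
  have h1 := h ‖y‖ (norm_nonneg y)
  have e : Real.exp (-‖y‖ ^ 2 / (2 * 1)) = Real.exp (0 * ‖y‖ - 1 / 4 * ‖y‖ ^ 2) *
      Real.exp (-‖y‖ ^ 2 / (2 * 2)) := by rw [← Real.exp_add]; ring_nf
  have hp : (0 : ℝ) < (2 * Real.pi * 2) ^ (-(d : ℝ) / 2) := by positivity
  have hE := Real.exp_pos (0 * ‖y‖ - 1 / 4 * ‖y‖ ^ 2)
  calc (2 * Real.pi * 1) ^ (-(d : ℝ) / 2) * Real.exp (-‖y‖ ^ 2 / (2 * 1)) * ‖y‖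
      = (2 * Real.pi * 1) ^ (-(d : ℝ) / 2) * (‖y‖ * Real.exp (0 * ‖y‖ - 1 / 4 * ‖y‖ ^ 2)) *
        Real.exp (-‖y‖ ^ 2 / (2 * 2)) := by rw [e]; ring
    _ ≤ (2 * Real.pi * 1) ^ (-(d : ℝ) / 2) * C * Real.exp (-‖y‖ ^ 2 / (2 * 2)) := by
        gcongr
        refine le_trans ?_ h1
        gcongr
        simp
    _ = _ := by field_simp

lemma heatGrad_eq_integral {ρ : ℝ} (hρ : 0 < ρ) (u : State d) :
    heatGrad μ (ρ, u) = ∫ x, gaussDensity ρ (u - x) • ρ⁻¹ • (x - u) ∂μ := by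
  have h1 := integrable_gaussAverage (μ := μ) continuous_id' polyGrowth_id (p := (ρ, u)) hρ
  have h2 := integrable_gaussAverage (μ := μ) continuous_const polyGrowth_one (p := (ρ, u)) hρ
  simp only at h1 h2
  rw [heatGrad, gaussAverage, gaussAverage, ← integral_smul_const, ← integral_sub h1
    (h2.smul_const u), ← integral_smul, ← integral_smul]
  refine integral_congr_ae (ae_of_all _ fun x => ?_)
  simp only [gaussDensity, smul_eq_mul, mul_one]
  module

/-- `‖∇ heat‖` has integral of order `ρ^{-1/2}`. -/
lemma lintegral_enorm_heatGrad_le {ρ : ℝ} (hρ : 0 < ρ) :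
    ∫⁻ u, ‖heatGrad μ (ρ, u)‖ₑ ≤
      ENNReal.ofReal (ρ⁻¹ * Real.sqrt ρ) * ∫⁻ y, ‖y‖ₑ ∂(stdNormal d) := by
  have hm : Measurable (fun p : State d × State d =>
      ENNReal.ofReal (gaussDensity ρ (p.1 - p.2)) * (ENNReal.ofReal ρ⁻¹ * ‖p.2 - p.1‖ₑ)) := by
    have := (continuous_gaussDensity (d := d) ρ).measurable
    fun_prop
  calc ∫⁻ u, ‖heatGrad μ (ρ, u)‖ₑ
      ≤ ∫⁻ u, (∫⁻ x, ENNReal.ofReal (gaussDensity ρ (u - x)) *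
          (ENNReal.ofReal ρ⁻¹ * ‖x - u‖ₑ) ∂μ) := by
        refine lintegral_mono fun u => ?_
        rw [heatGrad_eq_integral hρ]
        refine (enorm_integral_le_lintegral_enorm _).trans_eq (lintegral_congr fun x => ?_)
        rw [enorm_smul, enorm_smul, Real.enorm_of_nonneg (gaussDensity_nonneg hρ _),
          Real.enorm_of_nonneg (inv_nonneg.2 hρ.le)]
    _ = ∫⁻ x, (∫⁻ u, ENNReal.ofReal (gaussDensity ρ (u - x)) *
          (ENNReal.ofReal ρ⁻¹ * ‖x - u‖ₑ)) ∂μ := lintegral_lintegral_swap hm.aemeasurable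
    _ = ∫⁻ x, ENNReal.ofReal (ρ⁻¹ * Real.sqrt ρ) * (∫⁻ y, ‖y‖ₑ ∂(stdNormal d)) ∂μ := by
        refine lintegral_congr fun x => ?_
        rw [lintegral_gaussDensity_sub hρ x (f := fun u => ENNReal.ofReal ρ⁻¹ * ‖x - u‖ₑ)
          (by fun_prop), ← lintegral_const_mul _ measurable_enorm]
        refine lintegral_congr fun y => ?_
        rw [sub_add_cancel_left, enorm_neg, enorm_smul,
          Real.enorm_of_nonneg (Real.sqrt_nonneg _), ← mul_assoc,
          ENNReal.ofReal_mul (inv_nonneg.2 hρ.le)]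
    _ = _ := by simp

/-- Almost every flow line converges as the noise vanishes, since its expected length is finite. -/
lemma ae_tendsto_heatFlow_atBot :
    ∀ᵐ w ∂(densityMeasure fun x => heat μ (1, x)),
      Tendsto (heatFlow μ w) atBot (𝓝 (limUnder atBot (heatFlow μ w))) := by
  have := isProbabilityMeasure_heat (μ := μ) one_pos
  have htame := isTameField_heatField (IsProbabilityMeasure.ne_zero μ)
  have hc : Continuous (fun p : ℝ × State d => heatField μ (p.1, heatFlow μ p.2 p.1)) :=
    htame.contDiff.continuous.comp (continuous_fst.prodMk continuous_heatFlow_prod)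
  have hspeed : ∀ s : ℝ, ∫⁻ w, ‖heatField μ (s, heatFlow μ w s)‖ₑ
      ∂(densityMeasure fun x => heat μ (1, x)) ≤
      ENNReal.ofReal (1 / 2 * Real.exp (1 / 2 * s)) * ∫⁻ y, ‖y‖ₑ ∂(stdNormal d) := fun s => by
    have hmf : Measurable fun u => ‖heatField μ (s, u)‖ₑ :=
      (htame.contDiff.continuous.comp
        (by fun_prop : Continuous fun u : State d => (s, u))).measurable.enorm
    have hmap := lintegral_map (μ := densityMeasure fun x => heat μ (1, x)) hmf
      (continuous_heatFlow_right (μ := μ) s).measurable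
    rw [← hmap, map_heatFlow_densityMeasure, densityMeasure,
      lintegral_withDensity_eq_lintegral_mul _
        ((continuous_heat_slice (Real.exp_pos s)).measurable.ennreal_ofReal) hmf]
    have e : ∀ u, ((fun x => ENNReal.ofReal (heat μ (Real.exp s, x))) *
        fun u => ‖heatField μ (s, u)‖ₑ) u =
        ENNReal.ofReal (1 / 2 * Real.exp s) * ‖heatGrad μ (Real.exp s, u)‖ₑ := fun u => by
      have hp := heat_pos (IsProbabilityMeasure.ne_zero μ) (Real.exp_pos s) u
      simp only [Pi.mul_apply, heatField]
      rw [enorm_smul, ← mul_assoc, ← ofReal_norm (_ * _ : ℝ), ← ENNReal.ofReal_mul hp.le]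
      congr 2
      rw [Real.norm_eq_abs, abs_mul, abs_mul, abs_neg, abs_of_pos (Real.exp_pos s),
        abs_of_pos (inv_pos.2 hp), abs_of_pos (by norm_num : (0 : ℝ) < 1 / 2)]
      field_simp
    have hmg : Measurable fun u => ‖heatGrad μ (Real.exp s, u)‖ₑ :=
      (contDiff_heatGrad_exp.continuous.comp
        (by fun_prop : Continuous fun u : State d => (s, u))).measurable.enorm
    simp only [e]
    rw [lintegral_const_mul _ hmg]
    refine (mul_le_mul_right (lintegral_enorm_heatGrad_le (Real.exp_pos s)) _).trans_eq ?_
    rw [← mul_assoc, ← ENNReal.ofReal_mul (by positivity)]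
    congr 2
    rw [← Real.exp_half, ← Real.exp_neg, mul_assoc, ← Real.exp_add, ← Real.exp_add]
    ring_nf
  have hfin : ∫⁻ w, (∫⁻ s in Iic (0 : ℝ), ‖heatField μ (s, heatFlow μ w s)‖ₑ)
      ∂(densityMeasure fun x => heat μ (1, x)) < ⊤ := by
    rw [lintegral_lintegral_swap (by
      exact ((hc.comp continuous_swap).measurable.enorm).aemeasurable)]
    refine (lintegral_mono fun s => hspeed s).trans_lt ?_
    rw [lintegral_mul_const _ (by fun_prop)]
    refine ENNReal.mul_lt_top ?_ lintegral_enorm_stdNormal_lt_top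
    -- The expected speed is of order `e^s e^{-s/2} = e^{s/2}`, which is integrable at `-∞`.
    have hi : IntegrableOn (fun s : ℝ => 1 / 2 * Real.exp (1 / 2 * s)) (Iic 0) :=
      (integrableOn_exp_mul_Iic (by norm_num) 0).const_mul _
    refine lt_of_le_of_lt (lintegral_mono fun s => ?_) hi.hasFiniteIntegral
    rw [← ofReal_norm]
    exact ENNReal.ofReal_le_ofReal (le_abs_self _)
  have hmeas : Measurable fun w => ∫⁻ s in Iic (0 : ℝ), ‖heatField μ (s, heatFlow μ w s)‖ₑ :=
    Measurable.lintegral_prod_right' (f := fun p : State d × ℝ =>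
      ‖heatField μ (p.2, heatFlow μ p.1 p.2)‖ₑ) (hc.comp continuous_swap).measurable.enorm
  filter_upwards [ae_lt_top hmeas hfin.ne] with w hw
  refine tendsto_limUnder_of_hasDerivAt_of_integrableOn_Iic (a := 0)
    (fun s _ => hasDerivAt_heatFlow w s) ⟨?_, hw⟩
  exact (hc.comp (by fun_prop : Continuous fun s : ℝ => (s, w))).aestronglyMeasurable

end HeatFlow

/-! ### The probability-flow ODE -/

section ODE
variable {α σ : ℝ → ℝ}

/-- Logarithmic noise level `log (σ² / α²)` at reverse time `τ`. -/
def logNoise (α σ : ℝ → ℝ) (τ : ℝ) : ℝ := Real.log (noiseRatio α σ (1 - τ))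

/-- Derivative of `logNoise`. -/
def logNoiseRate (α σ : ℝ → ℝ) (τ : ℝ) : ℝ :=
  -(diffusionSq α σ (1 - τ) / α (1 - τ) ^ 2) / noiseRatio α σ (1 - τ)

lemma one_sub_mem_Ioo {τ : ℝ} (hτ : τ ∈ Ioo (0 : ℝ) 1) : 1 - τ ∈ Ioo (0 : ℝ) 1 :=
  ⟨by linarith [hτ.2], by linarith [hτ.1]⟩

lemma tendsto_one_sub (a : ℝ) :
    Tendsto (fun τ : ℝ => 1 - τ) (𝓝[Ioo 0 1] (1 - a)) (𝓝[Ioo 0 1] a) := by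
  refine tendsto_nhdsWithin_iff.2 ⟨?_, ?_⟩
  · have h1 : Tendsto (fun τ : ℝ => 1 - τ) (𝓝 (1 - a)) (𝓝 (1 - (1 - a))) :=
      (continuous_const.sub continuous_id').tendsto _
    rw [sub_sub_cancel] at h1
    exact h1.mono_left nhdsWithin_le_nhds
  · filter_upwards [self_mem_nhdsWithin] with τ hτ
    exact one_sub_mem_Ioo hτ

lemma tendsto_one_sub_zero :
    Tendsto (fun τ : ℝ => 1 - τ) (𝓝[Ioo 0 1] 0) (𝓝[Ioo 0 1] 1) := by
  simpa using tendsto_one_sub 1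

lemma tendsto_one_sub_one :
    Tendsto (fun τ : ℝ => 1 - τ) (𝓝[Ioo 0 1] 1) (𝓝[Ioo 0 1] 0) := by
  simpa using tendsto_one_sub 0

namespace IsNoiseSchedule
variable (h : IsNoiseSchedule α σ)
include h

lemma signal_one_sub_pos {τ : ℝ} (hτ : τ ∈ Ioo (0 : ℝ) 1) : 0 < α (1 - τ) :=
  h.signal_pos _ ⟨(one_sub_mem_Ioo hτ).1.le, (one_sub_mem_Ioo hτ).2⟩

lemma exp_logNoise {τ : ℝ} (hτ : τ ∈ Ioo (0 : ℝ) 1) :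
    Real.exp (logNoise α σ τ) = noiseRatio α σ (1 - τ) :=
  Real.exp_log (h.noiseRatio_pos (one_sub_mem_Ioo hτ))

lemma hasDerivAt_signal_one_sub {τ : ℝ} (hτ : τ ∈ Ioo (0 : ℝ) 1) :
    HasDerivAt (fun τ => α (1 - τ)) (-(linearDrift α (1 - τ) * α (1 - τ))) τ := by
  have h1 := (h.hasDerivAt_signal (one_sub_mem_Ioo hτ)).comp_const_sub 1 τ
  refine h1.congr_deriv ?_
  rw [linearDrift, div_mul_cancel₀ _ (h.signal_one_sub_pos hτ).ne']

lemma hasDerivAt_logNoise {τ : ℝ} (hτ : τ ∈ Ioo (0 : ℝ) 1) :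
    HasDerivAt (logNoise α σ) (logNoiseRate α σ τ) τ := by
  have h1 := (h.hasDerivAt_noiseRatio (one_sub_mem_Ioo hτ)).comp_const_sub 1 τ
  exact h1.log (h.noiseRatio_pos (one_sub_mem_Ioo hτ)).ne'

lemma logNoiseRate_nonpos {τ : ℝ} (hτ : τ ∈ Ioo (0 : ℝ) 1) : logNoiseRate α σ τ ≤ 0 := by
  have h1 := h.diffusionSq_nonneg _ ⟨(one_sub_mem_Ioo hτ).1.le, (one_sub_mem_Ioo hτ).2⟩
  have h2 := h.noiseRatio_pos (one_sub_mem_Ioo hτ)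
  rw [logNoiseRate, neg_div, neg_nonpos]
  positivity

lemma exists_logNoise_eq_zero : ∃ τ ∈ Ioo (0 : ℝ) 1, logNoise α σ τ = 0 := by
  obtain ⟨t, ht, h1⟩ := h.exists_noiseRatio_eq one_pos
  exact ⟨1 - t, one_sub_mem_Ioo ht, by rw [logNoise, sub_sub_cancel, h1, Real.log_one]⟩

lemma tendsto_logNoise_zero : Tendsto (logNoise α σ) (𝓝[Ioo 0 1] 0) atTop := by
  refine Real.tendsto_log_atTop.comp (h.tendsto_noiseRatio_one.comp ?_)
  rw [← nhdsWithin_Ioo_eq_nhdsLT zero_lt_one]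
  exact tendsto_one_sub_zero

lemma tendsto_logNoise_one : Tendsto (logNoise α σ) (𝓝[Ioo 0 1] 1) atBot := by
  refine Real.tendsto_log_nhdsNE_zero.comp (tendsto_nhdsWithin_iff.2 ⟨?_, ?_⟩)
  · have h1 := h.continuousOn_noiseRatio 0 (by simp)
    rw [ContinuousWithinAt, h.noiseRatio_zero] at h1
    exact (h1.mono_left (nhdsWithin_mono 0 Ioo_subset_Ico_self)).comp tendsto_one_sub_one
  · filter_upwards [self_mem_nhdsWithin] with τ hτ
    exact (h.noiseRatio_pos (one_sub_mem_Ioo hτ)).ne'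

lemma signal_mul_exp_half {τ : ℝ} (hτ : τ ∈ Ioo (0 : ℝ) 1) :
    α (1 - τ) * Real.exp (logNoise α σ τ / 2) = σ (1 - τ) := by
  have hα := h.signal_one_sub_pos hτ
  have hσ := h.noise_pos _ ⟨(one_sub_mem_Ioo hτ).1, (one_sub_mem_Ioo hτ).2.le⟩
  rw [Real.exp_half, h.exp_logNoise hτ, noiseRatio, ← div_pow, Real.sqrt_sq (by positivity)]
  field_simp

/-- In the original variables, flow lines have limits at reverse time `0`. -/
lemma tendsto_smul_heatFlow_zero {μ : Measure (State d)} [IsProbabilityMeasure μ] (w : State d) :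
    Tendsto (fun τ => α (1 - τ) • heatFlow μ w (logNoise α σ τ))
      (𝓝[Ioo 0 1] 0) (𝓝 (flowEnd μ w)) := by
  have hσ : Tendsto (fun τ => σ (1 - τ)) (𝓝[Ioo 0 1] 0) (𝓝 1) := by
    have h1 := h.continuousOn_noise 1 (by simp)
    rw [ContinuousWithinAt, h.noise_one] at h1
    exact (h1.mono_left (nhdsWithin_mono _ Ioo_subset_Icc_self)).comp tendsto_one_sub_zero
  have h2 := hσ.smul ((tendsto_scaledFlow (μ := μ) w).comp h.tendsto_logNoise_zero)
  rw [one_smul] at h2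
  refine h2.congr' ?_
  filter_upwards [self_mem_nhdsWithin] with τ hτ
  simp only [Function.comp, scaledFlow, smul_smul]
  rw [← h.signal_mul_exp_half hτ, mul_assoc, ← Real.exp_add]
  congr 2
  ring_nf
  simp

lemma tendsto_smul_heatFlow_one {μ : Measure (State d)} [IsProbabilityMeasure μ]
    {w l : State d}
    (hl : Tendsto (heatFlow μ w) atBot (𝓝 l)) :
    Tendsto (fun τ => α (1 - τ) • heatFlow μ w (logNoise α σ τ))
      (𝓝[Ioo 0 1] 1) (𝓝 l) := by
  have hα : Tendsto (fun τ => α (1 - τ)) (𝓝[Ioo 0 1] 1) (𝓝 1) := by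
    have h1 := h.continuousOn_signal 0 (by simp)
    rw [ContinuousWithinAt, h.signal_zero] at h1
    exact (h1.mono_left (nhdsWithin_mono _ Ioo_subset_Icc_self)).comp tendsto_one_sub_one
  simpa using hα.smul (hl.comp h.tendsto_logNoise_one)

variable {p₀ : State d → ℝ} (hp₀ : IsProbDensity p₀)
include hp₀

/-- In the coordinates `u = x / α` the probability-flow field is the heat field, up to the change of
time. -/
lemma odeVelocity_smul {τ : ℝ} (hτ : τ ∈ Ioo (0 : ℝ) 1) (u : State d) :
    odeVelocity α σ p₀ τ (α (1 - τ) • u) =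
      -(linearDrift α (1 - τ) * α (1 - τ)) • u + α (1 - τ) •
        logNoiseRate α σ τ • heatField (densityMeasure p₀) (logNoise α σ τ, u) := by
  have hα := h.signal_one_sub_pos hτ
  have hρ := h.noiseRatio_pos (one_sub_mem_Ioo hτ)
  have e : (α (1 - τ))⁻¹ • α (1 - τ) • u = u := by
    rw [smul_smul, inv_mul_cancel₀ hα.ne', one_smul]
  rw [odeVelocity, reverseScore_eq_heat h hp₀ hτ, e, heatField, logNoiseRate]
  simp only [h.exp_logNoise hτ, smul_smul]
  rw [neg_smul]
  congr 2
  field_simp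

lemma hasDerivAt_smul_heatFlow [IsProbabilityMeasure (densityMeasure p₀)] {τ : ℝ}
    (hτ : τ ∈ Ioo (0 : ℝ) 1) (w : State d) :
    HasDerivAt (fun τ => α (1 - τ) • heatFlow (densityMeasure p₀) w (logNoise α σ τ))
      (odeVelocity α σ p₀ τ
        (α (1 - τ) • heatFlow (densityMeasure p₀) w (logNoise α σ τ))) τ := by
  have h1 := (hasDerivAt_heatFlow (μ := densityMeasure p₀) w (logNoise α σ τ)).scomp τ
    (h.hasDerivAt_logNoise hτ)
  refine ((h.hasDerivAt_signal_one_sub hτ).fun_smul h1).congr_deriv ?_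
  rw [h.odeVelocity_smul hp₀ hτ, add_comm]
  rfl

/-- Solutions of the probability-flow equation on `(0,1)` are rescaled flow lines of the heat
flow. -/
lemma exists_eq_smul_heatFlow [IsProbabilityMeasure (densityMeasure p₀)] {y : ℝ → State d}
    (hy : ∀ τ ∈ Ioo (0 : ℝ) 1, HasDerivAt y (odeVelocity α σ p₀ τ (y τ)) τ) {τ₀ : ℝ}
    (hτ₀ : τ₀ ∈ Ioo (0 : ℝ) 1) (hs₀ : logNoise α σ τ₀ = 0) {τ : ℝ} (hτ : τ ∈ Ioo (0 : ℝ) 1) :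
    y τ = α (1 - τ) •
      heatFlow (densityMeasure p₀) ((α (1 - τ₀))⁻¹ • y τ₀) (logNoise α σ τ) := by
  set μ := densityMeasure p₀
  have htame := isTameField_heatField (μ := μ) (IsProbabilityMeasure.ne_zero μ)
  set U : ℝ → State d := fun τ => (α (1 - τ))⁻¹ • y τ
  set w := U τ₀ with hw
  set V : ℝ → State d := fun τ => heatFlow μ w (logNoise α σ τ)
  have hU : ∀ τ ∈ Ioo (0 : ℝ) 1,
      HasDerivAt U (logNoiseRate α σ τ • heatField μ (logNoise α σ τ, U τ)) τ := fun τ hτ => by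
    have hα := h.signal_one_sub_pos hτ
    refine (((h.hasDerivAt_signal_one_sub hτ).fun_inv hα.ne').fun_smul (hy τ hτ)).congr_deriv ?_
    have e : y τ = α (1 - τ) • U τ := by
      simp only [U, smul_smul, mul_inv_cancel₀ hα.ne', one_smul]
    rw [e, h.odeVelocity_smul hp₀ hτ]
    simp only [smul_add, smul_smul]
    rw [add_right_comm, ← add_smul, ← mul_assoc, inv_mul_cancel₀ hα.ne', one_mul]
    have : (α (1 - τ))⁻¹ * -(linearDrift α (1 - τ) * α (1 - τ)) +
        -(-(linearDrift α (1 - τ) * α (1 - τ))) / α (1 - τ) ^ 2 * α (1 - τ) = 0 := by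
      field_simp; ring
    rw [this, zero_smul, zero_add]
  have hV : ∀ τ ∈ Ioo (0 : ℝ) 1,
      HasDerivAt V (logNoiseRate α σ τ • heatField μ (logNoise α σ τ, V τ)) τ := fun τ hτ =>
    (hasDerivAt_heatFlow (μ := μ) w (logNoise α σ τ)).scomp τ (h.hasDerivAt_logNoise hτ)
  -- The time change need not be invertible, nor its rate bounded, so uniqueness is proved for the
  -- time-changed equation itself, with Grönwall's rate a multiple of the derivative of `logNoise`.
  have key : ∀ a b, a ∈ Ioo (0 : ℝ) 1 → b ∈ Ioo (0 : ℝ) 1 → a ≤ b → (U a = V a ↔ U b = V b) := by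
    intro a b ha hb hab
    have hsub : Icc a b ⊆ Ioo (0 : ℝ) 1 := fun t ht => ⟨ha.1.trans_le ht.1, ht.2.trans_lt hb.2⟩
    have hUc : ContinuousOn U (Icc a b) := fun t ht =>
      (hU t (hsub ht)).continuousAt.continuousWithinAt
    have hVc : ContinuousOn V (Icc a b) := fun t ht =>
      (hV t (hsub ht)).continuousAt.continuousWithinAt
    have hSc : ContinuousOn (logNoise α σ) (Icc a b) := fun t ht =>
      (h.hasDerivAt_logNoise (hsub ht)).continuousAt.continuousWithinAt
    obtain ⟨R₁, hR₁⟩ := isCompact_Icc.exists_bound_of_continuousOn hUc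
    obtain ⟨R₂, hR₂⟩ := isCompact_Icc.exists_bound_of_continuousOn hVc
    obtain ⟨T, hT⟩ := isCompact_Icc.exists_bound_of_continuousOn hSc
    obtain ⟨K, hK⟩ := IsTameField.exists_lipschitz htame.contDiff T (max R₁ R₂)
    have := dist_sq_solutions_le (v := heatField μ) (S := logNoise α σ) (c := logNoiseRate α σ)
      (ε := -1) hab hSc
      (fun t ht => h.hasDerivAt_logNoise (hsub (Ioo_subset_Icc_self ht)))
      (fun t ht => by
        rw [abs_of_nonpos (h.logNoiseRate_nonpos (hsub (Ioo_subset_Icc_self ht))), neg_one_mul])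
      hUc hVc (fun t ht => hU t (hsub (Ioo_subset_Icc_self ht)))
      (fun t ht => hV t (hsub (Ioo_subset_Icc_self ht))) fun t ht => by
        have ht' := Ioo_subset_Icc_self ht
        rw [← dist_eq_norm, ← dist_eq_norm]
        exact (hK _ (abs_le.1 (hT t ht'))).dist_le_mul _
          (mem_closedBall_zero_iff.2 ((hR₁ t ht').trans (le_max_left _ _))) _
          (mem_closedBall_zero_iff.2 ((hR₂ t ht').trans (le_max_right _ _)))
    constructor
    · intro h0
      have h1 := this.1
      rw [h0, sub_self, norm_zero] at h1
      have h2 : ‖U b - V b‖ ^ 2 = 0 := le_antisymm (by simpa using h1) (sq_nonneg _)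
      simpa [sub_eq_zero] using h2
    · intro h0
      have h1 := this.2
      rw [h0, sub_self, norm_zero] at h1
      have h2 : ‖U a - V a‖ ^ 2 = 0 := le_antisymm (by simpa using h1) (sq_nonneg _)
      simpa [sub_eq_zero] using h2
  have h0 : U τ₀ = V τ₀ := by simp only [V, hs₀, heatFlow_zero]; rfl
  have hτU : U τ = V τ := by
    rcases le_total τ₀ τ with hle | hle
    · exact (key τ₀ τ hτ₀ hτ hle).1 h0
    · exact (key τ τ₀ hτ hτ₀ hle).2 h0
  change _ = α (1 - τ) • V τ
  rw [← hτU]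
  simp only [U, smul_smul, mul_inv_cancel₀ (h.signal_one_sub_pos hτ).ne', one_smul]

/-- At every interior time the rescaled flow lines have the law `q_τ`. -/
lemma map_smul_heatFlow [IsProbabilityMeasure (densityMeasure p₀)] {τ : ℝ}
    (hτ : τ ∈ Ioo (0 : ℝ) 1) :
    (densityMeasure fun x => heat (densityMeasure p₀) (1, x)).map
      (fun w => α (1 - τ) • heatFlow (densityMeasure p₀) w (logNoise α σ τ)) =
      densityMeasure (reverseDensity α σ p₀ τ) := by
  have hα := h.signal_one_sub_pos hτ
  have hσ := h.noise_pos _ ⟨(one_sub_mem_Ioo hτ).1, (one_sub_mem_Ioo hτ).2.le⟩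
  have hc : Measurable fun x : State d => α (1 - τ) • x := by fun_prop
  have e : (fun w => α (1 - τ) • heatFlow (densityMeasure p₀) w (logNoise α σ τ)) =
      (fun x => α (1 - τ) • x) ∘ fun w => heatFlow (densityMeasure p₀) w (logNoise α σ τ) := rfl
  rw [e, ← Measure.map_map hc (continuous_heatFlow_right _).measurable,
    map_heatFlow_densityMeasure, densityMeasure_heat (Real.exp_pos _),
    Measure.map_map hc (by fun_prop),
    densityMeasure_reverseDensity h hp₀ (Ioo_subset_Icc_self hτ)]
  congr 1
  funext z
  simp only [Function.comp, smul_add, smul_smul, ← Real.exp_half]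
  rw [h.signal_mul_exp_half hτ]

/-- The flow lines of the heat flow, drawn at random from the heat solution at noise level `1`, give
a solution of the probability-flow equation. -/
theorem exists_reverseODESolution :
    ∃ (Ω : Type) (_ : MeasurableSpace Ω) (P : Measure Ω) (_ : IsProbabilityMeasure P)
      (Y : ℝ → Ω → State d), IsReverseODESolution α σ p₀ P Y := by
  have := hp₀.isProbabilityMeasure
  set μ := densityMeasure p₀ with hμ
  set P := densityMeasure fun x => heat μ (1, x) with hP
  have hPp : IsProbabilityMeasure P := isProbabilityMeasure_heat one_pos
  set X : ℝ → State d → State d := fun τ w => α (1 - τ) • heatFlow μ w (logNoise α σ τ) with hX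
  -- The end points of the path are its limits; at time `1` the limit exists only almost surely.
  set Y : ℝ → State d → State d := fun τ w =>
    if τ ∈ Ioo (0 : ℝ) 1 then X τ w else
      if τ ≤ 0 then flowEnd μ w else limUnder atBot (heatFlow μ w)
  have hYIoo : ∀ τ ∈ Ioo (0 : ℝ) 1, Y τ = X τ := fun τ hτ => by
    funext w; exact if_pos hτ
  have hY0 : Y 0 = flowEnd μ := by funext w; simp [Y]
  have hY1 : ∀ w, Y 1 w = limUnder atBot (heatFlow μ w) := fun w => by simp [Y]
  have hXm : ∀ τ, Measurable (X τ) := fun τ =>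
    ((continuous_heatFlow_right (μ := μ) (logNoise α σ τ)).const_smul (α (1 - τ))).measurable
  have hYev : ∀ (τ : ℝ) (w : State d), τ ∈ Ioo (0 : ℝ) 1 →
      (fun τ => Y τ w) =ᶠ[𝓝 τ] fun τ => X τ w := fun τ w hτ => by
    filter_upwards [Ioo_mem_nhds hτ.1 hτ.2] with t ht
    rw [hYIoo t ht]
  refine ⟨State d, inferInstance, P, hPp, Y, ?_, ?_, ?_, ?_⟩
  · intro τ hτ
    rcases hτ.1.eq_or_lt with rfl | h0
    · rw [hY0]; exact measurable_flowEnd.aemeasurable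
    rcases hτ.2.eq_or_lt with rfl | h1
    · refine aemeasurable_of_tendsto_metrizable_ae atBot (f := fun (s : ℝ) w => heatFlow μ w s)
        (fun s => (continuous_heatFlow_right (μ := μ) s).measurable.aemeasurable) ?_
      filter_upwards [ae_tendsto_heatFlow_atBot (μ := μ)] with w hw
      rw [hY1]
      exact hw
    · rw [hYIoo τ ⟨h0, h1⟩]; exact (hXm τ).aemeasurable
  · filter_upwards [ae_tendsto_heatFlow_atBot (μ := μ)] with w hw τ hτ
    have hIcc : ∀ τ₀ : ℝ, τ₀ ∈ Icc (0 : ℝ) 1 → τ₀ ∉ Ioo (0 : ℝ) 1 →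
        Tendsto (fun τ => X τ w) (𝓝[Ioo 0 1] τ₀) (𝓝 (Y τ₀ w)) →
        ContinuousWithinAt (fun τ => Y τ w) (Ioo 0 1) τ₀ := fun τ₀ _ _ hlim => by
      refine hlim.congr' ?_
      filter_upwards [self_mem_nhdsWithin] with t ht
      rw [hYIoo t ht]
    rcases hτ.1.eq_or_lt with rfl | h0
    · have h1 := hIcc 0 hτ (by simp) (by rw [hY0]; exact h.tendsto_smul_heatFlow_zero w)
      refine (continuousWithinAt_Icc_iff_Ici one_pos).2 ?_
      rw [← continuousWithinAt_Ioi_iff_Ici]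
      exact (continuousWithinAt_Ioo_iff_Ioi one_pos).1 h1
    rcases hτ.2.eq_or_lt with rfl | h1
    · have h1 := hIcc 1 hτ (by simp) (by rw [hY1]; exact h.tendsto_smul_heatFlow_one hw)
      refine (continuousWithinAt_Icc_iff_Iic one_pos).2 ?_
      rw [← continuousWithinAt_Iio_iff_Iic]
      exact (continuousWithinAt_Ioo_iff_Iio one_pos).1 h1
    · have h2 := (h.hasDerivAt_smul_heatFlow hp₀ ⟨h0, h1⟩ w).continuousAt
      exact (h2.congr (hYev τ w ⟨h0, h1⟩).symm).continuousWithinAt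
  · refine ae_of_all _ fun w τ hτ => ?_
    rw [hYIoo τ hτ]
    exact (h.hasDerivAt_smul_heatFlow hp₀ hτ w).congr_of_eventuallyEq (hYev τ w hτ)
  · refine hasLaw_reverseDensity_of_tendsto h hp₀ (Y := X) (by simp) (fun τ hτ => ?_)
      (ae_of_all _ fun w => ?_)
    · exact ⟨(hXm τ).aemeasurable, h.map_smul_heatFlow hp₀ hτ⟩
    · rw [hY0]
      exact h.tendsto_smul_heatFlow_zero w

/-- Every solution of the probability-flow equation has the density path `q_τ`: the initial law
determines the law of the flow line, since distinct flow lines have distinct starting points. -/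
theorem hasDensityPath_of_isReverseODESolution {Ω : Type*} [MeasurableSpace Ω] {P : Measure Ω}
    [IsProbabilityMeasure P] {Y : ℝ → Ω → State d} (hY : IsReverseODESolution α σ p₀ P Y) :
    HasDensityPath P Y (Icc 0 1) (reverseDensity α σ p₀) := by
  have := hp₀.isProbabilityMeasure
  set μ := densityMeasure p₀ with hμ
  obtain ⟨τ₀, hτ₀, hs₀⟩ := h.exists_logNoise_eq_zero
  set w : Ω → State d := fun ω => (α (1 - τ₀))⁻¹ • Y τ₀ ω with hw
  have hwm : AEMeasurable w P := (hY.aemeasurable τ₀ (Ioo_subset_Icc_self hτ₀)).const_smul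
    (α (1 - τ₀))⁻¹
  have hne : (𝓝[Ioo (0 : ℝ) 1] 0).NeBot := by
    rw [← mem_closure_iff_nhdsWithin_neBot, closure_Ioo zero_ne_one]
    simp
  have hline : ∀ᵐ ω ∂P, ∀ τ ∈ Ioo (0 : ℝ) 1,
      Y τ ω = α (1 - τ) • heatFlow μ (w ω) (logNoise α σ τ) := by
    filter_upwards [hY.hasDerivAt] with ω hω τ hτ
    exact h.exists_eq_smul_heatFlow hp₀ (y := fun τ => Y τ ω) hω hτ₀ hs₀ hτ
  have hstart : ∀ᵐ ω ∂P, Y 0 ω = flowEnd μ (w ω) := by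
    filter_upwards [hline, hY.continuousOn] with ω hω hc
    refine tendsto_nhds_unique
      ((hc 0 (by simp)).mono_left (nhdsWithin_mono 0 Ioo_subset_Icc_self)) ?_
    refine (h.tendsto_smul_heatFlow_zero (w ω)).congr' ?_
    filter_upwards [self_mem_nhdsWithin] with τ hτ
    rw [hω τ hτ]
  set Q := densityMeasure fun x => heat μ (1, x) with hQ
  have hQp : IsProbabilityMeasure Q := isProbabilityMeasure_heat one_pos
  have hQ0 : Q.map (flowEnd μ) = densityMeasure (reverseDensity α σ p₀ 0) := by
    refine (hasLaw_reverseDensity_of_tendsto h hp₀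
      (Y := fun τ w => α (1 - τ) • heatFlow μ w (logNoise α σ τ)) (P := Q)
      (by simp) (fun τ hτ => ?_) (ae_of_all _ fun w => ?_)).map_eq
    · exact ⟨((continuous_heatFlow_right (μ := μ) (logNoise α σ τ)).const_smul
        (α (1 - τ))).measurable.aemeasurable, h.map_smul_heatFlow hp₀ hτ⟩
    · exact h.tendsto_smul_heatFlow_zero w
  -- A measurable injective map between Polish spaces is a measurable embedding (Lusin-Souslin), so
  -- the law of the end point determines the law of the flow line.
  have hmap : P.map w = Q := by
    refine (measurable_flowEnd.measurableEmbedding (injective_flowEnd (μ := μ))).map_injective ?_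
    rw [hQ0, ← hY.initial.map_eq,
      AEMeasurable.map_map_of_aemeasurable measurable_flowEnd.aemeasurable hwm]
    exact Measure.map_congr (hstart.mono fun ω hω => hω.symm)
  have hlaw : ∀ τ ∈ Ioo (0 : ℝ) 1,
      HasLaw (Y τ) (densityMeasure (reverseDensity α σ p₀ τ)) P := fun τ hτ => by
    refine ⟨hY.aemeasurable τ (Ioo_subset_Icc_self hτ), ?_⟩
    have hm : Measurable fun w => α (1 - τ) • heatFlow μ w (logNoise α σ τ) :=
      ((continuous_heatFlow_right (μ := μ) (logNoise α σ τ)).const_smul (α (1 - τ))).measurable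
    have hmQ : Q.map (fun w => α (1 - τ) • heatFlow μ w (logNoise α σ τ)) =
        densityMeasure (reverseDensity α σ p₀ τ) := h.map_smul_heatFlow hp₀ hτ
    rw [← hmQ, ← hmap,
      AEMeasurable.map_map_of_aemeasurable hm.aemeasurable hwm]
    exact Measure.map_congr (hline.mono fun ω hω => hω τ hτ)
  intro τ hτ
  refine hasLaw_reverseDensity_of_tendsto h hp₀ hτ hlaw ?_
  filter_upwards [hY.continuousOn] with ω hω
  exact (hω τ hτ).mono_left (nhdsWithin_mono τ Ioo_subset_Icc_self)

end IsNoiseSchedule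
end ODE

/-! ### Differentiating along the diagonal against an integrable weight -/

/-- A function whose increments are, at every small scale, at most an arbitrarily small multiple of
the increments of a fixed function is constant. -/
lemma eq_of_forall_abs_sub_le {F W : ℝ → ℝ} {s t : ℝ} (hst : s ≤ t)
    (h : ∀ ε > 0, ∃ δ > 0, ∀ a ∈ Icc s t, ∀ b ∈ Icc s t, a ≤ b → b - a < δ →
      |F b - F a| ≤ ε * (W b - W a)) : F t = F s := by
  have key : ∀ ε > 0, |F t - F s| ≤ ε * (W t - W s) := by
    intro ε hε
    obtain ⟨δ, hδ, H⟩ := h ε hε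
    have claim : ∀ n : ℕ, ∀ x ∈ Icc s t, x - s ≤ n * (δ / 2) →
        |F x - F s| ≤ ε * (W x - W s) := by
      intro n
      induction n with
      | zero =>
        intro x hx hxn
        have : x = s := le_antisymm (by simpa using hxn) hx.1
        simp [this]
      | succ n ih =>
        intro x hx hxn
        push_cast at hxn
        have hy : max s (x - δ / 2) ∈ Icc s t :=
          ⟨le_max_left _ _, max_le hst (by linarith [hx.2])⟩
        have hyx : max s (x - δ / 2) ≤ x := max_le hx.1 (by linarith)
        have h1 := ih _ hy (by
          rcases max_cases s (x - δ / 2) with ⟨he, _⟩ | ⟨he, _⟩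
          · rw [he]; simp; positivity
          · rw [he]; linarith)
        have h2 := H _ hy _ hx hyx (by linarith [le_max_right s (x - δ / 2)])
        calc |F x - F s| ≤ |F x - F (max s (x - δ / 2))| + |F (max s (x - δ / 2)) - F s| :=
              abs_sub_le _ _ _
          _ ≤ _ := by linarith
    obtain ⟨n, hn⟩ := exists_nat_ge ((t - s) / (δ / 2))
    exact claim n t ⟨hst, le_rfl⟩ ((div_le_iff₀ (by positivity)).1 hn)
  have h0 : |F t - F s| ≤ 0 := by
    have hlim : Tendsto (fun ε : ℝ => ε * (W t - W s)) (𝓝[>] 0) (𝓝 (0 * (W t - W s))) :=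
      ((continuous_id.mul continuous_const).tendsto 0).mono_left nhdsWithin_le_nhds
    rw [zero_mul] at hlim
    exact ge_of_tendsto hlim (by filter_upwards [self_mem_nhdsWithin] with ε hε using key ε hε)
  linarith [abs_nonpos_iff.1 h0]

lemma exists_abs_sub_le_of_continuousOn_square {k : ℝ × ℝ → ℝ} {s t : ℝ}
    (hk : ContinuousOn k (Icc s t ×ˢ Icc s t)) {ε : ℝ} (hε : 0 < ε) :
    ∃ δ > 0, ∀ a ∈ Icc s t, ∀ b ∈ Icc s t, ∀ c ∈ Icc s t, |a - c| < δ → |b - c| < δ →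
      |k (a, b) - k (c, c)| ≤ ε := by
  have hu := (isCompact_Icc.prod isCompact_Icc).uniformContinuousOn_of_continuous hk
  rw [Metric.uniformContinuousOn_iff] at hu
  obtain ⟨δ, hδ, H⟩ := hu ε hε
  refine ⟨δ, hδ, fun a ha b hb c hc h1 h2 => ?_⟩
  have := H (a, b) ⟨ha, hb⟩ (c, c) ⟨hc, hc⟩ (by
    rw [Prod.dist_eq]
    simp only [Real.dist_eq]
    exact max_lt h1 h2)
  rw [Real.dist_eq] at this
  exact this.le

/-- Chain rule for `r ↦ D r r` when `D` is absolutely continuous in each variable separately, with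
derivatives of the form weight times continuous function. -/
lemma diagonal_sub_eq_integral {D : ℝ → ℝ → ℝ} {f g : ℝ → ℝ} {k₁ k₂ l₁ l₂ : ℝ × ℝ → ℝ} {s t : ℝ}
    (hst : s ≤ t) (hf : IntervalIntegrable f volume s t) (hg : IntervalIntegrable g volume s t)
    (hk₁ : ContinuousOn k₁ (Icc s t ×ˢ Icc s t)) (hk₂ : ContinuousOn k₂ (Icc s t ×ˢ Icc s t))
    (hl₁ : ContinuousOn l₁ (Icc s t ×ˢ Icc s t)) (hl₂ : ContinuousOn l₂ (Icc s t ×ˢ Icc s t))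
    (h1 : ∀ r ∈ Icc s t, ∀ a ∈ Icc s t, ∀ b ∈ Icc s t, a ≤ b →
      D b r - D a r = ∫ q in a..b, (f q * k₁ (q, r) + g q * k₂ (q, r)))
    (h2 : ∀ q ∈ Icc s t, ∀ a ∈ Icc s t, ∀ b ∈ Icc s t, a ≤ b →
      D q b - D q a = ∫ r in a..b, (f r * l₁ (q, r) + g r * l₂ (q, r))) :
    D t t - D s s =
      ∫ r in s..t, (f r * (k₁ (r, r) + l₁ (r, r)) + g r * (k₂ (r, r) + l₂ (r, r))) := by
  have hsub : ∀ a ∈ Icc s t, ∀ b ∈ Icc s t, a ≤ b → uIcc a b ⊆ Icc s t := by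
    intro a ha b hb hab
    rw [uIcc_of_le hab]
    exact Icc_subset_Icc ha.1 hb.2
  have hint : ∀ {w m : ℝ → ℝ}, IntervalIntegrable w volume s t → ContinuousOn m (Icc s t) →
      ∀ a ∈ Icc s t, ∀ b ∈ Icc s t, a ≤ b →
      IntervalIntegrable (fun r => w r * m r) volume a b := by
    intro w m hw hm a ha b hb hab
    refine IntervalIntegrable.mul_continuousOn (hw.mono_set ?_) (hm.mono (hsub a ha b hb hab))
    rw [uIcc_of_le hst]
    exact hsub a ha b hb hab
  have hdiag : ∀ {k : ℝ × ℝ → ℝ}, ContinuousOn k (Icc s t ×ˢ Icc s t) →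
      ContinuousOn (fun r => k (r, r)) (Icc s t) := fun hk =>
    hk.comp (by fun_prop) fun r hr => ⟨hr, hr⟩
  have hrow : ∀ {k : ℝ × ℝ → ℝ}, ContinuousOn k (Icc s t ×ˢ Icc s t) → ∀ r ∈ Icc s t,
      ContinuousOn (fun q => k (q, r)) (Icc s t) := fun hk r hr =>
    hk.comp (by fun_prop) fun q hq => ⟨hq, hr⟩
  have hcol : ∀ {k : ℝ × ℝ → ℝ}, ContinuousOn k (Icc s t ×ˢ Icc s t) → ∀ q ∈ Icc s t,
      ContinuousOn (fun r => k (q, r)) (Icc s t) := fun hk q hq =>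
    hk.comp (by fun_prop) fun r hr => ⟨hq, hr⟩
  set J : ℝ → ℝ := fun r => f r * (k₁ (r, r) + l₁ (r, r)) + g r * (k₂ (r, r) + l₂ (r, r)) with hJ
  have hJint : ∀ a ∈ Icc s t, ∀ b ∈ Icc s t, a ≤ b → IntervalIntegrable J volume a b :=
    fun a ha b hb hab => (hint hf ((hdiag hk₁).add (hdiag hl₁)) a ha b hb hab).add
      (hint hg ((hdiag hk₂).add (hdiag hl₂)) a ha b hb hab)
  have hWint : ∀ a ∈ Icc s t, ∀ b ∈ Icc s t, a ≤ b →
      IntervalIntegrable (fun r => |f r| + |g r|) volume a b := by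
    intro a ha b hb hab
    have := (hf.abs.add hg.abs)
    refine this.mono_set ?_
    rw [uIcc_of_le hst]
    exact hsub a ha b hb hab
  have hs : s ∈ Icc s t := ⟨le_rfl, hst⟩
  have key := eq_of_forall_abs_sub_le (F := fun x => D x x - ∫ r in s..x, J r)
    (W := fun x => ∫ r in s..x, (|f r| + |g r|)) hst (by
      intro ε hε
      obtain ⟨δ₁, hδ₁, H₁⟩ := exists_abs_sub_le_of_continuousOn_square hk₁ (half_pos hε)
      obtain ⟨δ₂, hδ₂, H₂⟩ := exists_abs_sub_le_of_continuousOn_square hk₂ (half_pos hε)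
      obtain ⟨δ₃, hδ₃, H₃⟩ := exists_abs_sub_le_of_continuousOn_square hl₁ (half_pos hε)
      obtain ⟨δ₄, hδ₄, H₄⟩ := exists_abs_sub_le_of_continuousOn_square hl₂ (half_pos hε)
      refine ⟨min (min δ₁ δ₂) (min δ₃ δ₄), by positivity, fun a ha b hb hab hba => ?_⟩
      have hlt := lt_min_iff.1 hba
      have hlt1 := lt_min_iff.1 hlt.1
      have hlt2 := lt_min_iff.1 hlt.2
      have e1 : (∫ r in s..b, J r) - ∫ r in s..a, J r = ∫ r in a..b, J r :=
        intervalIntegral.integral_interval_sub_left (hJint s hs b hb hb.1) (hJint s hs a ha ha.1)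
      have e2 : (∫ r in s..b, (|f r| + |g r|)) - ∫ r in s..a, (|f r| + |g r|)
          = ∫ r in a..b, (|f r| + |g r|) :=
        intervalIntegral.integral_interval_sub_left (hWint s hs b hb hb.1) (hWint s hs a ha ha.1)
      have i1 : IntervalIntegrable (fun q => f q * k₁ (q, b) + g q * k₂ (q, b)) volume a b :=
        (hint hf (hrow hk₁ b hb) a ha b hb hab).add (hint hg (hrow hk₂ b hb) a ha b hb hab)
      have i2 : IntervalIntegrable (fun r => f r * l₁ (a, r) + g r * l₂ (a, r)) volume a b :=
        (hint hf (hcol hl₁ a ha) a ha b hb hab).add (hint hg (hcol hl₂ a ha) a ha b hb hab)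
      have e3 : D b b - D a a = (D b b - D a b) + (D a b - D a a) := by ring
      have e4 : (D b b - ∫ r in s..b, J r) - (D a a - ∫ r in s..a, J r)
          = ∫ r in a..b, ((f r * k₁ (r, b) + g r * k₂ (r, b)) +
              (f r * l₁ (a, r) + g r * l₂ (a, r)) - J r) := by
        rw [intervalIntegral.integral_sub (i1.add i2) (hJint a ha b hb hab),
          intervalIntegral.integral_add i1 i2, ← h1 b hb a ha b hb hab, ← h2 a ha a ha b hb hab,
          ← e1]
        ring
      rw [e4, e2, ← intervalIntegral.integral_const_mul, ← Real.norm_eq_abs]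
      refine intervalIntegral.norm_integral_le_of_norm_le hab (ae_of_all _ fun r hr => ?_)
        ((hWint a ha b hb hab).const_mul ε)
      have hr' : r ∈ Icc s t := ⟨ha.1.trans hr.1.le, hr.2.trans hb.2⟩
      have hrb : |b - r| ≤ b - a := by rw [abs_of_nonneg (by linarith [hr.2])]; linarith [hr.1]
      have har : |a - r| ≤ b - a := by
        rw [abs_sub_comm, abs_of_nonneg (by linarith [hr.1])]; linarith [hr.2]
      have m1 := H₁ r hr' b hb r hr' (by simpa using hδ₁) (hrb.trans_lt hlt1.1)
      have m2 := H₂ r hr' b hb r hr' (by simpa using hδ₂) (hrb.trans_lt hlt1.2)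
      have m3 := H₃ a ha r hr' r hr' (har.trans_lt hlt2.1) (by simpa using hδ₃)
      have m4 := H₄ a ha r hr' r hr' (har.trans_lt hlt2.2) (by simpa using hδ₄)
      rw [Real.norm_eq_abs]
      have e5 : (f r * k₁ (r, b) + g r * k₂ (r, b)) + (f r * l₁ (a, r) + g r * l₂ (a, r)) - J r
          = f r * ((k₁ (r, b) - k₁ (r, r)) + (l₁ (a, r) - l₁ (r, r))) +
            g r * ((k₂ (r, b) - k₂ (r, r)) + (l₂ (a, r) - l₂ (r, r))) := by
        simp only [hJ]; ring
      rw [e5]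
      -- All four coefficients are within `ε / 2` of their diagonal values.
      calc _ ≤ |f r| * ε + |g r| * ε := by
            refine (abs_add_le _ _).trans (add_le_add ?_ ?_)
            · rw [abs_mul]
              refine mul_le_mul_of_nonneg_left ?_ (abs_nonneg _)
              exact (abs_add_le _ _).trans (by linarith)
            · rw [abs_mul]
              refine mul_le_mul_of_nonneg_left ?_ (abs_nonneg _)
              exact (abs_add_le _ _).trans (by linarith)
        _ = ε * (|f r| + |g r|) := by ring)
  simp only [intervalIntegral.integral_same, sub_zero] at key
  rw [← key]; ring

/-! ### Expectations of a continuous function along a process -/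

section Expectation

variable {Ω : Type*} [MeasurableSpace Ω] {P : Measure Ω}

lemma exists_bound_of_continuousOn_of_support {T : Type*} [TopologicalSpace T] {c : T × State d → ℝ}
    {S : Set T} {K : ℝ} (hS : IsCompact S) (hc : ContinuousOn c (S ×ˢ univ))
    (hK : ∀ p ∈ S, ∀ x, K < ‖x‖ → c (p, x) = 0) : ∃ C, ∀ p ∈ S, ∀ x, ‖c (p, x)‖ ≤ C := by
  obtain ⟨C, hC⟩ := (hS.prod (isCompact_closedBall (0 : State d) K)).exists_bound_of_continuousOn
    (hc.mono (prod_mono_right (subset_univ _)))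
  refine ⟨max C 0, fun p hp x => ?_⟩
  by_cases hx : K < ‖x‖
  · simp [hK p hp x hx]
  · exact (hC (p, x) ⟨hp, by simpa using not_lt.1 hx⟩).trans (le_max_left _ _)

lemma continuousOn_integral_along [IsFiniteMeasure P] {Z : ℝ → Ω → State d} {s t : ℝ}
    (hZ : ∀ r ∈ Icc s t, Measurable (Z r))
    (hcont : ∀ᵐ ω ∂P, ContinuousOn (fun r => Z r ω) (Icc s t)) {c : (ℝ × ℝ) × State d → ℝ} {C : ℝ}
    (hc : ContinuousOn c ((Icc s t ×ˢ Icc s t) ×ˢ univ))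
    (hC : ∀ p ∈ Icc s t ×ˢ Icc s t, ∀ x, ‖c (p, x)‖ ≤ C) :
    ContinuousOn (fun p : ℝ × ℝ => ∫ ω, c (p, Z p.2 ω) ∂P) (Icc s t ×ˢ Icc s t) := by
  refine continuousOn_of_dominated (bound := fun _ => C) ?_ ?_ (integrable_const C) ?_
  · intro p hp
    have h1 : Continuous fun x => c (p, x) := by
      rw [← continuousOn_univ]
      exact hc.comp (by fun_prop) fun x _ => ⟨hp, mem_univ x⟩
    exact (h1.measurable.comp (hZ p.2 hp.2)).aestronglyMeasurable
  · exact fun p hp => ae_of_all _ fun ω => hC p hp _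
  · filter_upwards [hcont] with ω hω
    refine hc.comp (continuousOn_id.prodMk (hω.comp continuousOn_snd fun p hp => hp.2)) ?_
    exact fun p hp => ⟨hp, mem_univ _⟩

lemma integrable_mul_prod_of_continuousOn [IsFiniteMeasure P] {X : Ω → State d} (hX : Measurable X)
    {a b : ℝ} (hab : a ≤ b) {w : ℝ → ℝ} (hw : IntervalIntegrable w volume a b)
    {k : ℝ × State d → ℝ} {C : ℝ} (hk : ContinuousOn k (Icc a b ×ˢ univ))
    (hC : ∀ q ∈ Icc a b, ∀ x, ‖k (q, x)‖ ≤ C) :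
    Integrable (fun z : ℝ × Ω => w z.1 * k (z.1, X z.2)) ((volume.restrict (Ioc a b)).prod P) := by
  -- Off the interval the integrand is irrelevant, so time may be clamped to make it measurable.
  set k' : ℝ × State d → ℝ := fun p => k (max a (min p.1 b), p.2) with hk'
  have hmem : ∀ q : ℝ, max a (min q b) ∈ Icc a b := fun q =>
    ⟨le_max_left _ _, max_le hab (min_le_right _ _)⟩
  have hk'c : Continuous k' := by
    rw [← continuousOn_univ]
    refine hk.comp (by fun_prop) fun p _ => ⟨hmem p.1, mem_univ _⟩
  have hm : Measurable fun z : ℝ × Ω => k' (z.1, X z.2) :=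
    hk'c.measurable.comp (measurable_fst.prodMk (hX.comp measurable_snd))
  have hw1 : Integrable (fun z : ℝ × Ω => w z.1) ((volume.restrict (Ioc a b)).prod P) := by
    have := ((intervalIntegrable_iff_integrableOn_Ioc_of_le hab).1 hw).integrable.mul_prod
      (integrable_const (μ := P) (1 : ℝ))
    simpa using this
  have h1 : Integrable (fun z : ℝ × Ω => w z.1 * k' (z.1, X z.2))
      ((volume.restrict (Ioc a b)).prod P) :=
    hw1.mul_bdd (c := C) hm.aestronglyMeasurable (ae_of_all _ fun z => hC _ (hmem _) _)
  refine h1.congr ?_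
  have : ∀ᵐ z ∂((volume.restrict (Ioc a b)).prod P), z.1 ∈ Ioc a b := by
    have h2 : ∀ᵐ q ∂(volume.restrict (Ioc a b)), q ∈ Ioc a b := ae_restrict_mem measurableSet_Ioc
    exact Measure.quasiMeasurePreserving_fst.ae h2
  filter_upwards [this] with z hz
  simp only [hk']
  rw [min_eq_left hz.2, max_eq_right hz.1.le]

end Expectation

/-! ### Time-dependent test functions -/

/-- The partial derivative of `G : ℝ × ℝ^d → ℝ` in its first variable. -/
def timeDeriv (G : ℝ × State d → ℝ) (p : ℝ × State d) : ℝ :=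
  deriv (fun r => G (r, p.2)) p.1

/-- The gradient of `G : ℝ × ℝ^d → ℝ` in its second variable. -/
def spatialGrad (G : ℝ × State d → ℝ) (p : ℝ × State d) : State d :=
  gradient (fun u => G (p.1, u)) p.2

/-- The Laplacian of `G : ℝ × ℝ^d → ℝ` in its second variable. -/
def spatialLap (G : ℝ × State d → ℝ) (p : ℝ × State d) : ℝ :=
  Laplacian.laplacian (fun u => G (p.1, u)) p.2

/-- The backward operator of the reverse SDE, `-∂_ρ + ∇ log (heat μ) · ∇ + ½ Δ`, in the
coordinates `ρ = σ² / α²`, `u = x / α`. -/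
def heatResidual (μ : Measure (State d)) (G : ℝ × State d → ℝ) (p : ℝ × State d) : ℝ :=
  -timeDeriv G p + (heat μ p)⁻¹ * inner ℝ (heatGrad μ p) (spatialGrad G p) +
    1 / 2 * spatialLap G p

lemma differentiable_gradient {f : State d → ℝ} (hf : ContDiff ℝ 2 f) :
    Differentiable ℝ (gradient f) := by
  have h1 : ContDiff ℝ 1 (fun y => (InnerProductSpace.toDual ℝ (State d)).symm (fderiv ℝ f y)) :=
    (InnerProductSpace.toDual ℝ (State d)).symm.contDiff.comp (hf.fderiv_right (by norm_num))
  exact h1.differentiable (by norm_num)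

lemma laplacian_comp_smul {f : State d → ℝ} (hf : ContDiff ℝ 2 f) (c : ℝ) (x : State d) :
    Laplacian.laplacian (fun y => f (c • y)) x = c * (c * Laplacian.laplacian f (c • x)) := by
  have hg : ∀ y, HasGradientAt f (gradient f y) y := fun y =>
    ((hf.differentiable (by norm_num)) y).hasGradientAt
  have hgd := differentiable_gradient hf
  have hc : DifferentiableAt ℝ (fun y => gradient f (c • y)) x :=
    (hgd.comp (differentiable_id.const_smul c)) x
  rw [laplacian_eq_divergence_gradient (f := fun y => f (c • y))
      (hf.comp (contDiff_const_smul c)).contDiffAt,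
    laplacian_eq_divergence_gradient hf.contDiffAt,
    show gradient (fun y => f (c • y)) = fun y => c • gradient f (c • y) from
      funext fun y => (hasGradientAt_comp_smul c (hg _)).gradient,
    divergence_const_smul _ hc, divergence_comp_smul _ (hgd _)]

section Smooth

variable {ρ₃ : ℝ} {G : ℝ × State d → ℝ}

lemma isOpen_lt_fst (ρ₃ : ℝ) : IsOpen {p : ℝ × State d | ρ₃ < p.1} :=
  isOpen_lt continuous_const continuous_fst

variable (hG : ContDiffOn ℝ (⊤ : ℕ∞) G {p | ρ₃ < p.1})
include hG

lemma contDiff_slice {ρ : ℝ} (hρ : ρ₃ < ρ) : ContDiff ℝ (⊤ : ℕ∞) (fun u => G (ρ, u)) :=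
  hG.comp_contDiff (contDiff_const.prodMk contDiff_id) fun _ => hρ

lemma hasFDerivAt_of_contDiffOn {p : ℝ × State d} (hp : ρ₃ < p.1) :
    HasFDerivAt G (fderiv ℝ G p) p :=
  ((hG.contDiffAt ((isOpen_lt_fst ρ₃).mem_nhds hp)).differentiableAt (by simp)).hasFDerivAt

lemma timeDeriv_eq {p : ℝ × State d} (hp : ρ₃ < p.1) : timeDeriv G p = fderiv ℝ G p (1, 0) :=
  (hasDerivAt_fst_slice (hasFDerivAt_of_contDiffOn hG hp)).deriv

lemma spatialGrad_eq {p : ℝ × State d} (hp : ρ₃ < p.1) :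
    spatialGrad G p = (InnerProductSpace.toDual ℝ (State d)).symm
      ((fderiv ℝ G p).comp (ContinuousLinearMap.inr ℝ ℝ (State d))) := by
  rw [spatialGrad, gradient,
    (hasFDerivAt_snd_slice (hasFDerivAt_of_contDiffOn hG hp)).fderiv]

lemma fderiv_apply_eq {p : ℝ × State d} (hp : ρ₃ < p.1) (v : ℝ × State d) :
    fderiv ℝ G p v = v.1 * timeDeriv G p + inner ℝ (spatialGrad G p) v.2 := by
  rw [timeDeriv_eq hG hp, spatialGrad_eq hG hp, InnerProductSpace.toDual_symm_apply]
  have : v = v.1 • ((1 : ℝ), (0 : State d)) + ((0 : ℝ), v.2) := by ext <;> simp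
  conv_lhs => rw [this]
  rw [map_add, map_smul]
  simp

lemma contDiffOn_spatialGrad : ContDiffOn ℝ (⊤ : ℕ∞) (spatialGrad G) {p | ρ₃ < p.1} := by
  have h1 : ContDiffOn ℝ (⊤ : ℕ∞) (fderiv ℝ G) {p | ρ₃ < p.1} :=
    hG.fderiv_of_isOpen (isOpen_lt_fst ρ₃) (by simp)
  have h2 : ContDiffOn ℝ (⊤ : ℕ∞) (fun p => (InnerProductSpace.toDual ℝ (State d)).symm
      ((fderiv ℝ G p).comp (ContinuousLinearMap.inr ℝ ℝ (State d)))) {p | ρ₃ < p.1} :=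
    (InnerProductSpace.toDual ℝ (State d)).symm.contDiff.comp_contDiffOn
      (h1.clm_comp contDiffOn_const)
  exact h2.congr fun p hp => spatialGrad_eq hG hp

lemma continuousOn_timeDeriv : ContinuousOn (timeDeriv G) {p | ρ₃ < p.1} := by
  have h1 : ContinuousOn (fderiv ℝ G) {p | ρ₃ < p.1} :=
    (hG.fderiv_of_isOpen (m := (⊤ : ℕ∞)) (isOpen_lt_fst ρ₃) (by simp)).continuousOn
  exact (h1.clm_apply continuousOn_const).congr fun p hp => timeDeriv_eq hG hp

lemma continuousOn_spatialLap : ContinuousOn (spatialLap G) {p | ρ₃ < p.1} := by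
  have hs := contDiffOn_spatialGrad hG
  have h1 : ContinuousOn (fderiv ℝ (spatialGrad G)) {p | ρ₃ < p.1} :=
    (hs.fderiv_of_isOpen (m := (⊤ : ℕ∞)) (isOpen_lt_fst ρ₃) (by simp)).continuousOn
  have h2 : ContinuousOn (fun p => ∑ i : Fin d,
      (fderiv ℝ (spatialGrad G) p ((0 : ℝ), EuclideanSpace.single i (1 : ℝ))) i)
      {p | ρ₃ < p.1} := by
    refine continuousOn_finsetSum _ fun i _ => ?_
    exact (EuclideanSpace.proj (𝕜 := ℝ) i).continuous.comp_continuousOn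
      (h1.clm_apply continuousOn_const)
  refine h2.congr fun p hp => ?_
  have hp' : ρ₃ < p.1 := hp
  rw [spatialLap, laplacian_eq_divergence_gradient
    ((contDiff_slice hG hp').of_le (by norm_cast)).contDiffAt, divergence]
  have h3 : HasFDerivAt (spatialGrad G) (fderiv ℝ (spatialGrad G) p) p :=
    ((hs.contDiffAt ((isOpen_lt_fst ρ₃).mem_nhds hp)).differentiableAt (by simp)).hasFDerivAt
  have h4 := (hasFDerivAt_snd_slice (ρ := p.1) (u := p.2) h3).fderiv
  simp only [spatialGrad] at h4
  rw [show gradient (fun u => G (p.1, u)) = fun u => gradient (fun v => G (p.1, v)) u from rfl, h4]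
  rfl

end Smooth

lemma eventually_zero_of_support {ρ₃ R : ℝ} {G : ℝ × State d → ℝ}
    (hR : ∀ p : ℝ × State d, ρ₃ < p.1 → R < ‖p.2‖ → G p = 0) {p : ℝ × State d} (hp : ρ₃ < p.1)
    (hpR : R < ‖p.2‖) :
    timeDeriv G p = 0 ∧ spatialGrad G p = 0 ∧ spatialLap G p = 0 := by
  have h1 : (fun r => G (r, p.2)) =ᶠ[𝓝 p.1] fun _ => 0 := by
    filter_upwards [lt_mem_nhds hp] with r hr using hR (r, p.2) hr hpR
  have h2 : (fun u => G (p.1, u)) =ᶠ[𝓝 p.2] fun _ => 0 := by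
    filter_upwards [(isOpen_lt continuous_const continuous_norm).mem_nhds hpR] with u hu
      using hR (p.1, u) hp hu
  refine ⟨?_, ?_, ?_⟩
  · rw [timeDeriv, h1.deriv_eq, deriv_const]
  · rw [spatialGrad, gradient, h2.fderiv_eq]
    simp
  · rw [spatialLap, InnerProductSpace.laplacian_eq_iteratedFDeriv_orthonormalBasis _
      (EuclideanSpace.basisFun (Fin d) ℝ)]
    simp only [(h2.iteratedFDeriv ℝ 2).eq_of_nhds]
    simp [iteratedFDeriv_fun_zero]

/-! ### The reverse SDE in heat coordinates -/

/-- The heat coordinates `(σ² / α², x / α)` of the point `x` at the reverse time `τ`. -/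
def heatPoint (α σ : ℝ → ℝ) (τ : ℝ) (x : State d) : ℝ × State d :=
  (noiseRatio α σ (1 - τ), (α (1 - τ))⁻¹ • x)

lemma contDiff_testFunction {α σ : ℝ → ℝ} {ρ₃ : ℝ} {G : ℝ × State d → ℝ}
    (hG : ContDiffOn ℝ (⊤ : ℕ∞) G {p | ρ₃ < p.1}) {q : ℝ} (hqρ : ρ₃ < noiseRatio α σ (1 - q)) :
    ContDiff ℝ (⊤ : ℕ∞) (fun x => G (heatPoint α σ q x)) :=
  (contDiff_slice hG hqρ).comp (contDiff_const_smul (α (1 - q))⁻¹)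

section SDE

variable {α σ : ℝ → ℝ} (h : IsNoiseSchedule α σ)
include h

lemma hasDerivAt_heatPoint {τ : ℝ} (hτ : τ ∈ Ioo (0 : ℝ) 1) (x : State d) :
    HasDerivAt (fun q => heatPoint α σ q x)
      (-(diffusionSq α σ (1 - τ) / α (1 - τ) ^ 2),
        linearDrift α (1 - τ) • (α (1 - τ))⁻¹ • x) τ := by
  have h1 := (h.hasDerivAt_noiseRatio (one_sub_mem_Ioo hτ)).comp_const_sub 1 τ
  have hα := (h.signal_one_sub_pos hτ).ne'
  have h2 : HasDerivAt (fun q => (α (1 - q))⁻¹ • x)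
      (linearDrift α (1 - τ) • (α (1 - τ))⁻¹ • x) τ := by
    refine (((h.hasDerivAt_signal_one_sub hτ).fun_inv hα).smul_const x).congr_deriv ?_
    rw [smul_smul]
    congr 1
    field_simp
  exact h1.prodMk h2

lemma continuousOn_heatPoint {s t : ℝ} (hs : 0 < s) (ht : t < 1) :
    ContinuousOn (fun z : ℝ × State d => heatPoint α σ z.1 z.2) (Icc s t ×ˢ univ) := by
  have hm : MapsTo (fun z : ℝ × State d => z.1) (Icc s t ×ˢ univ) (Icc s t) := fun z hz => hz.1
  have h1 : ContinuousOn (fun q => noiseRatio α σ (1 - q)) (Icc s t) :=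
    h.continuousOn_noiseRatio.comp (by fun_prop) fun q hq =>
      ⟨by linarith [hq.2], by linarith [hq.1]⟩
  have h2 : ContinuousOn (fun q => (α (1 - q))⁻¹) (Icc s t) := by
    refine ContinuousOn.inv₀ (h.continuousOn_signal.comp (by fun_prop) fun q hq =>
      ⟨by linarith [hq.2], by linarith [hq.1]⟩) fun q hq => ?_
    exact (h.signal_one_sub_pos ⟨hs.trans_le hq.1, hq.2.trans_lt ht⟩).ne'
  exact (h1.comp continuousOn_fst hm).prodMk ((h2.comp continuousOn_fst hm).smul continuousOn_snd)

lemma lt_heatPoint_fst {ρ₃ t : ℝ} (ht : t < 1) (hρ : ρ₃ < noiseRatio α σ (1 - t)) {q : ℝ}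
    (hq : q ∈ Ioc 0 t) (x : State d) : ρ₃ < (heatPoint α σ q x).1 := by
  refine hρ.trans_le (h.monotoneOn_noiseRatio ?_ ?_ ?_)
  · exact ⟨by linarith, by linarith [hq.1, hq.2]⟩
  · exact ⟨by linarith [hq.2], by linarith [hq.1]⟩
  · linarith [hq.2]

/-- A bound on the support of the test functions in the original space variable, uniform in time. -/
lemma exists_lt_norm_heatPoint {s t : ℝ} (hs : 0 < s) (ht : t < 1) (R : ℝ) :
    ∃ K, ∀ q ∈ Icc s t, ∀ x : State d, K < ‖x‖ → R < ‖(heatPoint α σ q x).2‖ := by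
  obtain ⟨C, hC⟩ := isCompact_Icc.exists_bound_of_continuousOn h.continuousOn_signal
  refine ⟨|R| * C, fun q hq x hx => ?_⟩
  have hα := h.signal_one_sub_pos (τ := q) ⟨hs.trans_le hq.1, hq.2.trans_lt ht⟩
  have h1 := hC (1 - q) ⟨by linarith [hq.2], by linarith [hq.1]⟩
  rw [Real.norm_of_nonneg hα.le] at h1
  rw [heatPoint, norm_smul, norm_inv, Real.norm_of_nonneg hα.le, inv_mul_eq_div, lt_div_iff₀ hα]
  refine lt_of_le_of_lt ?_ hx
  calc R * α (1 - q) ≤ |R| * α (1 - q) := by gcongr; exact le_abs_self R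
    _ ≤ |R| * C := by gcongr

variable {ρ₃ R s t : ℝ} {G : ℝ × State d → ℝ} (hG : ContDiffOn ℝ (⊤ : ℕ∞) G {p | ρ₃ < p.1})
  (hR : ∀ p : ℝ × State d, ρ₃ < p.1 → R < ‖p.2‖ → G p = 0)
  (hs : 0 < s) (ht : t < 1) (hρ : ρ₃ < noiseRatio α σ (1 - t))

include hG in
lemma hasDerivAt_testFunction {q : ℝ} (hq : q ∈ Ioo (0 : ℝ) 1) (x : State d)
    (hqρ : ρ₃ < (heatPoint α σ q x).1) :
    HasDerivAt (fun q => G (heatPoint α σ q x))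
      (linearDrift α (1 - q) * inner ℝ (spatialGrad G (heatPoint α σ q x)) ((α (1 - q))⁻¹ • x) +
        diffusionSq α σ (1 - q) *
          (-((α (1 - q))⁻¹ ^ 2 * timeDeriv G (heatPoint α σ q x)))) q := by
  refine ((hasFDerivAt_of_contDiffOn hG hqρ).comp_hasDerivAt q
    (hasDerivAt_heatPoint h hq x)).congr_deriv ?_
  rw [fderiv_apply_eq hG hqρ]
  simp only [inner_smul_right]
  field_simp
  ring

include hG in
lemma sdeGenerator_testFunction {p₀ : State d → ℝ} (hp₀ : IsProbDensity p₀) {q r : ℝ}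
    (hr : r ∈ Ioo (0 : ℝ) 1) (hqρ : ρ₃ < noiseRatio α σ (1 - q)) (x : State d) :
    sdeGenerator α σ p₀ r (fun x => G (heatPoint α σ q x)) x =
      linearDrift α (1 - r) *
        (-inner ℝ (spatialGrad G (heatPoint α σ q x)) ((α (1 - q))⁻¹ • x)) +
      diffusionSq α σ (1 - r) *
        ((α (1 - q))⁻¹ * ((α (1 - r))⁻¹ * ((heat (densityMeasure p₀) (heatPoint α σ r x))⁻¹ *
          inner ℝ (heatGrad (densityMeasure p₀) (heatPoint α σ r x))
            (spatialGrad G (heatPoint α σ q x)))) +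
          1 / 2 * ((α (1 - q))⁻¹ ^ 2 * spatialLap G (heatPoint α σ q x))) := by
  have hsl := contDiff_slice hG hqρ
  have hgr : gradient (fun x => G (heatPoint α σ q x)) x =
      (α (1 - q))⁻¹ • spatialGrad G (heatPoint α σ q x) :=
    (hasGradientAt_comp_smul _ ((hsl.differentiable (by simp)) _).hasGradientAt).gradient
  have hlap : Laplacian.laplacian (fun x => G (heatPoint α σ q x)) x =
      (α (1 - q))⁻¹ * ((α (1 - q))⁻¹ * spatialLap G (heatPoint α σ q x)) :=
    laplacian_comp_smul (hsl.of_le (by norm_cast)) _ x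
  rw [sdeGenerator, hgr, hlap, sdeDrift, reverseScore_eq_heat h hp₀ hr]
  simp only [inner_add_left, inner_neg_left, inner_smul_left, inner_smul_right, heatPoint,
    RCLike.conj_to_real]
  rw [real_inner_comm x]
  ring

end SDE

/-! ### Dynkin's formula for time-dependent test functions -/

section SDE

variable {α σ : ℝ → ℝ} {p₀ : State d → ℝ} {Ω : Type*} [mΩ : MeasurableSpace Ω] {P : Measure Ω}
  {𝓕 : Filtration ℝ mΩ} {Z : ℝ → Ω → State d}

lemma IsReverseSDESolution.measurable (hZ : IsReverseSDESolution α σ p₀ P 𝓕 Z) {τ : ℝ}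
    (hτ : τ ∈ Ioc (0 : ℝ) 1) : Measurable (Z τ) :=
  ((hZ.adapted τ hτ).mono (𝓕.le τ)).measurable

/-- Dynkin's formula: the martingale property, after taking expectations. -/
lemma IsReverseSDESolution.integral_sub_eq [IsProbabilityMeasure P]
    (hZ : IsReverseSDESolution α σ p₀ P 𝓕 Z) {φ : State d → ℝ} (hφ : ContDiff ℝ (⊤ : ℕ∞) φ)
    (hφc : HasCompactSupport φ) {s t : ℝ} (hs : 0 < s) (hst : s ≤ t) (ht : t < 1) :
    ∫ ω, φ (Z t ω) ∂P - ∫ ω, φ (Z s ω) ∂P =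
      ∫ r in s..t, (∫ ω, sdeGenerator α σ p₀ r φ (Z r ω) ∂P) := by
  obtain ⟨C, hC⟩ := hφ.continuous.bounded_above_of_compact_support hφc
  have hi : ∀ r ∈ Ioc (0 : ℝ) 1, Integrable (fun ω => φ (Z r ω)) P := fun r hr =>
    Integrable.of_bound
      (hφ.continuous.measurable.comp (hZ.measurable hr)).aestronglyMeasurable C
      (ae_of_all _ fun ω => hC _)
  have hit := hi t ⟨hs.trans_le hst, ht.le⟩
  have his := hi s ⟨hs, hst.trans ht.le⟩
  have hgen := hZ.integrable φ hφ hφc s t hs hst ht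
  have higen : Integrable (fun ω => ∫ r in s..t, sdeGenerator α σ p₀ r φ (Z r ω)) P := by
    simp only [intervalIntegral.integral_of_le hst]
    exact hgen.integral_prod_right
  have hm : ∫ ω, (P[fun ω => φ (Z t ω) - φ (Z s ω) -
      ∫ r in s..t, sdeGenerator α σ p₀ r φ (Z r ω) | 𝓕 s]) ω ∂P = 0 := by
    rw [integral_congr_ae (hZ.martingale φ hφ hφc s t hs hst ht)]
    simp
  have h1 : Integrable (fun ω => φ (Z t ω) - φ (Z s ω)) P := hit.sub his
  rw [integral_condExp (𝓕.le s), integral_sub h1 higen, integral_sub hit his, sub_eq_zero] at hm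
  rw [hm]
  simp only [intervalIntegral.integral_of_le hst]
  exact (integral_integral_swap hgen).symm

variable [IsProbabilityMeasure P]

/-- Dynkin's formula for a time-dependent test function `φ`. The martingale property concerns test
functions that do not depend on time; it is combined with the time derivative of `φ` along the
diagonal of `(q, r) ↦ E φ_q(Z_r)`. The part of the generator that involves the linear drift cancels
against the corresponding part of the time derivative. -/
lemma IsReverseSDESolution.integral_sub_eq_of_hasDerivAt
    (hZ : IsReverseSDESolution α σ p₀ P 𝓕 Z) {s t C₁ C₂ C₃ : ℝ} (hs : 0 < s) (hst : s ≤ t)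
    (ht : t < 1) {φ : ℝ → State d → ℝ} {c₁ c₂ : ℝ × State d → ℝ} {c₃ : (ℝ × ℝ) × State d → ℝ}
    (hc₁ : ContinuousOn c₁ (Icc s t ×ˢ univ)) (hc₂ : ContinuousOn c₂ (Icc s t ×ˢ univ))
    (hc₃ : ContinuousOn c₃ ((Icc s t ×ˢ Icc s t) ×ˢ univ))
    (hC₁ : ∀ q ∈ Icc s t, ∀ x, ‖c₁ (q, x)‖ ≤ C₁) (hC₂ : ∀ q ∈ Icc s t, ∀ x, ‖c₂ (q, x)‖ ≤ C₂)
    (hC₃ : ∀ p ∈ Icc s t ×ˢ Icc s t, ∀ x, ‖c₃ (p, x)‖ ≤ C₃)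
    (hφs : ∀ q ∈ Icc s t, ContDiff ℝ (⊤ : ℕ∞) (φ q))
    (hφc : ∀ q ∈ Icc s t, HasCompactSupport (φ q))
    (hφ : ∀ q ∈ Icc s t, ∀ x, HasDerivAt (fun q => φ q x)
      (linearDrift α (1 - q) * c₁ (q, x) + diffusionSq α σ (1 - q) * c₂ (q, x)) q)
    (hgen : ∀ q ∈ Icc s t, ∀ r ∈ Icc s t, ∀ x, sdeGenerator α σ p₀ r (φ q) x =
      linearDrift α (1 - r) * (-c₁ (q, x)) + diffusionSq α σ (1 - r) * c₃ ((q, r), x)) :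
    ∫ ω, φ t (Z t ω) ∂P - ∫ ω, φ s (Z s ω) ∂P =
      ∫ r in s..t, diffusionSq α σ (1 - r) *
        (∫ ω, (c₂ (r, Z r ω) + c₃ ((r, r), Z r ω)) ∂P) := by
  have hIoo : ∀ q ∈ Icc s t, q ∈ Ioo (0 : ℝ) 1 := fun q hq =>
    ⟨hs.trans_le hq.1, hq.2.trans_lt ht⟩
  have hcq : ContinuousOn (fun z : (ℝ × ℝ) × State d => (z.1.1, z.2))
      ((Icc s t ×ˢ Icc s t) ×ˢ univ) := by fun_prop
  have hmq : MapsTo (fun z : (ℝ × ℝ) × State d => (z.1.1, z.2))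
      ((Icc s t ×ˢ Icc s t) ×ˢ univ) (Icc s t ×ˢ univ) := fun z hz => ⟨hz.1.1, mem_univ _⟩
  have hmeas : ∀ r ∈ Icc s t, Measurable (Z r) := fun r hr =>
    hZ.measurable ⟨(hIoo r hr).1, (hIoo r hr).2.le⟩
  have hpath : ∀ᵐ ω ∂P, ContinuousOn (fun r => Z r ω) (Icc s t) :=
    hZ.continuousOn.mono fun ω hω => hω.mono fun r hr => ⟨(hIoo r hr).1, (hIoo r hr).2.le⟩
  have hE₁ := continuousOn_integral_along hmeas hpath (c := fun z => c₁ (z.1.1, z.2)) (C := C₁)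
    (hc₁.comp hcq hmq) fun p hp x => hC₁ p.1 hp.1 x
  have hE₂ := continuousOn_integral_along hmeas hpath (c := fun z => c₂ (z.1.1, z.2)) (C := C₂)
    (hc₂.comp hcq hmq) fun p hp x => hC₂ p.1 hp.1 x
  have hE₃ := continuousOn_integral_along hmeas hpath (c := c₃) (C := C₃) hc₃ hC₃
  obtain ⟨hf, hg⟩ := hZ.locallyIntegrable s t hs hst ht
  have hsub : ∀ {a b : ℝ}, a ∈ Icc s t → b ∈ Icc s t → a ≤ b → uIcc a b ⊆ Icc s t := by
    intro a b ha hb hab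
    rw [uIcc_of_le hab]
    exact Icc_subset_Icc ha.1 hb.2
  have hmono : ∀ {w : ℝ → ℝ}, IntervalIntegrable w volume s t → ∀ {a b : ℝ}, a ∈ Icc s t →
      b ∈ Icc s t → a ≤ b → IntervalIntegrable w volume a b := by
    intro w hw a b ha hb hab
    refine hw.mono_set ?_
    rw [uIcc_of_le hst]
    exact hsub ha hb hab
  have hφi : ∀ q ∈ Icc s t, ∀ r ∈ Icc s t, Integrable (fun ω => φ q (Z r ω)) P :=
    fun q hq r hr => by
    obtain ⟨C, hC⟩ := (hφs q hq).continuous.bounded_above_of_compact_support (hφc q hq)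
    exact Integrable.of_bound
      ((hφs q hq).continuous.measurable.comp (hmeas r hr)).aestronglyMeasurable C
      (ae_of_all _ fun ω => hC _)
  have hci : ∀ {c : ℝ × State d → ℝ} {C : ℝ}, ContinuousOn c (Icc s t ×ˢ univ) →
      (∀ q ∈ Icc s t, ∀ x, ‖c (q, x)‖ ≤ C) → ∀ q ∈ Icc s t, ∀ r ∈ Icc s t,
      Integrable (fun ω => c (q, Z r ω)) P := fun {c C} hc hC q hq r hr => by
    have : Continuous fun x => c (q, x) := by
      rw [← continuousOn_univ]
      exact hc.comp (by fun_prop) fun x _ => ⟨hq, mem_univ x⟩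
    exact Integrable.of_bound (this.measurable.comp (hmeas r hr)).aestronglyMeasurable C
      (ae_of_all _ fun ω => hC q hq _)
  have hc₃i : ∀ q ∈ Icc s t, ∀ r ∈ Icc s t, Integrable (fun ω => c₃ ((q, r), Z r ω)) P := by
    intro q hq r hr
    have : Continuous fun x => c₃ ((q, r), x) := by
      rw [← continuousOn_univ]
      exact hc₃.comp (by fun_prop) fun x _ => ⟨⟨hq, hr⟩, mem_univ x⟩
    exact Integrable.of_bound (this.measurable.comp (hmeas r hr)).aestronglyMeasurable C₃
      (ae_of_all _ fun ω => hC₃ (q, r) ⟨hq, hr⟩ _)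
  have key := diagonal_sub_eq_integral (D := fun q r => ∫ ω, φ q (Z r ω) ∂P)
    (l₁ := fun p => -∫ ω, c₁ (p.1, Z p.2 ω) ∂P) hst hf hg hE₁ hE₂ hE₁.neg hE₃ ?_ ?_
  · rw [key]
    refine intervalIntegral.integral_congr fun r hr => ?_
    rw [uIcc_of_le hst] at hr
    simp only [add_neg_cancel, mul_zero, zero_add]
    rw [← integral_add (hci hc₂ hC₂ r hr r hr) (hc₃i r hr r hr)]
  · intro r hr a ha b hb hab
    have i₁ := integrable_mul_prod_of_continuousOn (P := P) (hmeas r hr) hab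
      (hmono hf ha hb hab) (hc₁.mono (prod_mono_left (Icc_subset_Icc ha.1 hb.2)))
      fun q hq x => hC₁ q ⟨ha.1.trans hq.1, hq.2.trans hb.2⟩ x
    have i₂ := integrable_mul_prod_of_continuousOn (P := P) (hmeas r hr) hab
      (hmono hg ha hb hab) (hc₂.mono (prod_mono_left (Icc_subset_Icc ha.1 hb.2)))
      fun q hq x => hC₂ q ⟨ha.1.trans hq.1, hq.2.trans hb.2⟩ x
    have hftc : ∀ x : State d, φ b x - φ a x =
        ∫ q in a..b, (linearDrift α (1 - q) * c₁ (q, x) + diffusionSq α σ (1 - q) * c₂ (q, x)) := by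
      intro x
      have hcx : ∀ {c : ℝ × State d → ℝ}, ContinuousOn c (Icc s t ×ˢ univ) →
          ContinuousOn (fun q => c (q, x)) (uIcc a b) := fun hc =>
        hc.comp (by fun_prop) fun q hq => ⟨hsub ha hb hab hq, mem_univ _⟩
      refine (intervalIntegral.integral_eq_sub_of_hasDerivAt
        (f := fun q => φ q x) (fun q hq => hφ q (hsub ha hb hab hq) x) ?_).symm
      exact ((hmono hf ha hb hab).mul_continuousOn (hcx hc₁)).add
          ((hmono hg ha hb hab).mul_continuousOn (hcx hc₂))
    simp only
    rw [← integral_sub (hφi b hb r hr) (hφi a ha r hr)]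
    simp only [hftc, intervalIntegral.integral_of_le hab]
    have i₃ := i₁.add i₂
    rw [← integral_integral_swap (f := fun q ω => linearDrift α (1 - q) * c₁ (q, Z r ω) +
      diffusionSq α σ (1 - q) * c₂ (q, Z r ω)) i₃]
    refine setIntegral_congr_fun measurableSet_Ioc fun q hq => ?_
    have hq' : q ∈ Icc s t := ⟨ha.1.trans hq.1.le, hq.2.trans hb.2⟩
    rw [integral_add ((hci hc₁ hC₁ q hq' r hr).const_mul _)
      ((hci hc₂ hC₂ q hq' r hr).const_mul _), integral_const_mul, integral_const_mul]
  · intro q hq a ha b hb hab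
    simp only
    rw [hZ.integral_sub_eq (hφs q hq) (hφc q hq) (hIoo a ha).1 hab (hIoo b hb).2]
    refine intervalIntegral.integral_congr fun r hr => ?_
    have hr' := hsub ha hb hab hr
    simp only [hgen q hq r hr']
    have i₁ : Integrable (fun ω => -c₁ (q, Z r ω)) P := (hci hc₁ hC₁ q hq r hr').neg
    rw [integral_add (i₁.const_mul _) ((hc₃i q hq r hr').const_mul _),
      integral_const_mul, integral_const_mul, integral_neg]

variable (h : IsNoiseSchedule α σ) (hp₀ : IsProbDensity p₀)
  (hZ : IsReverseSDESolution α σ p₀ P 𝓕 Z)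
include h hp₀ hZ

/-- The evolution of `E G(σ² / α², Z / α)` along a solution of the reverse SDE. -/
theorem integral_heatPoint_sub {ρ₃ R s t : ℝ} {G : ℝ × State d → ℝ}
    (hG : ContDiffOn ℝ (⊤ : ℕ∞) G {p | ρ₃ < p.1})
    (hR : ∀ p : ℝ × State d, ρ₃ < p.1 → R < ‖p.2‖ → G p = 0)
    (hρ₃ : 0 ≤ ρ₃) (hs : 0 < s) (hst : s ≤ t) (ht : t < 1)
    (hρ : ρ₃ < noiseRatio α σ (1 - t)) :
    ∫ ω, G (heatPoint α σ t (Z t ω)) ∂P - ∫ ω, G (heatPoint α σ s (Z s ω)) ∂P =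
      ∫ r in s..t, diffusionSq α σ (1 - r) * (∫ ω, (α (1 - r))⁻¹ ^ 2 *
        heatResidual (densityMeasure p₀) G (heatPoint α σ r (Z r ω)) ∂P) := by
  have := hp₀.isProbabilityMeasure
  have hμ : densityMeasure p₀ ≠ 0 := IsProbabilityMeasure.ne_zero _
  have hIoo : ∀ q ∈ Icc s t, q ∈ Ioo (0 : ℝ) 1 := fun q hq =>
    ⟨hs.trans_le hq.1, hq.2.trans_lt ht⟩
  have hlt : ∀ q ∈ Icc s t, ∀ x : State d, ρ₃ < (heatPoint α σ q x).1 := fun q hq x =>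
    lt_heatPoint_fst h ht hρ ⟨hs.trans_le hq.1, hq.2⟩ x
  have hlt' : ∀ q ∈ Icc s t, ρ₃ < noiseRatio α σ (1 - q) := fun q hq => hlt q hq 0
  obtain ⟨K, hK⟩ := exists_lt_norm_heatPoint (d := d) h hs ht R
  have hzero : ∀ q ∈ Icc s t, ∀ x : State d, K < ‖x‖ →
      timeDeriv G (heatPoint α σ q x) = 0 ∧ spatialGrad G (heatPoint α σ q x) = 0 ∧
        spatialLap G (heatPoint α σ q x) = 0 := fun q hq x hx =>
    eventually_zero_of_support hR (hlt q hq x) (hK q hq x hx)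
  have hpt := continuousOn_heatPoint (d := d) h hs ht
  have hmaps : MapsTo (fun z : ℝ × State d => heatPoint α σ z.1 z.2) (Icc s t ×ˢ univ)
      {p | ρ₃ < p.1} := fun z hz => hlt z.1 hz.1 z.2
  have hmaps0 : MapsTo (fun z : ℝ × State d => heatPoint α σ z.1 z.2) (Icc s t ×ˢ univ)
      {p | 0 < p.1} := fun z hz => hρ₃.trans_lt (hlt z.1 hz.1 z.2)
  have hinv : ContinuousOn (fun z : ℝ × State d => (α (1 - z.1))⁻¹) (Icc s t ×ˢ univ) := by
    refine ContinuousOn.inv₀ (h.continuousOn_signal.comp (by fun_prop) fun z hz =>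
      ⟨by linarith [(hIoo z.1 hz.1).2], by linarith [(hIoo z.1 hz.1).1]⟩) fun z hz => ?_
    exact (h.signal_one_sub_pos (hIoo z.1 hz.1)).ne'
  have hgrad : ContinuousOn (fun z : ℝ × State d => spatialGrad G (heatPoint α σ z.1 z.2))
      (Icc s t ×ˢ univ) := (contDiffOn_spatialGrad hG).continuousOn.comp hpt hmaps
  have htime : ContinuousOn (fun z : ℝ × State d => timeDeriv G (heatPoint α σ z.1 z.2))
      (Icc s t ×ˢ univ) := (continuousOn_timeDeriv hG).comp hpt hmaps
  have hlap : ContinuousOn (fun z : ℝ × State d => spatialLap G (heatPoint α σ z.1 z.2))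
      (Icc s t ×ˢ univ) := (continuousOn_spatialLap hG).comp hpt hmaps
  have hlogGrad : ContinuousOn (fun z : ℝ × State d => (α (1 - z.1))⁻¹ •
      (heat (densityMeasure p₀) (heatPoint α σ z.1 z.2))⁻¹ •
      heatGrad (densityMeasure p₀) (heatPoint α σ z.1 z.2)) (Icc s t ×ˢ univ) :=
    hinv.smul (((contDiffOn_heat.continuousOn.comp hpt hmaps0).inv₀
      fun z hz => (heat_pos hμ (hmaps0 hz) _).ne').smul
      (contDiffOn_heatGrad.continuousOn.comp hpt hmaps0))
  have hc₁ : ContinuousOn (fun z : ℝ × State d => inner ℝ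
      (spatialGrad G (heatPoint α σ z.1 z.2)) ((α (1 - z.1))⁻¹ • z.2)) (Icc s t ×ˢ univ) :=
    hgrad.inner (hinv.smul continuousOn_snd)
  have hc₂ : ContinuousOn (fun z : ℝ × State d =>
      -((α (1 - z.1))⁻¹ ^ 2 * timeDeriv G (heatPoint α σ z.1 z.2))) (Icc s t ×ˢ univ) :=
    ((hinv.pow 2).mul htime).neg
  have hcq : ContinuousOn (fun z : (ℝ × ℝ) × State d => (z.1.1, z.2))
      ((Icc s t ×ˢ Icc s t) ×ˢ univ) := by fun_prop
  have hcr : ContinuousOn (fun z : (ℝ × ℝ) × State d => (z.1.2, z.2))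
      ((Icc s t ×ˢ Icc s t) ×ˢ univ) := by fun_prop
  have hmq : MapsTo (fun z : (ℝ × ℝ) × State d => (z.1.1, z.2))
      ((Icc s t ×ˢ Icc s t) ×ˢ univ) (Icc s t ×ˢ univ) := fun z hz => ⟨hz.1.1, mem_univ _⟩
  have hmr : MapsTo (fun z : (ℝ × ℝ) × State d => (z.1.2, z.2))
      ((Icc s t ×ˢ Icc s t) ×ˢ univ) (Icc s t ×ˢ univ) := fun z hz => ⟨hz.1.2, mem_univ _⟩
  have hq₁ := hinv.comp hcq hmq
  have hq₂ := hgrad.comp hcq hmq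
  have hq₃ := hlap.comp hcq hmq
  have hr₁ := hlogGrad.comp hcr hmr
  have hc₃ : ContinuousOn (fun z : (ℝ × ℝ) × State d => (α (1 - z.1.1))⁻¹ *
      inner ℝ ((α (1 - z.1.2))⁻¹ • (heat (densityMeasure p₀) (heatPoint α σ z.1.2 z.2))⁻¹ •
        heatGrad (densityMeasure p₀) (heatPoint α σ z.1.2 z.2))
          (spatialGrad G (heatPoint α σ z.1.1 z.2)) +
      1 / 2 * ((α (1 - z.1.1))⁻¹ ^ 2 * spatialLap G (heatPoint α σ z.1.1 z.2)))
      ((Icc s t ×ˢ Icc s t) ×ˢ univ) :=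
    (hq₁.mul (hr₁.inner hq₂)).add (continuousOn_const.mul ((hq₁.pow 2).mul hq₃))
  obtain ⟨C₁, hC₁⟩ := exists_bound_of_continuousOn_of_support isCompact_Icc hc₁ (K := K)
    fun q hq x hx => by simp [(hzero q hq x hx).2.1]
  obtain ⟨C₂, hC₂⟩ := exists_bound_of_continuousOn_of_support isCompact_Icc hc₂ (K := K)
    fun q hq x hx => by simp [(hzero q hq x hx).1]
  obtain ⟨C₃, hC₃⟩ := exists_bound_of_continuousOn_of_support (isCompact_Icc.prod isCompact_Icc)
    hc₃ (K := K) fun p hp x hx => by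
      simp [(hzero p.1 hp.1 x hx).2.1, (hzero p.1 hp.1 x hx).2.2]
  rw [hZ.integral_sub_eq_of_hasDerivAt hs hst ht hc₁ hc₂ hc₃ hC₁ hC₂ hC₃
    (φ := fun q x => G (heatPoint α σ q x))
    (fun q hq => contDiff_testFunction hG (hlt' q hq)) ?_
    (fun q hq x => hasDerivAt_testFunction h hG (hIoo q hq) x (hlt q hq x)) ?_]
  · refine intervalIntegral.integral_congr fun r _ => ?_
    simp only
    congr 2
    funext ω
    simp only [heatResidual, inner_smul_left, RCLike.conj_to_real]
    ring
  · refine fun q hq => HasCompactSupport.of_support_subset_isCompact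
      (isCompact_closedBall (0 : State d) K) fun x hx => ?_
    by_contra hxK
    refine hx (hR _ (hlt q hq x) (hK q hq x ?_))
    simpa using hxK
  · intro q hq r hr x
    rw [sdeGenerator_testFunction h hG hp₀ (hIoo r hr) (hlt' q hq)]
    simp only [inner_smul_left, RCLike.conj_to_real]

end SDE

/-! ### Quotients of heat flows are harmonic for the reverse SDE -/

lemma hasGradientAt_mul {f g : State d → ℝ} {a b x : State d} (hf : HasGradientAt f a x)
    (hg : HasGradientAt g b x) : HasGradientAt (fun y => f y * g y) (f x • b + g x • a) x := by
  rw [hasGradientAt_iff_hasFDerivAt]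
  refine (hf.hasFDerivAt.fun_mul hg.hasFDerivAt).congr_fderiv ?_
  apply ContinuousLinearMap.ext
  intro v
  simp

lemma laplacian_mul {f g : State d → ℝ} (hf : ContDiff ℝ 2 f) (hg : ContDiff ℝ 2 g) (x : State d) :
    Laplacian.laplacian (fun y => f y * g y) x =
      f x * Laplacian.laplacian g x + 2 * inner ℝ (gradient f x) (gradient g x) +
        g x * Laplacian.laplacian f x := by
  have hf' : ∀ y, HasGradientAt f (gradient f y) y := fun y =>
    ((hf.differentiable (by norm_num)) y).hasGradientAt
  have hg' : ∀ y, HasGradientAt g (gradient g y) y := fun y =>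
    ((hg.differentiable (by norm_num)) y).hasGradientAt
  have hfd := differentiable_gradient hf
  have hgd := differentiable_gradient hg
  rw [laplacian_eq_divergence_gradient (hf.mul hg).contDiffAt,
    laplacian_eq_divergence_gradient hf.contDiffAt, laplacian_eq_divergence_gradient hg.contDiffAt,
    show gradient (fun y => f y * g y) = fun y => f y • gradient g y + g y • gradient f y from
      funext fun y => (hasGradientAt_mul (hf' y) (hg' y)).gradient,
    divergence_add (((hf' x).hasFDerivAt.differentiableAt).fun_smul (hgd x))
      (((hg' x).hasFDerivAt.differentiableAt).fun_smul (hfd x)),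
    divergence_smul (hf' x) (hgd x), divergence_smul (hg' x) (hfd x),
    real_inner_comm (gradient f x) (gradient g x)]
  ring

lemma contDiff_heat_slice {μ : Measure (State d)} [IsFiniteMeasure μ] {ρ : ℝ} (hρ : 0 < ρ) :
    ContDiff ℝ (⊤ : ℕ∞) (fun u => heat μ (ρ, u)) :=
  contDiffOn_heat.comp_contDiff (contDiff_const.prodMk contDiff_id) fun _ => hρ

lemma laplacian_heat {μ : Measure (State d)} [IsFiniteMeasure μ] {ρ : ℝ} (hρ : 0 < ρ)
    (u : State d) : Laplacian.laplacian (fun u => heat μ (ρ, u)) u = heatLap μ (ρ, u) := by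
  rw [laplacian_eq_divergence_gradient ((contDiff_heat_slice hρ).of_le (by norm_cast)).contDiffAt,
    show gradient (fun u => heat μ (ρ, u)) = fun u => heatGrad μ (ρ, u) from
      funext fun u => (hasGradientAt_heat hρ u).gradient, heatLap]

/-- The quotient of the heat flow of `ν`, delayed by `ρ₃`, and of the heat flow of `μ`. -/
def heatQuotient (μ ν : Measure (State d)) (ρ₃ : ℝ) (p : ℝ × State d) : ℝ :=
  heat ν (p.1 - ρ₃, p.2) / heat μ p

section Quotient

variable {μ ν : Measure (State d)} [IsFiniteMeasure μ] [IsFiniteMeasure ν] {ρ₃ : ℝ}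

lemma contDiffOn_mul_heatQuotient (hμ : μ ≠ 0) (hρ₃ : 0 ≤ ρ₃) {χ : State d → ℝ}
    (hχ : ContDiff ℝ (⊤ : ℕ∞) χ) :
    ContDiffOn ℝ (⊤ : ℕ∞) (fun p => χ p.2 * heatQuotient μ ν ρ₃ p) {p | ρ₃ < p.1} := by
  refine (hχ.comp contDiff_snd).contDiffOn.mul (ContDiffOn.div ?_ ?_ fun p hp => ?_)
  · refine contDiffOn_heat.comp (t := {p : ℝ × State d | 0 < p.1})
      ((contDiffOn_fst.sub contDiffOn_const).prodMk contDiffOn_snd) fun p hp => ?_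
    have : ρ₃ < p.1 := hp
    simpa using this
  · exact contDiffOn_heat.mono fun p hp => hρ₃.trans_lt hp
  · exact (heat_pos hμ (hρ₃.trans_lt hp) p.2).ne'

/-- A quotient of two solutions of the heat equation is annihilated by the backward operator; a
cutoff contributes only through its own derivatives. -/
lemma heatResidual_mul_heatQuotient (hμ : μ ≠ 0) (hρ₃ : 0 ≤ ρ₃) {χ : State d → ℝ}
    (hχ : ContDiff ℝ (⊤ : ℕ∞) χ) {ρ : ℝ} (hρ : ρ₃ < ρ) (u : State d) :
    heatResidual μ (fun p => χ p.2 * heatQuotient μ ν ρ₃ p) (ρ, u) =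
      (inner ℝ (gradient χ u) (heatGrad ν (ρ - ρ₃, u)) +
        1 / 2 * (heat ν (ρ - ρ₃, u) * Laplacian.laplacian χ u)) / heat μ (ρ, u) := by
  have hρ0 : 0 < ρ := hρ₃.trans_lt hρ
  have hρ' : 0 < ρ - ρ₃ := sub_pos.2 hρ
  have hM := heat_pos hμ hρ0 u
  set G : ℝ × State d → ℝ := fun p => χ p.2 * heatQuotient μ ν ρ₃ p with hGdef
  have hG := contDiffOn_mul_heatQuotient (ν := ν) hμ hρ₃ hχ
  have htwo : (2 : WithTop ℕ∞) ≤ ((⊤ : ℕ∞) : WithTop ℕ∞) := by norm_cast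
  have hGs : ContDiff ℝ 2 (fun u => G (ρ, u)) := (contDiff_slice hG hρ).of_le htwo
  have hMs : ContDiff ℝ 2 (fun u => heat μ (ρ, u)) := (contDiff_heat_slice hρ0).of_le htwo
  have hNs : ContDiff ℝ 2 (fun u => heat ν (ρ - ρ₃, u)) := (contDiff_heat_slice hρ').of_le htwo
  -- Comparing the Laplacians of both sides of `G · heat μ = χ · heat ν` gives the spatial part of the
  -- operator, multiplied by `heat μ`.
  have hprod : (fun u => G (ρ, u) * heat μ (ρ, u)) = fun u => χ u * heat ν (ρ - ρ₃, u) := by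
    funext v
    have := (heat_pos hμ hρ0 v).ne'
    simp only [hGdef, heatQuotient]
    field_simp
  have hlap := congrArg (fun F : State d → ℝ => Laplacian.laplacian F u) hprod
  rw [laplacian_mul hGs hMs, laplacian_mul (hχ.of_le htwo) hNs, laplacian_heat hρ0,
    laplacian_heat hρ', (hasGradientAt_heat hρ0 u).gradient,
    (hasGradientAt_heat hρ' u).gradient] at hlap
  have hN : HasDerivAt (fun r => heat ν (r - ρ₃, u)) (1 / 2 * heatLap ν (ρ - ρ₃, u)) ρ :=
    (hasDerivAt_heat hρ' u).comp_sub_const ρ ρ₃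
  have htime : timeDeriv G (ρ, u) = χ u * ((1 / 2 * heatLap ν (ρ - ρ₃, u) * heat μ (ρ, u) -
      heat ν (ρ - ρ₃, u) * (1 / 2 * heatLap μ (ρ, u))) / heat μ (ρ, u) ^ 2) :=
    ((hN.fun_div (hasDerivAt_heat hρ0 u) hM.ne').const_mul (χ u)).deriv
  rw [heatResidual, htime, spatialGrad, spatialLap, eq_div_iff hM.ne']
  have hGv : G (ρ, u) = χ u * (heat ν (ρ - ρ₃, u) / heat μ (ρ, u)) := rfl
  rw [hGv, real_inner_comm] at hlap
  simp only
  have e1 : (-(χ u * ((1 / 2 * heatLap ν (ρ - ρ₃, u) * heat μ (ρ, u) -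
      heat ν (ρ - ρ₃, u) * (1 / 2 * heatLap μ (ρ, u))) / heat μ (ρ, u) ^ 2)) +
      (heat μ (ρ, u))⁻¹ * inner ℝ (heatGrad μ (ρ, u)) (gradient (fun u => G (ρ, u)) u) +
      1 / 2 * Laplacian.laplacian (fun u => G (ρ, u)) u) * heat μ (ρ, u) =
      -(1 / 2) * χ u * heatLap ν (ρ - ρ₃, u) +
      1 / 2 * (χ u * (heat ν (ρ - ρ₃, u) / heat μ (ρ, u)) * heatLap μ (ρ, u) +
        2 * inner ℝ (heatGrad μ (ρ, u)) (gradient (fun u => G (ρ, u)) u) +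
        heat μ (ρ, u) * Laplacian.laplacian (fun u => G (ρ, u)) u) := by
    field_simp
    ring
  rw [e1, hlap]
  ring

end Quotient

lemma heat_dirac (y : State d) (p : ℝ × State d) :
    heat (Measure.dirac y) p = (2 * Real.pi * p.1) ^ (-(d : ℝ) / 2) *
      Real.exp (-‖p.2 - y‖ ^ 2 / (2 * p.1)) := by
  simp [heat, gaussAverage]

lemma heatGrad_dirac (y : State d) (p : ℝ × State d) :
    heatGrad (Measure.dirac y) p = (heat (Measure.dirac y) p * p.1⁻¹) • (y - p.2) := by
  simp only [heat, heatGrad, gaussAverage, integral_dirac, smul_eq_mul, mul_one, ← smul_sub,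
    smul_smul]
  congr 1
  ring

/-- The quotient is bounded: `‖u‖ + K ≤ ‖u - y‖ + (‖y‖ + K)`, and
`(b + c)² / ρ ≤ b² / (ρ - ρ₃) + c² / ρ₃`. -/
lemma exists_heatQuotient_dirac_le {μ : Measure (State d)} [IsFiniteMeasure μ] (hμ : μ ≠ 0)
    {ρ₃ ρ₁ : ℝ} (hρ₃ : 0 < ρ₃) (hρ₁ : ρ₃ < ρ₁) (y : State d) :
    ∃ C, 0 ≤ C ∧ ∀ ρ, ρ₁ ≤ ρ → ∀ u, heatQuotient μ (Measure.dirac y) ρ₃ (ρ, u) ≤ C := by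
  obtain ⟨K, hK, hκ⟩ := exists_ball_measure_pos hμ
  set κ := μ.real (Metric.closedBall 0 K)
  have hρ₁' : 0 < ρ₁ - ρ₃ := sub_pos.2 hρ₁
  refine ⟨(ρ₁ / (ρ₁ - ρ₃)) ^ ((d : ℝ) / 2) * (Real.exp ((‖y‖ + K) ^ 2 / (2 * ρ₃)) / κ),
    by have := hρ₃.trans hρ₁; positivity, fun ρ hρ u => ?_⟩
  have hρ0 : 0 < ρ := hρ₃.trans (hρ₁.trans_le hρ)
  have hρ' : 0 < ρ - ρ₃ := by linarith
  have h1 : (2 * Real.pi * ρ) ^ (-(d : ℝ) / 2) *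
      (κ * Real.exp (-(‖u‖ + K) ^ 2 / (2 * ρ))) ≤ heat μ (ρ, u) := by
    unfold heat
    gcongr
    exact mul_exp_le_gaussAverage hρ0 u
  have h2 : Real.exp (-‖u - y‖ ^ 2 / (2 * (ρ - ρ₃))) ≤
      Real.exp ((‖y‖ + K) ^ 2 / (2 * ρ₃)) * Real.exp (-(‖u‖ + K) ^ 2 / (2 * ρ)) := by
    rw [← Real.exp_add, Real.exp_le_exp]
    have hb : ‖u‖ + K ≤ ‖u - y‖ + (‖y‖ + K) := by
      have := norm_add_le (u - y) y
      rw [sub_add_cancel] at this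
      linarith
    have hsq : (‖u‖ + K) ^ 2 ≤ (‖u - y‖ + (‖y‖ + K)) ^ 2 := by gcongr
    have htitu : (‖u - y‖ + (‖y‖ + K)) ^ 2 / ρ ≤
        ‖u - y‖ ^ 2 / (ρ - ρ₃) + (‖y‖ + K) ^ 2 / ρ₃ := by
      rw [div_add_div _ _ hρ'.ne' hρ₃.ne', div_le_div_iff₀ hρ0 (by positivity)]
      nlinarith [sq_nonneg (‖u - y‖ * ρ₃ - (‖y‖ + K) * (ρ - ρ₃))]
    have h3 : (‖u‖ + K) ^ 2 / ρ ≤ ‖u - y‖ ^ 2 / (ρ - ρ₃) + (‖y‖ + K) ^ 2 / ρ₃ :=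
      le_trans (by gcongr) htitu
    have e1 : -‖u - y‖ ^ 2 / (2 * (ρ - ρ₃)) = -(1 / 2) * (‖u - y‖ ^ 2 / (ρ - ρ₃)) := by
      field_simp
    have e2 : (‖y‖ + K) ^ 2 / (2 * ρ₃) = 1 / 2 * ((‖y‖ + K) ^ 2 / ρ₃) := by field_simp
    have e3 : -(‖u‖ + K) ^ 2 / (2 * ρ) = -(1 / 2) * ((‖u‖ + K) ^ 2 / ρ) := by field_simp
    rw [e1, e2, e3]
    linarith
  have h4 : (2 * Real.pi * (ρ - ρ₃)) ^ (-(d : ℝ) / 2) ≤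
      (ρ₁ / (ρ₁ - ρ₃)) ^ ((d : ℝ) / 2) * (2 * Real.pi * ρ) ^ (-(d : ℝ) / 2) := by
    have e : 2 * Real.pi * ρ = (2 * Real.pi * (ρ - ρ₃)) * (ρ / (ρ - ρ₃)) := by field_simp
    have hneg : (ρ / (ρ - ρ₃)) ^ (-(d : ℝ) / 2) = ((ρ / (ρ - ρ₃)) ^ ((d : ℝ) / 2))⁻¹ := by
      rw [neg_div, Real.rpow_neg (by positivity)]
    have hle : (ρ / (ρ - ρ₃)) ^ ((d : ℝ) / 2) ≤ (ρ₁ / (ρ₁ - ρ₃)) ^ ((d : ℝ) / 2) := by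
      refine Real.rpow_le_rpow (by positivity) ?_ (by positivity)
      rw [div_le_div_iff₀ hρ' hρ₁']
      nlinarith
    rw [e, Real.mul_rpow (x := 2 * Real.pi * (ρ - ρ₃)) (y := ρ / (ρ - ρ₃)) (by positivity)
      (by positivity), hneg]
    have hpos : 0 < (ρ / (ρ - ρ₃)) ^ ((d : ℝ) / 2) := by positivity
    calc (2 * Real.pi * (ρ - ρ₃)) ^ (-(d : ℝ) / 2)
        = (ρ / (ρ - ρ₃)) ^ ((d : ℝ) / 2) * ((2 * Real.pi * (ρ - ρ₃)) ^ (-(d : ℝ) / 2) *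
          ((ρ / (ρ - ρ₃)) ^ ((d : ℝ) / 2))⁻¹) := by field_simp
      _ ≤ _ := by gcongr
  rw [heatQuotient, heat_dirac, div_le_iff₀ (heat_pos hμ hρ0 u)]
  simp only
  have hρ₁0 := hρ₃.trans hρ₁
  calc (2 * Real.pi * (ρ - ρ₃)) ^ (-(d : ℝ) / 2) * Real.exp (-‖u - y‖ ^ 2 / (2 * (ρ - ρ₃)))
      ≤ ((ρ₁ / (ρ₁ - ρ₃)) ^ ((d : ℝ) / 2) * (2 * Real.pi * ρ) ^ (-(d : ℝ) / 2)) *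
        (Real.exp ((‖y‖ + K) ^ 2 / (2 * ρ₃)) * Real.exp (-(‖u‖ + K) ^ 2 / (2 * ρ))) := by gcongr
    _ = ((ρ₁ / (ρ₁ - ρ₃)) ^ ((d : ℝ) / 2) * (Real.exp ((‖y‖ + K) ^ 2 / (2 * ρ₃)) / κ)) *
        ((2 * Real.pi * ρ) ^ (-(d : ℝ) / 2) * (κ * Real.exp (-(‖u‖ + K) ^ 2 / (2 * ρ)))) := by
      field_simp
    _ ≤ _ := by gcongr

/-! ### Conservation of heat quotients along the reverse SDE -/

lemma gradient_laplacian_eq_zero {f : State d → ℝ} {c : ℝ} {x : State d}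
    (hf : f =ᶠ[𝓝 x] fun _ => c) : gradient f x = 0 ∧ Laplacian.laplacian f x = 0 := by
  constructor
  · rw [gradient, hf.fderiv_eq]
    simp
  · rw [(InnerProductSpace.laplacian_congr_nhds hf).eq_of_nhds, InnerProductSpace.laplacian_const]
    rfl

/-- A smooth cutoff, equal to `1` on the unit ball and to `0` off the ball of radius `2`, with the
bounds on its derivatives that are uniform under dilations. -/
lemma exists_cutoff (b : ℝ) : ∃ (χ : State d → ℝ) (C : ℝ), ContDiff ℝ (⊤ : ℕ∞) χ ∧
    (∀ v, 0 ≤ χ v ∧ χ v ≤ 1) ∧ (∀ v, ‖v‖ ≤ 1 → χ v = 1) ∧ (∀ v, 2 ≤ ‖v‖ → χ v = 0) ∧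
    ∀ v, ‖gradient χ v‖ * (‖v‖ + b) ≤ C ∧ |Laplacian.laplacian χ v| ≤ C := by
  let χ : ContDiffBump (0 : State d) := ⟨1, 2, one_pos, one_lt_two⟩
  have hχ : ContDiff ℝ (⊤ : ℕ∞) χ := χ.contDiff
  have hzero : ∀ v : State d, 2 ≤ ‖v‖ → χ v = 0 := fun v hv => χ.zero_of_le_dist (by simpa using hv)
  have hG : ContDiffOn ℝ (⊤ : ℕ∞) (fun p : ℝ × State d => χ p.2) {p | 0 < p.1} :=
    (hχ.comp contDiff_snd).contDiffOn
  have hm : ∀ z : ℝ × State d, z ∈ ({1} : Set ℝ) ×ˢ univ → z ∈ {p : ℝ × State d | 0 < p.1} := by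
    rintro z ⟨hz, -⟩
    rw [mem_singleton_iff] at hz
    simp [hz]
  have hsup : ∀ p : ℝ × State d, 0 < p.1 → 2 < ‖p.2‖ → χ p.2 = 0 := fun p _ hp => hzero p.2 hp.le
  obtain ⟨C₁, hC₁⟩ := exists_bound_of_continuousOn_of_support
    (c := fun p : ℝ × State d => ‖spatialGrad (fun p : ℝ × State d => χ p.2) p‖ * (‖p.2‖ + b))
    (isCompact_singleton (x := (1 : ℝ))) (K := 2)
    ((((contDiffOn_spatialGrad hG).continuousOn.mono hm).norm).mul (by fun_prop)) (by
      intro p hp x hx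
      have hp0 : (0 : ℝ) < p := by rw [mem_singleton_iff.1 hp]; exact one_pos
      simp only
      rw [(eventually_zero_of_support hsup (p := (p, x)) hp0 hx).2.1, norm_zero, zero_mul])
  obtain ⟨C₂, hC₂⟩ := exists_bound_of_continuousOn_of_support
    (c := spatialLap (fun p : ℝ × State d => χ p.2)) (isCompact_singleton (x := (1 : ℝ))) (K := 2)
    ((continuousOn_spatialLap hG).mono hm) (by
      intro p hp x hx
      have hp0 : (0 : ℝ) < p := by rw [mem_singleton_iff.1 hp]; exact one_pos
      exact (eventually_zero_of_support hsup (p := (p, x)) hp0 hx).2.2)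
  refine ⟨χ, max C₁ C₂, hχ, fun v => ⟨χ.nonneg, χ.le_one⟩,
    fun v hv => χ.one_of_mem_closedBall (by simpa using hv), hzero, fun v => ⟨?_, ?_⟩⟩
  · exact (Real.le_norm_self _).trans ((hC₁ 1 rfl v).trans (le_max_left _ _))
  · exact (hC₂ 1 rfl v).trans (le_max_right _ _)

lemma continuousOn_heatResidual {μ : Measure (State d)} [IsFiniteMeasure μ] (hμ : μ ≠ 0) {ρ₃ : ℝ}
    (hρ₃ : 0 ≤ ρ₃) {G : ℝ × State d → ℝ} (hG : ContDiffOn ℝ (⊤ : ℕ∞) G {p | ρ₃ < p.1}) :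
    ContinuousOn (heatResidual μ G) {p | ρ₃ < p.1} := by
  have hm : {p : ℝ × State d | ρ₃ < p.1} ⊆ {p | 0 < p.1} := fun p hp => hρ₃.trans_lt hp
  exact ((continuousOn_timeDeriv hG).neg.add
    (((contDiffOn_heat.continuousOn.mono hm).inv₀ fun p hp => (heat_pos hμ (hm hp) p.2).ne').mul
      ((contDiffOn_heatGrad.continuousOn.mono hm).inner
        (contDiffOn_spatialGrad hG).continuousOn))).add
    (continuousOn_const.mul (continuousOn_spatialLap hG))

/-- The residual created by a dilated cutoff is bounded uniformly in the dilation. -/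
lemma abs_heatResidual_cutoff_le {μ : Measure (State d)} [IsFiniteMeasure μ] (hμ : μ ≠ 0)
    {ρ₃ ρ₁ C B c : ℝ} (hρ₃ : 0 < ρ₃) (hρ₁ : ρ₃ < ρ₁) {y : State d} {χ : State d → ℝ}
    (hχ : ContDiff ℝ (⊤ : ℕ∞) χ)
    (hC : ∀ v, ‖gradient χ v‖ * (‖v‖ + ‖y‖) ≤ C ∧ |Laplacian.laplacian χ v| ≤ C)
    (hB0 : 0 ≤ B)
    (hB : ∀ ρ, ρ₁ ≤ ρ → ∀ u, heatQuotient μ (Measure.dirac y) ρ₃ (ρ, u) ≤ B)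
    (hc : c ∈ Ioc (0 : ℝ) 1) {ρ : ℝ} (hρ : ρ₁ ≤ ρ) (u : State d) :
    |heatResidual μ (fun p => χ (c • p.2) * heatQuotient μ (Measure.dirac y) ρ₃ p) (ρ, u)| ≤
      B * ((ρ₁ - ρ₃)⁻¹ * C + C) := by
  have hρ₁' : 0 < ρ₁ - ρ₃ := sub_pos.2 hρ₁
  have hρ0 : 0 < ρ := hρ₃.trans (hρ₁.trans_le hρ)
  have hρ' : 0 < ρ - ρ₃ := by linarith
  have hC0 : 0 ≤ C := (abs_nonneg _).trans (hC 0).2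
  have hQ0 : 0 ≤ heatQuotient μ (Measure.dirac y) ρ₃ (ρ, u) :=
    div_nonneg (heat_nonneg _ hρ' u) (heat_nonneg _ hρ0 u)
  have hgr : gradient (fun u => χ (c • u)) u = c • gradient χ (c • u) :=
    (hasGradientAt_comp_smul c ((hχ.differentiable (by simp)) _).hasGradientAt).gradient
  have e := heatResidual_mul_heatQuotient (ν := Measure.dirac y) hμ hρ₃.le
    (χ := fun u => χ (c • u)) (hχ.comp (contDiff_const_smul c)) (hρ₁.trans_le hρ) u
  rw [e, hgr, laplacian_comp_smul (hχ.of_le (by norm_cast)), heatGrad_dirac]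
  have e2 : (inner ℝ (c • gradient χ (c • u)) ((heat (Measure.dirac y) (ρ - ρ₃, u) *
      (ρ - ρ₃)⁻¹) • (y - u)) + 1 / 2 * (heat (Measure.dirac y) (ρ - ρ₃, u) *
        (c * (c * Laplacian.laplacian χ (c • u))))) / heat μ (ρ, u) =
      heatQuotient μ (Measure.dirac y) ρ₃ (ρ, u) *
        ((ρ - ρ₃)⁻¹ * inner ℝ (gradient χ (c • u)) (c • (y - u)) +
          1 / 2 * (c * c) * Laplacian.laplacian χ (c • u)) := by
    simp only [heatQuotient, inner_smul_left, inner_smul_right, RCLike.conj_to_real]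
    ring
  rw [show ((ρ, u) : ℝ × State d).1 - ρ₃ = ρ - ρ₃ from rfl] at *
  simp only at e2 ⊢
  rw [e2, abs_mul, abs_of_nonneg hQ0]
  have h1 : |inner ℝ (gradient χ (c • u)) (c • (y - u))| ≤ C := by
    refine (abs_real_inner_le_norm _ _).trans (le_trans ?_ (hC (c • u)).1)
    refine mul_le_mul_of_nonneg_left ?_ (norm_nonneg _)
    calc ‖c • (y - u)‖ ≤ ‖c • u‖ + ‖c • y‖ := by
          rw [smul_sub, norm_sub_rev]; exact norm_sub_le _ _
      _ ≤ ‖c • u‖ + ‖y‖ := by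
          rw [norm_smul c y, Real.norm_of_nonneg hc.1.le]
          have := mul_le_of_le_one_left (norm_nonneg y) hc.2
          linarith
  have h2 : |(ρ - ρ₃)⁻¹ * inner ℝ (gradient χ (c • u)) (c • (y - u))| ≤ (ρ₁ - ρ₃)⁻¹ * C := by
    rw [abs_mul, abs_of_pos (inv_pos.2 hρ')]
    gcongr
  have h3 : |1 / 2 * (c * c) * Laplacian.laplacian χ (c • u)| ≤ C := by
    have hcc : 0 ≤ 1 / 2 * (c * c) ∧ 1 / 2 * (c * c) ≤ 1 := by
      constructor <;> nlinarith [hc.1, hc.2]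
    rw [abs_mul, abs_of_nonneg hcc.1]
    calc _ ≤ 1 * |Laplacian.laplacian χ (c • u)| := by gcongr; exact hcc.2
      _ ≤ C := by rw [one_mul]; exact (hC _).2
  exact mul_le_mul (hB ρ hρ u) ((abs_add_le _ _).trans (add_le_add h2 h3)) (abs_nonneg _) hB0

section SDE

variable {α σ : ℝ → ℝ} {p₀ : State d → ℝ} {Ω : Type*} [mΩ : MeasurableSpace Ω] {P : Measure Ω}
  {𝓕 : Filtration ℝ mΩ} {Z : ℝ → Ω → State d} [IsProbabilityMeasure P]

/-- The expectation of a heat quotient is conserved along the reverse SDE. The quotient is cut off at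
radius `n + 1`, so that Dynkin's formula applies, and `n` tends to infinity. -/
theorem integral_heatQuotient_eq (h : IsNoiseSchedule α σ) (hp₀ : IsProbDensity p₀)
    (hZ : IsReverseSDESolution α σ p₀ P 𝓕 Z) {ρ₃ s t : ℝ} (hρ₃ : 0 < ρ₃) (hs : 0 < s)
    (hst : s ≤ t) (ht : t < 1) (hρ : ρ₃ < noiseRatio α σ (1 - t)) (y : State d) :
    ∫ ω, heatQuotient (densityMeasure p₀) (Measure.dirac y) ρ₃ (heatPoint α σ t (Z t ω)) ∂P =
      ∫ ω, heatQuotient (densityMeasure p₀) (Measure.dirac y) ρ₃ (heatPoint α σ s (Z s ω)) ∂P := by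
  have := hp₀.isProbabilityMeasure
  have hμ : densityMeasure p₀ ≠ 0 := IsProbabilityMeasure.ne_zero _
  set μ := densityMeasure p₀
  set Q := heatQuotient μ (Measure.dirac y) ρ₃ with hQ
  set ρ₁ := noiseRatio α σ (1 - t) with hρ₁
  have hIoo : ∀ q ∈ Icc s t, q ∈ Ioo (0 : ℝ) 1 := fun q hq =>
    ⟨hs.trans_le hq.1, hq.2.trans_lt ht⟩
  have hlt : ∀ q ∈ Icc s t, ∀ x : State d, ρ₃ < (heatPoint α σ q x).1 := fun q hq x =>
    lt_heatPoint_fst h ht hρ ⟨hs.trans_le hq.1, hq.2⟩ x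
  have hle : ∀ q ∈ Icc s t, ρ₁ ≤ noiseRatio α σ (1 - q) := fun q hq =>
    h.monotoneOn_noiseRatio ⟨by linarith, by linarith⟩
      ⟨by linarith [hq.2], by linarith [hq.1]⟩ (by linarith [hq.2])
  obtain ⟨B, hB0, hB⟩ := exists_heatQuotient_dirac_le hμ hρ₃ hρ y
  obtain ⟨χ, C, hχ, hχ01, hχ1, hχ0, hC⟩ := exists_cutoff (d := d) ‖y‖
  set c : ℕ → ℝ := fun n => ((n : ℝ) + 1)⁻¹ with hcdef
  have hc : ∀ n, c n ∈ Ioc (0 : ℝ) 1 := fun n =>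
    ⟨by positivity, inv_le_one_of_one_le₀ (by linarith [Nat.cast_nonneg (α := ℝ) n])⟩
  set G : ℕ → ℝ × State d → ℝ := fun n p => χ (c n • p.2) * Q p with hGdef
  have hG : ∀ n, ContDiffOn ℝ (⊤ : ℕ∞) (G n) {p | ρ₃ < p.1} := fun n =>
    contDiffOn_mul_heatQuotient hμ hρ₃.le (hχ.comp (contDiff_const_smul (c n)))
  have hsmall : ∀ u : State d, ∀ᶠ n in atTop, ‖c n • u‖ < 1 := by
    intro u
    have h1 : Tendsto c atTop (𝓝 0) := by
      simpa [hcdef, one_div] using tendsto_one_div_add_atTop_nhds_zero_nat (𝕜 := ℝ)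
    have h2 : Tendsto (fun n => ‖c n • u‖) atTop (𝓝 0) := by
      have := (h1.smul_const u).norm
      simpa using this
    exact h2.eventually_lt_const one_pos
  have hmeas : ∀ r ∈ Icc s t, Measurable (Z r) := fun r hr =>
    hZ.measurable ⟨(hIoo r hr).1, (hIoo r hr).2.le⟩
  have hpath : ∀ᵐ ω ∂P, ContinuousOn (fun r => Z r ω) (Icc s t) :=
    hZ.continuousOn.mono fun ω hω => hω.mono fun r hr => ⟨(hIoo r hr).1, (hIoo r hr).2.le⟩
  have hsm : s ∈ Icc s t := ⟨le_rfl, hst⟩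
  have htm : t ∈ Icc s t := ⟨hst, le_rfl⟩
  -- Removing the cutoff on the left of the evolution formula.
  have hleft : ∀ q ∈ Icc s t, Tendsto (fun n => ∫ ω, G n (heatPoint α σ q (Z q ω)) ∂P) atTop
      (𝓝 (∫ ω, Q (heatPoint α σ q (Z q ω)) ∂P)) := by
    intro q hq
    refine tendsto_integral_of_dominated_convergence (fun _ => B) (fun n => ?_)
      (integrable_const B) (fun n => ae_of_all _ fun ω => ?_) (ae_of_all _ fun ω => ?_)
    · exact ((contDiff_testFunction (hG n) (hlt q hq 0)).continuous.measurable.comp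
        (hmeas q hq)).aestronglyMeasurable
    · have hp := hlt q hq (Z q ω)
      have hQ0 : 0 ≤ Q (heatPoint α σ q (Z q ω)) :=
        div_nonneg (heat_nonneg _ (sub_pos.2 hp) _) (heat_nonneg _ (hρ₃.trans hp) _)
      have h1 := hχ01 (c n • (heatPoint α σ q (Z q ω)).2)
      rw [Real.norm_of_nonneg (mul_nonneg h1.1 hQ0)]
      exact (mul_le_of_le_one_left hQ0 h1.2).trans (hB _ (hle q hq) _)
    · refine tendsto_const_nhds.congr' ?_
      filter_upwards [hsmall (heatPoint α σ q (Z q ω)).2] with n hn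
      simp only [hGdef]
      rw [hχ1 _ hn.le, one_mul]
  have hinv : ContinuousOn (fun q => (α (1 - q))⁻¹) (Icc s t) := by
    refine ContinuousOn.inv₀ (h.continuousOn_signal.comp (by fun_prop) fun q hq =>
      ⟨by linarith [hq.2], by linarith [(hIoo q hq).1]⟩) fun q hq => ?_
    exact (h.signal_one_sub_pos (hIoo q hq)).ne'
  obtain ⟨A, hA⟩ := isCompact_Icc.exists_bound_of_continuousOn (hinv.pow 2)
  set D := B * ((ρ₁ - ρ₃)⁻¹ * C + C) with hD
  have hres : ∀ n, ∀ q ∈ Icc s t, ∀ x, ‖(α (1 - q))⁻¹ ^ 2 *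
      heatResidual μ (G n) (heatPoint α σ q x)‖ ≤ A * D := by
    intro n q hq x
    rw [norm_mul]
    refine mul_le_mul (hA q hq) ?_ (norm_nonneg _) ((norm_nonneg _).trans (hA q hq))
    exact abs_heatResidual_cutoff_le hμ hρ₃ hρ hχ hC hB0 hB (hc n) (hle q hq) _
  have hrescont : ∀ n, ContinuousOn (fun z : ℝ × State d => (α (1 - z.1))⁻¹ ^ 2 *
      heatResidual μ (G n) (heatPoint α σ z.1 z.2)) (Icc s t ×ˢ univ) := fun n =>
    ((hinv.comp continuousOn_fst fun z hz => hz.1).pow 2).mul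
      ((continuousOn_heatResidual hμ hρ₃.le (hG n)).comp (continuousOn_heatPoint h hs ht)
        fun z hz => hlt z.1 hz.1 z.2)
  have hcontI : ∀ n, ContinuousOn (fun r => ∫ ω, (α (1 - r))⁻¹ ^ 2 *
      heatResidual μ (G n) (heatPoint α σ r (Z r ω)) ∂P) (Icc s t) := by
    intro n
    have h1 := continuousOn_integral_along hmeas hpath (C := A * D)
      (c := fun z => (α (1 - z.1.2))⁻¹ ^ 2 * heatResidual μ (G n) (heatPoint α σ z.1.2 z.2))
      ((hrescont n).comp (f := fun z : (ℝ × ℝ) × State d => (z.1.2, z.2)) (by fun_prop)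
        fun z hz => ⟨hz.1.2, mem_univ _⟩) fun p hp x => hres n p.2 hp.2 x
    exact h1.comp (f := fun r : ℝ => (r, r)) (by fun_prop) fun r hr => ⟨hr, hr⟩
  -- On the right, the residual is bounded uniformly in `n` and vanishes once the cutoff is `1` near the
  -- point in question.
  have hinner : ∀ r ∈ Icc s t, Tendsto (fun n => ∫ ω, (α (1 - r))⁻¹ ^ 2 *
      heatResidual μ (G n) (heatPoint α σ r (Z r ω)) ∂P) atTop (𝓝 0) := by
    intro r hr
    have h0 : (0 : ℝ) = ∫ _, (0 : ℝ) ∂P := by simp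
    rw [h0]
    refine tendsto_integral_of_dominated_convergence (fun _ => A * D) (fun n => ?_)
      (integrable_const _) (fun n => ae_of_all _ fun ω => hres n r hr _) (ae_of_all _ fun ω => ?_)
    · have h1 : Continuous fun x => (α (1 - r))⁻¹ ^ 2 *
          heatResidual μ (G n) (heatPoint α σ r x) := by
        rw [← continuousOn_univ]
        exact (hrescont n).comp (f := fun x : State d => (r, x)) (by fun_prop)
          fun x _ => ⟨hr, mem_univ x⟩
      exact (h1.measurable.comp (hmeas r hr)).aestronglyMeasurable
    · refine tendsto_const_nhds.congr' ?_
      filter_upwards [hsmall (heatPoint α σ r (Z r ω)).2] with n hn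
      have hev : (fun u : State d => χ (c n • u)) =ᶠ[𝓝 (heatPoint α σ r (Z r ω)).2]
          fun _ => 1 := by
        have ho : IsOpen {u : State d | ‖c n • u‖ < 1} :=
          isOpen_lt (by fun_prop) continuous_const
        filter_upwards [ho.mem_nhds hn] with u hu using hχ1 _ (le_of_lt hu)
      have e := heatResidual_mul_heatQuotient (ν := Measure.dirac y) hμ hρ₃.le
        (χ := fun u => χ (c n • u)) (hχ.comp (contDiff_const_smul (c n))) (hlt r hr (Z r ω))
        (heatPoint α σ r (Z r ω)).2
      rw [(gradient_laplacian_eq_zero hev).1, (gradient_laplacian_eq_zero hev).2] at e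
      have e' : heatResidual μ (G n) (heatPoint α σ r (Z r ω)) = 0 := by
        refine e.trans ?_
        simp
      rw [e', mul_zero]
  obtain ⟨_, hg⟩ := hZ.locallyIntegrable s t hs hst ht
  have hright : Tendsto (fun n => ∫ r in s..t, diffusionSq α σ (1 - r) *
      (∫ ω, (α (1 - r))⁻¹ ^ 2 * heatResidual μ (G n) (heatPoint α σ r (Z r ω)) ∂P)) atTop
      (𝓝 (∫ _ in s..t, (0 : ℝ))) := by
    have hsub : uIoc s t ⊆ Icc s t := by
      rw [uIoc_of_le hst]; exact Ioc_subset_Icc_self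
    refine intervalIntegral.tendsto_integral_filter_of_dominated_convergence
      (fun r => |diffusionSq α σ (1 - r)| * (A * D)) (Eventually.of_forall fun n => ?_)
      (Eventually.of_forall fun n => ae_of_all _ fun r hr => ?_) (hg.abs.mul_const _)
      (ae_of_all _ fun r hr => ?_)
    · have h1 := hg.mul_continuousOn (by rw [uIcc_of_le hst]; exact hcontI n)
      exact (intervalIntegrable_iff.1 h1).aestronglyMeasurable
    · rw [norm_mul, Real.norm_eq_abs]
      refine mul_le_mul_of_nonneg_left ?_ (abs_nonneg _)
      refine (norm_integral_le_of_norm_le_const (ae_of_all _ fun ω => hres n r (hsub hr) _)).trans ?_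
      simp
    · have := (hinner r (hsub hr)).const_mul (diffusionSq α σ (1 - r))
      rwa [mul_zero] at this
  have hall : ∀ n, ∫ ω, G n (heatPoint α σ t (Z t ω)) ∂P -
      ∫ ω, G n (heatPoint α σ s (Z s ω)) ∂P = ∫ r in s..t, diffusionSq α σ (1 - r) *
      (∫ ω, (α (1 - r))⁻¹ ^ 2 * heatResidual μ (G n) (heatPoint α σ r (Z r ω)) ∂P) := by
    intro n
    refine integral_heatPoint_sub h hp₀ hZ (R := 2 * ((n : ℝ) + 1)) (hG n) (fun p _ hp => ?_)
      hρ₃.le hs hst ht hρ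
    simp only [hGdef]
    rw [hχ0, zero_mul]
    rw [norm_smul, Real.norm_of_nonneg (hc n).1.le, hcdef, inv_mul_eq_div,
      le_div_iff₀ (by positivity)]
    exact hp.le
  have hlim := tendsto_nhds_unique ((hleft t htm).sub (hleft s hsm))
    (hright.congr fun n => (hall n).symm)
  rw [intervalIntegral.integral_zero] at hlim
  exact sub_eq_zero.1 hlim

end SDE

/-! ### The conserved expectation, computed from the initial condition -/

lemma continuousAt_gaussMix (μ : Measure (State d)) [IsFiniteMeasure μ] (x : State d) :
    ContinuousAt (fun p : (ℝ × ℝ) × State d => gaussMix μ p.1.1 p.1.2 p.2) ((0, 1), x) := by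
  have hv : Tendsto (fun p : (ℝ × ℝ) × State d => p.1.2) (𝓝 ((0, 1), x)) (𝓝 1) :=
    (continuous_snd.comp continuous_fst).tendsto _
  have hpos : ∀ᶠ p : (ℝ × ℝ) × State d in 𝓝 ((0, 1), x), 0 < p.1.2 :=
    hv.eventually_const_lt one_pos
  unfold gaussMix
  refine ContinuousAt.mul ?_ ?_
  · refine ContinuousAt.rpow_const (by fun_prop) (Or.inl ?_)
    simp [Real.pi_ne_zero]
  · refine continuousAt_of_dominated (bound := fun _ => 1) ?_ ?_ (integrable_const _) ?_
    · exact Eventually.of_forall fun p => by fun_prop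
    · filter_upwards [hpos] with p hp
      refine ae_of_all _ fun y => ?_
      rw [Real.norm_eq_abs, Real.abs_exp]
      refine Real.exp_le_one_iff.2 (div_nonpos_of_nonpos_of_nonneg ?_ (by positivity))
      exact neg_nonpos.2 (by positivity)
    · refine ae_of_all _ fun y => ContinuousAt.rexp (ContinuousAt.div (by fun_prop) (by fun_prop) ?_)
      simp

lemma gaussMix_zero_one (μ : Measure (State d)) [IsProbabilityMeasure μ] (x : State d) :
    gaussMix μ 0 1 x = gaussDensity 1 x := by
  simp [gaussMix, gaussDensity]

/-- As the signal vanishes, quotients of Gaussian mixtures tend to `1` locally uniformly. -/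
lemma eventually_abs_gaussMix_div_sub_one_lt (μ ν : Measure (State d)) [IsProbabilityMeasure μ]
    [IsProbabilityMeasure ν] {ε : ℝ} (hε : 0 < ε) (R : ℝ) :
    ∀ᶠ p : ℝ × ℝ × ℝ in 𝓝 (0, 1, 1), ∀ x ∈ Metric.closedBall (0 : State d) R,
      |gaussMix ν p.1 p.2.1 x / gaussMix μ p.1 p.2.2 x - 1| < ε := by
  refine (isCompact_closedBall (0 : State d) R).eventually_forall_of_forall_eventually
    (P := fun (p : ℝ × ℝ × ℝ) x =>
      |gaussMix ν p.1 p.2.1 x / gaussMix μ p.1 p.2.2 x - 1| < ε) fun x _ => ?_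
  have hne : gaussDensity 1 x ≠ 0 := by
    unfold gaussDensity
    positivity
  have h1 : Tendsto (fun z : (ℝ × ℝ × ℝ) × State d => gaussMix ν z.1.1 z.1.2.1 z.2)
      (𝓝 ((0, 1, 1), x)) (𝓝 (gaussMix ν 0 1 x)) :=
    (continuousAt_gaussMix ν x).tendsto.comp (f := fun z : (ℝ × ℝ × ℝ) × State d =>
      ((z.1.1, z.1.2.1), z.2)) (Continuous.tendsto' (by fun_prop) _ _ rfl)
  have h2 : Tendsto (fun z : (ℝ × ℝ × ℝ) × State d => gaussMix μ z.1.1 z.1.2.2 z.2)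
      (𝓝 ((0, 1, 1), x)) (𝓝 (gaussMix μ 0 1 x)) :=
    (continuousAt_gaussMix μ x).tendsto.comp (f := fun z : (ℝ × ℝ × ℝ) × State d =>
      ((z.1.1, z.1.2.2), z.2)) (Continuous.tendsto' (by fun_prop) _ _ rfl)
  rw [gaussMix_zero_one] at h1 h2
  have h3 := ((h1.div h2 hne).sub_const 1).abs
  rw [div_self hne, sub_self, abs_zero] at h3
  exact h3.eventually_lt_const hε

/-- A bounded continuous function that vanishes on the ball of radius `R` and is `1` off the ball of
radius `R + 1`. -/
def tailFunction (R : ℝ) : BoundedContinuousFunction (State d) ℝ :=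
  BoundedContinuousFunction.ofNormedAddCommGroup (fun x => min 1 (max 0 (‖x‖ - R))) (by fun_prop) 1
    fun x => by
      rw [Real.norm_of_nonneg (le_min zero_le_one (le_max_left _ _))]
      exact min_le_left _ _

lemma tailFunction_apply (R : ℝ) (x : State d) :
    tailFunction R x = min 1 (max 0 (‖x‖ - R)) := rfl

lemma tailFunction_nonneg (R : ℝ) (x : State d) : 0 ≤ tailFunction R x :=
  le_min zero_le_one (le_max_left _ _)

lemma tailFunction_eq_one {R : ℝ} {x : State d} (hx : R + 1 ≤ ‖x‖) : tailFunction R x = 1 := by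
  rw [tailFunction_apply]
  exact min_eq_left ((by linarith : (1 : ℝ) ≤ ‖x‖ - R).trans (le_max_right _ _))

lemma tendsto_integral_tailFunction (ν : Measure (State d)) [IsFiniteMeasure ν] :
    Tendsto (fun n : ℕ => ∫ x, tailFunction (n : ℝ) x ∂ν) atTop (𝓝 0) := by
  have h0 : (0 : ℝ) = ∫ _, (0 : ℝ) ∂ν := by simp
  rw [h0]
  refine tendsto_integral_of_dominated_convergence (fun _ => 1)
    (fun n => (tailFunction (n : ℝ)).continuous.aestronglyMeasurable) (integrable_const _)
    (fun n => ae_of_all _ fun x => ?_) (ae_of_all _ fun x => ?_)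
  · rw [Real.norm_of_nonneg (tailFunction_nonneg _ x)]
    exact min_le_left _ _
  · refine tendsto_const_nhds.congr' ?_
    filter_upwards [eventually_ge_atTop ⌈‖x‖⌉₊] with n hn
    have : ‖x‖ ≤ n := Nat.ceil_le.1 hn
    rw [tailFunction_apply, max_eq_left (by linarith), min_eq_right zero_le_one]

section SDE

variable {α σ : ℝ → ℝ} {p₀ : State d → ℝ} {Ω : Type*} [mΩ : MeasurableSpace Ω] {P : Measure Ω}
  {𝓕 : Filtration ℝ mΩ} {Z : ℝ → Ω → State d} [IsProbabilityMeasure P]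

/-- In the original variables a heat quotient is a quotient of Gaussian mixtures, for which the limit
of vanishing signal makes sense. -/
lemma heatQuotient_heatPoint (h : IsNoiseSchedule α σ) (μ ν : Measure (State d)) {ρ₃ τ : ℝ}
    (hτ : τ ∈ Ioo (0 : ℝ) 1) (hρ : ρ₃ < noiseRatio α σ (1 - τ)) (x : State d) :
    heatQuotient μ ν ρ₃ (heatPoint α σ τ x) =
      gaussMix ν (α (1 - τ)) (σ (1 - τ) ^ 2 - α (1 - τ) ^ 2 * ρ₃) x /
        gaussMix μ (α (1 - τ)) (σ (1 - τ) ^ 2) x := by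
  have hα := h.signal_one_sub_pos hτ
  have hσ := h.noise_pos _ ⟨(one_sub_mem_Ioo hτ).1, (one_sub_mem_Ioo hτ).2.le⟩
  have e : (σ (1 - τ) ^ 2 - α (1 - τ) ^ 2 * ρ₃) / α (1 - τ) ^ 2 =
      noiseRatio α σ (1 - τ) - ρ₃ := by
    unfold noiseRatio
    field_simp
  have hv : 0 < σ (1 - τ) ^ 2 - α (1 - τ) ^ 2 * ρ₃ := by
    have h1 : 0 < (σ (1 - τ) ^ 2 - α (1 - τ) ^ 2 * ρ₃) / α (1 - τ) ^ 2 := by rw [e]; linarith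
    exact (div_pos_iff_of_pos_right (by positivity)).1 h1
  rw [gaussMix_eq_heat ν hα hv, gaussMix_eq_heat μ hα (by positivity), e,
    mul_div_mul_left _ _ (Real.rpow_pos_of_pos hα _).ne']
  rfl

/-- Along the reverse SDE the expectation of a heat quotient equals `1`: it is conserved, and it
tends to `1` at time `0`, where all Gaussian mixtures agree. -/
theorem integral_heatQuotient_eq_one (h : IsNoiseSchedule α σ) (hp₀ : IsProbDensity p₀)
    (hZ : IsReverseSDESolution α σ p₀ P 𝓕 Z) {ρ₃ t : ℝ} (hρ₃ : 0 < ρ₃)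
    (ht : t ∈ Ioo (0 : ℝ) 1) (hρ : ρ₃ < noiseRatio α σ (1 - t)) (y : State d) :
    ∫ ω, heatQuotient (densityMeasure p₀) (Measure.dirac y) ρ₃ (heatPoint α σ t (Z t ω)) ∂P
      = 1 := by
  have := hp₀.isProbabilityMeasure
  have := isProbabilityMeasure_reverseDensity h hp₀ (τ := 0) (by simp)
  have hμ : densityMeasure p₀ ≠ 0 := IsProbabilityMeasure.ne_zero _
  set μ := densityMeasure p₀
  set Q := heatQuotient μ (Measure.dirac y) ρ₃ with hQ
  set ν := densityMeasure (reverseDensity α σ p₀ 0)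
  obtain ⟨B, hB0, hB⟩ := exists_heatQuotient_dirac_le hμ hρ₃ hρ y
  have hle : ∀ q ∈ Ioc 0 t, noiseRatio α σ (1 - t) ≤ noiseRatio α σ (1 - q) := fun q hq =>
    h.monotoneOn_noiseRatio ⟨by linarith [ht.2], by linarith [ht.1]⟩
      ⟨by linarith [hq.2, ht.2], by linarith [hq.1]⟩ (by linarith [hq.2])
  have hpar : Tendsto (fun s => (α (1 - s), σ (1 - s) ^ 2 - α (1 - s) ^ 2 * ρ₃, σ (1 - s) ^ 2))
      (𝓝[>] 0) (𝓝 ((0 : ℝ), (1 : ℝ), (1 : ℝ))) := by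
    rw [← nhdsWithin_Ioo_eq_nhdsGT zero_lt_one]
    have hα : Tendsto (fun τ => α (1 - τ)) (𝓝[Ioo 0 1] 0) (𝓝 0) := by
      have h1 := h.continuousOn_signal 1 (by simp)
      rw [ContinuousWithinAt, h.signal_one] at h1
      exact (h1.mono_left (nhdsWithin_mono _ Ioo_subset_Icc_self)).comp tendsto_one_sub_zero
    have hσ : Tendsto (fun τ => σ (1 - τ)) (𝓝[Ioo 0 1] 0) (𝓝 1) := by
      have h1 := h.continuousOn_noise 1 (by simp)
      rw [ContinuousWithinAt, h.noise_one] at h1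
      exact (h1.mono_left (nhdsWithin_mono _ Ioo_subset_Icc_self)).comp tendsto_one_sub_zero
    have hσ2 := hσ.pow 2
    have h3 := hσ2.sub ((hα.pow 2).mul_const ρ₃)
    have h4 := hα.prodMk_nhds (h3.prodMk_nhds hσ2)
    simpa using h4
  set E := ∫ ω, Q (heatPoint α σ t (Z t ω)) ∂P with hE
  -- At small times the quotient is within `ε` of `1` on a large ball. Off the ball it is bounded, and
  -- the initial condition controls the mass there.
  have hbound : ∀ ε > 0, ∀ n : ℕ,
      |E - 1| ≤ ε + (B + 1) * ∫ x, tailFunction (n : ℝ) x ∂ν := by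
    intro ε hε n
    have hlim : Tendsto (fun s => ε + (B + 1) * ∫ ω, tailFunction (n : ℝ) (Z s ω) ∂P) (𝓝[>] 0)
        (𝓝 (ε + (B + 1) * ∫ x, tailFunction (n : ℝ) x ∂ν)) :=
      ((hZ.initial (tailFunction (n : ℝ))).const_mul (B + 1)).const_add ε
    refine ge_of_tendsto hlim ?_
    filter_upwards [hpar.eventually (eventually_abs_gaussMix_div_sub_one_lt μ (Measure.dirac y) hε
      ((n : ℝ) + 1)), Ioo_mem_nhdsGT ht.1] with s hs1 hs2
    have hs : s ∈ Ioo (0 : ℝ) 1 := ⟨hs2.1, hs2.2.trans ht.2⟩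
    have hρs : ρ₃ < noiseRatio α σ (1 - s) := hρ.trans_le (hle s ⟨hs2.1, hs2.2.le⟩)
    have hZm := hZ.measurable ⟨hs.1, hs.2.le⟩
    have hQn : ∀ x, 0 ≤ Q (heatPoint α σ s x) ∧ Q (heatPoint α σ s x) ≤ B := fun x =>
      ⟨div_nonneg (heat_nonneg _ (sub_pos.2 hρs) _) (heat_nonneg _ (hρ₃.trans hρs) _),
        hB _ (hle s ⟨hs2.1, hs2.2.le⟩) _⟩
    have hQc : Continuous fun x : State d => Q (heatPoint α σ s x) := by
      have h1 := contDiffOn_mul_heatQuotient (ν := Measure.dirac y) hμ hρ₃.le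
        (χ := fun _ => (1 : ℝ)) contDiff_const
      simp only [one_mul] at h1
      exact (contDiff_testFunction h1 hρs).continuous
    have hQi : Integrable (fun ω => Q (heatPoint α σ s (Z s ω))) P :=
      Integrable.of_bound (hQc.measurable.comp hZm).aestronglyMeasurable B
        (ae_of_all _ fun ω => by rw [Real.norm_of_nonneg (hQn _).1]; exact (hQn _).2)
    have hti : Integrable (fun ω => tailFunction (n : ℝ) (Z s ω)) P :=
      Integrable.of_bound ((tailFunction (n : ℝ)).continuous.measurable.comp
        hZm).aestronglyMeasurable ‖tailFunction (d := d) (n : ℝ)‖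
        (ae_of_all _ fun ω => BoundedContinuousFunction.norm_coe_le_norm _ _)
    have hpt : ∀ x, |Q (heatPoint α σ s x) - 1| ≤ ε + (B + 1) * tailFunction (n : ℝ) x := by
      intro x
      by_cases hx : ‖x‖ ≤ n + 1
      · have h1 := hs1 x (by simpa using hx)
        have h2 : 0 ≤ (B + 1) * tailFunction (n : ℝ) x :=
          mul_nonneg (by linarith) (tailFunction_nonneg _ x)
        rw [← heatQuotient_heatPoint h μ (Measure.dirac y) hs hρs x] at h1
        linarith [h1.le]
      · rw [tailFunction_eq_one (not_le.1 hx).le]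
        have h1 := hQn x
        rw [abs_le]
        constructor <;> linarith
    rw [hE, integral_heatQuotient_eq h hp₀ hZ hρ₃ hs2.1 hs2.2.le ht.2 hρ y]
    have e1 : ∫ ω, Q (heatPoint α σ s (Z s ω)) ∂P - 1 =
        ∫ ω, (Q (heatPoint α σ s (Z s ω)) - 1) ∂P := by
      rw [integral_sub hQi (integrable_const _)]
      simp
    have e2 : ε + (B + 1) * ∫ ω, tailFunction (n : ℝ) (Z s ω) ∂P =
        ∫ ω, (ε + (B + 1) * tailFunction (n : ℝ) (Z s ω)) ∂P := by
      rw [integral_add (integrable_const _) (hti.const_mul _), integral_const_mul]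
      simp
    rw [e1, e2]
    have hgi : Integrable (fun ω => ε + (B + 1) * tailFunction (n : ℝ) (Z s ω)) P :=
      (integrable_const _).add (hti.const_mul _)
    rw [← Real.norm_eq_abs]
    refine norm_integral_le_of_norm_le hgi (ae_of_all _ fun ω => ?_)
    rw [Real.norm_eq_abs]
    exact hpt _
  have hzero : |E - 1| ≤ 0 := by
    refine le_of_forall_pos_le_add fun ε hε => ?_
    have h1 := ((tendsto_integral_tailFunction ν).const_mul (B + 1)).const_add ε
    rw [mul_zero, add_zero] at h1
    rw [zero_add]
    exact ge_of_tendsto h1 (Eventually.of_forall fun n => hbound ε hε n)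
  linarith [abs_nonpos_iff.1 hzero]

end SDE

/-! ### Uniqueness of Laplace transforms and the law of the reverse SDE -/

/-- Finite measures on `ℝ^d` with the same finite Laplace transform are equal. -/
lemma measure_ext_of_laplace {η γ : Measure (State d)} [IsFiniteMeasure η] [IsFiniteMeasure γ]
    (hη : ∀ y, Integrable (fun u => Real.exp (inner ℝ u y)) η)
    (heq : ∀ y, ∫ u, Real.exp (inner ℝ u y) ∂η = ∫ u, Real.exp (inner ℝ u y) ∂γ) : η = γ := by
  have hmass : η = 0 ↔ γ = 0 := by
    have h0 := heq 0
    simp only [inner_zero_right, Real.exp_zero, integral_const, smul_eq_mul, mul_one] at h0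
    rw [← Measure.measure_univ_eq_zero, ← Measure.measure_univ_eq_zero, ← measureReal_eq_zero_iff,
      ← measureReal_eq_zero_iff, h0]
  refine Measure.ext_of_charFun (funext fun t => ?_)
  set X : State d → ℝ := fun u => inner ℝ u t
  have hmgf : mgf X η = mgf X γ := by
    funext s
    have := heq (s • t)
    simpa only [mgf, X, inner_smul_right] using this
  have hset : integrableExpSet X η = univ := by
    refine eq_univ_of_forall fun s => ?_
    have := hη (s • t)
    simpa only [integrableExpSet, mem_ofPred_eq, X, inner_smul_right] using this
  -- The Laplace transform extends analytically to the imaginary axis, where it is the characteristic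
  -- function.
  have hI := eqOn_complexMGF_of_mgf' hmgf hmass
    (show Complex.I ∈ {z : ℂ | z.re ∈ interior (integrableExpSet X η)} by simp [hset])
  simp only [complexMGF] at hI
  simp only [charFun_apply]
  simpa only [mul_comm Complex.I, X] using hI

lemma integral_heat_eq_one {μ : Measure (State d)} [IsProbabilityMeasure μ] {ρ : ℝ} (hρ : 0 < ρ) :
    ∫ u, heat μ (ρ, u) = 1 := by
  have h1 := isProbabilityMeasure_heat (μ := μ) hρ
  have h2 := h1.measure_univ
  rw [densityMeasure, withDensity_apply _ MeasurableSet.univ, Measure.restrict_univ] at h2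
  rw [integral_eq_lintegral_of_nonneg_ae (ae_of_all _ (heat_nonneg μ hρ))
    (continuous_heat_slice hρ).aestronglyMeasurable, h2, ENNReal.toReal_one]

/-- A measure reweighted by a Gaussian over a density `m`, with all Gaussian averages equal to `1`,
has an explicit Laplace transform. -/
lemma laplace_of_integral_heat_div {L : Measure (State d)} {m : State d → ℝ} (hm : Measurable m)
    (hm0 : ∀ u, 0 < m u) {ε : ℝ} (hε : 0 < ε)
    (H : ∀ y, ∫ u, heat (Measure.dirac y) (ε, u) / m u ∂L = 1) (y : State d) :
    Integrable (fun u => Real.exp (inner ℝ u y))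
      (L.withDensity fun u => ENNReal.ofReal (Real.exp (-‖u‖ ^ 2 / (2 * ε)) / m u)) ∧
    ∫ u, Real.exp (inner ℝ u y)
      ∂(L.withDensity fun u => ENNReal.ofReal (Real.exp (-‖u‖ ^ 2 / (2 * ε)) / m u)) =
      ((2 * Real.pi * ε) ^ (-(d : ℝ) / 2))⁻¹ * Real.exp (ε * ‖y‖ ^ 2 / 2) := by
  have hmeas : Measurable fun u : State d =>
      ENNReal.ofReal (Real.exp (-‖u‖ ^ 2 / (2 * ε)) / m u) := by fun_prop
  have hc : 0 < (2 * Real.pi * ε) ^ (-(d : ℝ) / 2) := by positivity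
  have e : ∀ u, (ENNReal.ofReal (Real.exp (-‖u‖ ^ 2 / (2 * ε)) / m u)).toReal •
      Real.exp (inner ℝ u y) = (((2 * Real.pi * ε) ^ (-(d : ℝ) / 2))⁻¹ *
        Real.exp (ε * ‖y‖ ^ 2 / 2)) * (heat (Measure.dirac (ε • y)) (ε, u) / m u) := by
    intro u
    rw [ENNReal.toReal_ofReal (div_nonneg (Real.exp_pos _).le (hm0 u).le), heat_dirac]
    have e1 : Real.exp (-‖u‖ ^ 2 / (2 * ε)) * Real.exp (inner ℝ u y) =
        Real.exp (ε * ‖y‖ ^ 2 / 2) * Real.exp (-‖u - ε • y‖ ^ 2 / (2 * ε)) := by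
      rw [← Real.exp_add, ← Real.exp_add, norm_sub_sq_real, inner_smul_right, norm_smul,
        Real.norm_of_nonneg hε.le]
      congr 1
      field_simp
      ring
    simp only [smul_eq_mul]
    rw [div_mul_eq_mul_div, e1]
    field_simp
  -- The Bochner integral of a function that is not integrable is `0`, which `H` excludes.
  have hi : Integrable (fun u => heat (Measure.dirac (ε • y)) (ε, u) / m u) L := by
    by_contra hcon
    have h1 := H (ε • y)
    rw [integral_undef hcon] at h1
    exact zero_ne_one h1
  constructor
  · rw [integrable_withDensity_iff_integrable_smul' hmeas
      (ae_of_all _ fun _ => ENNReal.ofReal_lt_top)]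
    simp only [e]
    exact hi.const_mul _
  · rw [integral_withDensity_eq_integral_toReal_smul hmeas
      (ae_of_all _ fun _ => ENNReal.ofReal_lt_top)]
    simp only [e]
    rw [integral_const_mul, H, mul_one]

/-- A law is determined by its Gaussian averages relative to its candidate density: the reweighted law
and the reweighted volume have the same Laplace transform. -/
lemma eq_densityMeasure_of_integral_heat_div {L : Measure (State d)} {m : State d → ℝ}
    (hm : Measurable m) (hm0 : ∀ u, 0 < m u) {ε : ℝ} (hε : 0 < ε)
    (H : ∀ y, ∫ u, heat (Measure.dirac y) (ε, u) / m u ∂L = 1) : L = densityMeasure m := by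
  have hV : ∀ y : State d, ∫ u, heat (Measure.dirac y) (ε, u) / (1 : ℝ) = 1 := fun y => by
    simp only [div_one]
    exact integral_heat_eq_one hε
  have h1 := laplace_of_integral_heat_div hm hm0 hε H
  have h2 := laplace_of_integral_heat_div (m := fun _ => 1) measurable_const (fun _ => one_pos) hε hV
  have hfin : ∀ {η : Measure (State d)}, Integrable (fun u => Real.exp (inner ℝ u (0 : State d))) η →
      IsFiniteMeasure η := fun hη => by
    simp only [inner_zero_right, Real.exp_zero] at hη
    exact (integrable_const_iff_isFiniteMeasure one_ne_zero).1 hη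
  have := hfin (h1 0).1
  have := hfin (h2 0).1
  have key := measure_ext_of_laplace (fun y => (h1 y).1) fun y => ((h1 y).2.trans (h2 y).2.symm)
  have key2 := congrArg (fun η : Measure (State d) =>
    η.withDensity fun u => ENNReal.ofReal (m u / Real.exp (-‖u‖ ^ 2 / (2 * ε)))) key
  rw [← withDensity_mul _ (by fun_prop) (by fun_prop),
    ← withDensity_mul _ (by fun_prop) (by fun_prop)] at key2
  have e1 : ((fun u => ENNReal.ofReal (Real.exp (-‖u‖ ^ 2 / (2 * ε)) / m u)) *
      fun u : State d => ENNReal.ofReal (m u / Real.exp (-‖u‖ ^ 2 / (2 * ε)))) = 1 := by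
    funext u
    rw [Pi.mul_apply, ← ENNReal.ofReal_mul (div_nonneg (Real.exp_pos _).le (hm0 u).le)]
    have := (hm0 u).ne'
    have h3 := (Real.exp_pos (-‖u‖ ^ 2 / (2 * ε))).ne'
    rw [div_mul_div_comm, mul_comm, div_self (by positivity), ENNReal.ofReal_one, Pi.one_apply]
  have e2 : ((fun u => ENNReal.ofReal (Real.exp (-‖u‖ ^ 2 / (2 * ε)) / 1)) *
      fun u : State d => ENNReal.ofReal (m u / Real.exp (-‖u‖ ^ 2 / (2 * ε)))) =
      fun u => ENNReal.ofReal (m u) := by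
    funext u
    rw [Pi.mul_apply, ← ENNReal.ofReal_mul (by positivity), div_one,
      mul_div_cancel₀ _ (Real.exp_pos _).ne']
  rw [e1, e2, withDensity_one] at key2
  exact key2

section SDE

variable {α σ : ℝ → ℝ} {p₀ : State d → ℝ}

lemma map_smul_densityMeasure_heat (h : IsNoiseSchedule α σ) (hp₀ : IsProbDensity p₀) {τ : ℝ}
    (hτ : τ ∈ Ioo (0 : ℝ) 1) :
    (densityMeasure fun u => heat (densityMeasure p₀) (noiseRatio α σ (1 - τ), u)).map
      (fun u => α (1 - τ) • u) = densityMeasure (reverseDensity α σ p₀ τ) := by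
  have := hp₀.isProbabilityMeasure
  have hα := h.signal_one_sub_pos hτ
  have hσ := h.noise_pos _ ⟨(one_sub_mem_Ioo hτ).1, (one_sub_mem_Ioo hτ).2.le⟩
  have hs : Real.sqrt (noiseRatio α σ (1 - τ)) = σ (1 - τ) / α (1 - τ) := by
    rw [noiseRatio, ← div_pow, Real.sqrt_sq (by positivity)]
  rw [densityMeasure_heat (h.noiseRatio_pos (one_sub_mem_Ioo hτ)),
    Measure.map_map (by fun_prop) (by fun_prop),
    densityMeasure_reverseDensity h hp₀ (Ioo_subset_Icc_self hτ)]
  congr 1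
  funext z
  simp only [Function.comp, smul_add, smul_smul, hs]
  rw [mul_div_cancel₀ _ hα.ne']

/-- Every weak solution of the reverse SDE has the density path `q_τ`. -/
theorem IsNoiseSchedule.hasDensityPath_of_isReverseSDESolution {Ω : Type*}
    [mΩ : MeasurableSpace Ω] {P : Measure Ω} [IsProbabilityMeasure P] {𝓕 : Filtration ℝ mΩ}
    {Z : ℝ → Ω → State d} (h : IsNoiseSchedule α σ) (hp₀ : IsProbDensity p₀)
    (hZ : IsReverseSDESolution α σ p₀ P 𝓕 Z) :
    HasDensityPath P Z (Ioc 0 1) (reverseDensity α σ p₀) := by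
  have := hp₀.isProbabilityMeasure
  have hμ : densityMeasure p₀ ≠ 0 := IsProbabilityMeasure.ne_zero _
  have hopen : ∀ τ ∈ Ioo (0 : ℝ) 1, HasLaw (Z τ) (densityMeasure (reverseDensity α σ p₀ τ)) P := by
    intro τ hτ
    have hZm := hZ.measurable ⟨hτ.1, hτ.2.le⟩
    have hα := h.signal_one_sub_pos hτ
    have hρ := h.noiseRatio_pos (one_sub_mem_Ioo hτ)
    set ρ := noiseRatio α σ (1 - τ) with hρdef
    have hUm : Measurable fun ω => (heatPoint α σ τ (Z τ ω)).2 :=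
      hZm.const_smul (α (1 - τ))⁻¹
    have hm := continuous_heat_slice (μ := densityMeasure p₀) hρ
    have hU : P.map (fun ω => (heatPoint α σ τ (Z τ ω)).2) =
        densityMeasure fun u => heat (densityMeasure p₀) (ρ, u) := by
      refine eq_densityMeasure_of_integral_heat_div hm.measurable (fun u => heat_pos hμ hρ u)
        (half_pos hρ) fun y => ?_
      have hc : Continuous fun u =>
          heat (Measure.dirac y) (ρ / 2, u) / heat (densityMeasure p₀) (ρ, u) :=
        (continuous_heat_slice (half_pos hρ)).div hm fun u => (heat_pos hμ hρ u).ne'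
      rw [integral_map hUm.aemeasurable hc.aestronglyMeasurable]
      rw [← integral_heatQuotient_eq_one h hp₀ hZ (half_pos hρ) hτ (half_lt_self hρ) y]
      refine integral_congr_ae (ae_of_all _ fun ω => ?_)
      simp only [heatQuotient, heatPoint, ← hρdef, sub_half]
    refine ⟨hZm.aemeasurable, ?_⟩
    rw [← map_smul_densityMeasure_heat h hp₀ hτ, ← hU, Measure.map_map (by fun_prop) hUm]
    congr 1
    funext ω
    simp only [Function.comp, heatPoint, smul_smul]
    rw [mul_inv_cancel₀ hα.ne', one_smul]
  intro τ hτ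
  rcases eq_or_lt_of_le hτ.2 with rfl | hlt
  · refine hasLaw_reverseDensity_of_tendsto h hp₀ (by simp) hopen ?_
    filter_upwards [hZ.continuousOn] with ω hω
    exact (hω 1 (by simp)).mono_left (nhdsWithin_mono 1 Ioo_subset_Ioc_self)
  · exact hopen τ ⟨hτ.1, hlt⟩

end SDE

end ReverseDiffusion

end

/-- The probability-flow ODE started from `p_1` has a solution, and all its solutions have the
density path `q_τ`; the same path is that of the reverse SDE. Equivalently, `q_τ > 0` solves the
continuity equation of the ODE as well as the Fokker-Planck equation of the SDE. -/
theorem mainTheorem2 {d : ℕ} {α σ : ℝ → ℝ} (hsched : IsNoiseSchedule α σ)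
    {p₀ : State d → ℝ} (hp₀ : IsProbDensity p₀) :
    (∃ (Ω : Type) (_ : MeasurableSpace Ω) (P : Measure Ω) (_ : IsProbabilityMeasure P)
      (Y : ℝ → Ω → State d), IsReverseODESolution α σ p₀ P Y) ∧
    (∀ (Ω : Type*) [MeasurableSpace Ω] (P : Measure Ω) [IsProbabilityMeasure P]
      (Y : ℝ → Ω → State d), IsReverseODESolution α σ p₀ P Y →
        HasDensityPath P Y (Icc 0 1) (reverseDensity α σ p₀)) ∧
    (∀ (Ω : Type*) [mΩ : MeasurableSpace Ω] (P : Measure Ω) [IsProbabilityMeasure P]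
      (𝓕 : Filtration ℝ mΩ) (Z : ℝ → Ω → State d), IsReverseSDESolution α σ p₀ P 𝓕 Z →
        HasDensityPath P Z (Ioc 0 1) (reverseDensity α σ p₀)) ∧
    (∀ τ ∈ Ico (0 : ℝ) 1, ∀ x, 0 < reverseDensity α σ p₀ τ x) ∧
    SolvesContinuityEquation (reverseDensity α σ p₀) (odeVelocity α σ p₀) ∧
    SolvesFokkerPlanck (reverseDensity α σ p₀) (sdeDrift α σ p₀)
      (fun τ => diffusionSq α σ (1 - τ)) := by
  exact ⟨hsched.exists_reverseODESolution hp₀,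
    fun _ _ _ _ _ hY => hsched.hasDensityPath_of_isReverseODESolution hp₀ hY,
    fun _ _ _ _ _ _ hZ => hsched.hasDensityPath_of_isReverseSDESolution hp₀ hZ,
    fun _ hτ x => reverseDensity_pos hsched hp₀ hτ x,
    solvesContinuityEquation hsched hp₀, solvesFokkerPlanck hsched hp₀⟩
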